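/- Let $m>0$ and $e\neq 0$ be real. Use light-front components $k=(k^+,k^1,k^2,k^-)$ on $\mathbb R^4$, with $k^\pm=(k^0\pm k^3)/\sqrt2$, the metric $h^{+-}=h^{-+}=1$, $h^{11}=h^{22}=-1$ (all other entries $0$), $k^2=2k^+k^--k_\perp^2$, and $4\times4$ matrices with $\{\gamma^\mu,\gamma^\nu\}=2h^{\mu\nu}$. Fourier transforms are normalized by $f(y)=(2\pi)^{-2}\int\hat f(k)e^{-ik\cdot y}\,d^4k$. Let $$\hat S^{(\pm)}(p)=(\gamma\cdot p+m)\hat D_m^{(\pm)}(p),\qquad \hat D^{(\pm)}_m(p)=\pm\tfrac{i}{2\pi}\,\theta(\pm p^-)\,\delta(2p^+p^--p_\perp^2-m^2)$$ be the positive and negative frequency parts of the causal fermion propagator, without instantaneous term. (a) The convolution $\hat P^{\mu\nu}(k)=e^2(2\pi)^{-2}\int d^4p\,\mathrm{tr}[\gamma^\mu\hat S^{(+)}(p)\gamma^\nu\hat S^{(-)}(p-k)]$, i.e. the Fourier transform of $P^{\mu\nu}(y)=e^2\,\mathrm{tr}[\gamma^\mu S^{(+)}(y)\gamma^\nu S^{(-)}(-y)]$,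 converges absolutely on test functions to a tempered distribution. The vacuum polarization part $d^{\mu\nu}(y)=P^{\mu\nu}(y)-P^{\nu\mu}(-y)$ of the second-order causal distribution has its support in the union of the closed forward and backward light cones, and it has singular order $\omega=2$: for some positive continuous $\rho$ with $\rho(a\alpha)/\rho(\alpha)\to a^{2}$ as $\alpha\to0^+$ for all $a>0$, the limit $\lim_{\alpha\to0^+}\rho(\alpha)\hat d^{\mu\nu}(k/\alpha)$ exists in the space of tempered distributions and is not zero. (b) There is exactly one central splitting $r^{\mu\nu}$ of $d^{\mu\nu}$, that is, a tempered distribution of singular order $2$ such that $r$ is supported in the closed forward cone, $r-d$ is supported in the closed backward cone, and $\hat r$ is of class $C^2$ near $k=0$ with $D^b\hat r(0)=0$ for all $|b|\le2$. Moreover $\hat d^{\mu\nu}$ is a continuous function, $\hat r^{\mu\nu}$ is a function, and for time-like $k$ $$\hat r^{\mu\nu}(k)=\frac{i}{2\pi}\,\mathrm{sgn}(k^-)\int_{-\infty}^{\infty}dt\,\frac{\hat d^{\mu\nu}(tk)}{t^{3}\,(1-t+\mathrm{sgn}(k^-)\,i0^+)} .$$ (c) The vacuum polarization tensor $\hat\Pi^{\mu\nu}(k)=i[\hat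 r^{\mu\nu}(k)+\hat P^{\nu\mu}(-k)]$ is transverse, $k_\mu\hat\Pi^{\mu\nu}=0$, and it is the locally integrable function (defined for $k^2\ne0$) $$\hat\Pi^{\mu\nu}(k)=-(2\pi)^{-4}\Big(h^{\mu\nu}-\frac{k^\mu k^\nu}{k^2}\Big)\hat\Pi(k),\qquad \hat\Pi(k)=\frac{e^2m^2}{3}\Big\{\frac{1+\xi}{1-\xi}\big(\xi-4+\xi^{-1}\big)\ln\xi+\frac{5}{3\xi}+\frac{5\xi}{3}-\frac{22}{3}\Big\},$$ $$\xi=\Big(1-\frac{k^2}{2m^2}\Big)+\frac{k^2}{2m^2}\sqrt{1-\frac{4m^2}{k^2}},$$ with principal branches of the root and of the logarithm. (d) The same construction in the instant form (metric $\mathrm{diag}(1,-1,-1,-1)$, $\theta(\pm p^-)$ replaced by $\theta(\pm p^0)$, and $\mathrm{sgn}(k^-)$ by $\mathrm{sgn}(k^0)$) satisfies (a)-(c) with its own metric in the transverse projector and with the same scalar $\hat\Pi$ as a function of $k^2$. So the two scalars coincide at corresponding momenta. (e) Let $C_0,C_\mu,C_1\in\mathbb C$ and $\tilde\Pi(k)=\hat\Pi(k)+C_0+C_\mu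 k^\mu+C_1k^2$. Let $\eta^\mu=(0,0,0,1)$, let $$D_{\mu\nu}=-(2\pi)^{-2}\Big\{\frac{h_{\mu\nu}}{k^2}-\frac{k_\mu\eta_\nu+k_\nu\eta_\mu}{k^2k^+}+\frac{\eta_\mu\eta_\nu}{(k^+)^2}\Big\}$$ be the free doubly transverse photon propagator, and let $\mathcal D=(1-DX)^{-1}D$, where $X^{\mu\nu}=-(h^{\mu\nu}-k^\mu k^\nu/k^2)\tilde\Pi(k)$, be the complete one. (i) If $\tilde\Pi$ is invariant under $k\mapsto-k$, then $C_\mu=0$. (ii) If in addition $\mathcal D$ keeps a simple pole at $k^2=0$ (for every $k_0$ with $k_0^2=0$, $k_0^+\neq0$, the limit of $k^2\mathcal D(k)$ as $k\to k_0$, $k^2\ne0$, exists and is not zero), then $C_0=0$. (iii) The invariance in (i), the condition in (ii) and charge normalization ($k^2(\mathcal D-D)\to0$ at all these $k_0$) hold together if and only if $C_0=0$, $C_\mu=0$ and $C_1=0$. -/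

import Mathlib

open MeasureTheory Filter Topology
open scoped SchwartzMap FourierTransform

noncomputable section

namespace LFQED

/-! ### Coordinates, metric, cones, Dirac matrices -/

/-- The two forms of relativistic dynamics. In the light-front form the components of a four-vector
are listed as `(x⁺, x¹, x², x⁻)`, in the instant form as `(x⁰, x¹, x², x³)`. -/
inductive Form
  | lightFront
  | instant

/-- Coordinate space of contravariant components, with its Lebesgue measure. -/
abbrev E4 := EuclideanSpace ℝ (Fin 4)

/-- The metric `h_{μν} = h^{μν}` (equal to its own inverse in both forms). -/
def metric : Form → Matrix (Fin 4) (Fin 4) ℝ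
  | .lightFront => !![0, 0, 0, 1; 0, -1, 0, 0; 0, 0, -1, 0; 1, 0, 0, 0]
  | .instant => !![1, 0, 0, 0; 0, -1, 0, 0; 0, 0, -1, 0; 0, 0, 0, -1]

theorem metric_mulVec_mulVec (F : Form) (v : Fin 4 → ℝ) :
    (metric F).mulVec ((metric F).mulVec v) = v := by
  cases F <;> ext i <;> fin_cases i <;>
    simp [metric, Matrix.mulVec, dotProduct, Fin.sum_univ_four]

/-- Lowering the index, `k^μ ↦ k_μ`, as a linear automorphism of `ℝ⁴`. -/
def lowerEquiv (F : Form) : E4 ≃ₗ[ℝ] E4 where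
  toFun k := WithLp.toLp 2 ((metric F).mulVec k.ofLp)
  invFun k := WithLp.toLp 2 ((metric F).mulVec k.ofLp)
  map_add' a b := by simp [Matrix.mulVec_add]
  map_smul' c a := by simp [Matrix.mulVec_smul]
  left_inv k := by
    ext i
    exact congrFun (metric_mulVec_mulVec F k.ofLp) i
  right_inv k := by
    ext i
    exact congrFun (metric_mulVec_mulVec F k.ofLp) i

/-- The covariant components `k_μ`. -/
def lowerIndex (F : Form) (k : E4) : E4 := lowerEquiv F k

/-- The invariant product `k · p = k_μ p^μ`. -/
def minkDot (F : Form) (k p : E4) : ℝ := ∑ μ, lowerIndex F k μ * p μ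

/-- `k² = k_μ k^μ`. -/
def minkSq (F : Form) (k : E4) : ℝ := minkDot F k k

/-- From instant-form to light-front components, `x^± = (x⁰ ± x³)/√2`. -/
def toLightFront (x : E4) : E4 :=
  !₂[(x 0 + x 3) / √2, x 1, x 2, (x 0 - x 3) / √2]

/-- The component which decides on the sign of the frequency: `p⁻` in the light-front form,
`p⁰` in the instant form. -/
def freq : Form → E4 → ℝ
  | .lightFront, p => p 3
  | .instant, p => p 0

/-- The closed forward light cone. -/
def forwardCone : Form → Set E4
  | .lightFront => {y | 0 ≤ minkSq .lightFront y ∧ 0 ≤ y 0 ∧ 0 ≤ y 3}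
  | .instant => {y | 0 ≤ minkSq .instant y ∧ 0 ≤ y 0}

/-- The closed backward light cone. -/
def backwardCone (F : Form) : Set E4 := {y | -y ∈ forwardCone F}

/-- Dirac matrices: `{γ^μ, γ^ν} = 2 h^{μν}`. -/
def IsDirac (F : Form) (γ : Fin 4 → Matrix (Fin 4) (Fin 4) ℂ) : Prop :=
  ∀ μ ν, γ μ * γ ν + γ ν * γ μ = ((2 * metric F μ ν : ℝ) : ℂ) • (1 : Matrix (Fin 4) (Fin 4) ℂ)

/-- `γ · p = γ^μ p_μ`. -/
def slash (F : Form) (γ : Fin 4 → Matrix (Fin 4) (Fin 4) ℂ) (p : E4) : Matrix (Fin 4) (Fin 4) ℂ :=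
  ∑ μ, ((lowerIndex F p μ : ℝ) : ℂ) • γ μ

/-! ### Tempered distributions

All distributions below are given by their Fourier transforms, with the convention
`f(y) = (2π)⁻² ∫ f̂(k) e^{-i k·y} dk`, where `k·y` is the invariant product. -/

/-- Rank-two tensors (upper indices `μ ν`) of tempered distributions on `ℝ⁴`. -/
abbrev TensorDist := Fin 4 → Fin 4 → 𝓢'(E4, ℂ)

/-- The linear map `k ↦ (2π)⁻¹ k_μ`. -/
def fourierEquiv (F : Form) : E4 ≃L[ℝ] E4 :=
  (lowerEquiv F).toContinuousLinearEquiv.trans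
    (ContinuousLinearEquiv.smulLeft (Units.mk0 ((2 * Real.pi)⁻¹ : ℝ) (by positivity)))

/-- The transformation `φ ↦ (k ↦ (2π)⁻² ∫ φ(y) e^{-i k·y} dy)` of Schwartz functions. -/
def minkowskiFourier (F : Form) : 𝓢(E4, ℂ) →L[ℂ] 𝓢(E4, ℂ) :=
  (((2 * Real.pi : ℝ) : ℂ) ^ 2)⁻¹ •
    (SchwartzMap.compCLMOfContinuousLinearEquiv ℂ (fourierEquiv F)).comp
      (FourierTransform.fourierCLM ℂ 𝓢(E4, ℂ))

theorem minkowskiFourier_apply (F : Form) (φ : 𝓢(E4, ℂ)) (k : E4) :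
    minkowskiFourier F φ k =
      (((2 * Real.pi : ℝ) : ℂ) ^ 2)⁻¹ *
        ∫ y : E4, Complex.exp (-Complex.I * (minkDot F k y : ℝ)) * φ y := by
  have h1 : minkowskiFourier F φ k =
      (((2 * Real.pi : ℝ) : ℂ) ^ 2)⁻¹ * (𝓕 (φ : E4 → ℂ)) (fourierEquiv F k) := rfl
  rw [h1, Real.fourier_eq']
  congr 1
  refine integral_congr_ae (Eventually.of_forall fun y => ?_)
  have h2 : (fourierEquiv F k) = (2 * Real.pi)⁻¹ • lowerIndex F k := rfl
  have h3 : inner ℝ y (lowerIndex F k) = minkDot F k y := by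
    simp [minkDot, PiLp.inner_apply]
  simp only [smul_eq_mul]
  rw [h2, inner_smul_right, h3]
  congr 2
  have hpi : (Real.pi : ℂ) ≠ 0 := by exact_mod_cast Real.pi_ne_zero
  push_cast
  field_simp

/-- The position-space distribution with Fourier transform `T`. -/
def positionSpace (F : Form) (T : 𝓢'(E4, ℂ)) : 𝓢'(E4, ℂ) :=
  PointwiseConvergenceCLM.precomp ℂ (minkowskiFourier F) T

/-- In position space, every component of the tensor has its support in the closed set `K`. -/
def SupportedIn (F : Form) (T : TensorDist) (K : Set E4) : Prop :=
  ∀ μ ν, Distribution.IsVanishingOn (positionSpace F (T μ ν)) Kᶜ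

/-- The reflected distribution `k ↦ T(-k)`, equivalently `y ↦ T(-y)`. -/
def reflect (T : 𝓢'(E4, ℂ)) : 𝓢'(E4, ℂ) :=
  PointwiseConvergenceCLM.precomp ℂ
    (SchwartzMap.compCLMOfContinuousLinearEquiv ℂ (ContinuousLinearEquiv.neg ℝ (M := E4))) T

/-- `T` is the regular distribution given by the function `f`. -/
def IsRegularDist (T : 𝓢'(E4, ℂ)) (f : E4 → ℂ) : Prop :=
  ∀ φ : 𝓢(E4, ℂ), Integrable (fun k => f k * φ k) ∧ T φ = ∫ k, f k * φ k

/-- The rescaled distribution `k ↦ T(k/α)` for `α > 0`: its value at the test function `φ` is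
`α⁴ ⟨T, φ(α ·)⟩`. -/
def rescaled (T : 𝓢'(E4, ℂ)) (α : ℝ) (φ : 𝓢(E4, ℂ)) : ℂ :=
  if h : α ≠ 0 then
    (α : ℂ) ^ 4 * T (SchwartzMap.compCLMOfContinuousLinearEquiv ℂ
      (ContinuousLinearEquiv.smulLeft (M₁ := E4) (R₁ := ℝ) (Units.mk0 α h)) φ)
  else 0

/-- `T` (a Fourier transform) has singular order `ω`: for some positive continuous power-counting
function `ρ` with `ρ(aα)/ρ(α) → a^ω` as `α → 0⁺`, the limit of `ρ(α) T(k/α)` exists in the space of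
tempered distributions and is not zero. -/
def HasSingularOrder (T : TensorDist) (ω : ℝ) : Prop :=
  ∃ (ρ : ℝ → ℝ) (T₀ : TensorDist),
    ContinuousOn ρ (Set.Ioi 0) ∧ (∀ α, 0 < α → 0 < ρ α) ∧
    (∀ a : ℝ, 0 < a → Tendsto (fun α => ρ (a * α) / ρ α) (𝓝[>] 0) (𝓝 (a ^ ω))) ∧
    T₀ ≠ 0 ∧
    ∀ μ ν (φ : 𝓢(E4, ℂ)),
      Tendsto (fun α => (ρ α : ℂ) * rescaled (T μ ν) α φ) (𝓝[>] 0) (𝓝 (T₀ μ ν φ))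

/-- The normalization condition at the origin: near `0` the distribution `T` is a function of class
`C^ω` all of whose derivatives of order at most `ω` vanish at `0`. -/
def VanishesToOrder (T : 𝓢'(E4, ℂ)) (ω : ℕ) : Prop :=
  ∃ (U : Set E4) (f : E4 → ℂ), IsOpen U ∧ (0 : E4) ∈ U ∧ ContDiffOn ℝ ω f U ∧
    (∀ j ≤ ω, iteratedFDeriv ℝ j f 0 = 0) ∧
    ∀ φ : 𝓢(E4, ℂ), HasCompactSupport φ → tsupport φ ⊆ U → T φ = ∫ k, f k * φ k

/-- `r` is a central splitting solution for the causal distribution `d` of singular order `ω`: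
`d = r - a` with `r` retarded and `a` advanced, `r` has again singular order `ω`, and
`D^b r̂(0) = 0` for `|b| ≤ ω`. -/
structure IsCentralSplitting (F : Form) (ω : ℕ) (d r : TensorDist) : Prop where
  retarded : SupportedIn F r (forwardCone F)
  advanced : SupportedIn F (r - d) (backwardCone F)
  order : HasSingularOrder r ω
  normalized : ∀ μ ν, VanishesToOrder (r μ ν) ω

/-- The dispersion relation with `ω + 1` subtractions,
`r̂(k) = (i/2π) sgn(k) ∫ dt d̂(tk) / (t^{ω+1} (1 - t + sgn(k) i0⁺))` for time-like `k`. -/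
def DispersionRelation (F : Form) (ω : ℕ) (d r : E4 → ℂ) : Prop :=
  ∀ k : E4, 0 < minkSq F k →
    (∀ ε : ℝ, 0 < ε → Integrable (fun t : ℝ =>
      d (t • k) / ((t : ℂ) ^ (ω + 1) * (1 - t + Real.sign (freq F k) * Complex.I * ε)))) ∧
    Tendsto (fun ε : ℝ => Complex.I / (2 * Real.pi) * Real.sign (freq F k) *
        ∫ t : ℝ, d (t • k) /
          ((t : ℂ) ^ (ω + 1) * (1 - t + Real.sign (freq F k) * Complex.I * ε)))
      (𝓝[>] 0) (𝓝 (r k))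

/-! ### The fermion propagator and the fermion loop -/

/-- For `s = ±1`, the measure `θ(± p⁻) δ(2p⁺p⁻ - ω_m²) d⁴p` with `ω_m² = p_⊥² + m²` in the
light-front form, and `θ(± p⁰) δ(p² - m²) d⁴p` in the instant form, obtained by integrating out
`p⁺` and `p⁰` respectively. -/
def massShell : Form → ℝ → ℝ → Measure E4
  | .lightFront, m, s =>
    ((volume.restrict {u : ℝ × ℝ × ℝ | 0 < s * u.2.2}).withDensity
      (fun u => ENNReal.ofReal (1 / (2 * |u.2.2|)))).map
      (fun u => !₂[(u.1 ^ 2 + u.2.1 ^ 2 + m ^ 2) / (2 * u.2.2), u.1, u.2.1, u.2.2])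
  | .instant, m, s =>
    ((volume : Measure (ℝ × ℝ × ℝ)).withDensity
      (fun u => ENNReal.ofReal (1 / (2 * √(u.1 ^ 2 + u.2.1 ^ 2 + u.2.2 ^ 2 + m ^ 2))))).map
      (fun u => !₂[s * √(u.1 ^ 2 + u.2.1 ^ 2 + u.2.2 ^ 2 + m ^ 2), u.1, u.2.1, u.2.2])

/-- The density with respect to `massShell F m s` of the positive (`s = 1`) and negative (`s = -1`)
frequency parts of the causal fermion propagator, without instantaneous term:
`Ŝ^(±)(p) = (γ·p + m) D̂_m^(±)(p)`, where `D̂_m^(±)(p) = ± (i/2π) θ(± p⁻) δ(p² - m²)`. -/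
def fermionPart (F : Form) (γ : Fin 4 → Matrix (Fin 4) (Fin 4) ℂ) (m s : ℝ) (p : E4) :
    Matrix (Fin 4) (Fin 4) ℂ :=
  ((s : ℂ) * (Complex.I / (2 * Real.pi))) • (slash F γ p + (m : ℂ) • 1)

/-- `P` is the Fourier transform of `P^{μν}(y) = e² tr[γ^μ S^(+)(y) γ^ν S^(-)(-y)]`, the product of
distributions being given by the convolution of the Fourier transforms:
`P̂^{μν}(k) = e² (2π)⁻² ∫ d⁴p tr[γ^μ Ŝ^(+)(p) γ^ν Ŝ^(-)(p - k)]`. -/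
def IsFermionLoop (F : Form) (e m : ℝ) (γ : Fin 4 → Matrix (Fin 4) (Fin 4) ℂ)
    (P : TensorDist) : Prop :=
  ∀ μ ν (φ : 𝓢(E4, ℂ)),
    Integrable (fun z : E4 × E4 =>
        (γ μ * fermionPart F γ m 1 z.1 * γ ν * fermionPart F γ m (-1) z.2).trace * φ (z.1 - z.2))
      ((massShell F m 1).prod (massShell F m (-1))) ∧
    P μ ν φ = (e : ℂ) ^ 2 * ((2 * Real.pi : ℝ) : ℂ)⁻¹ ^ 2 *
      ∫ z : E4 × E4,
        (γ μ * fermionPart F γ m 1 z.1 * γ ν * fermionPart F γ m (-1) z.2).trace * φ (z.1 - z.2)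
        ∂((massShell F m 1).prod (massShell F m (-1)))

/-! ### The inductive construction at second order

Numerical tensors of the vacuum polarization parts of the two-point distributions, i.e. the
coefficients of `:A_μ(x₁) A_ν(x₂):` as functions of `y = x₁ - x₂` (Fourier transformed). -/

/-- The part of `R₂' = -T₁(x₂) T₁(x₁)`: the tensor `-P^{νμ}(-y)`. -/
def retardedPrime (P : TensorDist) : TensorDist := fun μ ν => -reflect (P ν μ)

/-- The part of `A₂' = -T₁(x₁) T₁(x₂)`: the tensor `-P^{μν}(y)`. -/
def advancedPrime (P : TensorDist) : TensorDist := fun μ ν => -P μ ν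

/-- The causal distribution `D₂ = R₂' - A₂'`, with tensor `d^{μν}(y) = P^{μν}(y) - P^{νμ}(-y)`. -/
def causalDist (P : TensorDist) : TensorDist := retardedPrime P - advancedPrime P

/-- The vacuum polarization tensor `Π^{μν} = i [r^{μν}(y) + P^{νμ}(-y)]`, defined by
`T₂ = R₂ - R₂' = -i :A_μ(x₁) Π^{μν}(x₁ - x₂) A_ν(x₂):`. -/
def polarizationTensor (P r : TensorDist) : TensorDist :=
  fun μ ν => Complex.I • (r μ ν - retardedPrime P μ ν)

/-- `ξ = (1 - k²/2m²) + (k²/2m²) √(1 - 4m²/k²)`, with the principal branch of the root; here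
`s = k²`. -/
def xi (m s : ℝ) : ℂ :=
  ((1 - s / (2 * m ^ 2) : ℝ) : ℂ) +
    ((s / (2 * m ^ 2) : ℝ) : ℂ) * ((1 - 4 * m ^ 2 / s : ℝ) : ℂ) ^ (1 / 2 : ℂ)

/-- The vacuum polarization scalar as a function of `s = k² ≠ 0` (principal logarithm). -/
def piScalar (e m s : ℝ) : ℂ :=
  ((e ^ 2 * m ^ 2 / 3 : ℝ) : ℂ) *
    ((1 + xi m s) / (1 - xi m s) * (xi m s - 4 + (xi m s)⁻¹) * Complex.log (xi m s)
      + 5 / (3 * xi m s) + 5 * xi m s / 3 - 22 / 3)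

/-- The function `-(2π)⁻⁴ (h^{μν} - k^μ k^ν / k²) S(k)`. -/
def tensorOf (F : Form) (S : E4 → ℂ) (μ ν : Fin 4) (k : E4) : ℂ :=
  -(((2 * Real.pi : ℝ) : ℂ) ^ 4)⁻¹ * ((metric F μ ν - k μ * k ν / minkSq F k : ℝ) : ℂ) * S k

/-! ### Normalization constants and the complete photon propagator (light-front form) -/

/-- The scalar `Π̂(k) + C₀ + C_μ k^μ + C₁ k²`. -/
def modifiedScalar (e m : ℝ) (C₀ : ℂ) (C : Fin 4 → ℂ) (C₁ : ℂ) (k : E4) : ℂ :=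
  piScalar e m (minkSq .lightFront k) + C₀ + ∑ μ, C μ * (k μ : ℂ) + C₁ * (minkSq .lightFront k : ℂ)

/-- The vector `η^μ = (0, 0, 0, 1)`. -/
def eta : E4 := !₂[0, 0, 0, 1]

/-- The free doubly transverse photon propagator `D_{μν}(k)` away from its poles:
`-(2π)⁻² {h_{μν}/k² - (k_μ η_ν + k_ν η_μ)/(k² k⁺) + η_μ η_ν/(k⁺)²}`. -/
def freePhoton (k : E4) : Matrix (Fin 4) (Fin 4) ℂ := fun μ ν =>
  ((-((2 * Real.pi) ^ 2)⁻¹ * (metric .lightFront μ ν / minkSq .lightFront k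
      - (lowerIndex .lightFront k μ * lowerIndex .lightFront eta ν
          + lowerIndex .lightFront k ν * lowerIndex .lightFront eta μ) / (minkSq .lightFront k * k 0)
      + lowerIndex .lightFront eta μ * lowerIndex .lightFront eta ν / (k 0) ^ 2) : ℝ) : ℂ)

/-- The complete photon propagator with insertions of the polarization tensor with scalar `S`, i.e.
the sum `𝒟 = (1 - D X)⁻¹ D` of the geometric series with `X = (2π)⁴ Π`, which gives a meaning to
`𝒟⁻¹ = D⁻¹ - (2π)⁴ Π` for the degenerate matrix `D`. -/
def completePhoton (S : E4 → ℂ) (k : E4) : Matrix (Fin 4) (Fin 4) ℂ :=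
  (1 - freePhoton k *
      (((2 * Real.pi : ℝ) : ℂ) ^ 4 • Matrix.of fun μ ν => tensorOf .lightFront S μ ν k))⁻¹ *
    freePhoton k

/-- Parity: invariance under the reflection `k ↦ -k`. -/
def ParityInvariant (S : E4 → ℂ) : Prop :=
  ∀ k : E4, minkSq .lightFront k ≠ 0 → S (-k) = S k

/-- Photon mass shell: the complete photon propagator still has a simple pole at `k² = 0`. -/
def PhotonMassShell (S : E4 → ℂ) : Prop :=
  ∀ k₀ : E4, minkSq .lightFront k₀ = 0 → k₀ 0 ≠ 0 →
    ∃ R : Matrix (Fin 4) (Fin 4) ℂ, R ≠ 0 ∧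
      Tendsto (fun k => (minkSq .lightFront k : ℂ) • completePhoton S k)
        (𝓝[{k | minkSq .lightFront k ≠ 0}] k₀) (𝓝 R)

/-- Charge normalization: at `k² = 0` the complete photon propagator has the same residue as the
free one, so that the coupling constant `e` is the physical charge. -/
def ChargeNormalized (S : E4 → ℂ) : Prop :=
  ∀ k₀ : E4, minkSq .lightFront k₀ = 0 → k₀ 0 ≠ 0 →
    Tendsto (fun k => (minkSq .lightFront k : ℂ) • (completePhoton S k - freePhoton k))
      (𝓝[{k | minkSq .lightFront k ≠ 0}] k₀) (𝓝 0)

end LFQED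

end

open LFQED

/-! Everything rests on one holomorphic function, the spectral integral I(z) = ∫₀¹ v²(3 − v²)/(4m² −
z(1 − v²)) dv (`specInt`), on the plane cut along [4m², ∞).

The loop is an integral over the two-particle phase space. In the light-front variables (total
momentum, momentum fraction x, angle φ) this measure has the constant density 1/4
(`massShell_prod_massShell`), so the trace integrates in elementary terms: P̂ is the threshold
function (1 + 2m²/k²)√(1 − 4m²/k²), supported at positive frequency and k² > 4m², times the tensor
k²h − kk, up to a constant (`integral_loopKernel`, `isFermionLoop_loopDist`). The instant form
follows because an orthogonal linear map carries one mass-shell measure to the other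
(`massShell_eq_map`).

The threshold function is Im(s I(s + i0))/π (`mul_specBdry_im`). This suggests the splitting r̂ =
const · (k²h − kk) · k² I(k² ± i0), with the sign of the frequency. It is a boundary value from k +
ζη, Im ζ > 0, for every η in the open forward cone, because the square of such a complex vector
never meets the cut (`complexSq_mem_cutPlane`). With polynomial bounds, a contour shift
(`integral_eq_zero_of_tube`) yields support in the forward cone. The jump of r̂ across the cut is
d̂, and r − d is the reflection of r, hence advanced. The prefactor k²(k²h − kk) is of fourth order
at 0, which gives the normalization. Since s I(s) ~ −log|s|, r has singular order 2 with ρ = α²/(1 +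
|log α|), while ρ = α² serves for d. The dispersion relation turns into I by the substitution t =
c/√(1 − v²) (`integral_dispKernel`), and integrating I by partial fractions gives the scalar in
terms of ξ (`sq_mul_specInt`, `piScalar_eq_closedForm`).

Uniqueness: the difference of two central splittings is supported where the cones meet, at the
origin, so it acts on the dilations of a test function as a polynomial in the dilation factor. The
singular order allows degree at most 2, and the normalization removes these coefficients
(`eq_zero_of_point_support`).

For the normalization constants, DX is a scalar c times an idempotent that fixes D, so 𝒟 = D/(1 − c)
with c = (2π)⁻² Π̃/k². Since Π̂ = O((k²)²) at the light cone, the behaviour of c there shows C₀ and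
C₁ directly, and the reflection k ↦ −k isolates C_μ. -/

set_option linter.unusedSectionVars false

noncomputable section

namespace LFQED

/-! ### Tempered distributions: finite order, localization, point support. -/

section GeneralDistributions

variable {E : Type*} [NormedAddCommGroup E] [InnerProductSpace ℝ E] [FiniteDimensional ℝ E]

/-- A tempered distribution has finite order. -/
theorem exists_order_bound (T : 𝓢'(E, ℂ)) : ∃ (N : ℕ) (C : ℝ), 0 ≤ C ∧ ∀ (φ : 𝓢(E, ℂ)) (M : ℝ),
    0 ≤ M → (∀ k ≤ N, ∀ n ≤ N, ∀ x, ‖x‖ ^ k * ‖iteratedFDeriv ℝ n φ x‖ ≤ M) → ‖T φ‖ ≤ C * M := by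
  have hcont : Continuous fun φ : 𝓢(E, ℂ) => ‖T φ‖ := (map_continuous T).norm
  let q : Seminorm ℂ 𝓢(E, ℂ) :=
    (normSeminorm ℂ ℂ).comp ((T : 𝓢(E, ℂ) →L[ℂ] ℂ) : 𝓢(E, ℂ) →ₗ[ℂ] ℂ)
  have hq : ∀ φ, q φ = ‖T φ‖ := fun φ => rfl
  obtain ⟨s, C, -, hC⟩ := Seminorm.bound_of_continuous (schwartz_withSeminorms ℂ E ℂ) q hcont
  refine ⟨s.sup fun p => max p.1 p.2, C, C.2, fun φ M hM h => ?_⟩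
  rw [← hq]
  refine (hC φ).trans ?_
  simp only [smul_apply]
  refine mul_le_mul_of_nonneg_left ?_ C.2
  refine Seminorm.finset_sup_apply_le hM fun p hp => ?_
  have hle : max p.1 p.2 ≤ s.sup fun p => max p.1 p.2 :=
    Finset.le_sup (f := fun p : ℕ × ℕ => max p.1 p.2) hp
  exact SchwartzMap.seminorm_le_bound ℂ p.1 p.2 φ hM
    (h p.1 ((le_max_left _ _).trans hle) p.2 ((le_max_right _ _).trans hle))

/-- The dilation `x ↦ χ(c x)` of a smooth bump function `χ` around the origin. -/
def dilatedBump (c : ℝ) (x : E) : ℂ :=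
  ((⟨1, 2, one_pos, one_lt_two⟩ : ContDiffBump (0 : E)) (c • x) : ℝ)

theorem dilatedBump_eq_comp (c : ℝ) :
    (dilatedBump c : E → ℂ) = fun x => dilatedBump 1 (c • x) := by
  ext x
  simp [dilatedBump]

theorem contDiff_dilatedBump (c : ℝ) {n : ℕ∞} : ContDiff ℝ n (dilatedBump c : E → ℂ) := by
  unfold dilatedBump
  exact Complex.ofRealCLM.contDiff.comp
    ((ContDiffBump.contDiff _).comp (contDiff_const_smul c))

theorem dilatedBump_eq_one {c : ℝ} {x : E} (h : ‖c • x‖ ≤ 1) : dilatedBump c x = 1 := by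
  unfold dilatedBump
  rw [ContDiffBump.one_of_mem_closedBall _ (by simpa using h)]
  simp

theorem dilatedBump_eq_zero {c : ℝ} {x : E} (h : 2 ≤ ‖c • x‖) : dilatedBump c x = 0 := by
  unfold dilatedBump
  rw [ContDiffBump.zero_of_le_dist _ (by simpa using h)]
  simp

theorem hasCompactSupport_dilatedBump {c : ℝ} (hc : 0 < c) :
    HasCompactSupport (dilatedBump c : E → ℂ) := by
  refine HasCompactSupport.intro (isCompact_closedBall (0 : E) (2 / c)) fun x hx => ?_
  apply dilatedBump_eq_zero
  rw [norm_smul, Real.norm_of_nonneg hc.le]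
  simp only [Metric.mem_closedBall, dist_zero_right, not_le] at hx
  rw [div_lt_iff₀ hc] at hx
  linarith

theorem hasTemperateGrowth_dilatedBump {c : ℝ} (hc : 0 < c) :
    (dilatedBump c : E → ℂ).HasTemperateGrowth :=
  (hasCompactSupport_dilatedBump hc).hasTemperateGrowth (contDiff_dilatedBump c (n := ⊤))

/-- Each derivative of χ(c x) produces one factor c. The constant is uniform in c, as it is used
both for c → 0 (cutoff at infinity) and for c → ∞ (cutoff at the origin). -/
theorem exists_iteratedFDeriv_dilatedBump_le (N : ℕ) : ∃ A : ℝ, 0 ≤ A ∧ ∀ c : ℝ, 0 < c →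
    ∀ i ≤ N, ∀ x : E, ‖iteratedFDeriv ℝ i (dilatedBump c : E → ℂ) x‖ ≤ A * c ^ i := by
  have h1 : ∀ i : ℕ, ∃ A : ℝ, ∀ x : E, ‖iteratedFDeriv ℝ i (dilatedBump 1 : E → ℂ) x‖ ≤ A := by
    intro i
    obtain ⟨A, -, hA⟩ := ((hasCompactSupport_dilatedBump (E := E) one_pos).toSchwartzMap
      (contDiff_dilatedBump 1)).decay 0 i
    exact ⟨A, fun x => (le_of_eq (by simp; rfl)).trans (hA x)⟩
  choose A hA using h1
  refine ⟨∑ i ∈ Finset.range (N + 1), |A i|, Finset.sum_nonneg fun _ _ => abs_nonneg _, ?_⟩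
  intro c hc i hi x
  have h2 : iteratedFDeriv ℝ i (dilatedBump c : E → ℂ) x =
      c ^ i • iteratedFDeriv ℝ i (dilatedBump 1 : E → ℂ) (c • x) := by
    rw [dilatedBump_eq_comp c]
    exact congrFun (iteratedFDeriv_comp_const_smul c (contDiff_dilatedBump 1 (n := i))) x
  have h3 : |A i| ≤ ∑ i ∈ Finset.range (N + 1), |A i| :=
    Finset.single_le_sum (f := fun i => |A i|) (fun _ _ => abs_nonneg _)
      (Finset.mem_range.2 (Nat.lt_succ_of_le hi))
  rw [h2, norm_smul, norm_pow, Real.norm_of_nonneg hc.le, mul_comm]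
  exact mul_le_mul_of_nonneg_right (((hA i (c • x)).trans (le_abs_self _)).trans h3)
    (pow_nonneg hc.le i)

/-- The product of a Schwartz function with `x ↦ χ(c x)`. -/
def cutoff (c : ℝ) (φ : 𝓢(E, ℂ)) : 𝓢(E, ℂ) := SchwartzMap.smulLeftCLM ℂ (dilatedBump c) φ

theorem cutoff_apply {c : ℝ} (hc : 0 < c) (φ : 𝓢(E, ℂ)) (x : E) :
    cutoff c φ x = dilatedBump c x * φ x := by
  rw [cutoff, SchwartzMap.smulLeftCLM_apply_apply (hasTemperateGrowth_dilatedBump hc), smul_eq_mul]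

theorem coe_cutoff {c : ℝ} (hc : 0 < c) (φ : 𝓢(E, ℂ)) :
    (cutoff c φ : E → ℂ) = fun x => dilatedBump c x * φ x := funext (cutoff_apply hc φ)

theorem hasCompactSupport_cutoff {c : ℝ} (hc : 0 < c) (φ : 𝓢(E, ℂ)) :
    HasCompactSupport (cutoff c φ) := by
  rw [coe_cutoff hc]
  exact (hasCompactSupport_dilatedBump hc).mul_right

theorem tsupport_cutoff_subset {c : ℝ} (hc : 0 < c) (φ : 𝓢(E, ℂ)) :
    tsupport (cutoff c φ) ⊆ tsupport φ := by
  rw [coe_cutoff hc]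
  exact tsupport_mul_subset_right

/-- Where χ(c x) differs from 1 one has c‖x‖ ≥ 1, so a factor c‖x‖ may be inserted at the price of
one more power of ‖x‖. Every seminorm of the remainder is therefore O(c), and T is bounded by
finitely many of them. -/
theorem tendsto_apply_cutoff (T : 𝓢'(E, ℂ)) (φ : 𝓢(E, ℂ)) :
    Tendsto (fun c => T (cutoff c φ)) (𝓝[>] 0) (𝓝 (T φ)) := by
  obtain ⟨N, C, hC, hT⟩ := exists_order_bound T
  obtain ⟨A, hA, hAb⟩ := exists_iteratedFDeriv_dilatedBump_le (E := E) N
  choose S hS using fun k n => φ.decay k n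
  set B : ℝ := ∑ k ∈ Finset.range (N + 2), ∑ n ∈ Finset.range (N + 1), S k n with hB
  have hSB : ∀ k ≤ N + 1, ∀ n ≤ N, S k n ≤ B := by
    intro k hk n hn
    calc S k n ≤ ∑ n ∈ Finset.range (N + 1), S k n :=
          Finset.single_le_sum (f := fun n => S k n) (fun n _ => (hS k n).1.le)
            (Finset.mem_range.2 (Nat.lt_succ_of_le hn))
      _ ≤ B := Finset.single_le_sum (f := fun k => ∑ n ∈ Finset.range (N + 1), S k n)
            (fun k _ => Finset.sum_nonneg fun n _ => (hS k n).1.le)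
            (Finset.mem_range.2 (Nat.lt_succ_of_le hk))
  have hB0 : 0 ≤ B := (hS 0 0).1.le.trans (hSB 0 (by omega) 0 (by omega))
  have key : ∀ c : ℝ, 0 < c → c ≤ 1 → ‖T (φ - cutoff c φ)‖ ≤ C * ((2 ^ N * ((1 + A) * B)) * c) := by
    intro c hc hc1
    refine hT _ _ (by positivity) fun k hk n hn x => ?_
    have hfun : ((φ - cutoff c φ : 𝓢(E, ℂ)) : E → ℂ) = fun x => (1 - dilatedBump c x) * φ x := by
      ext x
      rw [sub_apply, cutoff_apply hc]
      ring
    rw [hfun]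
    by_cases hx : ‖c • x‖ < 1
    · have h0 : (fun x => (1 - dilatedBump c x) * φ x) =ᶠ[𝓝 x] fun _ => 0 := by
        have : {y : E | ‖c • y‖ < 1} ∈ 𝓝 x :=
          (isOpen_lt (by fun_prop) continuous_const).mem_nhds hx
        filter_upwards [this] with y hy
        rw [dilatedBump_eq_one (le_of_lt hy)]
        simp
      rw [(h0.iteratedFDeriv ℝ n).eq_of_nhds]
      have : iteratedFDeriv ℝ n (fun _ : E => (0 : ℂ)) x = 0 := by
        simp
      rw [this, norm_zero, mul_zero]
      positivity
    · push Not at hx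
      rw [norm_smul, Real.norm_of_nonneg hc.le] at hx
      have hd : ContDiff ℝ N fun x : E => 1 - dilatedBump c x :=
        contDiff_const.sub (contDiff_dilatedBump c)
      have h1 := norm_iteratedFDeriv_mul_le hd (φ.smooth N) x
        (show ((n : ℕ) : WithTop ℕ∞) ≤ ((N : ℕ∞) : WithTop ℕ∞) by exact_mod_cast hn)
      have h2 : ∀ i ≤ n, ‖iteratedFDeriv ℝ i (fun x : E => 1 - dilatedBump c x) x‖ ≤ 1 + A := by
        intro i hi
        have : (fun x : E => 1 - dilatedBump c x) = (fun _ => (1 : ℂ)) - dilatedBump c := rfl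
        rw [this, iteratedFDeriv_sub_apply contDiff_const.contDiffAt
          (contDiff_dilatedBump c (n := i)).contDiffAt]
        refine (norm_sub_le _ _).trans (add_le_add ?_ ?_)
        · rcases Nat.eq_zero_or_pos i with rfl | hi
          · simp
          · rw [iteratedFDeriv_const_of_ne hi.ne']
            simp
        · refine (hAb c hc i (hi.trans hn) x).trans ?_
          exact mul_le_of_le_one_right hA (pow_le_one₀ hc.le hc1)
      calc ‖x‖ ^ k * _ ≤ ‖x‖ ^ k * ∑ i ∈ Finset.range (n + 1), (n.choose i : ℝ) *
            ‖iteratedFDeriv ℝ i (fun x : E => 1 - dilatedBump c x) x‖ *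
            ‖iteratedFDeriv ℝ (n - i) φ x‖ := by gcongr
        _ ≤ ∑ i ∈ Finset.range (n + 1), (n.choose i : ℝ) * ((1 + A) * B * c) := by
            rw [Finset.mul_sum]
            refine Finset.sum_le_sum fun i hi => ?_
            have hi' : i ≤ n := Nat.le_of_lt_succ (Finset.mem_range.1 hi)
            have h3 := (hS (k + 1) (n - i)).2 x
            have h4 := hSB (k + 1) (by omega) (n - i) (by omega)
            have h5 : ‖x‖ ^ k * ‖iteratedFDeriv ℝ (n - i) φ x‖ ≤ B * c := by
              calc ‖x‖ ^ k * ‖iteratedFDeriv ℝ (n - i) φ x‖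
                  ≤ ‖x‖ ^ k * ‖iteratedFDeriv ℝ (n - i) φ x‖ * (c * ‖x‖) :=
                    le_mul_of_one_le_right (by positivity) hx
                _ = c * (‖x‖ ^ (k + 1) * ‖iteratedFDeriv ℝ (n - i) φ x‖) := by ring
                _ ≤ c * B := by gcongr; exact h3.trans h4
                _ = B * c := mul_comm _ _
            calc _ = (n.choose i : ℝ) * (‖iteratedFDeriv ℝ i (fun x : E => 1 - dilatedBump c x) x‖ *
                  (‖x‖ ^ k * ‖iteratedFDeriv ℝ (n - i) φ x‖)) := by ring
              _ ≤ (n.choose i : ℝ) * ((1 + A) * (B * c)) := by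
                  gcongr
                  exact h2 i hi'
              _ = _ := by ring
        _ = 2 ^ n * ((1 + A) * B * c) := by
            rw [← Finset.sum_mul]
            congr 1
            exact_mod_cast Nat.sum_range_choose n
        _ ≤ 2 ^ N * ((1 + A) * B * c) := by
            gcongr
            norm_num
        _ = _ := by ring
  have hlim : Tendsto (fun c : ℝ => C * ((2 ^ N * ((1 + A) * B)) * c)) (𝓝[>] 0) (𝓝 0) := by
    have : Continuous fun c : ℝ => C * ((2 ^ N * ((1 + A) * B)) * c) := by fun_prop
    simpa using (this.tendsto 0).mono_left nhdsWithin_le_nhds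
  rw [tendsto_iff_norm_sub_tendsto_zero]
  refine squeeze_zero' (Eventually.of_forall fun _ => norm_nonneg _) ?_ hlim
  filter_upwards [Ioc_mem_nhdsGT (zero_lt_one (α := ℝ))] with c hc
  rw [← map_sub, ← norm_neg, ← map_neg, neg_sub]
  exact key c hc.1 hc.2

/-- A tempered distribution vanishing on the compactly supported test functions of an open set
vanishes on the set. -/
theorem isVanishingOn_of_compactSupport {T : 𝓢'(E, ℂ)} {U : Set E}
    (h : ∀ φ : 𝓢(E, ℂ), HasCompactSupport φ → tsupport φ ⊆ U → T φ = 0) :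
    Distribution.IsVanishingOn T U := by
  intro φ hφ
  have h1 := tendsto_apply_cutoff T φ
  refine tendsto_nhds_unique h1 (Tendsto.congr' ?_ tendsto_const_nhds)
  filter_upwards [self_mem_nhdsWithin] with c hc
  exact (h _ (hasCompactSupport_cutoff hc φ) ((tsupport_cutoff_subset hc φ).trans hφ)).symm

theorem eq_zero_of_compactSupport {T : 𝓢'(E, ℂ)}
    (h : ∀ φ : 𝓢(E, ℂ), HasCompactSupport φ → T φ = 0) : T = 0 := by
  ext φ
  exact isVanishingOn_of_compactSupport (U := Set.univ) (fun φ hφ _ => h φ hφ) φ (Set.subset_univ _)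

/-- Vanishing of a tempered distribution is a local property. -/
theorem isVanishingOn_of_locally {T : 𝓢'(E, ℂ)} {U : Set E}
    (h : ∀ x ∈ U, ∃ V ∈ 𝓝 x, ∀ φ : 𝓢(E, ℂ), HasCompactSupport φ → tsupport φ ⊆ V → T φ = 0) :
    Distribution.IsVanishingOn T U := by
  refine isVanishingOn_of_compactSupport fun φ hφ hU => ?_
  have h' : ∀ x : tsupport φ, ∃ f : ContDiffBump (x : E), ∀ ψ : 𝓢(E, ℂ), HasCompactSupport ψ →
      tsupport ψ ⊆ Metric.closedBall (x : E) f.rOut → T ψ = 0 := by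
    intro x
    obtain ⟨V, hV, hV0⟩ := h x (hU x.2)
    obtain ⟨r, hr, hrV⟩ := Metric.nhds_basis_closedBall.mem_iff.1 hV
    exact ⟨⟨r / 2, r, by positivity, by linarith⟩, fun ψ h1 h2 => hV0 ψ h1 (h2.trans hrV)⟩
  choose f hf using h'
  have hcompact : IsCompact (tsupport φ) := hφ
  obtain ⟨t, ht⟩ := hcompact.elim_finite_subcover (fun x : tsupport φ => Metric.ball (x : E) (f x).rIn)
    (fun _ => Metric.isOpen_ball)
    (fun x hx => Set.mem_iUnion.2 ⟨⟨x, hx⟩, Metric.mem_ball_self (f ⟨x, hx⟩).rIn_pos⟩)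
  have hgrow : ∀ x : tsupport φ, (fun y => ((f x y : ℝ) : ℂ)).HasTemperateGrowth := fun x =>
    ((f x).hasCompactSupport.comp_left (g := fun r : ℝ => (r : ℂ)) Complex.ofReal_zero).hasTemperateGrowth
      (Complex.ofRealCLM.contDiff.comp (f x).contDiff)
  -- In place of a partition of unity, φ is multiplied by the product of the factors 1 − f x. Each
  -- factor subtracts a piece supported in a ball where T vanishes, so the value of T is unchanged,
  -- and the product over a cover of the support is 0.
  have hprod : ∀ s : Finset (tsupport φ), ∃ ψ : 𝓢(E, ℂ), HasCompactSupport ψ ∧ T ψ = T φ ∧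
      ∀ y, ψ y = (∏ x ∈ s, (1 - ((f x y : ℝ) : ℂ))) * φ y := by
    intro s
    induction s using Finset.cons_induction with
    | empty => exact ⟨φ, hφ, rfl, by simp⟩
    | cons x s hx ih =>
      obtain ⟨ψ, h1, h2, h3⟩ := ih
      set θ := SchwartzMap.smulLeftCLM ℂ (fun y => ((f x y : ℝ) : ℂ)) ψ with hθ
      have hθa : ∀ y, θ y = ((f x y : ℝ) : ℂ) * ψ y := fun y => by
        rw [hθ, SchwartzMap.smulLeftCLM_apply_apply (hgrow x), smul_eq_mul]
      have hθf : (θ : E → ℂ) = (fun y => ((f x y : ℝ) : ℂ)) * ψ := funext hθa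
      have hθc : HasCompactSupport θ := by
        rw [hθf]
        exact h1.mul_left
      refine ⟨ψ - θ, ?_, ?_, fun y => ?_⟩
      · have : ((ψ - θ : 𝓢(E, ℂ)) : E → ℂ) = (ψ : E → ℂ) - θ := rfl
        rw [this]
        exact h1.sub hθc
      · rw [map_sub, h2, hf x θ hθc, sub_zero]
        rw [hθf]
        refine (tsupport_mul_subset_left).trans ?_
        rw [← (f x).tsupport_eq]
        exact tsupport_comp_subset (g := fun r : ℝ => (r : ℂ)) Complex.ofReal_zero _
      · rw [sub_apply, hθa, h3, Finset.prod_cons]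
        ring
  obtain ⟨ψ, -, h2, h3⟩ := hprod t
  rw [← h2]
  have : ψ = 0 := by
    ext y
    rw [h3]
    by_cases hy : y ∈ tsupport φ
    · obtain ⟨x, hx, hxy⟩ := Set.mem_iUnion₂.1 (ht hy)
      rw [Finset.prod_eq_zero hx, zero_mul]
      · rfl
      · rw [(f x).one_of_mem_closedBall (Metric.ball_subset_closedBall hxy)]
        simp
    · rw [image_eq_zero_of_notMem_tsupport hy, mul_zero]
      rfl
  rw [this, map_zero]

/-- Taylor estimate at a zero of order `N`. -/
theorem norm_iteratedFDeriv_le_of_vanishing (φ : 𝓢(E, ℂ)) (N : ℕ)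
    (h0 : ∀ j ≤ N, iteratedFDeriv ℝ j φ 0 = 0) : ∃ B : ℝ, 0 ≤ B ∧ ∀ j ≤ N, ∀ x : E,
      ‖iteratedFDeriv ℝ j φ x‖ ≤ B * ‖x‖ ^ (N + 1 - j) := by
  obtain ⟨B, hB, hBd⟩ := φ.decay 0 (N + 1)
  simp only [pow_zero, one_mul] at hBd
  refine ⟨B, hB.le, ?_⟩
  -- Descent from the bounded derivative of order N + 1: the mean value inequality on the ball of
  -- radius ‖x‖ gains one power of ‖x‖ for each order removed.
  have key : ∀ i ≤ N + 1, ∀ x : E, ‖iteratedFDeriv ℝ (N + 1 - i) φ x‖ ≤ B * ‖x‖ ^ i := by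
    intro i
    induction i with
    | zero => intro _ x; simpa using hBd x
    | succ i ih =>
      intro hi x
      have hsm : ContDiff ℝ ((N + 1 : ℕ) : WithTop ℕ∞) φ := φ.smooth (N + 1 : ℕ)
      have hdiff : Differentiable ℝ (iteratedFDeriv ℝ (N + 1 - (i + 1)) φ) :=
        hsm.differentiable_iteratedFDeriv (Nat.cast_lt.2 (by omega))
      have h1 := (convex_closedBall (0 : E) ‖x‖).norm_image_sub_le_of_norm_fderiv_le
        (𝕜 := ℝ) (f := iteratedFDeriv ℝ (N + 1 - (i + 1)) φ) (C := B * ‖x‖ ^ i) (x := 0) (y := x)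
        (fun y _ => hdiff y) (fun y hy => ?_) (by simp) (by simp)
      · rw [h0 _ (by omega), sub_zero, sub_zero] at h1
        exact h1.trans (le_of_eq (by ring))
      · rw [norm_fderiv_iteratedFDeriv, show N + 1 - (i + 1) + 1 = N + 1 - i by omega]
        refine (ih (by omega) y).trans ?_
        have : ‖y‖ ≤ ‖x‖ := by simpa using hy
        gcongr
  intro j hj x
  have := key (N + 1 - j) (by omega) x
  rwa [show N + 1 - (N + 1 - j) = j by omega] at this

/-- A tempered distribution with support at the origin only sees a jet of finite order. -/
theorem exists_jet_order {T : 𝓢'(E, ℂ)} (hT : Distribution.IsVanishingOn T {0}ᶜ) :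
    ∃ N : ℕ, ∀ φ : 𝓢(E, ℂ), (∀ j ≤ N, iteratedFDeriv ℝ j φ 0 = 0) → T φ = 0 := by
  obtain ⟨N, C, hC, hT'⟩ := exists_order_bound T
  refine ⟨N, fun φ h0 => ?_⟩
  obtain ⟨A, hA, hAb⟩ := exists_iteratedFDeriv_dilatedBump_le (E := E) N
  obtain ⟨B, hB, hBd⟩ := norm_iteratedFDeriv_le_of_vanishing φ N h0
  have hcut : ∀ c : ℝ, 0 < c → T (cutoff c φ) = T φ := by
    intro c hc
    have h1 : T (φ - cutoff c φ) = 0 := by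
      apply hT
      intro x hx hx0
      rw [Set.mem_singleton_iff] at hx0
      subst hx0
      have h2 : ((φ - cutoff c φ : 𝓢(E, ℂ)) : E → ℂ) =ᶠ[𝓝 0] 0 := by
        have : {y : E | ‖c • y‖ < 1} ∈ 𝓝 0 :=
          (isOpen_lt (by fun_prop) continuous_const).mem_nhds (by simp)
        filter_upwards [this] with y hy
        rw [sub_apply, cutoff_apply hc, dilatedBump_eq_one (le_of_lt hy)]
        simp
      exact (notMem_tsupport_iff_eventuallyEq.2 h2) hx
    rw [map_sub, sub_eq_zero] at h1
    exact h1.symm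
  -- On the support ‖x‖ ≤ 2/c. In a Leibniz term the bump costs c^i, and the derivative of φ of
  -- order n − i gains c^{-(N+1-n+i)}, at least i + 1 powers since n ≤ N. The surplus c⁻¹ tends to
  -- 0.
  have key : ∀ c : ℝ, 1 ≤ c → ‖T φ‖ ≤ C * ((2 ^ N * 2 ^ N * (A * (B * 2 ^ (N + 1)))) * c⁻¹) := by
    intro c hc1
    have hc : 0 < c := by linarith
    rw [← hcut c hc]
    refine hT' _ _ (by positivity) fun k hk n hn x => ?_
    rw [coe_cutoff hc]
    by_cases hx : 2 < ‖c • x‖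
    · have h0 : (fun x => dilatedBump c x * φ x) =ᶠ[𝓝 x] fun _ => 0 := by
        have : {y : E | 2 < ‖c • y‖} ∈ 𝓝 x :=
          (isOpen_lt continuous_const (by fun_prop)).mem_nhds hx
        filter_upwards [this] with y hy
        rw [dilatedBump_eq_zero (le_of_lt hy)]
        simp
      rw [(h0.iteratedFDeriv ℝ n).eq_of_nhds]
      have : iteratedFDeriv ℝ n (fun _ : E => (0 : ℂ)) x = 0 := by
        simp
      rw [this, norm_zero, mul_zero]
      positivity
    · push Not at hx
      rw [norm_smul, Real.norm_of_nonneg hc.le] at hx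
      have hx' : ‖x‖ ≤ 2 * c⁻¹ := by
        rw [← div_eq_mul_inv, le_div_iff₀ hc]
        linarith
      have hx2 : ‖x‖ ≤ 2 := by nlinarith [norm_nonneg x]
      have hci : c⁻¹ ≤ 1 := inv_le_one_of_one_le₀ hc1
      have h1 := norm_iteratedFDeriv_mul_le (contDiff_dilatedBump c (n := N)) (φ.smooth N) x
        (show ((n : ℕ) : WithTop ℕ∞) ≤ ((N : ℕ∞) : WithTop ℕ∞) by exact_mod_cast hn)
      calc ‖x‖ ^ k * _ ≤ 2 ^ N * ∑ i ∈ Finset.range (n + 1), (n.choose i : ℝ) *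
            ‖iteratedFDeriv ℝ i (dilatedBump c : E → ℂ) x‖ *
            ‖iteratedFDeriv ℝ (n - i) φ x‖ := by
            gcongr
            calc ‖x‖ ^ k ≤ 2 ^ k := by gcongr
              _ ≤ 2 ^ N := by gcongr; norm_num
        _ ≤ 2 ^ N * ∑ i ∈ Finset.range (n + 1), (n.choose i : ℝ) * (A * (B * 2 ^ (N + 1)) * c⁻¹) := by
            refine mul_le_mul_of_nonneg_left (Finset.sum_le_sum fun i hi => ?_) (by positivity)
            have hi' : i ≤ n := Nat.le_of_lt_succ (Finset.mem_range.1 hi)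
            rw [mul_assoc]
            refine mul_le_mul_of_nonneg_left ?_ (by positivity)
            have h3 := hAb c hc i (by omega) x
            have h4 := hBd (n - i) (by omega) x
            have h5 : ‖x‖ ^ (N + 1 - (n - i)) ≤ 2 ^ (N + 1) * (c⁻¹) ^ (i + 1) := by
              calc ‖x‖ ^ (N + 1 - (n - i)) ≤ (2 * c⁻¹) ^ (N + 1 - (n - i)) := by gcongr
                _ = 2 ^ (N + 1 - (n - i)) * (c⁻¹) ^ (N + 1 - (n - i)) := by ring
                _ ≤ 2 ^ (N + 1) * (c⁻¹) ^ (i + 1) := by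
                    apply mul_le_mul
                    · exact pow_le_pow_right₀ (by norm_num) (by omega)
                    · exact pow_le_pow_of_le_one (by positivity) hci (by omega)
                    · positivity
                    · positivity
            calc _ ≤ (A * c ^ i) * (B * (2 ^ (N + 1) * (c⁻¹) ^ (i + 1))) := by
                  gcongr
                  exact h4.trans (by gcongr)
              _ = A * (B * 2 ^ (N + 1)) * c⁻¹ * (c * c⁻¹) ^ i := by ring
              _ = _ := by rw [mul_inv_cancel₀ hc.ne', one_pow, mul_one]
        _ = 2 ^ N * (2 ^ n * (A * (B * 2 ^ (N + 1)) * c⁻¹)) := by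
            rw [← Finset.sum_mul]
            congr 2
            exact_mod_cast Nat.sum_range_choose n
        _ ≤ 2 ^ N * (2 ^ N * (A * (B * 2 ^ (N + 1)) * c⁻¹)) := by
            gcongr
            norm_num
        _ = _ := by ring
  have hlim : Tendsto (fun c : ℝ => C * ((2 ^ N * 2 ^ N * (A * (B * 2 ^ (N + 1)))) * c⁻¹)) atTop
      (𝓝 0) := by
    simpa using (tendsto_inv_atTop_zero.const_mul (2 ^ N * 2 ^ N * (A * (B * 2 ^ (N + 1))))).const_mul C
  have : ‖T φ‖ ≤ 0 := ge_of_tendsto hlim (by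
    filter_upwards [eventually_ge_atTop 1] with c hc using key c hc)
  simpa using this

/-- Dilation of Schwartz functions. -/
abbrev dilate (a : ℝ) (ha : a ≠ 0) : 𝓢(E, ℂ) →L[ℂ] 𝓢(E, ℂ) :=
  SchwartzMap.compCLMOfContinuousLinearEquiv ℂ
    (ContinuousLinearEquiv.smulLeft (M₁ := E) (R₁ := ℝ) (Units.mk0 a ha))

theorem dilate_apply (a : ℝ) (ha : a ≠ 0) (φ : 𝓢(E, ℂ)) (x : E) : dilate a ha φ x = φ (a • x) := rfl

/-- The dilations of a test function are mapped to a polynomial by a distribution with support at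
the origin. -/
theorem exists_polynomial_dilate {T : 𝓢'(E, ℂ)} (hT : Distribution.IsVanishingOn T {0}ᶜ)
    (φ : 𝓢(E, ℂ)) : ∃ p : Polynomial ℂ, ∀ (a : ℝ) (ha : a ≠ 0), T (dilate a ha φ) = p.eval (a : ℂ) := by
  obtain ⟨N, hN⟩ := exists_jet_order hT
  let J : 𝓢(E, ℂ) →ₗ[ℂ] ((j : Fin (N + 1)) → (E [×(j : ℕ)]→L[ℝ] ℂ)) :=
    { toFun := fun φ j => iteratedFDeriv ℝ j φ 0
      map_add' := fun φ ψ => by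
        ext1 j
        have : ((φ + ψ : 𝓢(E, ℂ)) : E → ℂ) = (φ : E → ℂ) + ψ := rfl
        rw [this, iteratedFDeriv_add_apply (φ.contDiffAt j) (ψ.contDiffAt j)]
        rfl
      map_smul' := fun c φ => by
        ext1 j
        have : ((c • φ : 𝓢(E, ℂ)) : E → ℂ) = c • (φ : E → ℂ) := rfl
        rw [this, iteratedFDeriv_const_smul_apply (φ.contDiffAt j)]
        rfl }
  let T' : 𝓢(E, ℂ) →ₗ[ℂ] ℂ := ((T : 𝓢(E, ℂ) →L[ℂ] ℂ) : 𝓢(E, ℂ) →ₗ[ℂ] ℂ)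
  have hker : LinearMap.ker J ≤ LinearMap.ker T' := by
    intro ψ hψ
    refine hN ψ fun j hj => ?_
    exact congrFun (LinearMap.mem_ker.1 hψ) ⟨j, Nat.lt_succ_of_le hj⟩
  -- T vanishes on the kernel of the jet map J, so it factors through the range of J. A left inverse
  -- of the injective quotient map extends the functional to the whole space of jets.
  obtain ⟨Λ, hΛ⟩ : ∃ Λ : ((j : Fin (N + 1)) → (E [×(j : ℕ)]→L[ℝ] ℂ)) →ₗ[ℂ] ℂ, Λ ∘ₗ J = T' := by
    obtain ⟨g, hg⟩ := (J.ker.liftQ J le_rfl).exists_leftInverse_of_injective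
      (Submodule.ker_liftQ_eq_bot _ _ _ le_rfl)
    refine ⟨(J.ker.liftQ T' hker) ∘ₗ g, ?_⟩
    ext ψ
    have := LinearMap.congr_fun hg (Submodule.Quotient.mk ψ)
    simp only [LinearMap.comp_apply, Submodule.liftQ_apply, LinearMap.id_apply] at this ⊢
    rw [this, Submodule.liftQ_apply]
  refine ⟨∑ j : Fin (N + 1), Polynomial.monomial (j : ℕ) (Λ (Pi.single j (J φ j))), fun a ha => ?_⟩
  -- Dilation by a multiplies the jet component of order j by a^j; this is where the polynomial
  -- comes from.
  have h1 : J (dilate a ha φ) = ∑ j : Fin (N + 1), ((a : ℂ) ^ (j : ℕ)) • Pi.single j (J φ j) := by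
    ext1 j
    rw [Finset.sum_apply, Finset.sum_eq_single j]
    · rw [Pi.smul_apply, Pi.single_eq_same]
      have : (dilate a ha φ : E → ℂ) = fun x => φ (a • x) := rfl
      change iteratedFDeriv ℝ j (dilate a ha φ) 0 = (a : ℂ) ^ (j : ℕ) • iteratedFDeriv ℝ j φ 0
      rw [this, iteratedFDeriv_comp_const_smul a (φ.smooth j)]
      simp only [smul_zero]
      ext v
      simp
    · intro b _ hb
      rw [Pi.smul_apply, Pi.single_eq_of_ne hb.symm]
      exact smul_zero (A := E [×(j : ℕ)]→L[ℝ] ℂ) ((a : ℂ) ^ (b : ℕ))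
    · simp
  calc T (dilate a ha φ) = Λ (J (dilate a ha φ)) := (LinearMap.congr_fun hΛ _).symm
    _ = _ := by
      rw [h1, map_sum, Polynomial.eval_finsetSum]
      refine Finset.sum_congr rfl fun j _ => ?_
      rw [map_smul, Polynomial.eval_monomial, smul_eq_mul, mul_comm]

end GeneralDistributions

/-! ### Minkowski geometry in the two forms. -/

theorem lowerIndex_instant (k : E4) : lowerIndex .instant k = !₂[k 0, -k 1, -k 2, -k 3] := by
  ext i
  fin_cases i <;>
    simp [lowerIndex, lowerEquiv, metric, dotProduct, Fin.sum_univ_four]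

theorem lowerIndex_lightFront (k : E4) : lowerIndex .lightFront k = !₂[k 3, -k 1, -k 2, k 0] := by
  ext i
  fin_cases i <;>
    simp [lowerIndex, lowerEquiv, metric, dotProduct, Fin.sum_univ_four]

theorem minkDot_instant (k p : E4) :
    minkDot .instant k p = k 0 * p 0 - k 1 * p 1 - k 2 * p 2 - k 3 * p 3 := by
  simp [minkDot, lowerIndex_instant, Fin.sum_univ_four]
  ring

theorem minkDot_lightFront (k p : E4) :
    minkDot .lightFront k p = k 3 * p 0 - k 1 * p 1 - k 2 * p 2 + k 0 * p 3 := by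
  simp [minkDot, lowerIndex_lightFront, Fin.sum_univ_four]
  ring

theorem norm_lowerIndex (F : Form) (k : E4) : ‖lowerIndex F k‖ = ‖k‖ := by
  cases F
  · simp [lowerIndex_lightFront, EuclideanSpace.norm_eq, Fin.sum_univ_four]
    congr 1
    ring
  · simp [lowerIndex_instant, EuclideanSpace.norm_eq, Fin.sum_univ_four]

/-- Reduces bilinearity and continuity to the Euclidean inner product, and, as lowering an index
preserves the norm, gives the Cauchy–Schwarz bound. -/
theorem minkDot_eq_inner (F : Form) (k p : E4) : minkDot F k p = inner ℝ (lowerIndex F k) p := by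
  simp [minkDot, PiLp.inner_apply, mul_comm]

theorem abs_minkDot_le (F : Form) (k p : E4) : |minkDot F k p| ≤ ‖k‖ * ‖p‖ := by
  rw [minkDot_eq_inner, ← norm_lowerIndex F k]
  exact abs_real_inner_le_norm _ _

theorem minkDot_comm (F : Form) (k p : E4) : minkDot F k p = minkDot F p k := by
  cases F
  · rw [minkDot_lightFront, minkDot_lightFront]; ring
  · rw [minkDot_instant, minkDot_instant]; ring

theorem minkDot_add_left (F : Form) (k k' p : E4) :
    minkDot F (k + k') p = minkDot F k p + minkDot F k' p := by
  simp only [minkDot_eq_inner, lowerIndex, map_add, inner_add_left]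

theorem minkDot_smul_left (F : Form) (c : ℝ) (k p : E4) :
    minkDot F (c • k) p = c * minkDot F k p := by
  simp only [minkDot_eq_inner, lowerIndex, map_smul, real_inner_smul_left]

theorem minkDot_add_right (F : Form) (k p p' : E4) :
    minkDot F k (p + p') = minkDot F k p + minkDot F k p' := by
  simp only [minkDot_eq_inner, inner_add_right]

theorem minkDot_smul_right (F : Form) (c : ℝ) (k p : E4) :
    minkDot F k (c • p) = c * minkDot F k p := by
  simp only [minkDot_eq_inner, real_inner_smul_right]

theorem minkDot_neg_left (F : Form) (k p : E4) : minkDot F (-k) p = -minkDot F k p := by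
  rw [← neg_one_smul ℝ k, minkDot_smul_left]; ring

theorem minkDot_neg_right (F : Form) (k p : E4) : minkDot F k (-p) = -minkDot F k p := by
  rw [minkDot_comm, minkDot_neg_left, minkDot_comm]

@[fun_prop]
theorem continuous_lowerIndex (F : Form) : Continuous (lowerIndex F) :=
  (lowerEquiv F).toContinuousLinearEquiv.continuous

@[fun_prop]
theorem Continuous.minkDot {X : Type*} [TopologicalSpace X] (F : Form) {f g : X → E4}
    (hf : Continuous f) (hg : Continuous g) : Continuous fun x => minkDot F (f x) (g x) := by
  simp only [minkDot_eq_inner]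
  exact ((continuous_lowerIndex F).comp hf).inner hg

@[fun_prop]
theorem continuous_minkSq (F : Form) : Continuous (minkSq F) :=
  Continuous.minkDot F continuous_id continuous_id

theorem minkSq_add_smul (F : Form) (k η : E4) (t : ℝ) :
    minkSq F (k + t • η) = minkSq F k + 2 * t * minkDot F k η + t ^ 2 * minkSq F η := by
  simp only [minkSq, minkDot_add_left, minkDot_add_right, minkDot_smul_left, minkDot_smul_right]
  rw [minkDot_comm F η k]
  ring

theorem minkSq_smul (F : Form) (c : ℝ) (k : E4) : minkSq F (c • k) = c ^ 2 * minkSq F k := by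
  simp only [minkSq, minkDot_smul_left, minkDot_smul_right]
  ring

theorem minkSq_neg (F : Form) (k : E4) : minkSq F (-k) = minkSq F k := by
  simp only [minkSq, minkDot_neg_left, minkDot_neg_right, neg_neg]

theorem freq_neg (F : Form) (k : E4) : freq F (-k) = -freq F k := by
  cases F <;> simp [freq]

theorem freq_smul (F : Form) (c : ℝ) (k : E4) : freq F (c • k) = c * freq F k := by
  cases F <;> simp [freq]

@[fun_prop]
theorem continuous_freq (F : Form) : Continuous (freq F) := by
  cases F
  · exact (by fun_prop : Continuous fun k : E4 => k 3)
  · exact (by fun_prop : Continuous fun k : E4 => k 0)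

theorem abs_minkSq_le (F : Form) (k : E4) : |minkSq F k| ≤ ‖k‖ ^ 2 := by
  rw [sq]
  exact abs_minkDot_le F k k

theorem toLightFront_toLightFront (x : E4) : toLightFront (toLightFront x) = x := by
  have h2 : (√2 : ℝ) ≠ 0 := by positivity
  have h3 : (√2 : ℝ) ^ 2 = 2 := Real.sq_sqrt (by norm_num)
  ext i
  fin_cases i <;> simp [toLightFront]
  · field_simp; rw [h3]; ring
  · field_simp; rw [h3]; ring

/-- The passage from instant-form to light-front components is a Euclidean isometry. -/
def lightFrontEquiv : E4 ≃ₗᵢ[ℝ] E4 where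
  toFun := toLightFront
  invFun := toLightFront
  left_inv := toLightFront_toLightFront
  right_inv := toLightFront_toLightFront
  map_add' x y := by
    ext i
    fin_cases i <;> simp [toLightFront] <;> ring
  map_smul' c x := by
    ext i
    fin_cases i <;> simp [toLightFront] <;> ring
  norm_map' x := by
    have h3 : (√2 : ℝ) ^ 2 = 2 := Real.sq_sqrt (by norm_num)
    simp [toLightFront, EuclideanSpace.norm_eq, Fin.sum_univ_four, div_pow, h3]
    congr 1
    ring

/-- The passage from instant-form components to the components of a given form. -/
def fromInstant : Form → (E4 ≃ₗᵢ[ℝ] E4)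
  | .lightFront => lightFrontEquiv
  | .instant => LinearIsometryEquiv.refl ℝ E4

theorem minkDot_toLightFront (x y : E4) :
    minkDot .lightFront (toLightFront x) (toLightFront y) = minkDot .instant x y := by
  have h3 : (√2 : ℝ) ^ 2 = 2 := Real.sq_sqrt (by norm_num)
  rw [minkDot_lightFront, minkDot_instant]
  simp only [toLightFront, Fin.isValue, PiLp.toLp_apply, Matrix.cons_val]
  field_simp
  rw [h3]
  ring

theorem minkDot_fromInstant (F : Form) (x y : E4) :
    minkDot F (fromInstant F x) (fromInstant F y) = minkDot .instant x y := by
  cases F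
  · exact minkDot_toLightFront x y
  · rfl

theorem minkSq_fromInstant (F : Form) (x : E4) :
    minkSq F (fromInstant F x) = minkSq .instant x := minkDot_fromInstant F x x

theorem minkSq_instant (x : E4) : minkSq .instant x = x 0 ^ 2 - x 1 ^ 2 - x 2 ^ 2 - x 3 ^ 2 := by
  rw [minkSq, minkDot_instant]; ring

theorem minkSq_lightFront (x : E4) : minkSq .lightFront x = 2 * x 0 * x 3 - x 1 ^ 2 - x 2 ^ 2 := by
  rw [minkSq, minkDot_lightFront]; ring

theorem abs_three_lt_of_timelike {x : E4} (h : 0 < minkSq .instant x) : |x 3| < |x 0| := by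
  rw [minkSq_instant] at h
  apply sq_lt_sq.1
  nlinarith [sq_nonneg (x 1), sq_nonneg (x 2)]

/-- A time-like vector has |x³| < |x⁰|, so x⁰ − x³ and x⁰ have the same sign. -/
theorem freq_fromInstant_pos_iff (F : Form) {x : E4} (h : 0 < minkSq .instant x) :
    0 < freq F (fromInstant F x) ↔ 0 < x 0 := by
  cases F
  · have h1 := abs_three_lt_of_timelike h
    have h2 : freq .lightFront (fromInstant .lightFront x) = (x 0 - x 3) / √2 := by
      simp [freq, fromInstant, lightFrontEquiv, toLightFront]
    rw [h2, div_pos_iff_of_pos_right (by positivity)]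
    rw [abs_lt] at h1
    constructor
    · intro h3
      by_contra h4
      rw [abs_of_nonpos (not_lt.1 h4)] at h1
      linarith
    · intro h3
      rw [abs_of_pos h3] at h1
      linarith
  · rfl

/-- The open forward cone. -/
def openCone (F : Form) : Set E4 := {η | 0 < minkSq F η ∧ 0 < freq F η}

theorem fromInstant_mem_openCone (F : Form) {x : E4} :
    fromInstant F x ∈ openCone F ↔ x ∈ openCone .instant := by
  simp only [openCone, Set.mem_ofPred_eq, minkSq_fromInstant]
  exact and_congr_right fun h => freq_fromInstant_pos_iff F h

theorem fromInstant_mem_forwardCone (F : Form) {x : E4} :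
    fromInstant F x ∈ forwardCone F ↔ x ∈ forwardCone .instant := by
  cases F
  · have h0 : fromInstant .lightFront x 0 = (x 0 + x 3) / √2 := by
      simp [fromInstant, lightFrontEquiv, toLightFront]
    have h3 : fromInstant .lightFront x 3 = (x 0 - x 3) / √2 := by
      simp [fromInstant, lightFrontEquiv, toLightFront]
    simp only [forwardCone, Set.mem_ofPred_eq, minkSq_fromInstant, h0, h3]
    have hs : (0 : ℝ) < √2 := by positivity
    refine and_congr_right fun h => ?_
    have h1 : |x 3| ≤ |x 0| := by
      rw [minkSq_instant] at h
      apply sq_le_sq.1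
      nlinarith [sq_nonneg (x 1), sq_nonneg (x 2)]
    constructor
    · rintro ⟨h4, h5⟩
      have := add_nonneg h4 h5
      rw [← add_div, le_div_iff₀ hs] at this
      linarith
    · intro h4
      rw [abs_of_nonneg h4, abs_le] at h1
      constructor <;> apply div_nonneg _ hs.le <;> linarith
  · rfl

/-- Reversed Cauchy–Schwarz: in instant components the spatial product is smaller in modulus than
k⁰η⁰. -/
theorem minkDot_pos (F : Form) {k η : E4} (hk : k ∈ openCone F) (hη : η ∈ openCone F) :
    0 < minkDot F k η := by
  obtain ⟨k, rfl⟩ := (fromInstant F).surjective k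
  obtain ⟨η, rfl⟩ := (fromInstant F).surjective η
  rw [fromInstant_mem_openCone] at hk hη
  rw [minkDot_fromInstant, minkDot_instant]
  obtain ⟨hk1, hk2⟩ := hk
  obtain ⟨hη1, hη2⟩ := hη
  rw [minkSq_instant] at hk1 hη1
  simp only [freq] at hk2 hη2
  have h1 : (k 1 * η 1 + k 2 * η 2 + k 3 * η 3) ^ 2 < (k 0 * η 0) ^ 2 := by
    have h2 : (k 1 * η 1 + k 2 * η 2 + k 3 * η 3) ^ 2 ≤
        (k 1 ^ 2 + k 2 ^ 2 + k 3 ^ 2) * (η 1 ^ 2 + η 2 ^ 2 + η 3 ^ 2) := by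
      nlinarith [sq_nonneg (k 1 * η 2 - k 2 * η 1), sq_nonneg (k 1 * η 3 - k 3 * η 1),
        sq_nonneg (k 2 * η 3 - k 3 * η 2)]
    have h3 : (k 1 ^ 2 + k 2 ^ 2 + k 3 ^ 2) * (η 1 ^ 2 + η 2 ^ 2 + η 3 ^ 2) < k 0 ^ 2 * η 0 ^ 2 := by
      apply mul_lt_mul'' <;> first | positivity | linarith
    rw [mul_pow]
    linarith
  have h4 := abs_lt_of_sq_lt_sq h1 (by positivity)
  rw [abs_lt] at h4
  linarith [h4.2]

theorem freq_ne_zero (F : Form) {k : E4} (hk : 0 < minkSq F k) : freq F k ≠ 0 := by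
  intro h
  cases F
  · rw [minkSq_lightFront] at hk
    simp only [freq] at h
    rw [h] at hk
    nlinarith [sq_nonneg (k 1), sq_nonneg (k 2)]
  · rw [minkSq_instant] at hk
    simp only [freq] at h
    rw [h] at hk
    nlinarith [sq_nonneg (k 1), sq_nonneg (k 2), sq_nonneg (k 3)]

theorem minkDot_neg (F : Form) {k η : E4} (hk : 0 < minkSq F k) (hf : freq F k < 0)
    (hη : η ∈ openCone F) : minkDot F k η < 0 := by
  have := minkDot_pos F (k := -k) ⟨by rwa [minkSq_neg], by rw [freq_neg]; linarith⟩ hη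
  rw [minkDot_neg_left] at this
  linarith

/-- If k were time-like, then k · η would have the strict sign of the frequency of k. This is the
real fact behind the avoidance of the cut in the tube. -/
theorem minkSq_nonpos_of_minkDot_eq_zero (F : Form) {k η : E4} (hη : η ∈ openCone F)
    (h : minkDot F k η = 0) : minkSq F k ≤ 0 := by
  by_contra hk
  push Not at hk
  rcases lt_or_gt_of_ne (freq_ne_zero F hk) with hf | hf
  · exact (minkDot_neg F hk hf hη).ne h
  · exact (minkDot_pos F ⟨hk, hf⟩ hη).ne' h

/-- The closed forward cone is determined by half-spaces with time-like normals. -/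
theorem exists_minkDot_neg (F : Form) {y : E4} (hy : y ∉ forwardCone F) :
    ∃ η ∈ openCone F, minkDot F η y < 0 := by
  obtain ⟨y, rfl⟩ := (fromInstant F).surjective y
  rw [fromInstant_mem_forwardCone] at hy
  suffices h : ∃ η ∈ openCone .instant, minkDot .instant η y < 0 by
    obtain ⟨η, h1, h2⟩ := h
    exact ⟨fromInstant F η, (fromInstant_mem_openCone F).2 h1, by rwa [minkDot_fromInstant]⟩
  by_cases h0 : y 0 < 0
  · refine ⟨!₂[1, 0, 0, 0], ⟨?_, ?_⟩, ?_⟩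
    · simp [minkSq_instant]
    · simp [freq]
    · rw [minkDot_instant]
      simpa using h0
  · push Not at h0
    have h1 : minkSq .instant y < 0 := by
      by_contra h2
      exact hy ⟨not_lt.1 h2, h0⟩
    rw [minkSq_instant] at h1
    set S := y 1 ^ 2 + y 2 ^ 2 + y 3 ^ 2 with hS
    have hS0 : 0 ≤ S := by positivity
    have hyS : y 0 < √S := Real.lt_sqrt_of_sq_lt (by linarith)
    have hSp : 0 < √S := lt_of_le_of_lt h0 hyS
    have hSS : √S ^ 2 = S := Real.sq_sqrt hS0
    -- The normal is η = (√S + ε, y¹, y², y³), time-like for ε > 0. With ε(y⁰ + 1) = √S(√S − y⁰) one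
    -- gets η · y = −√S(√S − y⁰) + εy⁰ = −ε.
    have hε : 0 < √S * (√S - y 0) / (y 0 + 1) := by
      apply div_pos (mul_pos hSp (by linarith)) (by linarith)
    set ε := √S * (√S - y 0) / (y 0 + 1) with hεdef
    have hε2 : ε * (y 0 + 1) = √S * (√S - y 0) := by
      rw [hεdef]; field_simp
    refine ⟨!₂[√S + ε, y 1, y 2, y 3], ⟨?_, ?_⟩, ?_⟩
    · rw [minkSq_instant]
      simp
      nlinarith
    · simp [freq]
      linarith
    · rw [minkDot_instant]
      simp
      nlinarith

theorem isClosed_forwardCone (F : Form) : IsClosed (forwardCone F) := by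
  cases F
  · exact (isClosed_le continuous_const (continuous_minkSq _)).inter
      ((isClosed_le continuous_const (by fun_prop : Continuous fun y : E4 => y 0)).inter
        (isClosed_le continuous_const (by fun_prop : Continuous fun y : E4 => y 3)))
  · exact (isClosed_le continuous_const (continuous_minkSq _)).inter
      (isClosed_le continuous_const (by fun_prop : Continuous fun y : E4 => y 0))

theorem isClosed_backwardCone (F : Form) : IsClosed (backwardCone F) :=
  (isClosed_forwardCone F).preimage continuous_neg

theorem eq_zero_of_mem_cones (F : Form) {y : E4} (h1 : y ∈ forwardCone F)
    (h2 : y ∈ backwardCone F) : y = 0 := by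
  obtain ⟨y, rfl⟩ := (fromInstant F).surjective y
  rw [backwardCone, Set.mem_ofPred_eq, ← map_neg, fromInstant_mem_forwardCone] at h2
  rw [fromInstant_mem_forwardCone] at h1
  obtain ⟨h1, h3⟩ := h1
  have h4 : y 0 = 0 := by
    have := h2.2
    simp at this
    linarith
  rw [minkSq_instant, h4] at h1
  have h5 : y 1 = 0 := by nlinarith [sq_nonneg (y 1), sq_nonneg (y 2), sq_nonneg (y 3)]
  have h6 : y 2 = 0 := by nlinarith [sq_nonneg (y 1), sq_nonneg (y 2), sq_nonneg (y 3)]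
  have h7 : y 3 = 0 := by nlinarith [sq_nonneg (y 1), sq_nonneg (y 2), sq_nonneg (y 3)]
  have : y = 0 := by
    ext i
    fin_cases i <;> simp [h4, h5, h6, h7]
  rw [this, map_zero]

theorem exists_mem_openCone (F : Form) : ∃ η, η ∈ openCone F :=
  ⟨fromInstant F !₂[1, 0, 0, 0], (fromInstant_mem_openCone F).2
    ⟨by simp [minkSq_instant], by simp [freq]⟩⟩

/-- Along every line in a fixed time-like direction k² − c is a polynomial of degree exactly two, so
it vanishes at finitely many points; a set that is null on all parallel lines is null. -/
theorem ae_minkSq_ne (F : Form) (c : ℝ) : ∀ᵐ k : E4, minkSq F k ≠ c := by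
  obtain ⟨η, hη, -⟩ := exists_mem_openCone F
  refine ae_mem_of_ae_add_linearMap_mem (LinearMap.toSpanSingleton ℝ E4 η) volume volume
    (s := {k | minkSq F k ≠ c})
    ((isClosed_singleton.preimage (continuous_minkSq F)).isOpen_compl.measurableSet) fun k => ?_
  let p : Polynomial ℝ := Polynomial.C (minkSq F η) * Polynomial.X ^ 2 +
    Polynomial.C (2 * minkDot F k η) * Polynomial.X + Polynomial.C (minkSq F k - c)
  have hp : p ≠ 0 := by
    intro h
    have h2 := Polynomial.natDegree_quadratic (R := ℝ) (b := 2 * minkDot F k η)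
      (c := minkSq F k - c) hη.ne'
    change p.natDegree = 2 at h2
    rw [h] at h2
    simp at h2
  refine (p.roots.toFinset.finite_toSet.countable.ae_notMem volume).mono fun t ht => ?_
  intro h
  apply ht
  simp only [LinearMap.toSpanSingleton_apply, minkSq_add_smul] at h
  simp only [Finset.mem_coe, Multiset.mem_toFinset]
  rw [Polynomial.mem_roots hp, Polynomial.IsRoot.def]
  simp only [p, Polynomial.eval_add, Polynomial.eval_mul, Polynomial.eval_C, Polynomial.eval_pow,
    Polynomial.eval_X]
  linarith

/-! ### Scaling, growth, and uniqueness of the central splitting. -/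

theorem minkowskiFourier_surjective (F : Form) : Function.Surjective (minkowskiFourier F) := by
  intro φ
  have hc : ((((2 * Real.pi : ℝ) : ℂ) ^ 2)⁻¹ : ℂ) ≠ 0 := by
    have := Real.pi_ne_zero
    simp [this]
  obtain ⟨ψ, hψ⟩ : ∃ ψ : 𝓢(E4, ℂ), 𝓕 ψ =
      SchwartzMap.compCLMOfContinuousLinearEquiv ℂ (fourierEquiv F).symm
        (((((2 * Real.pi : ℝ) : ℂ) ^ 2)⁻¹)⁻¹ • φ) :=
    ⟨𝓕⁻ _, FourierTransform.fourier_fourierInv_eq _⟩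
  refine ⟨ψ, ?_⟩
  ext k
  have h1 : minkowskiFourier F ψ k =
      (((2 * Real.pi : ℝ) : ℂ) ^ 2)⁻¹ * (𝓕 ψ) (fourierEquiv F k) := rfl
  rw [h1, hψ, SchwartzMap.compCLMOfContinuousLinearEquiv_apply, Function.comp_apply,
    ContinuousLinearEquiv.symm_apply_apply, smul_apply, smul_eq_mul,
    mul_inv_cancel_left₀ hc]

theorem dilate_minkowskiFourier (F : Form) (a : ℝ) (ha : 0 < a) (ψ : 𝓢(E4, ℂ)) :
    dilate a ha.ne' (minkowskiFourier F ψ) =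
      ((a : ℂ) ^ 4)⁻¹ • minkowskiFourier F (dilate a⁻¹ (inv_ne_zero ha.ne') ψ) := by
  ext k
  rw [dilate_apply, smul_apply, minkowskiFourier_apply, minkowskiFourier_apply]
  have h1 := Measure.integral_comp_smul (volume : Measure E4)
    (fun y : E4 => Complex.exp (-Complex.I * (minkDot F (a • k) y : ℝ)) * ψ y) a⁻¹
  have h2 : ∀ y, Complex.exp (-Complex.I * (minkDot F (a • k) (a⁻¹ • y) : ℝ)) * ψ (a⁻¹ • y) =
      Complex.exp (-Complex.I * (minkDot F k y : ℝ)) * dilate a⁻¹ (inv_ne_zero ha.ne') ψ y := by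
    intro y
    rw [dilate_apply, minkDot_smul_left, minkDot_smul_right, mul_inv_cancel_left₀ ha.ne']
  simp_rw [h2] at h1
  rw [h1]
  have h3 : |((a⁻¹) ^ Module.finrank ℝ E4)⁻¹| = a ^ 4 := by
    simp [abs_of_pos ha]
  rw [h3, smul_eq_mul, Complex.real_smul]
  have : (a : ℂ) ≠ 0 := by exact_mod_cast ha.ne'
  push_cast
  field_simp

theorem rescaled_of_pos (T : 𝓢'(E4, ℂ)) {α : ℝ} (hα : 0 < α) (φ : 𝓢(E4, ℂ)) :
    rescaled T α φ = (α : ℂ) ^ 4 * T (dilate α hα.ne' φ) := by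
  rw [rescaled, dif_pos hα.ne']

/-- The factor α⁴ in `rescaled` cancels the Jacobian of the dilation, so rescaling in momentum space
is a plain inverse dilation of the position-space test function. -/
theorem rescaled_minkowskiFourier (F : Form) (T : 𝓢'(E4, ℂ)) {α : ℝ} (hα : 0 < α)
    (ψ : 𝓢(E4, ℂ)) : rescaled T α (minkowskiFourier F ψ) =
      positionSpace F T (dilate α⁻¹ (inv_ne_zero hα.ne') ψ) := by
  rw [rescaled_of_pos T hα, dilate_minkowskiFourier F α hα, map_smul, smul_eq_mul,
    mul_inv_cancel_left₀ (pow_ne_zero 4 (by exact_mod_cast hα.ne'))]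
  rfl

theorem rescaled_sub (T T' : 𝓢'(E4, ℂ)) (α : ℝ) (φ : 𝓢(E4, ℂ)) :
    rescaled (T - T') α φ = rescaled T α φ - rescaled T' α φ := by
  unfold rescaled
  split_ifs
  · rw [← mul_sub]; rfl
  · simp

/-- A distribution of singular order `2` grows at most like `6 ^ n` along `α = 2 ^ (-n)`. -/
theorem HasSingularOrder.exists_bound {T : TensorDist} (h : HasSingularOrder T 2) (μ ν : Fin 4)
    (φ : 𝓢(E4, ℂ)) : ∃ C : ℝ, ∀ᶠ n : ℕ in atTop, ‖rescaled (T μ ν) ((2⁻¹ : ℝ) ^ n) φ‖ ≤ C * 6 ^ n := by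
  obtain ⟨ρ, T₀, -, hpos, hreg, -, hlim⟩ := h
  have hα : Tendsto (fun n : ℕ => (2⁻¹ : ℝ) ^ n) atTop (𝓝[>] 0) :=
    tendsto_nhdsWithin_iff.2 ⟨tendsto_pow_atTop_nhds_zero_of_lt_one (by norm_num) (by norm_num),
      Eventually.of_forall fun n => by simp⟩
  have h1 := ((hlim μ ν φ).comp hα).norm.eventually_lt_const (lt_add_one _)
  -- Each halving of α multiplies ρ by about 1/4, eventually by more than 1/6. Any base strictly
  -- between 2² and 2³ would do in place of 6: it has to absorb the slowly varying part of ρ and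
  -- still exclude cubic growth.
  have h2 := ((hreg 2⁻¹ (by norm_num)).comp hα).eventually_const_lt
    (show (6⁻¹ : ℝ) < 2⁻¹ ^ (2 : ℝ) by norm_num)
  obtain ⟨N, hN⟩ := eventually_atTop.1 h2
  have h3 : ∀ n, N ≤ n → ρ ((2⁻¹ : ℝ) ^ N) * 6⁻¹ ^ n ≤ ρ ((2⁻¹ : ℝ) ^ n) := by
    intro n hn
    induction n, hn using Nat.le_induction with
    | base =>
      exact mul_le_of_le_one_right (hpos _ (by positivity)).le (pow_le_one₀ (by norm_num) (by norm_num))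
    | succ n hn ih =>
      have h4 := hN n hn
      simp only [Function.comp_apply] at h4
      rw [lt_div_iff₀ (hpos _ (by positivity)), ← pow_succ'] at h4
      rw [pow_succ]
      linarith
  have hρN := hpos ((2⁻¹ : ℝ) ^ N) (by positivity)
  refine ⟨(‖T₀ μ ν φ‖ + 1) / ρ ((2⁻¹ : ℝ) ^ N), ?_⟩
  filter_upwards [h1, eventually_ge_atTop N] with n hn1 hn2
  have h5 := h3 n hn2
  have hρn := hpos ((2⁻¹ : ℝ) ^ n) (by positivity)
  simp only [Function.comp_apply, norm_mul, Complex.norm_real, Real.norm_of_nonneg hρn.le] at hn1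
  rw [div_mul_eq_mul_div, le_div_iff₀ hρN]
  have h6 : ρ ((2⁻¹ : ℝ) ^ N) ≤ ρ ((2⁻¹ : ℝ) ^ n) * 6 ^ n := by
    calc ρ ((2⁻¹ : ℝ) ^ N) = ρ ((2⁻¹ : ℝ) ^ N) * 6⁻¹ ^ n * 6 ^ n := by
          rw [mul_assoc, ← mul_pow]; norm_num
      _ ≤ _ := by gcongr
  calc _ ≤ ‖rescaled (T μ ν) ((2⁻¹ : ℝ) ^ n) φ‖ * (ρ ((2⁻¹ : ℝ) ^ n) * 6 ^ n) := by gcongr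
    _ = (ρ ((2⁻¹ : ℝ) ^ n) * ‖rescaled (T μ ν) ((2⁻¹ : ℝ) ^ n) φ‖) * 6 ^ n := by ring
    _ ≤ _ := by gcongr

/-- A polynomial of degree at least 3 grows at least like 8^n along 2^n, too fast for 6^n. The
reversed polynomial at 2^{-n} isolates the leading coefficient. -/
theorem Polynomial.natDegree_le_two_of_bound {p : Polynomial ℂ} {C : ℝ}
    (h : ∀ᶠ n : ℕ in atTop, ‖p.eval ((2 : ℂ) ^ n)‖ ≤ C * 6 ^ n) : p.natDegree ≤ 2 := by
  by_contra hd
  push Not at hd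
  have hp : p ≠ 0 := by
    rintro rfl
    simp at hd
  have hlc : 0 < ‖p.leadingCoeff‖ := norm_pos_iff.2 (Polynomial.leadingCoeff_ne_zero.2 hp)
  have hr : ∀ n : ℕ, ‖p.eval ((2 : ℂ) ^ n)‖ =
      ‖p.reverse.eval (((2 : ℂ) ^ n)⁻¹)‖ * ((2 : ℝ) ^ n) ^ p.natDegree := by
    intro n
    let _ : Invertible ((2 : ℂ) ^ n) := invertibleOfNonzero (by simp)
    have := Polynomial.eval₂_reverse_mul_pow (RingHom.id ℂ) ((2 : ℂ) ^ n) p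
    rw [invOf_eq_inv] at this
    simp only [Polynomial.eval₂_id] at this
    rw [← this, norm_mul, norm_pow, norm_pow, Complex.norm_ofNat]
  have h1 : Tendsto (fun n : ℕ => ‖p.reverse.eval (((2 : ℂ) ^ n)⁻¹)‖) atTop
      (𝓝 ‖p.leadingCoeff‖) := by
    have h2 : Tendsto (fun n : ℕ => ((2 : ℂ) ^ n)⁻¹) atTop (𝓝 0) := by
      simp_rw [← inv_pow]
      exact tendsto_pow_atTop_nhds_zero_of_norm_lt_one (by norm_num)
    have h3 := ((p.reverse.continuous.tendsto 0).comp h2).norm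
    rwa [← Polynomial.coeff_zero_eq_eval_zero, Polynomial.coeff_zero_reverse] at h3
  have h4 : ∀ᶠ n : ℕ in atTop, ‖p.leadingCoeff‖ / 2 * (4 / 3 : ℝ) ^ n ≤ C := by
    filter_upwards [h, h1.eventually_const_lt (half_lt_self hlc)] with n hn1 hn2
    rw [hr] at hn1
    have h5 : (8 : ℝ) ^ n ≤ ((2 : ℝ) ^ n) ^ p.natDegree := by
      calc (8 : ℝ) ^ n = ((2 : ℝ) ^ n) ^ 3 := by rw [← pow_mul, mul_comm, pow_mul]; norm_num
        _ ≤ _ := pow_le_pow_right₀ (one_le_pow₀ (by norm_num)) hd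
    have h6 : ‖p.leadingCoeff‖ / 2 * 8 ^ n ≤ C * 6 ^ n := by
      refine le_trans ?_ hn1
      gcongr
    have h7 : (8 : ℝ) ^ n = (4 / 3) ^ n * 6 ^ n := by rw [← mul_pow]; norm_num
    rw [h7, ← mul_assoc] at h6
    exact le_of_mul_le_mul_right h6 (by positivity)
  have h8 : Tendsto (fun n : ℕ => ‖p.leadingCoeff‖ / 2 * (4 / 3 : ℝ) ^ n) atTop atTop :=
    (tendsto_pow_atTop_atTop_of_one_lt (by norm_num)).const_mul_atTop (by positivity)
  obtain ⟨n, hn1, hn2⟩ := (h4.and (h8.eventually_gt_atTop C)).exists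
  linarith

theorem Polynomial.eq_zero_of_tendsto {p : Polynomial ℂ} (hp : p.natDegree ≤ 2)
    (h : Tendsto (fun x : ℝ => p.eval (x : ℂ) / (x : ℂ) ^ 2) (𝓝[>] 0) (𝓝 0)) : p = 0 := by
  have hx : Tendsto (fun x : ℝ => (x : ℂ)) (𝓝[>] 0) (𝓝 0) :=
    (Complex.continuous_ofReal.tendsto' 0 0 (by simp)).mono_left nhdsWithin_le_nhds
  have hev : ∀ x : ℂ, p.eval x = p.coeff 0 + p.coeff 1 * x + p.coeff 2 * x ^ 2 := by
    intro x
    rw [Polynomial.eval_eq_sum_range' (n := 3) (by omega)]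
    simp [Finset.sum_range_succ]
  have h0 : p.coeff 0 = 0 := by
    have h1 := h.mul (hx.pow 2)
    have h2 : Tendsto (fun x : ℝ => p.eval (x : ℂ)) (𝓝[>] 0) (𝓝 (p.eval 0)) :=
      (p.continuous.tendsto 0).comp hx
    rw [← Polynomial.coeff_zero_eq_eval_zero] at h2
    rw [zero_mul] at h1
    refine tendsto_nhds_unique h2 (h1.congr' ?_)
    filter_upwards [self_mem_nhdsWithin] with x hx0
    have : (x : ℂ) ≠ 0 := by exact_mod_cast (ne_of_gt hx0)
    field_simp
  have h1 : p.coeff 1 = 0 := by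
    have h1 := h.mul hx
    have h2 : Tendsto (fun x : ℝ => p.coeff 1 + p.coeff 2 * (x : ℂ)) (𝓝[>] 0)
        (𝓝 (p.coeff 1 + p.coeff 2 * 0)) := (hx.const_mul _).const_add _
    rw [zero_mul] at h1
    rw [mul_zero, add_zero] at h2
    refine tendsto_nhds_unique h2 (h1.congr' ?_)
    filter_upwards [self_mem_nhdsWithin] with x hx0
    have : (x : ℂ) ≠ 0 := by exact_mod_cast (ne_of_gt hx0)
    rw [hev, h0]
    field_simp
    ring
  have h2 : p.coeff 2 = 0 := by
    refine tendsto_nhds_unique (tendsto_const_nhds (f := 𝓝[>] (0 : ℝ))) (h.congr' ?_)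
    filter_upwards [self_mem_nhdsWithin] with x hx0
    have : (x : ℂ) ≠ 0 := by exact_mod_cast (ne_of_gt hx0)
    rw [hev, h0, h1]
    field_simp
    ring
  ext n
  rcases n with _ | _ | _ | n
  · simpa using h0
  · simpa using h1
  · simpa using h2
  · rw [Polynomial.coeff_eq_zero_of_natDegree_lt (by omega)]
    simp

/-- A function of class `C²` whose derivatives of order at most two vanish at the origin. -/
theorem isLittleO_of_iteratedFDeriv_eq_zero {f : E4 → ℂ} {U : Set E4} (hU : IsOpen U)
    (h0 : (0 : E4) ∈ U) (hf : ContDiffOn ℝ (2 : ℕ) f U)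
    (hz : ∀ j ≤ 2, iteratedFDeriv ℝ j f 0 = 0) :
    f =o[𝓝 0] fun x => ‖x‖ ^ 2 := by
  have hf0 : f 0 = 0 := by
    have := congrArg (fun g => g ![]) (hz 0 (by norm_num))
    simpa using this
  have hd1 : fderiv ℝ f 0 = 0 := by
    have h1 := norm_iteratedFDeriv_fderiv (𝕜 := ℝ) (f := f) (x := 0) (n := 0)
    rw [norm_iteratedFDeriv_zero, zero_add, hz 1 (by norm_num), norm_zero, norm_eq_zero] at h1
    exact h1
  have hd2 : fderiv ℝ (fderiv ℝ f) 0 = 0 := by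
    have h1 := norm_iteratedFDeriv_fderiv (𝕜 := ℝ) (f := f) (x := 0) (n := 1)
    have h2 := norm_iteratedFDeriv_fderiv (𝕜 := ℝ) (f := fderiv ℝ f) (x := 0) (n := 0)
    rw [norm_iteratedFDeriv_zero, zero_add, h1, hz 2 (by norm_num), norm_zero, norm_eq_zero] at h2
    exact h2
  have hcd : ContDiffOn ℝ 1 (fderiv ℝ f) U := hf.fderiv_of_isOpen hU (by norm_num)
  have hdf : DifferentiableAt ℝ (fderiv ℝ f) 0 :=
    (hcd.differentiableOn one_ne_zero).differentiableAt (hU.mem_nhds h0)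
  -- Only class C² is available, hence Peano's form of Taylor's theorem: the derivative is o(‖x‖)
  -- because it is differentiable at 0 with derivative 0, and the mean value inequality integrates
  -- this.
  have hlo : (fderiv ℝ f) =o[𝓝 0] fun x => x := by
    have := hdf.hasFDerivAt.isLittleO
    simpa [hd1, hd2] using this
  rw [Asymptotics.isLittleO_iff]
  intro c hc
  obtain ⟨r, hr0, hr⟩ := Metric.eventually_nhds_iff_ball.1 ((hlo.def hc).and (hU.mem_nhds h0))
  filter_upwards [Metric.ball_mem_nhds (0 : E4) hr0] with x hx
  have hsub : Metric.closedBall (0 : E4) ‖x‖ ⊆ Metric.ball 0 r :=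
    Metric.closedBall_subset_ball (by simpa using hx)
  have h1 := (convex_closedBall (0 : E4) ‖x‖).norm_image_sub_le_of_norm_fderiv_le
    (𝕜 := ℝ) (f := f) (C := c * ‖x‖) (x := 0) (y := x)
    (fun y hy => ((hf.differentiableOn (by norm_num)).differentiableAt
      (hU.mem_nhds (hr y (hsub hy)).2))) (fun y hy => ?_) (by simp) (by simp)
  · rw [hf0, sub_zero, sub_zero] at h1
    simpa [sq, mul_assoc] using h1
  · refine (hr y (hsub hy)).1.trans ?_
    have : ‖y‖ ≤ ‖x‖ := by simpa using hy
    gcongr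

/-- If the function `f` is of order `o(|k|²)` at the origin, then `⟨T, φ(a ·)⟩ = o(a⁻⁶)` at
infinity. -/
theorem VanishesToOrder.tendsto {T : 𝓢'(E4, ℂ)} (h : VanishesToOrder T 2) {φ : 𝓢(E4, ℂ)}
    (hφ : HasCompactSupport φ) :
    Tendsto (fun x : ℝ => rescaled T x⁻¹ φ / (x : ℂ) ^ 2) (𝓝[>] 0) (𝓝 0) := by
  obtain ⟨U, f, hU, h0, hf, hz, hT⟩ := h
  have hlo := isLittleO_of_iteratedFDeriv_eq_zero hU h0 hf hz
  obtain ⟨R, hR0, hR⟩ : ∃ R : ℝ, 0 < R ∧ tsupport φ ⊆ Metric.closedBall 0 R := by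
    obtain ⟨R, hR⟩ := (show IsCompact (tsupport φ) from hφ).isBounded.subset_closedBall (0 : E4)
    exact ⟨max R 1, by positivity, hR.trans (Metric.closedBall_subset_closedBall (le_max_left _ _))⟩
  have hint : Integrable fun k : E4 => ‖k‖ ^ 2 * ‖φ k‖ := φ.integrable_pow_mul volume 2
  rw [Metric.tendsto_nhds]
  intro ε hε
  set I := ∫ k : E4, ‖k‖ ^ 2 * ‖φ k‖ with hI
  have hI0 : 0 ≤ I := integral_nonneg fun k => by positivity
  have hδ : 0 < ε / (I + 1) := by positivity
  obtain ⟨r, hr0, hr⟩ := Metric.eventually_nhds_iff_ball.1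
    ((hlo.def hδ).and (hU.mem_nhds h0))
  have hev : ∀ᶠ x : ℝ in 𝓝[>] 0, x * R < r := by
    have : Tendsto (fun x : ℝ => x * R) (𝓝[>] 0) (𝓝 0) := by
      have : Continuous fun x : ℝ => x * R := by fun_prop
      simpa using (this.tendsto 0).mono_left nhdsWithin_le_nhds
    exact this.eventually_lt_const hr0
  filter_upwards [hev, self_mem_nhdsWithin] with x hx hx0
  have hx0 : 0 < x := hx0
  have hxi : 0 < x⁻¹ := inv_pos.2 hx0
  rw [dist_zero_right, rescaled_of_pos T hxi]
  have hsupp : ∀ k, k ∈ tsupport (dilate x⁻¹ hxi.ne' φ) → x⁻¹ • k ∈ tsupport φ := by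
    intro k hk
    have h1 : tsupport (dilate x⁻¹ hxi.ne' φ : E4 → ℂ) ⊆ (fun k : E4 => x⁻¹ • k) ⁻¹' tsupport φ := by
      refine closure_minimal ?_ ((isClosed_tsupport _).preimage (continuous_const_smul x⁻¹))
      intro k hk
      exact subset_tsupport _ hk
    exact h1 hk
  have hball : tsupport (dilate x⁻¹ hxi.ne' φ : E4 → ℂ) ⊆ Metric.closedBall 0 (x * R) := by
    intro k hk
    have := hR (hsupp k hk)
    rw [mem_closedBall_zero_iff, norm_smul, Real.norm_of_nonneg hxi.le, inv_mul_le_iff₀ hx0] at this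
    rwa [mem_closedBall_zero_iff]
  have hball' : Metric.closedBall (0 : E4) (x * R) ⊆ Metric.ball 0 r :=
    Metric.closedBall_subset_ball hx
  rw [hT (dilate x⁻¹ hxi.ne' φ)
    (HasCompactSupport.of_support_subset_isCompact (isCompact_closedBall 0 (x * R))
      ((subset_tsupport _).trans hball))
    (hball.trans (hball'.trans fun k hk => (hr k hk).2))]
  have h2 := Measure.integral_comp_smul (volume : Measure E4)
    (fun k : E4 => f k * dilate x⁻¹ hxi.ne' φ k) x
  have h3 : |(x ^ Module.finrank ℝ E4)⁻¹| = (x ^ 4)⁻¹ := by simp [abs_of_pos hx0]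
  rw [h3] at h2
  -- Substituting x • k moves the dilation from φ to f. For small x the argument of f lies in the
  -- ball where f is o(‖·‖²), and the Jacobian x⁴ cancels the factor α⁴ of `rescaled`.
  have h4 : ∫ k : E4, f k * dilate x⁻¹ hxi.ne' φ k = (x : ℂ) ^ 4 * ∫ k : E4, f (x • k) * φ k := by
    have h5 : ∀ k : E4, dilate x⁻¹ hxi.ne' φ (x • k) = φ k := fun k => by
      rw [dilate_apply, inv_smul_smul₀ hx0.ne']
    simp_rw [h5] at h2
    rw [h2, Complex.real_smul]
    have : (x : ℂ) ≠ 0 := by exact_mod_cast hx0.ne'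
    push_cast
    field_simp
  have hxc : (x : ℂ) ≠ 0 := by exact_mod_cast hx0.ne'
  rw [h4, ← mul_assoc]
  have h6 : (((x⁻¹ : ℝ) : ℂ) ^ 4 * (x : ℂ) ^ 4) = 1 := by
    push_cast
    field_simp
  rw [h6, one_mul, norm_div, norm_pow, Complex.norm_real, Real.norm_of_nonneg hx0.le,
    div_lt_iff₀ (by positivity)]
  calc ‖∫ k : E4, f (x • k) * φ k‖ ≤ ∫ k : E4, ε / (I + 1) * x ^ 2 * (‖k‖ ^ 2 * ‖φ k‖) := by
        refine norm_integral_le_of_norm_le (hint.const_mul _) (Eventually.of_forall fun k => ?_)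
        by_cases hk : k ∈ tsupport φ
        · have h7 : x • k ∈ Metric.ball (0 : E4) r := by
            have := hR hk
            rw [mem_closedBall_zero_iff] at this
            rw [mem_ball_zero_iff, norm_smul, Real.norm_of_nonneg hx0.le]
            exact lt_of_le_of_lt (by gcongr) hx
          have h8 := (hr _ h7).1
          rw [norm_pow, norm_norm, norm_smul, Real.norm_of_nonneg hx0.le] at h8
          rw [norm_mul]
          calc _ ≤ ε / (I + 1) * (x * ‖k‖) ^ 2 * ‖φ k‖ := by gcongr
            _ = _ := by ring
        · rw [image_eq_zero_of_notMem_tsupport hk]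
          simp
    _ = ε * x ^ 2 * (I / (I + 1)) := by
        rw [integral_const_mul, ← hI]
        ring
    _ < ε * x ^ 2 * 1 := by
        gcongr
        rw [div_lt_one (by positivity)]
        linarith
    _ = _ := mul_one _

/-- A distribution with point support in position space is zero if it is of singular order two, up
to sums, and vanishes to second order at the origin. -/
theorem eq_zero_of_point_support (F : Form) {T : 𝓢'(E4, ℂ)}
    (hT : Distribution.IsVanishingOn (positionSpace F T) {0}ᶜ)
    (hgrow : ∀ φ : 𝓢(E4, ℂ), ∃ C : ℝ, ∀ᶠ n : ℕ in atTop,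
      ‖rescaled T ((2⁻¹ : ℝ) ^ n) φ‖ ≤ C * 6 ^ n)
    (hvan : ∀ φ : 𝓢(E4, ℂ), HasCompactSupport φ →
      Tendsto (fun x : ℝ => rescaled T x⁻¹ φ / (x : ℂ) ^ 2) (𝓝[>] 0) (𝓝 0)) : T = 0 := by
  refine eq_zero_of_compactSupport fun φ hφ => ?_
  obtain ⟨ψ, rfl⟩ := minkowskiFourier_surjective F φ
  -- As a function of x = 1/α the rescaled distribution is a polynomial p(x). Its growth at x = 2^n
  -- bounds the degree by 2, and p(x) = o(x²) at x → 0 removes the coefficients that are left.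
  obtain ⟨p, hp⟩ := exists_polynomial_dilate hT ψ
  have h1 : ∀ x : ℝ, 0 < x → rescaled T x⁻¹ (minkowskiFourier F ψ) = p.eval (x : ℂ) := by
    intro x hx
    rw [rescaled_minkowskiFourier F T (inv_pos.2 hx), hp]
    simp
  obtain ⟨C, hC⟩ := hgrow (minkowskiFourier F ψ)
  have hdeg : p.natDegree ≤ 2 := by
    refine Polynomial.natDegree_le_two_of_bound (C := C) (hC.mono fun n hn => ?_)
    rw [inv_pow, h1 _ (by positivity)] at hn
    simpa using hn
  have hp0 : p = 0 := by
    refine Polynomial.eq_zero_of_tendsto hdeg ((hvan _ hφ).congr' ?_)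
    filter_upwards [self_mem_nhdsWithin] with x hx
    rw [h1 x hx]
  have h2 := h1 1 one_pos
  rw [hp0, Polynomial.eval_zero, rescaled_of_pos T (by norm_num)] at h2
  have h3 : dilate (1 : ℝ)⁻¹ (by norm_num) (minkowskiFourier F ψ) = minkowskiFourier F ψ := by
    ext k
    rw [dilate_apply]
    simp
  rw [h3] at h2
  simpa using h2

theorem isVanishingOn_compl_zero (F : Form) {T : 𝓢'(E4, ℂ)}
    (h1 : Distribution.IsVanishingOn T (forwardCone F)ᶜ)
    (h2 : Distribution.IsVanishingOn T (backwardCone F)ᶜ) :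
    Distribution.IsVanishingOn T {0}ᶜ := by
  refine isVanishingOn_of_locally fun y hy => ?_
  by_cases hy1 : y ∈ forwardCone F
  · have hy2 : y ∈ (backwardCone F)ᶜ := fun hy2 => hy (eq_zero_of_mem_cones F hy1 hy2)
    exact ⟨_, (isClosed_backwardCone F).isOpen_compl.mem_nhds hy2, fun φ _ hφ => h2 φ hφ⟩
  · exact ⟨_, (isClosed_forwardCone F).isOpen_compl.mem_nhds hy1, fun φ _ hφ => h1 φ hφ⟩

/-- Central splittings of singular order two are unique. -/
theorem IsCentralSplitting.unique {F : Form} {d r r' : TensorDist}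
    (h : IsCentralSplitting F 2 d r) (h' : IsCentralSplitting F 2 d r') : r' = r := by
  funext μ ν
  rw [← sub_eq_zero]
  have hpos : ∀ T T' : 𝓢'(E4, ℂ), positionSpace F (T - T') = positionSpace F T - positionSpace F T' :=
    fun T T' => map_sub _ _ _
  have ho : ∀ {r : TensorDist}, IsCentralSplitting F 2 d r → HasSingularOrder r 2 := fun h => by
    simpa using h.order
  refine eq_zero_of_point_support F (isVanishingOn_compl_zero F ?_ ?_) ?_ ?_
  · intro φ hφ
    rw [hpos, sub_apply, h'.retarded μ ν φ hφ, h.retarded μ ν φ hφ, sub_zero]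
  · intro φ hφ
    have h1 := h'.advanced μ ν φ hφ
    have h2 := h.advanced μ ν φ hφ
    rw [Pi.sub_apply, Pi.sub_apply, hpos, sub_apply] at h1 h2
    rw [hpos, sub_apply]
    linear_combination h1 - h2
  · intro φ
    obtain ⟨C, hC⟩ := (ho h).exists_bound μ ν φ
    obtain ⟨C', hC'⟩ := (ho h').exists_bound μ ν φ
    refine ⟨C' + C, ?_⟩
    filter_upwards [hC, hC'] with n h1 h2
    rw [rescaled_sub, add_mul]
    exact (norm_sub_le _ _).trans (add_le_add h2 h1)
  · intro φ hφ
    have h1 := ((h'.normalized μ ν).tendsto hφ).sub ((h.normalized μ ν).tendsto hφ)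
    rw [sub_zero] at h1
    refine h1.congr fun x => ?_
    rw [rescaled_sub, sub_div]

/-! ### Boundary values of holomorphic functions and support in a half-space. -/

/-- Continuity of the Fourier transform in quantitative form: the constants do not depend on φ, so
the bound applies uniformly to the family `expWeight` as t varies. -/
theorem exists_decay_minkowskiFourier (F : Form) (N : ℕ) : ∃ (M : ℕ) (C : ℝ), 0 ≤ C ∧
    ∀ (φ : 𝓢(E4, ℂ)) (B : ℝ), 0 ≤ B →
      (∀ k ≤ M, ∀ n ≤ M, ∀ x, ‖x‖ ^ k * ‖iteratedFDeriv ℝ n φ x‖ ≤ B) →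
      ∀ k, (1 + ‖k‖) ^ N * ‖minkowskiFourier F φ k‖ ≤ C * B := by
  let p : Seminorm ℂ 𝓢(E4, ℂ) := (Finset.Iic (N, 0)).sup (schwartzSeminormFamily ℂ E4 ℂ)
  have hp : Continuous p := Seminorm.continuous_finsetSup fun i _ =>
    (schwartz_withSeminorms ℂ E4 ℂ).continuous_seminorm i
  let q : Seminorm ℂ 𝓢(E4, ℂ) :=
    p.comp (minkowskiFourier F : 𝓢(E4, ℂ) →ₗ[ℂ] 𝓢(E4, ℂ))
  have hq : Continuous q := hp.comp (minkowskiFourier F).continuous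
  obtain ⟨s, C, -, hC⟩ := Seminorm.bound_of_continuous (schwartz_withSeminorms ℂ E4 ℂ) q hq
  refine ⟨s.sup fun p => max p.1 p.2, 2 ^ N * C, by positivity, fun φ B hB h k => ?_⟩
  have h1 : (1 + ‖k‖) ^ N * ‖minkowskiFourier F φ k‖ ≤ 2 ^ N * q φ := by
    have := SchwartzMap.one_add_le_sup_seminorm_apply (𝕜 := ℂ) (m := (N, 0)) (k := N) (n := 0)
      le_rfl le_rfl (minkowskiFourier F φ) k
    rwa [norm_iteratedFDeriv_zero] at this
  refine h1.trans ?_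
  rw [mul_assoc]
  refine mul_le_mul_of_nonneg_left ((hC φ).trans ?_) (by positivity)
  simp only [smul_apply]
  refine mul_le_mul_of_nonneg_left ?_ C.2
  refine Seminorm.finset_sup_apply_le hB fun p hp => ?_
  have hle : max p.1 p.2 ≤ s.sup fun p => max p.1 p.2 :=
    Finset.le_sup (f := fun p : ℕ × ℕ => max p.1 p.2) hp
  exact SchwartzMap.seminorm_le_bound ℂ p.1 p.2 φ hB
    (h p.1 ((le_max_left _ _).trans hle) p.2 ((le_max_right _ _).trans hle))

/-- The continuous linear functional `y ↦ η · y`. -/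
def minkDotCLM (F : Form) (η : E4) : E4 →L[ℝ] ℝ := innerSL ℝ (lowerIndex F η)

theorem minkDotCLM_apply (F : Form) (η y : E4) : minkDotCLM F η y = minkDot F η y := by
  rw [minkDot_eq_inner]
  rfl

theorem contDiff_exp_smul (F : Form) (η : E4) (ψ : 𝓢(E4, ℂ)) (t : ℝ) {n : ℕ∞} :
    ContDiff ℝ n fun y => Real.exp ((t • minkDotCLM F η) y) • ψ y :=
  (Real.contDiff_exp.comp (t • minkDotCLM F η).contDiff).smul (ψ.smooth n)

theorem hasCompactSupport_exp_smul (F : Form) (η : E4) {ψ : 𝓢(E4, ℂ)} (hψ : HasCompactSupport ψ)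
    (t : ℝ) : HasCompactSupport fun y => Real.exp ((t • minkDotCLM F η) y) • ψ y :=
  HasCompactSupport.smul_left (f := fun y => Real.exp ((t • minkDotCLM F η) y)) hψ

/-- The test function `y ↦ e^{t η·y} ψ(y)`. -/
def expWeight (F : Form) (η : E4) {ψ : 𝓢(E4, ℂ)} (hψ : HasCompactSupport ψ) (t : ℝ) : 𝓢(E4, ℂ) :=
  HasCompactSupport.toSchwartzMap (f := fun y => Real.exp ((t • minkDotCLM F η) y) • ψ y)
    (hasCompactSupport_exp_smul F η hψ t) (contDiff_exp_smul F η ψ t)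

theorem expWeight_apply (F : Form) (η : E4) {ψ : 𝓢(E4, ℂ)} (hψ : HasCompactSupport ψ) (t : ℝ)
    (y : E4) : expWeight F η hψ t y = Real.exp (t * minkDot F η y) • ψ y := by
  simp [expWeight, minkDotCLM_apply]

theorem norm_iteratedFDeriv_exp_comp_le (L : E4 →L[ℝ] ℝ) (n : ℕ) (y : E4) :
    ‖iteratedFDeriv ℝ n (fun y => Real.exp (L y)) y‖ ≤ Real.exp (L y) * ‖L‖ ^ n := by
  have h1 := L.iteratedFDeriv_comp_right (f := Real.exp) (Real.contDiff_exp (n := n)) y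
    (i := n) le_rfl
  have h2 : (Real.exp ∘ L) = fun y => Real.exp (L y) := rfl
  rw [← h2, h1]
  refine (ContinuousMultilinearMap.norm_compContinuousLinearMap_le _ _).trans ?_
  rw [norm_iteratedFDeriv_eq_norm_iteratedDeriv, iteratedDeriv_eq_iterate, Real.iter_deriv_exp,
    Real.norm_of_nonneg (Real.exp_pos _).le]
  simp

/-- On the compact support η · y ≤ −δ, so the weight is at most e^{−δt}. This beats the powers of t
that differentiation of the exponential produces. -/
theorem exists_expWeight_bound (F : Form) (η : E4) {ψ : 𝓢(E4, ℂ)} (hψ : HasCompactSupport ψ)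
    (hsupp : tsupport ψ ⊆ {y | minkDot F η y < 0}) (M N : ℕ) : ∃ C : ℝ, 0 ≤ C ∧ ∀ t : ℝ, 0 ≤ t →
      ∀ k ≤ M, ∀ n ≤ M, ∀ y, ‖y‖ ^ k * ‖iteratedFDeriv ℝ n (expWeight F η hψ t) y‖ ≤
        C * ((1 + t) ^ N)⁻¹ := by
  obtain ⟨δ, hδ, hδs⟩ : ∃ δ : ℝ, 0 < δ ∧ ∀ y ∈ tsupport ψ, minkDot F η y ≤ -δ := by
    rcases (tsupport ψ).eq_empty_or_nonempty with he | hne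
    · exact ⟨1, one_pos, by simp [he]⟩
    · obtain ⟨y, hy, hmax⟩ := (show IsCompact (tsupport ψ) from hψ).exists_isMaxOn hne
        (Continuous.minkDot F continuous_const continuous_id).continuousOn
      exact ⟨-minkDot F η y, by simpa using hsupp hy, fun z hz => by simpa using hmax hz⟩
  choose S hS using fun k n => ψ.decay k n
  set B : ℝ := ∑ k ∈ Finset.range (M + 1), ∑ n ∈ Finset.range (M + 1), S k n with hB
  have hSB : ∀ k ≤ M, ∀ n ≤ M, S k n ≤ B := by
    intro k hk n hn
    calc S k n ≤ ∑ n ∈ Finset.range (M + 1), S k n :=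
          Finset.single_le_sum (f := fun n => S k n) (fun n _ => (hS k n).1.le)
            (Finset.mem_range.2 (Nat.lt_succ_of_le hn))
      _ ≤ B := Finset.single_le_sum (f := fun k => ∑ n ∈ Finset.range (M + 1), S k n)
            (fun k _ => Finset.sum_nonneg fun n _ => (hS k n).1.le)
            (Finset.mem_range.2 (Nat.lt_succ_of_le hk))
  have hB0 : 0 ≤ B := (hS 0 0).1.le.trans (hSB 0 (by omega) 0 (by omega))
  obtain ⟨K, hK0, hK⟩ : ∃ K : ℝ, 0 ≤ K ∧ ∀ t : ℝ, 0 ≤ t →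
      (1 + t) ^ (M + N) * Real.exp (-δ * t) ≤ K := by
    -- From z^n/n! ≤ e^z with z = δ(1 + t).
    refine ⟨((M + N).factorial : ℝ) / δ ^ (M + N) * Real.exp δ, by positivity, fun t ht => ?_⟩
    have h1 := Real.pow_div_factorial_le_exp (δ * (1 + t)) (by positivity) (M + N)
    rw [div_le_iff₀ (by positivity), mul_pow] at h1
    have h2 : Real.exp (-δ * t) = (Real.exp (δ * (1 + t)))⁻¹ * Real.exp δ := by
      rw [← Real.exp_neg, ← Real.exp_add]
      congr 1
      ring
    rw [h2, ← mul_assoc]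
    refine mul_le_mul_of_nonneg_right ?_ (Real.exp_pos _).le
    rw [← div_eq_mul_inv, div_le_div_iff₀ (Real.exp_pos _) (by positivity)]
    linarith
  set L := minkDotCLM F η with hL
  refine ⟨2 ^ M * ((1 + ‖L‖) ^ M * B) * K, by positivity, fun t ht k hk n hn y => ?_⟩
  have hfun : (expWeight F η hψ t : E4 → ℂ) = fun y => Real.exp ((t • L) y) • ψ y := rfl
  have hexp : ContDiff ℝ M fun y => Real.exp ((t • L) y) :=
    Real.contDiff_exp.comp (t • L).contDiff
  have h1 := norm_iteratedFDeriv_smul_le hexp (ψ.smooth M) y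
    (show ((n : ℕ) : WithTop ℕ∞) ≤ ((M : ℕ∞) : WithTop ℕ∞) by exact_mod_cast hn)
  rw [hfun]
  have hmain : ∀ i ≤ n, ‖y‖ ^ k * (‖iteratedFDeriv ℝ i (fun y => Real.exp ((t • L) y)) y‖ *
      ‖iteratedFDeriv ℝ (n - i) ψ y‖) ≤ Real.exp (-δ * t) * ((1 + t) ^ M * ((1 + ‖L‖) ^ M * B)) := by
    intro i hi
    by_cases hy : y ∈ tsupport ψ
    · have h2 : ‖iteratedFDeriv ℝ i (fun y => Real.exp ((t • L) y)) y‖ ≤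
          Real.exp (-δ * t) * ((1 + t) ^ M * (1 + ‖L‖) ^ M) := by
        refine (norm_iteratedFDeriv_exp_comp_le (t • L) i y).trans ?_
        gcongr
        · have h3 := hδs y hy
          have h4 : (t • L) y = t * minkDot F η y := by
            simp [hL, minkDotCLM_apply]
          rw [h4]
          nlinarith
        · rw [norm_smul, Real.norm_of_nonneg ht, ← mul_pow]
          calc (t * ‖L‖) ^ i ≤ ((1 + t) * (1 + ‖L‖)) ^ i := by
                gcongr <;> linarith
            _ ≤ ((1 + t) * (1 + ‖L‖)) ^ M := by
                refine pow_le_pow_right₀ ?_ (hi.trans hn)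
                have := norm_nonneg L
                nlinarith
      have h3 := ((hS k (n - i)).2 y).trans (hSB k hk (n - i) (by omega))
      calc _ = ‖iteratedFDeriv ℝ i (fun y => Real.exp ((t • L) y)) y‖ *
            (‖y‖ ^ k * ‖iteratedFDeriv ℝ (n - i) ψ y‖) := by ring
        _ ≤ (Real.exp (-δ * t) * ((1 + t) ^ M * (1 + ‖L‖) ^ M)) * B := by gcongr
        _ = _ := by ring
    · have h2 : iteratedFDeriv ℝ (n - i) ψ y = 0 := by
        by_contra h3
        exact hy (support_iteratedFDeriv_subset (n - i) h3)
      rw [h2, norm_zero, mul_zero, mul_zero]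
      positivity
  calc _ ≤ ‖y‖ ^ k * ∑ i ∈ Finset.range (n + 1), (n.choose i : ℝ) *
        ‖iteratedFDeriv ℝ i (fun y => Real.exp ((t • L) y)) y‖ * ‖iteratedFDeriv ℝ (n - i) ψ y‖ :=
        mul_le_mul_of_nonneg_left h1 (by positivity)
    _ ≤ ∑ i ∈ Finset.range (n + 1), (n.choose i : ℝ) *
        (Real.exp (-δ * t) * ((1 + t) ^ M * ((1 + ‖L‖) ^ M * B))) := by
        rw [Finset.mul_sum]
        refine Finset.sum_le_sum fun i hi => ?_
        have := hmain i (Nat.le_of_lt_succ (Finset.mem_range.1 hi))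
        calc _ = (n.choose i : ℝ) * (‖y‖ ^ k *
              (‖iteratedFDeriv ℝ i (fun y => Real.exp ((t • L) y)) y‖ *
                ‖iteratedFDeriv ℝ (n - i) ψ y‖)) := by ring
          _ ≤ _ := by gcongr
    _ = 2 ^ n * (Real.exp (-δ * t) * ((1 + t) ^ M * ((1 + ‖L‖) ^ M * B))) := by
        rw [← Finset.sum_mul]
        congr 1
        exact_mod_cast Nat.sum_range_choose n
    _ ≤ 2 ^ M * (Real.exp (-δ * t) * ((1 + t) ^ M * ((1 + ‖L‖) ^ M * B))) := by
        gcongr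
        norm_num
    _ = 2 ^ M * ((1 + ‖L‖) ^ M * B) * (((1 + t) ^ (M + N) * Real.exp (-δ * t)) * ((1 + t) ^ N)⁻¹) := by
        rw [pow_add]
        field_simp
    _ ≤ 2 ^ M * ((1 + ‖L‖) ^ M * B) * (K * ((1 + t) ^ N)⁻¹) := by
        gcongr
        exact hK t ht
    _ = _ := by ring

theorem exists_fourier_expWeight_bound (F : Form) (η : E4) {ψ : 𝓢(E4, ℂ)}
    (hψ : HasCompactSupport ψ) (hsupp : tsupport ψ ⊆ {y | minkDot F η y < 0}) (N : ℕ) :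
    ∃ C : ℝ, 0 ≤ C ∧ ∀ t : ℝ, 0 ≤ t → ∀ k,
      ‖minkowskiFourier F (expWeight F η hψ t) k‖ ≤ C * ((1 + ‖k‖) ^ N)⁻¹ * ((1 + t) ^ N)⁻¹ := by
  obtain ⟨M, C, hC, h1⟩ := exists_decay_minkowskiFourier F N
  obtain ⟨C', hC', h2⟩ := exists_expWeight_bound F η hψ hsupp M N
  refine ⟨C * C', by positivity, fun t ht k => ?_⟩
  have h3 := h1 _ (C' * ((1 + t) ^ N)⁻¹) (by positivity) (h2 t ht) k
  rw [mul_comm, ← le_div_iff₀ (by positivity), div_eq_mul_inv] at h3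
  linarith

/-- The Fourier–Laplace transform of `ψ` at the complex momentum `k + ζ η`. -/
def fourierLaplace (F : Form) (η : E4) (ψ : 𝓢(E4, ℂ)) (k : E4) (ζ : ℂ) : ℂ :=
  (((2 * Real.pi : ℝ) : ℂ) ^ 2)⁻¹ *
    ∫ y : E4, Complex.exp (-Complex.I * ((minkDot F k y : ℝ) + ζ * (minkDot F η y : ℝ))) * ψ y

/-- An imaginary momentum shift itη turns the phase into the real weight e^{tη·y}. The decay of
`expWeight` thus becomes decay in the upper half-plane. -/
theorem fourierLaplace_eq (F : Form) (η : E4) {ψ : 𝓢(E4, ℂ)} (hψ : HasCompactSupport ψ) (k : E4)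
    (t : ℝ) : fourierLaplace F η ψ k (t * Complex.I) =
      minkowskiFourier F (expWeight F η hψ t) k := by
  rw [fourierLaplace, minkowskiFourier_apply]
  congr 1
  refine integral_congr_ae (Eventually.of_forall fun y => ?_)
  simp only
  rw [expWeight_apply, Complex.real_smul, ← mul_assoc, Complex.ofReal_exp, ← Complex.exp_add]
  congr 2
  push_cast
  linear_combination -(t : ℂ) * (minkDot F η y : ℝ) * Complex.I_sq

theorem fourierLaplace_add_smul (F : Form) (η : E4) (ψ : 𝓢(E4, ℂ)) (k : E4) (ζ : ℂ) (c : ℝ) :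
    fourierLaplace F η ψ (k + c • η) ζ = fourierLaplace F η ψ k (ζ + c) := by
  simp only [fourierLaplace, minkDot_add_left, minkDot_smul_left]
  congr 1
  refine integral_congr_ae (Eventually.of_forall fun y => ?_)
  simp only
  congr 2
  push_cast
  ring

theorem fourierLaplace_zero (F : Form) (η : E4) (ψ : 𝓢(E4, ℂ)) (k : E4) :
    fourierLaplace F η ψ k 0 = minkowskiFourier F ψ k := by
  rw [fourierLaplace, minkowskiFourier_apply]
  simp

theorem continuous_fourierLaplace (F : Form) (η : E4) {ψ : 𝓢(E4, ℂ)} (hψ : HasCompactSupport ψ) :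
    Continuous fun p : E4 × ℂ => fourierLaplace F η ψ p.1 p.2 := by
  refine continuous_const.mul ?_
  have h1 : Continuous fun p : E4 × ℂ => ∫ y in tsupport ψ,
      Complex.exp (-Complex.I * ((minkDot F p.1 y : ℝ) + p.2 * (minkDot F η y : ℝ))) * ψ y := by
    refine continuous_parametric_integral_of_continuous ?_ hψ
    have h2 : Continuous fun q : (E4 × ℂ) × E4 => minkDot F q.1.1 q.2 :=
      Continuous.minkDot F (by fun_prop) (by fun_prop)
    have h3 : Continuous fun q : (E4 × ℂ) × E4 => minkDot F η q.2 :=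
      Continuous.minkDot F (by fun_prop) (by fun_prop)
    have h4 := ψ.continuous
    simp only [Function.uncurry_def]
    fun_prop
  convert h1 using 2 with p
  rw [setIntegral_eq_integral_of_forall_compl_eq_zero]
  intro y hy
  rw [image_eq_zero_of_notMem_tsupport hy, mul_zero]

theorem differentiable_fourierLaplace (F : Form) (η : E4) {ψ : 𝓢(E4, ℂ)}
    (hψ : HasCompactSupport ψ) (k : E4) : Differentiable ℂ (fourierLaplace F η ψ k) := by
  obtain ⟨R, hR⟩ := (show IsCompact (tsupport ψ) from hψ).isBounded.subset_closedBall (0 : E4)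
  intro ζ₀
  refine DifferentiableAt.const_mul ?_ _
  set f : ℂ → E4 → ℂ := fun ζ y =>
    Complex.exp (-Complex.I * ((minkDot F k y : ℝ) + ζ * (minkDot F η y : ℝ))) * ψ y with hf
  set f' : ℂ → E4 → ℂ := fun ζ y =>
    Complex.exp (-Complex.I * ((minkDot F k y : ℝ) + ζ * (minkDot F η y : ℝ))) *
      (-Complex.I * (minkDot F η y : ℝ)) * ψ y with hf'
  have hcont : ∀ ζ, Continuous (f ζ) := by
    intro ζ
    have h2 : Continuous fun y : E4 => minkDot F k y := Continuous.minkDot F (by fun_prop) (by fun_prop)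
    have h3 : Continuous fun y : E4 => minkDot F η y := Continuous.minkDot F (by fun_prop) (by fun_prop)
    have h4 := ψ.continuous
    simp only [hf]
    fun_prop
  have hcont' : Continuous (f' ζ₀) := by
    have h2 : Continuous fun y : E4 => minkDot F k y := Continuous.minkDot F (by fun_prop) (by fun_prop)
    have h3 : Continuous fun y : E4 => minkDot F η y := Continuous.minkDot F (by fun_prop) (by fun_prop)
    have h4 := ψ.continuous
    simp only [hf']
    fun_prop
  have key := hasDerivAt_integral_of_dominated_loc_of_deriv_le (μ := volume) (F := f) (F' := f')
    (x₀ := ζ₀) (s := Metric.ball ζ₀ 1)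
    (bound := fun y => Real.exp ((‖ζ₀‖ + 1) * (‖η‖ * R)) * (‖η‖ * R) * ‖ψ y‖)
    (Metric.ball_mem_nhds _ one_pos)
    (Eventually.of_forall fun ζ => (hcont ζ).aestronglyMeasurable)
    ((hcont ζ₀).integrable_of_hasCompactSupport hψ.mul_left)
    hcont'.aestronglyMeasurable ?_ (ψ.integrable.norm.const_mul _) ?_
  · exact key.2.differentiableAt
  · refine Eventually.of_forall fun y ζ hζ => ?_
    by_cases hy : y ∈ tsupport ψ
    · have hyR : ‖y‖ ≤ R := by simpa using hR hy
      have hm : |minkDot F η y| ≤ ‖η‖ * R := (abs_minkDot_le F η y).trans (by gcongr)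
      have hζ' : ‖ζ‖ ≤ ‖ζ₀‖ + 1 := by
        have h1 : ‖ζ - ζ₀‖ < 1 := by simpa [dist_eq_norm] using hζ
        calc ‖ζ‖ = ‖ζ₀ + (ζ - ζ₀)‖ := by congr 1; ring
          _ ≤ _ := (norm_add_le _ _).trans (by linarith)
      simp only [hf', norm_mul, norm_neg, Complex.norm_I, one_mul, Complex.norm_real]
      rw [Complex.norm_exp, Real.norm_eq_abs]
      refine mul_le_mul_of_nonneg_right ?_ (norm_nonneg _)
      refine mul_le_mul ?_ hm (abs_nonneg _) (Real.exp_pos _).le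
      refine Real.exp_le_exp.2 ?_
      have h5 : (-Complex.I * ((minkDot F k y : ℝ) + ζ * (minkDot F η y : ℝ))).re =
          ζ.im * minkDot F η y := by simp
      rw [h5]
      calc ζ.im * minkDot F η y ≤ |ζ.im * minkDot F η y| := le_abs_self _
        _ = |ζ.im| * |minkDot F η y| := abs_mul _ _
        _ ≤ _ := mul_le_mul ((Complex.abs_im_le_norm ζ).trans hζ') hm (abs_nonneg _) (by positivity)
    · simp [hf', image_eq_zero_of_notMem_tsupport hy]
  · refine Eventually.of_forall fun y ζ hζ => ?_
    have h1 : HasDerivAt (fun ζ : ℂ => -Complex.I * ((minkDot F k y : ℝ) + ζ * (minkDot F η y : ℝ)))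
        (-Complex.I * (minkDot F η y : ℝ)) ζ := by
      have := (((hasDerivAt_id ζ).mul_const ((minkDot F η y : ℝ) : ℂ)).const_add
        ((minkDot F k y : ℝ) : ℂ)).const_mul (-Complex.I)
      simpa using this
    exact h1.cexp.mul_const (ψ y)

theorem integral_four_terms {a b c d : E4 → ℂ} (ha : Integrable a) (hb : Integrable b)
    (hc : Integrable c) (hd : Integrable d) (z : ℂ) :
    ∫ k, ((a k - b k) + z * c k - z * d k) =
      ((∫ k, a k) - ∫ k, b k) + z * (∫ k, c k) - z * ∫ k, d k := by
  rw [integral_sub (f := fun k => (a k - b k) + z * c k) (g := fun k => z * d k)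
      ((ha.sub hb).add (hc.const_mul _)) (hd.const_mul _),
    integral_add (f := fun k => a k - b k) (g := fun k => z * c k) (ha.sub hb) (hc.const_mul _),
    integral_sub ha hb, integral_const_mul, integral_const_mul]

theorem integral_intervalIntegral_swap {f : E4 → ℝ → ℂ} {a b : ℝ} (hab : a ≤ b)
    (hf : ContinuousOn (Function.uncurry f) (Set.univ ×ˢ Set.Icc a b)) {g : E4 → ℝ}
    (hg : Integrable g) (hfg : ∀ k, ∀ t ∈ Set.Icc a b, ‖f k t‖ ≤ g k) :
    Integrable (fun k => ∫ t in a..b, f k t) ∧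
      ∫ k, ∫ t in a..b, f k t = ∫ t in a..b, ∫ k, f k t := by
  simp only [intervalIntegral.integral_of_le hab]
  have hmeas : (volume : Measure E4).prod ((volume : Measure ℝ).restrict (Set.Ioc a b)) =
      ((volume : Measure E4).prod (volume : Measure ℝ)).restrict (Set.univ ×ˢ Set.Ioc a b) := by
    rw [← Measure.prod_restrict, Measure.restrict_univ]
  have h1 : Integrable (Function.uncurry f)
      ((volume : Measure E4).prod ((volume : Measure ℝ).restrict (Set.Ioc a b))) := by
    refine Integrable.mono' (hg.comp_fst ((volume : Measure ℝ).restrict (Set.Ioc a b))) ?_ ?_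
    · rw [hmeas]
      exact (hf.mono (Set.prod_mono_right Set.Ioc_subset_Icc_self)).aestronglyMeasurable
        (MeasurableSet.univ.prod measurableSet_Ioc)
    · rw [hmeas]
      refine (ae_restrict_iff' (MeasurableSet.univ.prod measurableSet_Ioc)).2
        (Eventually.of_forall fun p hp => ?_)
      exact hfg p.1 p.2 (Set.Ioc_subset_Icc_self hp.2)
  exact ⟨h1.integral_prod_left, integral_integral_swap h1⟩

/-- Boundary values of holomorphic functions of moderate growth in the direction `η` have Fourier
transforms vanishing in the half-space `η · y < 0`. -/
theorem integral_eq_zero_of_tube (F : Form) {η : E4} {R : E4 → ℂ → ℂ} {r : E4 → ℂ} {ψ : 𝓢(E4, ℂ)}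
    (hψ : HasCompactSupport ψ) (hsupp : tsupport ψ ⊆ {y | minkDot F η y < 0})
    (hol : ∀ k, DifferentiableOn ℂ (R k) {ζ | 0 < ζ.im})
    (hshift : ∀ k ζ (c : ℝ), R (k + c • η) ζ = R k (ζ + c))
    (hcont : ContinuousOn (fun p : E4 × ℂ => R p.1 p.2) {p | 0 < p.2.im})
    {N : ℕ} {C : ℝ} (hbound : ∀ k (t : ℝ), 0 < t → ‖R k (t * Complex.I)‖ ≤ C * (1 + ‖k‖ + t) ^ N)
    (hlim : ∀ k, Tendsto (fun t : ℝ => R k (t * Complex.I)) (𝓝[>] 0) (𝓝 (r k))) :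
    ∫ k, r k * minkowskiFourier F ψ k = 0 := by
  have hC : 0 ≤ C := by
    have := (norm_nonneg _).trans (hbound 0 1 one_pos)
    exact nonneg_of_mul_nonneg_left this (by positivity)
  -- Of the N + 5 powers, N absorb the growth of R, since 1 + ‖k‖ + t ≤ (1 + ‖k‖)(1 + t); the other
  -- five make the bound integrable over four dimensions and leave decay in t.
  obtain ⟨C', hC', hdecay⟩ := exists_fourier_expWeight_bound F η hψ hsupp (N + 5)
  set G : E4 → ℂ → ℂ := fun k ζ => R k ζ * fourierLaplace F η ψ k ζ with hG
  have hGshift : ∀ k ζ (c : ℝ), G (k + c • η) ζ = G k (ζ + c) := fun k ζ c => by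
    simp only [hG, hshift, fourierLaplace_add_smul]
  have hGcont : ContinuousOn (fun p : E4 × ℂ => G p.1 p.2) {p | 0 < p.2.im} :=
    hcont.mul (continuous_fourierLaplace F η hψ).continuousOn
  set w : E4 → ℝ := fun k => ((1 + ‖k‖) ^ 5)⁻¹ with hw
  have hwint : Integrable w := by
    have := integrable_one_add_norm (E := E4) (μ := volume) (r := 5) (by simp; norm_num)
    refine this.congr (Eventually.of_forall fun k => ?_)
    simp only [hw]
    rw [Real.rpow_neg (by positivity)]
    norm_cast
  have hGb : ∀ k (t : ℝ), 0 < t → ‖G k (t * Complex.I)‖ ≤ C * C' * w k * (1 + t)⁻¹ := by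
    intro k t ht
    simp only [hG]
    rw [norm_mul, fourierLaplace_eq F η hψ]
    have h1 : (1 + ‖k‖ + t) ^ N ≤ (1 + ‖k‖) ^ N * (1 + t) ^ N := by
      rw [← mul_pow]
      gcongr
      nlinarith [norm_nonneg k]
    have h2 : ((1 + t) ^ 5)⁻¹ ≤ (1 + t)⁻¹ := by
      gcongr
      exact le_self_pow₀ (by linarith) (by norm_num)
    calc _ ≤ (C * ((1 + ‖k‖) ^ N * (1 + t) ^ N)) *
          (C' * ((1 + ‖k‖) ^ (N + 5))⁻¹ * ((1 + t) ^ (N + 5))⁻¹) := by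
          refine mul_le_mul ((hbound k t ht).trans (by gcongr)) (hdecay t ht.le k)
            (norm_nonneg _) (by positivity)
      _ = C * C' * w k * ((1 + t) ^ 5)⁻¹ := by
          simp only [hw, pow_add]
          field_simp
      _ ≤ _ := by gcongr
  have hGb' : ∀ k (t : ℝ), 0 < t → ∀ c ∈ Set.Icc (0 : ℝ) 1,
      ‖G k (c + t * Complex.I)‖ ≤ C * C' * (1 + ‖η‖) ^ 5 * w k := by
    intro k t ht c hc
    rw [add_comm, ← hGshift]
    refine (hGb _ t ht).trans ?_
    have h1 : w (k + c • η) ≤ (1 + ‖η‖) ^ 5 * w k := by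
      simp only [hw]
      rw [← div_eq_mul_inv, ← one_div, div_le_div_iff₀ (by positivity) (by positivity), one_mul,
        ← mul_pow]
      gcongr
      have h2 : ‖k‖ ≤ ‖k + c • η‖ + ‖η‖ := by
        calc ‖k‖ = ‖k + c • η - c • η‖ := by rw [add_sub_cancel_right]
          _ ≤ ‖k + c • η‖ + ‖c • η‖ := norm_sub_le _ _
          _ ≤ _ := by
            rw [norm_smul, Real.norm_of_nonneg hc.1]
            gcongr
            exact mul_le_of_le_one_left (norm_nonneg _) hc.2
      nlinarith [norm_nonneg (k + c • η), norm_nonneg η]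
    calc _ ≤ C * C' * w (k + c • η) * 1 := by
          have : (1 + t)⁻¹ ≤ 1 := inv_le_one_of_one_le₀ (by linarith)
          gcongr
      _ ≤ _ := by
          rw [mul_one, mul_assoc (C * C')]
          gcongr
  set H : ℝ → ℂ := fun t => ∫ k, G k (t * Complex.I) with hH
  -- Cauchy's theorem for ζ in the rectangle with corners it₀ and 1 + it₁, at each fixed k. Since G
  -- depends only on k + ζη, integration over k turns the horizontal sides into H t₀ and H t₁ and
  -- makes the vertical sides equal, by translation invariance; the latter cancel.
  have hconst : ∀ t₀ t₁ : ℝ, 0 < t₀ → t₀ ≤ t₁ → H t₀ = H t₁ := by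
    intro t₀ t₁ h0 h01
    have h1 : 0 < t₁ := h0.trans_le h01
    have hwi : Integrable fun k => C * C' * (1 + ‖η‖) ^ 5 * w k := hwint.const_mul _
    have hrect : ∀ k, ((∫ c in (0 : ℝ)..1, G k (c + t₀ * Complex.I)) -
        (∫ c in (0 : ℝ)..1, G k (c + t₁ * Complex.I))) +
        Complex.I * (∫ t in t₀..t₁, G k (1 + t * Complex.I)) -
        Complex.I * (∫ t in t₀..t₁, G k (t * Complex.I)) = 0 := by
      intro k
      have := Complex.integral_boundary_rect_eq_zero_of_differentiableOn (G k)
        (t₀ * Complex.I) (1 + t₁ * Complex.I) ?_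
      · simpa using this
      · refine ((hol k).mul (differentiable_fourierLaplace F η hψ k).differentiableOn).mono ?_
        intro ζ hζ
        have := hζ.2
        simp only [Complex.mul_im, Complex.ofReal_re, Complex.I_im, mul_one, Complex.ofReal_im,
          Complex.I_re, mul_zero, add_zero, Complex.add_im, Complex.one_im, zero_add,
          Set.mem_preimage, Set.uIcc_of_le h01] at this
        exact h0.trans_le this.1
    have hhor : ∀ t : ℝ, 0 < t → Integrable (fun k => ∫ c in (0 : ℝ)..1, G k (c + t * Complex.I)) ∧
        ∫ k, ∫ c in (0 : ℝ)..1, G k (c + t * Complex.I) = H t := by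
      intro t ht
      obtain ⟨h2, h3⟩ := integral_intervalIntegral_swap (f := fun k c => G k (c + t * Complex.I))
        zero_le_one (hGcont.comp (f := fun p : E4 × ℝ => (p.1, (p.2 : ℂ) + t * Complex.I))
          (by fun_prop) (fun p _ => by simpa using ht)) hwi (fun k c hc => hGb' k t ht c hc)
      refine ⟨h2, h3.trans ?_⟩
      have h4 : ∀ c : ℝ, ∫ k, G k (c + t * Complex.I) = H t := by
        intro c
        simp only [hH]
        rw [← integral_add_right_eq_self (fun k => G k (t * Complex.I)) (c • η)]
        simp only [hGshift, add_comm]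
      simp only [h4]
      simp
    have hver : ∀ c ∈ Set.Icc (0 : ℝ) 1,
        Integrable (fun k => ∫ t in t₀..t₁, G k (c + t * Complex.I)) ∧
        ∫ k, ∫ t in t₀..t₁, G k (c + t * Complex.I) = ∫ t in t₀..t₁, H t := by
      intro c hc
      obtain ⟨h2, h3⟩ := integral_intervalIntegral_swap (f := fun k t => G k (c + t * Complex.I))
        h01 (hGcont.comp (f := fun p : E4 × ℝ => (p.1, (c : ℂ) + p.2 * Complex.I))
          (by fun_prop) (fun p hp => by simpa using h0.trans_le hp.2.1)) hwi
          (fun k t ht => hGb' k t (h0.trans_le ht.1) c hc)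
      refine ⟨h2, h3.trans ?_⟩
      congr 1
      ext t
      simp only [hH]
      rw [← integral_add_right_eq_self (fun k => G k (t * Complex.I)) (c • η)]
      simp only [hGshift, add_comm]
    obtain ⟨i1, e1⟩ := hhor t₀ h0
    obtain ⟨i2, e2⟩ := hhor t₁ h1
    obtain ⟨i3, e3⟩ := hver 1 (by simp)
    obtain ⟨i4, e4⟩ := hver 0 (by simp)
    simp only [Complex.ofReal_one, Complex.ofReal_zero, zero_add] at i3 e3 i4 e4
    have hsum : ∫ k, (((∫ c in (0 : ℝ)..1, G k (c + t₀ * Complex.I)) -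
        (∫ c in (0 : ℝ)..1, G k (c + t₁ * Complex.I))) +
        Complex.I * (∫ t in t₀..t₁, G k (1 + t * Complex.I)) -
        Complex.I * (∫ t in t₀..t₁, G k (t * Complex.I))) = 0 := by
      simp only [hrect, integral_zero]
    rw [integral_four_terms i1 i2 i3 i4, e1, e2, e3, e4] at hsum
    linear_combination hsum
  -- The constant value of H is 0, from its limit at large t, and it equals the boundary integral,
  -- from its limit at t → 0⁺ by dominated convergence.
  have hinf : Tendsto H atTop (𝓝 0) := by
    have h1 : Tendsto (fun t : ℝ => C * C' * (∫ k, w k) * (1 + t)⁻¹) atTop (𝓝 0) := by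
      have : Tendsto (fun t : ℝ => (1 + t)⁻¹) atTop (𝓝 0) :=
        tendsto_inv_atTop_zero.comp (tendsto_atTop_add_const_left _ 1 tendsto_id)
      simpa using this.const_mul (C * C' * ∫ k, w k)
    refine squeeze_zero_norm' ?_ h1
    filter_upwards [eventually_gt_atTop 0] with t ht
    have h2 := norm_integral_le_of_norm_le ((hwint.const_mul (C * C')).mul_const (1 + t)⁻¹)
      (Eventually.of_forall fun k => hGb k t ht)
    rwa [integral_mul_const, integral_const_mul] at h2
  have hzero : Tendsto H (𝓝[>] 0) (𝓝 (∫ k, r k * minkowskiFourier F ψ k)) := by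
    refine tendsto_integral_filter_of_dominated_convergence (fun k => C * C' * w k) ?_ ?_
      (hwint.const_mul _) ?_
    · filter_upwards [self_mem_nhdsWithin] with t ht
      refine Continuous.aestronglyMeasurable ?_
      exact hGcont.comp_continuous (f := fun k : E4 => (k, (t : ℂ) * Complex.I)) (by fun_prop)
        (fun k => by simpa using ht)
    · filter_upwards [self_mem_nhdsWithin] with t ht
      refine Eventually.of_forall fun k => (hGb k t ht).trans ?_
      have ht : 0 < t := ht
      refine mul_le_of_le_one_right (by positivity) (inv_le_one_of_one_le₀ (by linarith))
    · refine Eventually.of_forall fun k => (hlim k).mul ?_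
      rw [← fourierLaplace_zero F η ψ k]
      have h1 : Continuous fun t : ℝ => fourierLaplace F η ψ k (t * Complex.I) :=
        (differentiable_fourierLaplace F η hψ k).continuous.comp (by fun_prop)
      have h2 := h1.tendsto 0
      simp only [Complex.ofReal_zero, zero_mul] at h2
      exact h2.mono_left nhdsWithin_le_nhds
  have hH0 : ∀ t : ℝ, 0 < t → H t = 0 := by
    intro t ht
    refine tendsto_nhds_unique (tendsto_const_nhds (f := atTop)) (hinf.congr' ?_)
    filter_upwards [eventually_ge_atTop t] with s hs
    exact (hconst t s ht hs).symm
  refine tendsto_nhds_unique hzero (tendsto_const_nhds.congr' ?_)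
  filter_upwards [self_mem_nhdsWithin] with t ht
  exact (hH0 t ht).symm

/-! ### The spectral integral: holomorphy, closed form, growth, boundary values. -/

/-- The spectral integral of the fermion loop,
`I(z) = ∫₀¹ v² (3 - v²) / (4m² - z (1 - v²)) dv`. -/
def specInt (m : ℝ) (z : ℂ) : ℂ :=
  ∫ v in (0 : ℝ)..1, ((v ^ 2 * (3 - v ^ 2) : ℝ) : ℂ) / ((4 * m ^ 2 : ℝ) - z * (1 - v ^ 2 : ℝ))

/-- The complex plane cut along `[4m², ∞)`. -/
def cutPlane (m : ℝ) : Set ℂ := {z | z.im ≠ 0 ∨ z.re < 4 * m ^ 2}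

theorem isOpen_cutPlane (m : ℝ) : IsOpen (cutPlane m) :=
  (isOpen_ne_fun Complex.continuous_im continuous_const).union
    (isOpen_lt Complex.continuous_re continuous_const)

theorem specInt_den_ne_zero {m : ℝ} (hm : 0 < m) {z : ℂ} (hz : z ∈ cutPlane m) {v : ℝ}
    (hv : v ∈ Set.Icc (0 : ℝ) 1) : ((4 * m ^ 2 : ℝ) : ℂ) - z * (1 - v ^ 2 : ℝ) ≠ 0 := by
  intro h
  have hre := congrArg Complex.re h
  have him := congrArg Complex.im h
  simp only [Complex.sub_re, Complex.mul_re, Complex.ofReal_re, Complex.ofReal_im, mul_zero,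
    sub_zero, Complex.zero_re, Complex.sub_im, Complex.mul_im, Complex.zero_im, zero_sub,
    zero_add, neg_eq_zero, mul_eq_zero] at hre him
  have hv2 : v ^ 2 ≤ 1 := pow_le_one₀ hv.1 hv.2
  have hm2 : 0 < m ^ 2 := by positivity
  rcases him with him | him
  · rcases hz with hz | hz
    · exact hz him
    · by_cases hz0 : z.re ≤ 0
      · nlinarith
      · push Not at hz0
        nlinarith [sq_nonneg v]
  · rw [him] at hre
    nlinarith

theorem differentiableOn_specInt {m : ℝ} (hm : 0 < m) :
    DifferentiableOn ℂ (specInt m) (cutPlane m) := by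
  intro z₀ hz₀
  refine DifferentiableAt.differentiableWithinAt ?_
  obtain ⟨r, hr, hrs⟩ := Metric.nhds_basis_closedBall.mem_iff.1 ((isOpen_cutPlane m).mem_nhds hz₀)
  set f' : ℂ → ℝ → ℂ := fun z v => ((v ^ 2 * (3 - v ^ 2) : ℝ) : ℂ) * (1 - v ^ 2 : ℝ) /
    ((4 * m ^ 2 : ℝ) - z * (1 - v ^ 2 : ℝ)) ^ 2 with hf'
  have hcont : ContinuousOn (fun p : ℂ × ℝ => f' p.1 p.2)
      (Metric.closedBall z₀ r ×ˢ Set.Icc (0 : ℝ) 1) := by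
    refine ContinuousOn.div (by fun_prop) (by fun_prop) fun p hp => ?_
    exact pow_ne_zero 2 (specInt_den_ne_zero hm (hrs hp.1) hp.2)
  obtain ⟨B, hB⟩ := ((isCompact_closedBall z₀ r).prod isCompact_Icc).exists_bound_of_continuousOn
    hcont
  have hcont1 : ∀ z ∈ Metric.closedBall z₀ r, ContinuousOn (fun v : ℝ =>
      ((v ^ 2 * (3 - v ^ 2) : ℝ) : ℂ) / ((4 * m ^ 2 : ℝ) - z * (1 - v ^ 2 : ℝ)))
      (Set.Icc (0 : ℝ) 1) := by
    intro z hz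
    refine ContinuousOn.div (by fun_prop) (by fun_prop) fun v hv => ?_
    exact specInt_den_ne_zero hm (hrs hz) hv
  have hsub : Set.uIoc (0 : ℝ) 1 ⊆ Set.Icc 0 1 := by
    rw [Set.uIoc_of_le zero_le_one]
    exact Set.Ioc_subset_Icc_self
  have key := intervalIntegral.hasDerivAt_integral_of_dominated_loc_of_deriv_le (μ := volume)
    (𝕜 := ℂ) (F := fun z v => ((v ^ 2 * (3 - v ^ 2) : ℝ) : ℂ) /
      ((4 * m ^ 2 : ℝ) - z * (1 - v ^ 2 : ℝ))) (F' := f') (x₀ := z₀)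
    (s := Metric.ball z₀ r) (bound := fun _ => B) (a := 0) (b := 1)
    (Metric.ball_mem_nhds _ hr) ?_ ?_ ?_ ?_ ?_ ?_
  · exact key.2.differentiableAt
  · filter_upwards [Metric.ball_mem_nhds z₀ hr] with z hz
    exact ((hcont1 z (Metric.ball_subset_closedBall hz)).mono hsub).aestronglyMeasurable
      measurableSet_uIoc
  · rw [intervalIntegrable_iff_integrableOn_Icc_of_le zero_le_one]
    exact (hcont1 z₀ (Metric.mem_closedBall_self hr.le)).integrableOn_Icc
  · refine ContinuousOn.aestronglyMeasurable ?_ measurableSet_uIoc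
    refine (hcont.comp (f := fun v : ℝ => (z₀, v)) (by fun_prop) ?_)
    exact fun v hv => ⟨Metric.mem_closedBall_self hr.le, hsub hv⟩
  · refine Eventually.of_forall fun v hv z hz => ?_
    exact hB (z, v) ⟨Metric.ball_subset_closedBall hz, hsub hv⟩
  · simp
  · refine Eventually.of_forall fun v hv z hz => ?_
    have hne := specInt_den_ne_zero hm (hrs (Metric.ball_subset_closedBall hz)) (hsub hv)
    have h1 : HasDerivAt (fun z : ℂ => ((4 * m ^ 2 : ℝ) : ℂ) - z * (1 - v ^ 2 : ℝ))
        (-(1 - v ^ 2 : ℝ)) z := by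
      exact (((hasDerivAt_id z).mul_const ((1 - v ^ 2 : ℝ) : ℂ)).const_sub
        ((4 * m ^ 2 : ℝ) : ℂ)).congr_deriv (by rw [one_mul])
    have h2 := (hasDerivAt_const z (((v ^ 2 * (3 - v ^ 2) : ℝ) : ℂ))).div h1 hne
    refine h2.congr_deriv ?_
    simp only [hf']
    ring

/-- Schwarz reflection. The lower half-plane, hence negative frequency, is always reduced to the
upper one by this. -/
theorem specInt_conj (m : ℝ) (z : ℂ) :
    specInt m ((starRingEnd ℂ) z) = (starRingEnd ℂ) (specInt m z) := by
  simp only [specInt]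
  rw [intervalIntegral.integral_of_le zero_le_one, intervalIntegral.integral_of_le zero_le_one,
    ← integral_conj]
  refine integral_congr_ae (Eventually.of_forall fun v => ?_)
  simp only [map_div₀, map_sub, map_mul, Complex.conj_ofReal]

/-- The square root `√(1 - 4m²/z)`. -/
def rootFn (m : ℝ) (z : ℂ) : ℂ := (1 - 4 * m ^ 2 / z) ^ (1 / 2 : ℂ)

/-- The closed form of `z² I(z)`. -/
def closedForm (m : ℝ) (z : ℂ) : ℂ :=
  (z + 2 * m ^ 2) * (rootFn m z * Complex.log ((rootFn m z - 1) / (rootFn m z + 1))) +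
    4 * m ^ 2 + 5 * z / 3

theorem rootFn_sq (m : ℝ) (z : ℂ) : rootFn m z ^ 2 = 1 - 4 * m ^ 2 / z := by
  rw [rootFn, ← Complex.cpow_nat_mul]
  norm_num

/-- A non-negative multiple of Im z, so z ↦ 1 − 4m²/z maps the closed upper half-plane to itself.
Hence its principal root lies in the closed first quadrant when Im z ≥ 0. -/
theorem one_sub_div_im (m : ℝ) (z : ℂ) :
    (1 - 4 * (m : ℂ) ^ 2 / z).im = 4 * m ^ 2 * z.im / Complex.normSq z := by
  have : (1 - 4 * (m : ℂ) ^ 2 / z) = 1 - ((4 * m ^ 2 : ℝ) : ℂ) * z⁻¹ := by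
    push_cast
    rw [div_eq_mul_inv]
  rw [this, Complex.sub_im, Complex.im_ofReal_mul, Complex.inv_im]
  simp
  ring

theorem arg_rootFn (m : ℝ) (z : ℂ) (hz : 1 - 4 * (m : ℂ) ^ 2 / z ≠ 0) :
    rootFn m z = Complex.exp (Complex.log (1 - 4 * (m : ℂ) ^ 2 / z) / 2) := by
  rw [rootFn, Complex.cpow_def_of_ne_zero hz]
  congr 1
  ring

theorem rootFn_re_nonneg (m : ℝ) (z : ℂ) : 0 ≤ (rootFn m z).re := by
  by_cases h : 1 - 4 * (m : ℂ) ^ 2 / z = 0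
  · rw [rootFn, h, Complex.zero_cpow (by norm_num)]
    simp
  · rw [arg_rootFn m z h, Complex.exp_re]
    refine mul_nonneg (Real.exp_pos _).le (Real.cos_nonneg_of_mem_Icc ?_)
    have h1 := Complex.arg_le_pi (1 - 4 * (m : ℂ) ^ 2 / z)
    have h2 := Complex.neg_pi_lt_arg (1 - 4 * (m : ℂ) ^ 2 / z)
    have h3 : (Complex.log (1 - 4 * (m : ℂ) ^ 2 / z) / 2).im =
        Complex.arg (1 - 4 * (m : ℂ) ^ 2 / z) / 2 := by
      simp [Complex.div_ofNat_im, Complex.log_im]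
    rw [h3]
    constructor <;> linarith

theorem rootFn_im_nonneg (m : ℝ) (z : ℂ) (hz : 0 ≤ z.im) : 0 ≤ (rootFn m z).im := by
  by_cases h : 1 - 4 * (m : ℂ) ^ 2 / z = 0
  · rw [rootFn, h, Complex.zero_cpow (by norm_num)]
    simp
  · rw [arg_rootFn m z h, Complex.exp_im]
    refine mul_nonneg (Real.exp_pos _).le (Real.sin_nonneg_of_mem_Icc ?_)
    have h1 := Complex.arg_le_pi (1 - 4 * (m : ℂ) ^ 2 / z)
    have h2 : 0 ≤ Complex.arg (1 - 4 * (m : ℂ) ^ 2 / z) := by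
      rw [Complex.arg_nonneg_iff, one_sub_div_im]
      exact div_nonneg (by positivity) (Complex.normSq_nonneg z)
    have h3 : (Complex.log (1 - 4 * (m : ℂ) ^ 2 / z) / 2).im =
        Complex.arg (1 - 4 * (m : ℂ) ^ 2 / z) / 2 := by
      simp [Complex.div_ofNat_im, Complex.log_im]
    rw [h3]
    constructor <;> linarith [Real.pi_pos]

theorem rootFn_im_pos {m : ℝ} (hm : 0 < m) {z : ℂ} (hz : 0 < z.im) : 0 < (rootFn m z).im := by
  refine lt_of_le_of_ne (rootFn_im_nonneg m z hz.le) fun h => ?_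
  have h1 := congrArg Complex.im (rootFn_sq m z)
  rw [one_sub_div_im, sq, Complex.mul_im, ← h] at h1
  have hz0 : z ≠ 0 := by rintro rfl; simp at hz
  have : 0 < 4 * m ^ 2 * z.im / Complex.normSq z :=
    div_pos (by positivity) (Complex.normSq_pos.2 hz0)
  simp at h1
  linarith

/-- For v > 0 and w in the upper half-plane the quotient stays in the upper half-plane, so its
logarithm stays on the principal branch. -/
theorem im_sub_div_add (w : ℂ) (v : ℝ) :
    ((w - v) / (w + v)).im = 2 * v * w.im / Complex.normSq (w + v) := by
  rw [Complex.div_im]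
  simp
  ring

/-- The spectral integral in the upper half-plane. -/
theorem sq_mul_specInt {m : ℝ} (hm : 0 < m) {z : ℂ} (hz : 0 < z.im) :
    z ^ 2 * specInt m z = closedForm m z := by
  have hz0 : z ≠ 0 := by rintro rfl; simp at hz
  set w := rootFn m z with hw
  have hwi : 0 < w.im := rootFn_im_pos hm hz
  have hwr : 0 ≤ w.re := rootFn_re_nonneg m z
  have hw2 : w ^ 2 = 1 - 4 * m ^ 2 / z := rootFn_sq m z
  have hplus : ∀ v : ℝ, w + v ≠ 0 := fun v h => by
    have := congrArg Complex.im h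
    simp at this
    linarith
  have hminus : ∀ v : ℝ, w - v ≠ 0 := fun v h => by
    have := congrArg Complex.im h
    simp at this
    linarith
  have hslit : ∀ v ∈ Set.Icc (0 : ℝ) 1, (w - v) / (w + v) ∈ Complex.slitPlane := by
    intro v hv
    rcases eq_or_lt_of_le hv.1 with h0 | h0
    · subst h0
      have := hplus 0
      simp only [Complex.ofReal_zero, add_zero] at this
      simp [this]
    · right
      rw [im_sub_div_add]
      exact (div_pos (by positivity) (Complex.normSq_pos.2 (hplus v))).ne'
  -- With w² = 1 − 4m²/z the denominator splits into linear factors in v.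
  have hden : ∀ v : ℝ, ((4 * m ^ 2 : ℝ) : ℂ) - z * (1 - v ^ 2 : ℝ) = -z * ((w - v) * (w + v)) := by
    intro v
    have : (w - v) * (w + v) = w ^ 2 - v ^ 2 := by ring
    rw [this, hw2]
    push_cast
    field_simp
    ring
  -- Antiderivative by division with remainder and partial fractions; the derivative of log((w −
  -- v)/(w + v)) is −2w/(w² − v²). At v = 0 the logarithm is log 1, so only the endpoint v = 1
  -- contributes.
  have hderiv : ∀ v ∈ Set.uIcc (0 : ℝ) 1, HasDerivAt (fun v : ℝ => (-(v : ℂ) ^ 3 / 3 +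
      (3 - w ^ 2) * v + (3 - w ^ 2) * (w / 2) * Complex.log ((w - v) / (w + v))) / z)
      (((v ^ 2 * (3 - v ^ 2) : ℝ) : ℂ) / ((4 * m ^ 2 : ℝ) - z * (1 - v ^ 2 : ℝ))) v := by
    intro v hv
    rw [Set.uIcc_of_le zero_le_one] at hv
    have h0 : HasDerivAt (fun v : ℝ => (v : ℂ)) 1 v := Complex.ofRealCLM.hasDerivAt
    have h1 := ((h0.const_sub w).div (h0.const_add w) (hplus v)).clog_real (hslit v hv)
    have h2 := (((((h0.pow 3).neg).div_const 3).add (h0.const_mul (3 - w ^ 2))).add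
      (h1.const_mul ((3 - w ^ 2) * (w / 2)))).div_const z
    refine h2.congr_deriv ?_
    rw [hden]
    have := hplus v
    have := hminus v
    push_cast
    simp only [Pi.div_apply]
    field_simp
    ring
  have hint : IntervalIntegrable (fun v : ℝ => ((v ^ 2 * (3 - v ^ 2) : ℝ) : ℂ) /
      ((4 * m ^ 2 : ℝ) - z * (1 - v ^ 2 : ℝ))) volume 0 1 := by
    refine ContinuousOn.intervalIntegrable ?_
    rw [Set.uIcc_of_le zero_le_one]
    exact ContinuousOn.div (by fun_prop) (by fun_prop)
      fun v hv => specInt_den_ne_zero hm (Or.inl hz.ne') hv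
  have hI := intervalIntegral.integral_eq_sub_of_hasDerivAt hderiv hint
  have hw0 : w / w = 1 := div_self (by rintro h; rw [h] at hwi; simp at hwi)
  rw [specInt, hI, closedForm, ← hw]
  simp only [Complex.ofReal_one, Complex.ofReal_zero, sub_zero, add_zero, hw0, Complex.log_one]
  have hm2 : z * w ^ 2 = z - 4 * m ^ 2 := by
    rw [hw2]
    field_simp
  have h3 : z ^ 2 * ((-1 ^ 3 / 3 + (3 - w ^ 2) * 1 +
      (3 - w ^ 2) * (w / 2) * Complex.log ((w - 1) / (w + 1))) / z -
      (-0 ^ 3 / 3 + (3 - w ^ 2) * 0 + (3 - w ^ 2) * (w / 2) * 0) / z) =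
      z * (8 / 3) - z * w ^ 2 + (3 * z - z * w ^ 2) * (w / 2) * Complex.log ((w - 1) / (w + 1)) := by
    field_simp
    ring
  rw [h3, hm2]
  ring

theorem norm_specInt_le {m : ℝ} (hm : 0 < m) {z : ℂ} (hz : ‖z‖ ≤ 2 * m ^ 2) :
    ‖specInt m z‖ ≤ 3 / (2 * m ^ 2) := by
  have h := intervalIntegral.norm_integral_le_of_norm_le_const (a := 0) (b := 1)
    (C := 3 / (2 * m ^ 2)) (f := fun v : ℝ => ((v ^ 2 * (3 - v ^ 2) : ℝ) : ℂ) /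
      ((4 * m ^ 2 : ℝ) - z * (1 - v ^ 2 : ℝ))) ?_
  · simpa [specInt] using h
  · intro v hv
    rw [Set.uIoc_of_le zero_le_one] at hv
    have hv2 : v ^ 2 ≤ 1 := pow_le_one₀ hv.1.le hv.2
    rw [norm_div, Complex.norm_real]
    gcongr
    · rw [Real.norm_of_nonneg (mul_nonneg (sq_nonneg v) (by linarith))]
      nlinarith [sq_nonneg v]
    · have h1 : ‖z * (1 - v ^ 2 : ℝ)‖ ≤ 2 * m ^ 2 := by
        rw [norm_mul, Complex.norm_real, Real.norm_of_nonneg (by linarith)]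
        nlinarith [sq_nonneg v, norm_nonneg z]
      have h2 := norm_sub_norm_le ((4 * m ^ 2 : ℝ) : ℂ) (z * (1 - v ^ 2 : ℝ))
      rw [Complex.norm_real, Real.norm_of_nonneg (by positivity)] at h2
      linarith

/-- For |z| ≤ 2m² the integrand is bounded. For larger |z| the closed form applies: ξ = (w − 1)/(w +
1) satisfies |ξ| ≤ 1 and |ξ| = (4m²/|z|)/|w + 1|², which is at least of the order 1/|z|, so its
logarithm grows only like log|z|. -/
theorem norm_mul_specInt_le_of_im_pos {m : ℝ} (hm : 0 < m) : ∃ C : ℝ, 0 ≤ C ∧ ∀ z : ℂ, 0 < z.im →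
    ‖z * specInt m z‖ ≤ C * (1 + Real.log (1 + ‖z‖)) := by
  set A := |Real.log (9 / (4 * m ^ 2))| with hA
  refine ⟨4 * (A + 1 + Real.pi) + 8, by positivity, fun z hz => ?_⟩
  have hlog : 0 ≤ Real.log (1 + ‖z‖) := Real.log_nonneg (by linarith [norm_nonneg z])
  have hA0 : 0 ≤ A := abs_nonneg _
  have hpi := Real.pi_pos
  rcases le_total ‖z‖ (2 * m ^ 2) with h | h
  · have h1 : ‖z * specInt m z‖ ≤ 3 := by
      rw [norm_mul]
      calc _ ≤ (2 * m ^ 2) * (3 / (2 * m ^ 2)) := by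
            gcongr
            exact norm_specInt_le hm h
        _ = 3 := by field_simp
    nlinarith [mul_nonneg (by positivity : (0 : ℝ) ≤ 4 * (A + 1 + Real.pi) + 8) hlog]
  · have hz0 : z ≠ 0 := by rintro rfl; simp at hz
    have hnz : 0 < ‖z‖ := norm_pos_iff.2 hz0
    set w := rootFn m z with hw
    have hwr : 0 ≤ w.re := rootFn_re_nonneg m z
    have hw2 : w ^ 2 = 1 - 4 * m ^ 2 / z := rootFn_sq m z
    have hdiv : ‖(4 * m ^ 2 / z : ℂ)‖ = 4 * m ^ 2 / ‖z‖ := by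
      rw [norm_div, norm_mul, norm_pow, Complex.norm_real, Real.norm_of_nonneg hm.le]
      norm_num
    have hdiv2 : 4 * m ^ 2 / ‖z‖ ≤ 2 := by
      rw [div_le_iff₀ hnz]
      linarith
    have hwn : ‖w‖ ≤ 2 := by
      have h1 : ‖w‖ ^ 2 ≤ 3 := by
        rw [← norm_pow, hw2]
        refine (norm_sub_le _ _).trans ?_
        rw [hdiv, norm_one]
        linarith
      nlinarith [norm_nonneg w]
    have hp1 : 1 ≤ ‖w + 1‖ := by
      have := Complex.re_le_norm (w + 1)
      simp at this
      linarith
    have hp3 : ‖w + 1‖ ≤ 3 := (norm_add_le _ _).trans (by rw [norm_one]; linarith)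
    have hprod : ‖w - 1‖ * ‖w + 1‖ = 4 * m ^ 2 / ‖z‖ := by
      rw [← norm_mul, ← hdiv, ← norm_neg (4 * m ^ 2 / z : ℂ)]
      congr 1
      linear_combination hw2
    have hle : ‖w - 1‖ ≤ ‖w + 1‖ := by
      rw [Complex.norm_def, Complex.norm_def]
      refine Real.sqrt_le_sqrt ?_
      simp only [Complex.normSq_apply, Complex.sub_re, Complex.add_re, Complex.one_re,
        Complex.sub_im, Complex.add_im, Complex.one_im]
      nlinarith
    have hξ : ‖(w - 1) / (w + 1)‖ = (4 * m ^ 2 / ‖z‖) / ‖w + 1‖ ^ 2 := by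
      rw [norm_div, ← hprod]
      field_simp
    have hξ1 : ‖(w - 1) / (w + 1)‖ ≤ 1 := by
      rw [norm_div]
      exact div_le_one_of_le₀ hle (norm_nonneg _)
    have hξ2 : (9 / (4 * m ^ 2) * (1 + ‖z‖))⁻¹ ≤ ‖(w - 1) / (w + 1)‖ := by
      rw [hξ]
      calc (9 / (4 * m ^ 2) * (1 + ‖z‖))⁻¹ = (4 * m ^ 2 / (1 + ‖z‖)) / 3 ^ 2 := by
            field_simp
            norm_num
        _ ≤ _ := by
            gcongr
            linarith
    have hξ0 : 0 < (9 / (4 * m ^ 2) * (1 + ‖z‖))⁻¹ := by positivity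
    have hlogξ : ‖Complex.log ((w - 1) / (w + 1))‖ ≤ A + Real.log (1 + ‖z‖) + Real.pi := by
      refine (Complex.norm_le_abs_re_add_abs_im _).trans ?_
      rw [Complex.log_re, Complex.log_im]
      refine add_le_add ?_ (Complex.abs_arg_le_pi _)
      rw [abs_of_nonpos (Real.log_nonpos (norm_nonneg _) hξ1)]
      have h2 := Real.log_le_log hξ0 hξ2
      rw [Real.log_inv, Real.log_mul (by positivity) (by positivity)] at h2
      have h3 := le_abs_self (Real.log (9 / (4 * m ^ 2)))
      rw [← hA] at h3
      linarith
    have heq : z * specInt m z = (1 + 2 * m ^ 2 / z) *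
        (w * Complex.log ((w - 1) / (w + 1))) + 4 * m ^ 2 / z + 5 / 3 := by
      have h1 := sq_mul_specInt hm hz
      rw [closedForm, ← hw] at h1
      have h2 : z * specInt m z = (z ^ 2 * specInt m z) / z := by field_simp
      rw [h2, h1]
      field_simp
    have hc : ‖(1 + 2 * m ^ 2 / z : ℂ)‖ ≤ 2 := by
      refine (norm_add_le _ _).trans ?_
      have : (2 * m ^ 2 / z : ℂ) = (1 / 2) * (4 * m ^ 2 / z) := by ring
      rw [this, norm_mul, hdiv, norm_one]
      norm_num
      linarith
    rw [heq]
    calc _ ≤ ‖(1 + 2 * m ^ 2 / z : ℂ)‖ * (‖w‖ * ‖Complex.log ((w - 1) / (w + 1))‖) +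
          ‖(4 * m ^ 2 / z : ℂ)‖ + ‖(5 / 3 : ℂ)‖ := by
          refine (norm_add₃_le).trans ?_
          rw [norm_mul, norm_mul]
      _ ≤ 2 * (2 * (A + Real.log (1 + ‖z‖) + Real.pi)) + 2 + 2 := by
          rw [hdiv]
          have h5 : ‖(5 / 3 : ℂ)‖ ≤ 2 := by norm_num
          gcongr
      _ ≤ _ := by nlinarith [mul_nonneg hA0 hlog, mul_nonneg hpi.le hlog]

theorem tendsto_add_mul_I (z : ℂ) : Tendsto (fun ε : ℝ => z + ε * Complex.I) (𝓝[>] 0) (𝓝 z) := by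
  have h : Continuous fun ε : ℝ => z + ε * Complex.I := by fun_prop
  simpa using (h.tendsto 0).mono_left nhdsWithin_le_nhds

theorem tendsto_add_mul_I' (s : ℝ) :
    Tendsto (fun ε : ℝ => (s : ℂ) + ε * Complex.I) (𝓝[>] 0) (𝓝[{z : ℂ | 0 < z.im}] (s : ℂ)) := by
  refine tendsto_nhdsWithin_iff.2 ⟨tendsto_add_mul_I s, ?_⟩
  filter_upwards [self_mem_nhdsWithin] with ε hε
  simpa using hε

theorem neBot_upper (s : ℝ) : (𝓝[{z : ℂ | 0 < z.im}] (s : ℂ)).NeBot := (tendsto_add_mul_I' s).neBot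

theorem continuous_logBound (C : ℝ) : Continuous fun z : ℂ => C * (1 + Real.log (1 + ‖z‖)) := by
  refine continuous_const.mul (continuous_const.add (Continuous.log (by fun_prop) fun z => ?_))
  have := norm_nonneg z
  positivity

/-- Conjugation covers the lower half-plane, and continuity from above the real points below the
threshold. -/
theorem norm_mul_specInt_le {m : ℝ} (hm : 0 < m) : ∃ C : ℝ, 0 ≤ C ∧ ∀ z ∈ cutPlane m,
    ‖z * specInt m z‖ ≤ C * (1 + Real.log (1 + ‖z‖)) := by
  obtain ⟨C, hC, h⟩ := norm_mul_specInt_le_of_im_pos hm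
  refine ⟨C, hC, fun z hz => ?_⟩
  rcases lt_trichotomy z.im 0 with hi | hi | hi
  · have h1 := h ((starRingEnd ℂ) z) (by simpa using hi)
    rw [specInt_conj, ← map_mul, RCLike.norm_conj, RCLike.norm_conj] at h1
    exact h1
  · have hcont : ContinuousAt (fun z => z * specInt m z) z :=
      continuousAt_id.mul (((differentiableOn_specInt hm).differentiableAt
        ((isOpen_cutPlane m).mem_nhds hz)).continuousAt)
    have h1 := (hcont.tendsto.comp (tendsto_add_mul_I z)).norm
    have h2 := ((continuous_logBound C).tendsto z).comp (tendsto_add_mul_I z)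
    refine le_of_tendsto_of_tendsto h1 h2 ?_
    filter_upwards [self_mem_nhdsWithin] with ε hε
    exact h _ (by simpa [hi] using hε)
  · exact h z hi

/-- The principal argument is π on the negative axis, so the logarithm is continuous from above
there. For this reason principal branches give the boundary values from the upper half-plane. -/
theorem continuousWithinAt_log_upper {z : ℂ} (hz : z ≠ 0) :
    ContinuousWithinAt Complex.log {z | 0 ≤ z.im} z := by
  by_cases hs : z ∈ Complex.slitPlane
  · exact (continuousAt_clog hs).continuousWithinAt
  · rw [Complex.mem_slitPlane_iff, not_or, not_lt, not_not] at hs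
    refine Complex.continuousWithinAt_log_of_re_neg_of_im_zero ?_ hs.2
    refine lt_of_le_of_ne hs.1 fun h => hz (Complex.ext h hs.2)

/-- The map z ↦ 1 − 4m²/z preserves the closed upper half-plane, so the root inherits the one-sided
continuity of the logarithm. At the threshold the base is 0, and continuity comes from the positive
real part of the exponent. -/
theorem continuousWithinAt_rootFn (m : ℝ) {s : ℝ} (hs : s ≠ 0) :
    ContinuousWithinAt (rootFn m) {z | 0 ≤ z.im} (s : ℂ) := by
  have hsc : (s : ℂ) ≠ 0 := by exact_mod_cast hs
  have h1 : ContinuousWithinAt (fun z : ℂ => 1 - 4 * (m : ℂ) ^ 2 / z) {z | 0 ≤ z.im} (s : ℂ) :=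
    (continuousAt_const.sub (continuousAt_const.div continuousAt_id hsc)).continuousWithinAt
  have hmaps : Set.MapsTo (fun z : ℂ => 1 - 4 * (m : ℂ) ^ 2 / z) {z | 0 ≤ z.im} {z | 0 ≤ z.im} := by
    intro z hz
    have hz : 0 ≤ z.im := hz
    rw [Set.mem_ofPred_eq, one_sub_div_im]
    exact div_nonneg (by positivity) (Complex.normSq_nonneg z)
  have h2 : ContinuousWithinAt (fun z : ℂ => z ^ (1 / 2 : ℂ)) {z | 0 ≤ z.im}
      (1 - 4 * (m : ℂ) ^ 2 / (s : ℂ)) := by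
    by_cases h0 : 1 - 4 * (m : ℂ) ^ 2 / (s : ℂ) = 0
    · rw [h0]
      have h3 := Complex.continuousAt_cpow_zero_of_re_pos (z := 1 / 2) (by norm_num)
      exact (h3.comp (f := fun z : ℂ => (z, (1 / 2 : ℂ))) (by fun_prop)).continuousWithinAt
    · have h3 : ContinuousWithinAt (fun z : ℂ => Complex.exp (Complex.log z * (1 / 2)))
          {z | 0 ≤ z.im} (1 - 4 * (m : ℂ) ^ 2 / (s : ℂ)) :=
        ((continuousWithinAt_log_upper h0).mul
          continuousWithinAt_const).cexp
      refine h3.congr_of_eventuallyEq ?_ (Complex.cpow_def_of_ne_zero h0 _)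
      filter_upwards [mem_nhdsWithin_of_mem_nhds (isOpen_ne.mem_nhds h0)] with z hz
      exact Complex.cpow_def_of_ne_zero hz _
  exact ContinuousWithinAt.comp (g := fun z : ℂ => z ^ (1 / 2 : ℂ))
    (f := fun z : ℂ => 1 - 4 * (m : ℂ) ^ 2 / z) (t := {z : ℂ | 0 ≤ z.im}) h2 h1 hmaps

theorem rootFn_add_one_ne_zero (m : ℝ) (z : ℂ) : rootFn m z + 1 ≠ 0 := by
  intro h
  have h1 := congrArg Complex.re h
  have := rootFn_re_nonneg m z
  simp at h1
  linarith

theorem rootFn_sub_one_ne_zero {m : ℝ} (hm : 0 < m) {z : ℂ} (hz : z ≠ 0) : rootFn m z - 1 ≠ 0 := by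
  intro h
  have h1 := rootFn_sq m z
  rw [sub_eq_zero.1 h] at h1
  have h2 : 4 * (m : ℂ) ^ 2 / z = 0 := by linear_combination h1
  have : (m : ℂ) ≠ 0 := by exact_mod_cast hm.ne'
  rw [div_eq_zero_iff] at h2
  simp [this, hz] at h2

theorem continuousWithinAt_closedForm {m : ℝ} (hm : 0 < m) {s : ℝ} (hs : s ≠ 0) :
    ContinuousWithinAt (closedForm m) {z | 0 ≤ z.im} (s : ℂ) := by
  have hsc : (s : ℂ) ≠ 0 := by exact_mod_cast hs
  have hw := continuousWithinAt_rootFn m hs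
  have hξ : ContinuousWithinAt (fun z => (rootFn m z - 1) / (rootFn m z + 1)) {z | 0 ≤ z.im} (s : ℂ) :=
    (hw.sub continuousWithinAt_const).div (hw.add continuousWithinAt_const)
      (rootFn_add_one_ne_zero m _)
  have him : ∀ z : ℂ, 0 ≤ z.im → 0 ≤ ((rootFn m z - 1) / (rootFn m z + 1)).im := by
    intro z hz
    have := im_sub_div_add (rootFn m z) 1
    rw [Complex.ofReal_one] at this
    rw [this]
    have := rootFn_im_nonneg m z hz
    exact div_nonneg (by positivity) (Complex.normSq_nonneg _)
  have hlog : ContinuousWithinAt (fun z => Complex.log ((rootFn m z - 1) / (rootFn m z + 1)))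
      {z | 0 ≤ z.im} (s : ℂ) :=
    ContinuousWithinAt.comp (g := Complex.log)
      (f := fun z => (rootFn m z - 1) / (rootFn m z + 1)) (t := {z : ℂ | 0 ≤ z.im})
      (continuousWithinAt_log_upper (div_ne_zero (rootFn_sub_one_ne_zero hm hsc)
        (rootFn_add_one_ne_zero m _))) hξ him
  have hid : ContinuousWithinAt (fun z : ℂ => z) {z | 0 ≤ z.im} (s : ℂ) := continuousWithinAt_id
  exact (((hid.add continuousWithinAt_const).mul (hw.mul hlog)).add continuousWithinAt_const).add
    ((continuousWithinAt_const.mul hid).div_const _)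

/-- The boundary value `I(s + i0⁺)` of the spectral integral. -/
def specBdry (m s : ℝ) : ℂ :=
  if s < 4 * m ^ 2 then specInt m s else closedForm m s / (s : ℂ) ^ 2

theorem ofReal_mem_cutPlane {m s : ℝ} (hs : s < 4 * m ^ 2) : (s : ℂ) ∈ cutPlane m :=
  Or.inr (by simpa using hs)

theorem continuousAt_specInt {m : ℝ} (hm : 0 < m) {z : ℂ} (hz : z ∈ cutPlane m) :
    ContinuousAt (specInt m) z :=
  ((differentiableOn_specInt hm).differentiableAt ((isOpen_cutPlane m).mem_nhds hz)).continuousAt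

theorem tendsto_specInt_closedForm {m : ℝ} (hm : 0 < m) {s : ℝ} (hs : s ≠ 0) :
    Tendsto (specInt m) (𝓝[{z | 0 < z.im}] (s : ℂ)) (𝓝 (closedForm m s / (s : ℂ) ^ 2)) := by
  have hsc : (s : ℂ) ≠ 0 := by exact_mod_cast hs
  have h1 : Tendsto (closedForm m) (𝓝[{z | 0 < z.im}] (s : ℂ)) (𝓝 (closedForm m s)) :=
    (continuousWithinAt_closedForm hm hs).tendsto.mono_left
      (nhdsWithin_mono _ fun z (hz : 0 < z.im) => le_of_lt hz)
  have h2 : Tendsto (fun z : ℂ => z ^ 2) (𝓝[{z | 0 < z.im}] (s : ℂ)) (𝓝 ((s : ℂ) ^ 2)) :=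
    ((continuous_pow 2).tendsto _).mono_left nhdsWithin_le_nhds
  refine (h1.div h2 (pow_ne_zero 2 hsc)).congr' ?_
  filter_upwards [self_mem_nhdsWithin] with z hz
  have hz : 0 < z.im := hz
  have hz0 : z ≠ 0 := by rintro rfl; simp at hz
  simp only [Pi.div_apply]
  rw [← sq_mul_specInt hm hz]
  field_simp

/-- Both branches of `specBdry` are needed: at s = 0 the quotient of the closed form by s² says
nothing, and from the threshold on the integrand is singular on the path of integration. Where both
apply, uniqueness of limits identifies them. -/
theorem tendsto_specInt_upper {m : ℝ} (hm : 0 < m) (s : ℝ) :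
    Tendsto (specInt m) (𝓝[{z | 0 < z.im}] (s : ℂ)) (𝓝 (specBdry m s)) := by
  rw [specBdry]
  split_ifs with h
  · exact (continuousAt_specInt hm (ofReal_mem_cutPlane h)).tendsto.mono_left nhdsWithin_le_nhds
  · exact tendsto_specInt_closedForm hm (by nlinarith [sq_pos_of_pos hm])

theorem sq_mul_specBdry {m : ℝ} (hm : 0 < m) {s : ℝ} (hs : s ≠ 0) :
    (s : ℂ) ^ 2 * specBdry m s = closedForm m s := by
  have := neBot_upper s
  rw [tendsto_nhds_unique (tendsto_specInt_upper hm s) (tendsto_specInt_closedForm hm hs)]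
  have hsc : (s : ℂ) ≠ 0 := by exact_mod_cast hs
  field_simp

theorem norm_mul_specBdry_le {m : ℝ} (hm : 0 < m) : ∃ C : ℝ, 0 ≤ C ∧ ∀ s : ℝ,
    ‖(s : ℂ) * specBdry m s‖ ≤ C * (1 + Real.log (1 + |s|)) := by
  obtain ⟨C, hC, h⟩ := norm_mul_specInt_le hm
  refine ⟨C, hC, fun s => ?_⟩
  have := neBot_upper s
  have h1 : Tendsto (fun z => ‖z * specInt m z‖) (𝓝[{z | 0 < z.im}] (s : ℂ))
      (𝓝 ‖(s : ℂ) * specBdry m s‖) :=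
    ((tendsto_id.mono_left nhdsWithin_le_nhds).mul (tendsto_specInt_upper hm s)).norm
  have h2 := ((continuous_logBound C).tendsto (s : ℂ)).mono_left
    (nhdsWithin_le_nhds (s := {z | 0 < z.im}))
  rw [Complex.norm_real, Real.norm_eq_abs] at h2
  refine le_of_tendsto_of_tendsto h1 h2 ?_
  filter_upwards [self_mem_nhdsWithin] with z hz
  exact h z (Or.inl (ne_of_gt hz))

/-- With w = √(1 − 4m²/s) one has ξ = (w − 1)/(w + 1), hence (1 + ξ)/(1 − ξ) = w and m²(ξ + ξ⁻¹) =
2m² − s. These two identities remove ξ outside the logarithm. -/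
theorem piScalar_eq_closedForm (e : ℝ) {m : ℝ} (hm : 0 < m) {s : ℝ} (hs : s ≠ 0) :
    piScalar e m s = -((e : ℂ) ^ 2 / 3) * closedForm m s := by
  have hsc : (s : ℂ) ≠ 0 := by exact_mod_cast hs
  have hmc : (m : ℂ) ≠ 0 := by exact_mod_cast hm.ne'
  have hp := rootFn_add_one_ne_zero m (s : ℂ)
  have hmn := rootFn_sub_one_ne_zero hm hsc
  have hsq := rootFn_sq m (s : ℂ)
  have hroot : ((1 - 4 * m ^ 2 / s : ℝ) : ℂ) ^ (1 / 2 : ℂ) = rootFn m s := by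
    rw [rootFn]
    push_cast
    rfl
  set w := rootFn m s with hw
  have hsw : (s : ℂ) * w ^ 2 = s - 4 * m ^ 2 := by
    rw [hsq]
    field_simp
  have hxi : xi m s = (w - 1) / (w + 1) := by
    rw [xi, hroot, eq_div_iff hp]
    push_cast
    field_simp
    linear_combination hsw
  have hratio : (1 + xi m s) / (1 - xi m s) = w := by
    rw [hxi]
    field_simp
    ring
  have hsum : (m : ℂ) ^ 2 * (xi m s + (xi m s)⁻¹) = 2 * m ^ 2 - s := by
    have hww : w ^ 2 - 1 ≠ 0 := by
      have : w ^ 2 - 1 = (w - 1) * (w + 1) := by ring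
      rw [this]
      exact mul_ne_zero hmn hp
    have h1 : xi m s + (xi m s)⁻¹ = 2 * (w ^ 2 + 1) / (w ^ 2 - 1) := by
      rw [hxi, inv_div, eq_div_iff hww]
      field_simp
      ring
    rw [h1, ← mul_div_assoc, div_eq_iff hww]
    linear_combination hsw
  rw [piScalar, hratio, closedForm, ← hw, ← hxi]
  push_cast
  have h5 : (5 / (3 * xi m s) : ℂ) = 5 / 3 * (xi m s)⁻¹ := by
    rw [div_eq_mul_inv, mul_inv]
    ring
  rw [h5]
  linear_combination (e ^ 2 / 3 * (w * Complex.log (xi m s)) + 5 / 9 * (e : ℂ) ^ 2) * hsum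

theorem piScalar_eq_specBdry (e : ℝ) {m : ℝ} (hm : 0 < m) {s : ℝ} (hs : s ≠ 0) :
    piScalar e m s = -((e : ℂ) ^ 2 / 3) * (s : ℂ) ^ 2 * specBdry m s := by
  rw [piScalar_eq_closedForm e hm hs, ← sq_mul_specBdry hm hs, mul_assoc]

/-! ### Functions of polynomial growth as tempered distributions. -/

/-- Measurable functions of polynomial growth. -/
def IsModerate (f : E4 → ℂ) : Prop :=
  Measurable f ∧ ∃ (N : ℕ) (C : ℝ), ∀ k, ‖f k‖ ≤ C * (1 + ‖k‖) ^ N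

/-- Five spare powers are split off because (1 + ‖k‖)⁻⁵ is integrable in dimension four. -/
theorem one_add_norm_pow_mul_le (φ : 𝓢(E4, ℂ)) (N : ℕ) (k : E4) : (1 + ‖k‖) ^ N * ‖φ k‖ ≤
    (1 + ‖k‖) ^ (-(5 : ℝ)) * (2 ^ (N + 5) *
      ((Finset.Iic (N + 5, 0)).sup (fun p => SchwartzMap.seminorm ℂ p.1 p.2) φ)) := by
  have h := SchwartzMap.one_add_le_sup_seminorm_apply (𝕜 := ℂ) (m := (N + 5, 0)) (k := N + 5)
    (n := 0) le_rfl le_rfl φ k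
  rw [norm_iteratedFDeriv_zero, pow_add, mul_assoc] at h
  have h5 : (1 + ‖k‖) ^ (-(5 : ℝ)) = ((1 + ‖k‖) ^ 5)⁻¹ := by
    rw [Real.rpow_neg (by positivity)]
    norm_cast
  rw [h5, ← div_eq_inv_mul, le_div_iff₀ (by positivity)]
  linarith

theorem integrable_one_add_norm_rpow : Integrable fun k : E4 => (1 + ‖k‖) ^ (-(5 : ℝ)) :=
  integrable_one_add_norm (by simp; norm_num)

theorem integrable_pow_mul_schwartz (C : ℝ) (N : ℕ) (φ : 𝓢(E4, ℂ)) :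
    Integrable fun k : E4 => C * (1 + ‖k‖) ^ N * ‖φ k‖ := by
  simp_rw [mul_assoc]
  refine Integrable.const_mul ?_ C
  refine (integrable_one_add_norm_rpow.mul_const _).mono' ?_
    (Eventually.of_forall fun k => ?_) (g := fun k => (1 + ‖k‖) ^ (-(5 : ℝ)) * (2 ^ (N + 5) *
      ((Finset.Iic (N + 5, 0)).sup (fun p => SchwartzMap.seminorm ℂ p.1 p.2) φ)))
  · exact (((continuous_const.add continuous_norm).pow N).mul φ.continuous.norm).aestronglyMeasurable
  · rw [Real.norm_of_nonneg (by positivity)]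
    exact one_add_norm_pow_mul_le φ N k

namespace IsModerate

variable {f g : E4 → ℂ}

theorem bound_nonneg {N : ℕ} {C : ℝ} (h : ∀ k, ‖f k‖ ≤ C * (1 + ‖k‖) ^ N) : 0 ≤ C := by
  simpa using (norm_nonneg _).trans (h 0)

theorem const (c : ℂ) : IsModerate fun _ => c := ⟨measurable_const, 0, ‖c‖, by simp⟩

theorem mul (hf : IsModerate f) (hg : IsModerate g) : IsModerate fun k => f k * g k := by
  obtain ⟨hfm, N, C, hC⟩ := hf
  obtain ⟨hgm, N', C', hC'⟩ := hg
  refine ⟨hfm.mul hgm, N + N', C * C', fun k => ?_⟩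
  rw [norm_mul, pow_add, mul_mul_mul_comm]
  have := bound_nonneg hC
  exact mul_le_mul (hC k) (hC' k) (norm_nonneg _) (by positivity)

theorem add (hf : IsModerate f) (hg : IsModerate g) : IsModerate fun k => f k + g k := by
  obtain ⟨hfm, N, C, hC⟩ := hf
  obtain ⟨hgm, N', C', hC'⟩ := hg
  refine ⟨hfm.add hgm, N + N', C + C', fun k => (norm_add_le _ _).trans ?_⟩
  have h0 := bound_nonneg hC
  have h0' := bound_nonneg hC'
  have h1 : (1 : ℝ) ≤ 1 + ‖k‖ := by linarith [norm_nonneg k]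
  rw [add_mul]
  refine add_le_add ((hC k).trans ?_) ((hC' k).trans ?_)
  · gcongr
    omega
  · gcongr
    omega

theorem neg (hf : IsModerate f) : IsModerate fun k => -f k := by
  simpa using (const (-1)).mul hf

theorem sub (hf : IsModerate f) (hg : IsModerate g) : IsModerate fun k => f k - g k := by
  simpa [sub_eq_add_neg] using hf.add hg.neg

theorem comp_neg (hf : IsModerate f) : IsModerate fun k => f (-k) := by
  obtain ⟨hfm, N, C, hC⟩ := hf
  exact ⟨hfm.comp measurable_neg, N, C, fun k => by simpa using hC (-k)⟩

theorem integrable_mul (hf : IsModerate f) (φ : 𝓢(E4, ℂ)) : Integrable fun k => f k * φ k := by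
  obtain ⟨hfm, N, C, hC⟩ := hf
  refine (integrable_pow_mul_schwartz C N φ).mono'
    (hfm.aestronglyMeasurable.mul φ.continuous.aestronglyMeasurable) (Eventually.of_forall fun k => ?_)
  rw [norm_mul]
  exact mul_le_mul_of_nonneg_right (hC k) (norm_nonneg _)

/-- The regular tempered distribution given by a function of polynomial growth. -/
def toDist (hf : IsModerate f) : 𝓢'(E4, ℂ) :=
  ContinuousLinearMap.toPointwiseConvergenceCLM ℂ (RingHom.id ℂ) 𝓢(E4, ℂ) ℂ
    (SchwartzMap.mkCLMtoNormedSpace (σ := RingHom.id ℂ) (fun φ : 𝓢(E4, ℂ) => ∫ k, f k * φ k)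
      (fun φ ψ => by
        rw [← integral_add (hf.integrable_mul φ) (hf.integrable_mul ψ)]
        simp [mul_add])
      (fun a φ => by
        rw [RingHom.id_apply, smul_eq_mul, ← integral_const_mul]
        refine integral_congr_ae (Eventually.of_forall fun k => ?_)
        simp only [smul_apply, smul_eq_mul]
        ring)
      (by
        obtain ⟨-, N, C, hC⟩ := id hf
        have h0 := bound_nonneg hC
        refine ⟨Finset.Iic (N + 5, 0), C * ((∫ k : E4, (1 + ‖k‖) ^ (-(5 : ℝ))) * 2 ^ (N + 5)),
          mul_nonneg h0 (mul_nonneg (integral_nonneg fun k => by positivity) (by positivity)),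
          fun φ => ?_⟩
        refine (norm_integral_le_integral_norm _).trans ?_
        have h : ∀ k, ‖f k * φ k‖ ≤ C * ((1 + ‖k‖) ^ (-(5 : ℝ)) * (2 ^ (N + 5) *
            ((Finset.Iic (N + 5, 0)).sup (fun p => SchwartzMap.seminorm ℂ p.1 p.2) φ))) := by
          intro k
          rw [norm_mul]
          refine (mul_le_mul_of_nonneg_right (hC k) (norm_nonneg _)).trans ?_
          rw [mul_assoc]
          exact mul_le_mul_of_nonneg_left (one_add_norm_pow_mul_le φ N k) h0
        refine (integral_mono (hf.integrable_mul φ).norm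
          ((integrable_one_add_norm_rpow.mul_const _).const_mul C) h).trans (le_of_eq ?_)
        rw [integral_const_mul, integral_mul_const]
        simp only [mul_assoc]
        rfl))

theorem toDist_apply (hf : IsModerate f) (φ : 𝓢(E4, ℂ)) : hf.toDist φ = ∫ k, f k * φ k := rfl

theorem isRegularDist (hf : IsModerate f) : IsRegularDist hf.toDist f :=
  fun φ => ⟨hf.integrable_mul φ, rfl⟩

theorem reflect_toDist (hf : IsModerate f) : reflect hf.toDist = hf.comp_neg.toDist := by
  ext φ
  have h : reflect hf.toDist φ = ∫ k, f k * φ (-k) := rfl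
  rw [h, toDist_apply, ← integral_neg_eq_self]
  simp

theorem toDist_sub (hf : IsModerate f) (hg : IsModerate g) :
    hf.toDist - hg.toDist = (hf.sub hg).toDist := by
  ext φ
  have h : (hf.toDist - hg.toDist) φ = (∫ k, f k * φ k) - ∫ k, g k * φ k := rfl
  rw [h, toDist_apply, ← integral_sub (hf.integrable_mul φ) (hg.integrable_mul φ)]
  simp only [sub_mul]

theorem toDist_congr (hf : IsModerate f) (hg : IsModerate g) (h : ∀ k, f k = g k) :
    hf.toDist = hg.toDist := by
  ext φ
  simp [toDist_apply, h]

theorem rescaled_toDist (hf : IsModerate f) {α : ℝ} (hα : 0 < α) (φ : 𝓢(E4, ℂ)) :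
    rescaled hf.toDist α φ = ∫ k, f (α⁻¹ • k) * φ k := by
  rw [rescaled_of_pos _ hα, toDist_apply]
  have h := Measure.integral_comp_smul (volume : Measure E4) (fun k => f (α⁻¹ • k) * φ k) α
  have h3 : |(α ^ Module.finrank ℝ E4)⁻¹| = (α ^ 4)⁻¹ := by simp [abs_of_pos hα]
  rw [h3] at h
  simp only [dilate_apply]
  simp only [inv_smul_smul₀ hα.ne'] at h
  rw [h, Complex.real_smul]
  have : (α : ℂ) ≠ 0 := by exact_mod_cast hα.ne'
  push_cast
  field_simp

/-- Dominated convergence for the rescaled distributions. -/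
theorem tendsto_rescaled (hf : IsModerate f) (hg : IsModerate g) {ρ : ℝ → ℝ} {N : ℕ} {C : ℝ}
    (hbound : ∀ᶠ α in 𝓝[>] (0 : ℝ), ∀ k, ‖(ρ α : ℂ) * f (α⁻¹ • k)‖ ≤ C * (1 + ‖k‖) ^ N)
    (hlim : ∀ᵐ k : E4, Tendsto (fun α : ℝ => (ρ α : ℂ) * f (α⁻¹ • k)) (𝓝[>] 0) (𝓝 (g k)))
    (φ : 𝓢(E4, ℂ)) :
    Tendsto (fun α => (ρ α : ℂ) * rescaled hf.toDist α φ) (𝓝[>] 0) (𝓝 (hg.toDist φ)) := by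
  have h : Tendsto (fun α : ℝ => ∫ k, ((ρ α : ℂ) * f (α⁻¹ • k)) * φ k) (𝓝[>] 0)
      (𝓝 (∫ k, g k * φ k)) := by
    refine tendsto_integral_filter_of_dominated_convergence
      (fun k => C * (1 + ‖k‖) ^ N * ‖φ k‖) (Eventually.of_forall fun α => ?_) ?_
      (integrable_pow_mul_schwartz C N φ) ?_
    · exact ((measurable_const.mul (hf.1.comp (measurable_const_smul _))).aestronglyMeasurable).mul
        φ.continuous.aestronglyMeasurable
    · filter_upwards [hbound] with α hα
      refine Eventually.of_forall fun k => ?_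
      rw [norm_mul]
      exact mul_le_mul_of_nonneg_right (hα k) (norm_nonneg _)
    · filter_upwards [hlim] with k hk
      exact hk.mul_const _
  refine h.congr' ?_
  filter_upwards [self_mem_nhdsWithin] with α hα
  rw [rescaled_toDist hf hα, ← integral_const_mul]
  simp only [mul_assoc]

theorem eq_zero_of_toDist_eq_zero (hf : IsModerate f) (h : hf.toDist = 0) : f =ᵐ[volume] 0 := by
  refine ae_eq_zero_of_integral_contDiff_smul_eq_zero ?_ fun g hg hgs => ?_
  · obtain ⟨hfm, N, C, hC⟩ := hf
    have hc : Continuous fun k : E4 => C * (1 + ‖k‖) ^ N := by fun_prop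
    refine hc.locallyIntegrable.mono hfm.aestronglyMeasurable
      (Eventually.of_forall fun k => (hC k).trans (le_abs_self _))
  · have hsm : ContDiff ℝ (⊤ : ℕ∞) fun k => (g k : ℂ) := Complex.ofRealCLM.contDiff.comp hg
    have hcs : HasCompactSupport fun k => (g k : ℂ) := hgs.comp_left (g := Complex.ofReal) rfl
    have h1 : hf.toDist (hcs.toSchwartzMap hsm) = 0 := by rw [h]; rfl
    rw [toDist_apply] at h1
    rw [← h1]
    refine integral_congr_ae (Eventually.of_forall fun k => ?_)
    simp [mul_comm]

end IsModerate

theorem Distribution.isVanishingOn_sub {T T' : 𝓢'(E4, ℂ)} {U : Set E4}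
    (h : Distribution.IsVanishingOn T U) (h' : Distribution.IsVanishingOn T' U) :
    Distribution.IsVanishingOn (T - T') U := by
  intro φ hφ
  have h1 : (T - T') φ = T φ - T' φ := rfl
  rw [h1, h φ hφ, h' φ hφ, sub_zero]

theorem positionSpace_sub (F : Form) (T T' : 𝓢'(E4, ℂ)) :
    positionSpace F (T - T') = positionSpace F T - positionSpace F T' := rfl

theorem positionSpace_reflect (F : Form) (T : 𝓢'(E4, ℂ)) :
    positionSpace F (reflect T) = reflect (positionSpace F T) := by
  ext φ
  change T _ = T _
  congr 1
  ext k
  change minkowskiFourier F φ (-k) = minkowskiFourier F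
    (SchwartzMap.compCLMOfContinuousLinearEquiv ℂ (ContinuousLinearEquiv.neg ℝ (M := E4)) φ) k
  rw [minkowskiFourier_apply, minkowskiFourier_apply, ← integral_neg_eq_self]
  congr 1
  refine integral_congr_ae (Eventually.of_forall fun y => ?_)
  simp only [minkDot_neg_left, minkDot_neg_right, neg_neg]
  rfl

theorem SupportedIn.reflect {F : Form} {T : TensorDist} (h : SupportedIn F T (forwardCone F)) :
    SupportedIn F (fun μ ν => reflect (T μ ν)) (backwardCone F) := by
  intro μ ν φ hφ
  rw [positionSpace_reflect]
  refine h μ ν _ ?_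
  intro y hy
  have h1 := tsupport_comp_subset_preimage φ (continuous_neg (G := E4)) hy
  have h2 := hφ h1
  intro h3
  exact h2 (by simpa [backwardCone] using h3)

/-! ### The loop, causal and retarded functions in momentum space and their relations. -/

/-- The symmetric tensor `k² h^{μν} - k^μ k^ν`. -/
def transverse (F : Form) (μ ν : Fin 4) (k : E4) : ℝ := minkSq F k * metric F μ ν - k μ * k ν

/-- The threshold function `θ(s - 4m²) (1 + 2m²/s) √(1 - 4m²/s)`. -/
def bubble (m s : ℝ) : ℝ := if 4 * m ^ 2 < s then (1 + 2 * m ^ 2 / s) * √(1 - 4 * m ^ 2 / s) else 0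

/-- The coefficient of the fermion loop. -/
def loopConst (e : ℝ) : ℝ := e ^ 2 / (24 * Real.pi ^ 3)

/-- The coefficient of the retarded distribution. -/
def retConst (e : ℝ) : ℂ := -Complex.I * ((e ^ 2 / 3 / (2 * Real.pi) ^ 4 : ℝ) : ℂ)

/-- The Fourier transform of the fermion loop as a function. -/
def loopFn (F : Form) (e m : ℝ) (μ ν : Fin 4) (k : E4) : ℂ :=
  if 0 < freq F k then ((loopConst e * bubble m (minkSq F k) * transverse F μ ν k : ℝ) : ℂ) else 0

/-- The Fourier transform of the causal distribution as a function. -/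
def causalFn (F : Form) (e m : ℝ) (μ ν : Fin 4) (k : E4) : ℂ :=
  ((loopConst e * (Real.sign (freq F k) * bubble m (minkSq F k)) * transverse F μ ν k : ℝ) : ℂ)

/-- The boundary value of the spectral integral at `k² + i0⁺ sgn(k)`. -/
def bdryFn (F : Form) (m : ℝ) (k : E4) : ℂ :=
  if 0 < freq F k then specBdry m (minkSq F k) else (starRingEnd ℂ) (specBdry m (minkSq F k))

/-- The Fourier transform of the retarded distribution as a function. -/
def retFn (F : Form) (e m : ℝ) (μ ν : Fin 4) (k : E4) : ℂ :=
  retConst e * (transverse F μ ν k : ℂ) * ((minkSq F k : ℂ) * bdryFn F m k)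

theorem metric_comm (F : Form) (μ ν : Fin 4) : metric F μ ν = metric F ν μ := by
  cases F <;> fin_cases μ <;> fin_cases ν <;> rfl

theorem abs_metric_le (F : Form) (μ ν : Fin 4) : |metric F μ ν| ≤ 1 := by
  cases F <;> fin_cases μ <;> fin_cases ν <;> simp [metric]

theorem transverse_comm (F : Form) (μ ν : Fin 4) (k : E4) :
    transverse F μ ν k = transverse F ν μ k := by
  rw [transverse, transverse, metric_comm, mul_comm (k μ)]

theorem transverse_smul (F : Form) (μ ν : Fin 4) (c : ℝ) (k : E4) :
    transverse F μ ν (c • k) = c ^ 2 * transverse F μ ν k := by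
  simp only [transverse, minkSq_smul, PiLp.smul_apply, smul_eq_mul]
  ring

theorem transverse_neg (F : Form) (μ ν : Fin 4) (k : E4) :
    transverse F μ ν (-k) = transverse F μ ν k := by
  simp [transverse, minkSq_neg]

@[fun_prop]
theorem continuous_transverse (F : Form) (μ ν : Fin 4) : Continuous (transverse F μ ν) := by
  have := continuous_minkSq F
  unfold transverse
  fun_prop

theorem abs_apply_le_norm (k : E4) (i : Fin 4) : |k i| ≤ ‖k‖ := by
  have := PiLp.norm_apply_le k i
  simpa using this

theorem abs_transverse_le (F : Form) (μ ν : Fin 4) (k : E4) :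
    |transverse F μ ν k| ≤ 2 * ‖k‖ ^ 2 := by
  have h1 := abs_minkSq_le F k
  have h2 := abs_metric_le F μ ν
  have h3 := abs_apply_le_norm k μ
  have h4 := abs_apply_le_norm k ν
  calc |transverse F μ ν k| ≤ |minkSq F k * metric F μ ν| + |k μ * k ν| := abs_sub _ _
    _ ≤ ‖k‖ ^ 2 * 1 + ‖k‖ * ‖k‖ := by
        rw [abs_mul, abs_mul]
        gcongr
    _ = 2 * ‖k‖ ^ 2 := by ring

theorem bubble_of_lt {m s : ℝ} (h : 4 * m ^ 2 < s) :
    bubble m s = (1 + 2 * m ^ 2 / s) * √(1 - 4 * m ^ 2 / s) := if_pos h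

theorem bubble_of_le {m s : ℝ} (h : s ≤ 4 * m ^ 2) : bubble m s = 0 := if_neg h.not_gt

theorem bubble_nonneg (m s : ℝ) : 0 ≤ bubble m s := by
  rw [bubble]
  split_ifs with h
  · have : 0 ≤ s := by nlinarith [sq_nonneg m]
    positivity
  · exact le_rfl

theorem bubble_le (m s : ℝ) : bubble m s ≤ 2 := by
  rw [bubble]
  split_ifs with h
  · have hs : 0 < s := by nlinarith [sq_nonneg m]
    have h1 : 2 * m ^ 2 / s ≤ 1 := by rw [div_le_one hs]; nlinarith [sq_nonneg m]
    have h2 : √(1 - 4 * m ^ 2 / s) ≤ 1 := by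
      rw [Real.sqrt_le_one]
      have : 0 ≤ 4 * m ^ 2 / s := by positivity
      linarith
    have h3 : 0 ≤ 2 * m ^ 2 / s := by positivity
    nlinarith [Real.sqrt_nonneg (1 - 4 * m ^ 2 / s)]
  · norm_num

/-- The root vanishes at the threshold, so replacing s by max(s, 4m²) reproduces the case
distinction in one continuous formula. -/
theorem continuous_bubble {m : ℝ} (hm : 0 < m) : Continuous (bubble m) := by
  have h : bubble m = fun s => (1 + 2 * m ^ 2 / max s (4 * m ^ 2)) *
      √(1 - 4 * m ^ 2 / max s (4 * m ^ 2)) := by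
    ext s
    have h4 : 4 * m ^ 2 ≠ 0 := by positivity
    rcases lt_or_ge (4 * m ^ 2) s with h | h
    · rw [bubble_of_lt h, max_eq_left h.le]
    · rw [bubble_of_le h, max_eq_right h, div_self h4]
      simp
  have hne : ∀ s : ℝ, max s (4 * m ^ 2) ≠ 0 := fun s =>
    (lt_of_lt_of_le (by positivity) (le_max_right s (4 * m ^ 2))).ne'
  rw [h]
  fun_prop (disch := exact hne _)

theorem rootFn_ofReal {m s : ℝ} (h : 4 * m ^ 2 ≤ s) (hs : 0 < s) :
    rootFn m s = (√(1 - 4 * m ^ 2 / s) : ℝ) := by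
  have h0 : 0 ≤ 1 - 4 * m ^ 2 / s := by
    rw [sub_nonneg, div_le_one hs]
    exact h
  rw [Real.sqrt_eq_rpow, Complex.ofReal_cpow h0, rootFn]
  push_cast
  rfl

/-- Below the threshold the integral is real. Above it ξ is negative, log ξ has imaginary part π,
and the closed form yields π(1 + 2m²/s)√(1 − 4m²/s). -/
theorem mul_specBdry_im {m : ℝ} (hm : 0 < m) (s : ℝ) :
    ((s : ℂ) * specBdry m s).im = Real.pi * bubble m s := by
  rcases lt_or_ge s (4 * m ^ 2) with h | h
  · rw [bubble_of_le h.le, specBdry, if_pos h]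
    have h1 : (starRingEnd ℂ) (specInt m s) = specInt m s := by
      rw [← specInt_conj, Complex.conj_ofReal]
    rw [Complex.im_ofReal_mul, Complex.conj_eq_iff_im.1 h1]
    simp
  · have hs : 0 < s := lt_of_lt_of_le (by positivity) h
    have hsc : (s : ℂ) ≠ 0 := by exact_mod_cast hs.ne'
    set w := √(1 - 4 * m ^ 2 / s) with hw
    have hw0 : 0 ≤ w := Real.sqrt_nonneg _
    have hw1 : w < 1 := by
      rw [hw, Real.sqrt_lt' one_pos]
      have : 0 < 4 * m ^ 2 / s := by positivity
      linarith
    have hb : bubble m s = (1 + 2 * m ^ 2 / s) * w := by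
      rcases h.lt_or_eq with h' | h'
      · exact bubble_of_lt h'
      · rw [bubble_of_le h'.ge, hw, ← h', div_self (by positivity)]
        simp
    have hlog : Complex.log (((w : ℂ) - 1) / ((w : ℂ) + 1)) =
        (Real.log ((1 - w) / (1 + w)) : ℝ) + Real.pi * Complex.I := by
      have h1 : ((w : ℂ) - 1) / ((w : ℂ) + 1) = -(((1 - w) / (1 + w) : ℝ) : ℂ) := by
        have h2 : (w : ℂ) + 1 ≠ 0 := by exact_mod_cast (by linarith : w + 1 ≠ 0)
        have h3 : (1 : ℂ) + w ≠ 0 := by rwa [add_comm]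
        push_cast
        field_simp
        ring
      have hpos : 0 < (1 - w) / (1 + w) := div_pos (by linarith) (by linarith)
      rw [h1, Complex.log, norm_neg, Complex.norm_of_nonneg hpos.le, ← Complex.ofReal_neg,
        Complex.arg_ofReal_of_neg (neg_lt_zero.2 hpos)]
    have h1 : (s : ℂ) * specBdry m s = (((s + 2 * m ^ 2) * (w * Real.log ((1 - w) / (1 + w))) +
        4 * m ^ 2 + 5 * s / 3) / s : ℝ) + (((s + 2 * m ^ 2) * w * Real.pi / s : ℝ) : ℂ) * Complex.I := by
      have h2 := sq_mul_specBdry hm hs.ne'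
      rw [closedForm, rootFn_ofReal h hs, ← hw, hlog] at h2
      have h3 : (s : ℂ) * specBdry m s = (s : ℂ) ^ 2 * specBdry m s / s := by field_simp
      rw [h3, h2]
      push_cast
      field_simp
      ring
    rw [h1, hb]
    simp only [Complex.add_im, Complex.ofReal_im, Complex.mul_im, Complex.ofReal_re, Complex.I_im,
      Complex.I_re, mul_one, mul_zero, add_zero, zero_add]
    field_simp

theorem mul_specBdry_sub_conj {m : ℝ} (hm : 0 < m) (s : ℝ) :
    (s : ℂ) * specBdry m s - (s : ℂ) * (starRingEnd ℂ) (specBdry m s) =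
      ((2 * Real.pi * bubble m s : ℝ) : ℂ) * Complex.I := by
  have h : (s : ℂ) * (starRingEnd ℂ) (specBdry m s) = (starRingEnd ℂ) ((s : ℂ) * specBdry m s) := by
    rw [map_mul, Complex.conj_ofReal]
  rw [h, Complex.sub_conj, mul_specBdry_im hm]
  push_cast
  ring

/-- This fixes the constant of the splitting: the jump 2πi · `bubble` of the spectral integral,
times `retConst`, must be the coefficient of the loop. -/
theorem retConst_mul (e b : ℝ) : retConst e * (((2 * Real.pi * b : ℝ) : ℂ) * Complex.I) =
    ((loopConst e * b : ℝ) : ℂ) := by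
  have hpi : (Real.pi : ℂ) ≠ 0 := by exact_mod_cast Real.pi_ne_zero
  rw [retConst, loopConst]
  push_cast
  field_simp
  rw [Complex.I_sq]
  ring

theorem bubble_eq_zero_of_freq {F : Form} {m : ℝ} {k : E4} (h : freq F k = 0) :
    bubble m (minkSq F k) = 0 := by
  refine bubble_of_le ?_
  by_contra h1
  exact freq_ne_zero F (by nlinarith [sq_nonneg m]) h

variable (F : Form) (e : ℝ) {m : ℝ} (μ ν : Fin 4) (k : E4)

theorem loopFn_sub_loopFn_neg :
    loopFn F e m μ ν k - loopFn F e m ν μ (-k) = causalFn F e m μ ν k := by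
  simp only [loopFn, causalFn, freq_neg, minkSq_neg, transverse_neg, transverse_comm F ν μ]
  rcases lt_trichotomy (freq F k) 0 with h | h | h
  · rw [if_neg (by linarith), if_pos (by linarith), Real.sign_of_neg h]
    push_cast
    ring
  · simp [bubble_eq_zero_of_freq h]
  · rw [if_pos h, if_neg (by linarith), Real.sign_of_pos h]
    push_cast
    ring

/-- The values at k and −k are the two boundary values of one function at the same k², on opposite
sides of the cut. Their difference is the discontinuity, which is the causal function. -/
theorem retFn_sub_retFn_neg (hm : 0 < m) :
    retFn F e m μ ν k - retFn F e m μ ν (-k) = causalFn F e m μ ν k := by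
  have h1 := mul_specBdry_sub_conj hm (minkSq F k)
  have h2 := retConst_mul e (bubble m (minkSq F k))
  simp only [retFn, causalFn, bdryFn, freq_neg, minkSq_neg, transverse_neg]
  rcases lt_trichotomy (freq F k) 0 with h | h | h
  · rw [if_neg (by linarith), if_pos (by linarith), Real.sign_of_neg h]
    push_cast at h1 h2 ⊢
    linear_combination (-retConst e * (transverse F μ ν k : ℂ)) * h1 -
      (transverse F μ ν k : ℂ) * h2
  · simp [bubble_eq_zero_of_freq h, h]
  · rw [if_pos h, if_neg (by linarith), Real.sign_of_pos h]
    push_cast at h1 h2 ⊢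
    linear_combination (retConst e * (transverse F μ ν k : ℂ)) * h1 +
      (transverse F μ ν k : ℂ) * h2

/-- The loop at −k is present only for negative frequency, where it moves the boundary value from
below the cut to above it. The sum has the Feynman prescription k² + i0 everywhere and no longer
refers to the frequency. -/
theorem retFn_add_loopFn_neg (hm : 0 < m) :
    retFn F e m μ ν k + loopFn F e m ν μ (-k) =
      retConst e * (transverse F μ ν k : ℂ) * ((minkSq F k : ℂ) * specBdry m (minkSq F k)) := by
  have h1 := mul_specBdry_sub_conj hm (minkSq F k)
  have h2 := retConst_mul e (bubble m (minkSq F k))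
  simp only [retFn, loopFn, bdryFn, freq_neg, minkSq_neg, transverse_neg, transverse_comm F ν μ]
  rcases lt_trichotomy (freq F k) 0 with h | h | h
  · rw [if_neg (by linarith), if_pos (by linarith)]
    push_cast at h1 h2 ⊢
    linear_combination (-retConst e * (transverse F μ ν k : ℂ)) * h1 -
      (transverse F μ ν k : ℂ) * h2
  · rw [bubble_eq_zero_of_freq h] at h1
    simp only [h, lt_irrefl, neg_zero, if_false, add_zero]
    push_cast at h1
    linear_combination (-retConst e * (transverse F μ ν k : ℂ)) * h1
  · rw [if_pos h, if_neg (by linarith), add_zero]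

theorem retFn_add_loopFn_neg_eq_tensorOf (hm : 0 < m) (hk : minkSq F k ≠ 0) :
    Complex.I * (retFn F e m μ ν k + loopFn F e m ν μ (-k)) =
      tensorOf F (fun k => piScalar e m (minkSq F k)) μ ν k := by
  rw [retFn_add_loopFn_neg F e μ ν k hm, tensorOf, piScalar_eq_specBdry e hm hk, retConst, transverse]
  have hs : (minkSq F k : ℂ) ≠ 0 := by exact_mod_cast hk
  have hpi : (Real.pi : ℂ) ≠ 0 := by exact_mod_cast Real.pi_ne_zero
  push_cast
  field_simp
  rw [Complex.I_sq]
  ring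

/-- The sign jumps only at zero frequency, where k² ≤ 0 lies below the threshold and `bubble`
vanishes in a neighbourhood. -/
theorem continuous_causalFn (hm : 0 < m) : Continuous (causalFn F e m μ ν) := by
  have h : Continuous fun k => Real.sign (freq F k) * bubble m (minkSq F k) := by
    rw [continuous_iff_continuousAt]
    intro k
    have hb := ((continuous_bubble hm).comp (continuous_minkSq F)).continuousAt (x := k)
    rcases lt_trichotomy (freq F k) 0 with h | h | h
    · refine (hb.const_mul (-1)).congr ?_
      filter_upwards [(continuous_freq F).continuousAt.eventually_lt_const h] with p hp
      rw [Real.sign_of_neg hp]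
      rfl
    · have h1 : minkSq F k < 4 * m ^ 2 := by
        by_contra h1
        exact freq_ne_zero F (by nlinarith [sq_pos_of_pos hm]) h
      refine (continuousAt_const (y := (0 : ℝ))).congr ?_
      filter_upwards [(continuous_minkSq F).continuousAt.eventually_lt_const h1] with p hp
      rw [bubble_of_le hp.le, mul_zero]
    · refine hb.congr ?_
      filter_upwards [(continuous_freq F).continuousAt.eventually_const_lt h] with p hp
      rw [Real.sign_of_pos hp, one_mul]
      rfl
  unfold causalFn
  fun_prop

theorem measurable_specBdry (hm : 0 < m) : Measurable (specBdry m) := by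
  have hlim : Tendsto (fun n : ℕ => (1 / ((n : ℝ) + 1) : ℝ)) atTop (𝓝[>] 0) :=
    tendsto_nhdsWithin_iff.2 ⟨tendsto_one_div_add_atTop_nhds_zero_nat,
      Eventually.of_forall fun n => by simp only [Set.mem_Ioi]; positivity⟩
  refine measurable_of_tendsto_metrizable (f := fun (n : ℕ) (s : ℝ) =>
    specInt m ((s : ℂ) + ((1 / ((n : ℝ) + 1) : ℝ) : ℂ) * Complex.I)) (fun n => ?_) ?_
  · refine Continuous.measurable ?_
    refine (differentiableOn_specInt hm).continuousOn.comp_continuous (by fun_prop) fun s => Or.inl ?_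
    simp only [Complex.add_im, Complex.ofReal_im, Complex.mul_im, Complex.ofReal_re, Complex.I_im,
      Complex.I_re, mul_one, mul_zero, add_zero, zero_add]
    positivity
  · rw [tendsto_pi_nhds]
    exact fun s => (tendsto_specInt_upper hm s).comp ((tendsto_add_mul_I' s).comp hlim)

theorem isModerate_loopFn (hm : 0 < m) : IsModerate (loopFn F e m μ ν) := by
  have hb := continuous_bubble hm
  have hs := continuous_minkSq F
  refine ⟨Measurable.ite (measurableSet_lt measurable_const (continuous_freq F).measurable)
    (Continuous.measurable (by fun_prop)) measurable_const, 2, |loopConst e| * 4, fun k => ?_⟩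
  have h1 : ‖loopFn F e m μ ν k‖ ≤ |loopConst e| * 2 * (2 * ‖k‖ ^ 2) := by
    rw [loopFn]
    split_ifs
    · rw [Complex.norm_real, Real.norm_eq_abs, abs_mul, abs_mul, abs_of_nonneg (bubble_nonneg _ _)]
      have := bubble_le m (minkSq F k)
      have := abs_transverse_le F μ ν k
      gcongr
    · simp only [norm_zero]; positivity
  have h2 : ‖k‖ ^ 2 ≤ (1 + ‖k‖) ^ 2 := by gcongr; linarith
  nlinarith [abs_nonneg (loopConst e)]

theorem norm_bdryFn : ‖bdryFn F m k‖ = ‖specBdry m (minkSq F k)‖ := by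
  rw [bdryFn]
  split_ifs
  · rfl
  · exact RCLike.norm_conj _

theorem isModerate_retFn (hm : 0 < m) : IsModerate (retFn F e m μ ν) := by
  obtain ⟨C, hC, hb⟩ := norm_mul_specBdry_le hm
  have hs := (continuous_minkSq F).measurable
  have hsb : Measurable fun k => specBdry m (minkSq F k) := (measurable_specBdry hm).comp hs
  have hbd : Measurable (bdryFn F m) :=
    Measurable.ite (measurableSet_lt measurable_const (continuous_freq F).measurable) hsb
      (Complex.continuous_conj.measurable.comp hsb)
  have ht := (continuous_transverse F μ ν).measurable
  refine ⟨(measurable_const.mul (Complex.measurable_ofReal.comp ht)).mul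
    ((Complex.measurable_ofReal.comp hs).mul hbd), 4, ‖retConst e‖ * 2 * C, fun k => ?_⟩
  have h1 := abs_transverse_le F μ ν k
  have h2 := hb (minkSq F k)
  have h3 : Real.log (1 + |minkSq F k|) ≤ ‖k‖ ^ 2 := by
    have := Real.log_le_sub_one_of_pos (by positivity : 0 < 1 + |minkSq F k|)
    linarith [abs_minkSq_le F k]
  rw [retFn, norm_mul, norm_mul, norm_mul, norm_bdryFn, ← norm_mul _ (specBdry _ _),
    Complex.norm_real (transverse F μ ν k), Real.norm_eq_abs]
  calc ‖retConst e‖ * |transverse F μ ν k| * ‖(minkSq F k : ℂ) * specBdry m (minkSq F k)‖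
      ≤ ‖retConst e‖ * (2 * ‖k‖ ^ 2) * (C * (1 + ‖k‖ ^ 2)) := by
        gcongr
        exact h2.trans (by gcongr)
    _ = ‖retConst e‖ * 2 * C * (‖k‖ ^ 2 * (1 + ‖k‖ ^ 2)) := by ring
    _ ≤ _ := by
        gcongr
        have := norm_nonneg k
        calc ‖k‖ ^ 2 * (1 + ‖k‖ ^ 2) ≤ (1 + ‖k‖) ^ 2 * (1 + ‖k‖) ^ 2 := by
              gcongr <;> nlinarith
          _ = (1 + ‖k‖) ^ 4 := by ring

/-! ### Holomorphic extension to the forward tube and causal support. -/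

/-- The invariant square of the complex vector `k + ζ η`. -/
def complexSq (F : Form) (η k : E4) (ζ : ℂ) : ℂ :=
  (minkSq F k : ℂ) + 2 * ζ * (minkDot F k η : ℂ) + ζ ^ 2 * (minkSq F η : ℂ)

/-- The holomorphic extension of the retarded distribution to `k + ζ η`. -/
def retExt (F : Form) (e m : ℝ) (μ ν : Fin 4) (η k : E4) (ζ : ℂ) : ℂ :=
  retConst e * (complexSq F η k ζ * (metric F μ ν : ℂ) -
    ((k μ : ℂ) + ζ * (η μ : ℂ)) * ((k ν : ℂ) + ζ * (η ν : ℂ))) *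
    (complexSq F η k ζ * specInt m (complexSq F η k ζ))

theorem complexSq_add (F : Form) (η k : E4) (ζ : ℂ) (c : ℝ) :
    complexSq F η (k + c • η) ζ = complexSq F η k (ζ + c) := by
  have h : minkDot F (k + c • η) η = minkDot F k η + c * minkSq F η := by
    rw [minkDot_add_left, minkDot_smul_left, minkSq]
  simp only [complexSq, minkSq_add_smul, h]
  push_cast
  ring

theorem complexSq_im (F : Form) (η k : E4) (ζ : ℂ) :
    (complexSq F η k ζ).im = 2 * ζ.im * (minkDot F k η + ζ.re * minkSq F η) := by
  simp only [complexSq, sq, Complex.add_im, Complex.mul_im, Complex.ofReal_re, Complex.ofReal_im,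
    Complex.mul_re]
  simp
  ring

/-- The imaginary part of (k + ζη)² is 2 Im ζ times the product of k + Re ζ η with η. If it
vanishes, that real vector is orthogonal to a time-like one, so its square is at most 0, and the
real part, smaller by (Im ζ)²η², is negative. -/
theorem complexSq_mem_cutPlane {F : Form} {m : ℝ} {η : E4} (hη : η ∈ openCone F) (k : E4)
    {ζ : ℂ} (hζ : 0 < ζ.im) : complexSq F η k ζ ∈ cutPlane m := by
  by_cases h : minkDot F k η + ζ.re * minkSq F η = 0
  · right
    have h0 : minkDot F (k + ζ.re • η) η = 0 := by
      rw [minkDot_add_left, minkDot_smul_left]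
      exact h
    have h1 : complexSq F η k ζ = complexSq F η (k + ζ.re • η) (ζ.im * Complex.I) := by
      rw [complexSq_add, add_comm, Complex.re_add_im]
    have h2 := minkSq_nonpos_of_minkDot_eq_zero F hη h0
    have h3 : (complexSq F η k ζ).re = minkSq F (k + ζ.re • η) - ζ.im ^ 2 * minkSq F η := by
      rw [h1, complexSq, h0, mul_pow, Complex.I_sq]
      simp [← Complex.ofReal_pow]
      ring
    have h4 : 0 < ζ.im ^ 2 * minkSq F η := mul_pos (by positivity) hη.1
    rw [h3]
    nlinarith [sq_nonneg m]
  · left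
    rw [complexSq_im]
    positivity

theorem continuous_complexSq (F : Form) (η : E4) :
    Continuous fun p : E4 × ℂ => complexSq F η p.1 p.2 := by
  have h1 := (continuous_minkSq F).comp (continuous_fst (X := E4) (Y := ℂ))
  have h2 : Continuous fun p : E4 × ℂ => minkDot F p.1 η :=
    Continuous.minkDot F continuous_fst continuous_const
  unfold complexSq
  fun_prop

theorem continuousOn_retExt {F : Form} {e m : ℝ} (hm : 0 < m) {μ ν : Fin 4} {η : E4}
    (hη : η ∈ openCone F) :
    ContinuousOn (fun p : E4 × ℂ => retExt F e m μ ν η p.1 p.2) {p | 0 < p.2.im} := by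
  have hz := continuous_complexSq F η
  have h1 : ContinuousOn (fun p : E4 × ℂ => specInt m (complexSq F η p.1 p.2)) {p | 0 < p.2.im} :=
    (differentiableOn_specInt hm).continuousOn.comp hz.continuousOn
      fun p hp => complexSq_mem_cutPlane hη _ hp
  refine ContinuousOn.mul (Continuous.continuousOn ?_) (hz.continuousOn.mul h1)
  fun_prop

theorem differentiableOn_retExt {F : Form} {e m : ℝ} (hm : 0 < m) {μ ν : Fin 4} {η : E4}
    (hη : η ∈ openCone F) (k : E4) : DifferentiableOn ℂ (retExt F e m μ ν η k) {ζ | 0 < ζ.im} := by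
  have hz : Differentiable ℂ (complexSq F η k) := by
    unfold complexSq
    fun_prop
  have h1 : DifferentiableOn ℂ (fun ζ => specInt m (complexSq F η k ζ)) {ζ | 0 < ζ.im} :=
    (differentiableOn_specInt hm).comp hz.differentiableOn
      fun ζ hζ => complexSq_mem_cutPlane hη _ hζ
  refine DifferentiableOn.mul (Differentiable.differentiableOn ?_) (hz.differentiableOn.mul h1)
  fun_prop

theorem retExt_add (F : Form) (e m : ℝ) (μ ν : Fin 4) (η k : E4) (ζ : ℂ) (c : ℝ) :
    retExt F e m μ ν η (k + c • η) ζ = retExt F e m μ ν η k (ζ + c) := by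
  simp only [retExt, complexSq_add, PiLp.add_apply, PiLp.smul_apply, smul_eq_mul]
  push_cast
  ring

theorem norm_complexSq_le (F : Form) (η k : E4) {t : ℝ} (ht : 0 < t) :
    ‖complexSq F η k (t * Complex.I)‖ ≤ (1 + ‖η‖) ^ 2 * (1 + ‖k‖ + t) ^ 2 := by
  have h1 : ‖(minkSq F k : ℂ)‖ ≤ ‖k‖ ^ 2 := by
    simpa using abs_minkSq_le F k
  have h2 : ‖2 * (t * Complex.I) * (minkDot F k η : ℂ)‖ ≤ 2 * t * (‖k‖ * ‖η‖) := by
    simp only [norm_mul, Complex.norm_I, mul_one, Complex.norm_ofNat, Complex.norm_real,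
      Real.norm_eq_abs, abs_of_pos ht]
    have := abs_minkDot_le F k η
    gcongr
  have h3 : ‖(t * Complex.I) ^ 2 * (minkSq F η : ℂ)‖ ≤ t ^ 2 * ‖η‖ ^ 2 := by
    simp only [norm_mul, norm_pow, Complex.norm_I, mul_one, Complex.norm_real, Real.norm_eq_abs,
      abs_of_pos ht]
    have := abs_minkSq_le F η
    gcongr
  have hk := norm_nonneg k
  have hη := norm_nonneg η
  calc _ ≤ ‖k‖ ^ 2 + 2 * t * (‖k‖ * ‖η‖) + t ^ 2 * ‖η‖ ^ 2 :=
        (norm_add₃_le).trans (by gcongr)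
    _ = (‖k‖ + t * ‖η‖) ^ 2 := by ring
    _ ≤ ((1 + ‖η‖) * (1 + ‖k‖ + t)) ^ 2 := by
        gcongr
        nlinarith [mul_nonneg hη hk]
    _ = _ := by ring

theorem norm_apply_add_le (η k : E4) (i : Fin 4) {t : ℝ} (ht : 0 < t) :
    ‖(k i : ℂ) + t * Complex.I * (η i : ℂ)‖ ≤ (1 + ‖η‖) * (1 + ‖k‖ + t) := by
  have hk := norm_nonneg k
  have hη := norm_nonneg η
  refine (norm_add_le _ _).trans ?_
  simp only [norm_mul, Complex.norm_I, mul_one, Complex.norm_real, Real.norm_eq_abs, abs_of_pos ht]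
  have h1 := abs_apply_le_norm k i
  have h2 := mul_le_mul_of_nonneg_left (abs_apply_le_norm η i) ht.le
  nlinarith [mul_nonneg hη hk]

theorem exists_retExt_bound {F : Form} (e : ℝ) {m : ℝ} (hm : 0 < m) (μ ν : Fin 4) {η : E4}
    (hη : η ∈ openCone F) : ∃ C : ℝ, ∀ k (t : ℝ), 0 < t →
      ‖retExt F e m μ ν η k (t * Complex.I)‖ ≤ C * (1 + ‖k‖ + t) ^ 4 := by
  obtain ⟨C, hC, hb⟩ := norm_mul_specInt_le hm
  refine ⟨‖retConst e‖ * (2 * (1 + ‖η‖) ^ 2) * (C * (1 + (1 + ‖η‖) ^ 2)), fun k t ht => ?_⟩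
  have hk := norm_nonneg k
  set X := 1 + ‖k‖ + t with hX
  have hX1 : 1 ≤ X := by linarith
  set A := (1 + ‖η‖) ^ 2 with hA
  have hz := norm_complexSq_le F η k ht
  set z := complexSq F η k (t * Complex.I) with hzdef
  have h1 : ‖z * (metric F μ ν : ℂ) - ((k μ : ℂ) + t * Complex.I * (η μ : ℂ)) *
      ((k ν : ℂ) + t * Complex.I * (η ν : ℂ))‖ ≤ 2 * A * X ^ 2 := by
    refine (norm_sub_le _ _).trans ?_
    rw [norm_mul, norm_mul, Complex.norm_real, Real.norm_eq_abs]
    have h4 := abs_metric_le F μ ν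
    calc _ ≤ A * X ^ 2 * 1 + ((1 + ‖η‖) * X) * ((1 + ‖η‖) * X) := by
          gcongr
          · exact norm_apply_add_le η k μ ht
          · exact norm_apply_add_le η k ν ht
      _ = 2 * A * X ^ 2 := by rw [hA]; ring
  have h2 : ‖z * specInt m z‖ ≤ C * (1 + A) * X ^ 2 := by
    refine (hb z (complexSq_mem_cutPlane hη k (by simpa using ht))).trans ?_
    have := Real.log_le_sub_one_of_pos (by positivity : 0 < 1 + ‖z‖)
    rw [mul_assoc]
    refine mul_le_mul_of_nonneg_left ?_ hC
    nlinarith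
  rw [retExt, norm_mul, norm_mul]
  calc _ ≤ ‖retConst e‖ * (2 * A * X ^ 2) * (C * (1 + A) * X ^ 2) := by gcongr
    _ = _ := by ring

/-- Along ζ = it the imaginary part is 2t k · η. For time-like k this has the sign of the frequency,
which selects the side of the cut independently of η; below the threshold there is no cut. -/
theorem tendsto_specInt_complexSq {F : Form} {m : ℝ} (hm : 0 < m) {η : E4} (hη : η ∈ openCone F)
    (k : E4) : Tendsto (fun t : ℝ => specInt m (complexSq F η k (t * Complex.I))) (𝓝[>] 0)
      (𝓝 (bdryFn F m k)) := by
  have h0 : Tendsto (fun t : ℝ => complexSq F η k (t * Complex.I)) (𝓝[>] 0) (𝓝 (minkSq F k : ℂ)) := by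
    have h : Continuous fun t : ℝ => complexSq F η k (t * Complex.I) := by
      unfold complexSq
      fun_prop
    have := (h.tendsto 0).mono_left (nhdsWithin_le_nhds (s := Set.Ioi 0))
    simpa [complexSq] using this
  have him : ∀ t : ℝ, (complexSq F η k (t * Complex.I)).im = 2 * t * minkDot F k η := by
    intro t
    rw [complexSq_im]
    simp
  rcases lt_or_ge (minkSq F k) (4 * m ^ 2) with h | h
  · have h1 : bdryFn F m k = specInt m (minkSq F k) := by
      rw [bdryFn, specBdry, if_pos h, ← specInt_conj, Complex.conj_ofReal, ite_self]
    rw [h1]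
    exact (continuousAt_specInt hm (ofReal_mem_cutPlane h)).tendsto.comp h0
  · have hk : 0 < minkSq F k := lt_of_lt_of_le (by positivity) h
    rcases (freq_ne_zero F hk).lt_or_gt with hf | hf
    · have hd := minkDot_neg F hk hf hη
      rw [bdryFn, if_neg (by linarith)]
      have h1 : Tendsto (fun t : ℝ => (starRingEnd ℂ) (complexSq F η k (t * Complex.I))) (𝓝[>] 0)
          (𝓝[{z | 0 < z.im}] (minkSq F k : ℂ)) := by
        refine tendsto_nhdsWithin_iff.2 ⟨?_, ?_⟩
        · simpa [Function.comp_def] using (Complex.continuous_conj.tendsto _).comp h0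
        · filter_upwards [self_mem_nhdsWithin] with t ht
          simp only [Complex.conj_im, him]
          have ht : 0 < t := ht
          nlinarith
      refine ((Complex.continuous_conj.tendsto _).comp ((tendsto_specInt_upper hm _).comp h1)).congr
        fun t => ?_
      simp [specInt_conj]
    · have hd := minkDot_pos F ⟨hk, hf⟩ hη
      rw [bdryFn, if_pos hf]
      refine (tendsto_specInt_upper hm _).comp (tendsto_nhdsWithin_iff.2 ⟨h0, ?_⟩)
      filter_upwards [self_mem_nhdsWithin] with t ht
      have ht : 0 < t := ht
      simp only [him]
      positivity

theorem tendsto_retExt {F : Form} (e : ℝ) {m : ℝ} (hm : 0 < m) (μ ν : Fin 4) {η : E4}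
    (hη : η ∈ openCone F) (k : E4) :
    Tendsto (fun t : ℝ => retExt F e m μ ν η k (t * Complex.I)) (𝓝[>] 0)
      (𝓝 (retFn F e m μ ν k)) := by
  have h0 : Tendsto (fun t : ℝ => complexSq F η k (t * Complex.I)) (𝓝[>] 0) (𝓝 (minkSq F k : ℂ)) := by
    have h : Continuous fun t : ℝ => complexSq F η k (t * Complex.I) := by
      unfold complexSq
      fun_prop
    have := (h.tendsto 0).mono_left (nhdsWithin_le_nhds (s := Set.Ioi 0))
    simpa [complexSq] using this
  have h1 : ∀ i, Tendsto (fun t : ℝ => (k i : ℂ) + t * Complex.I * (η i : ℂ)) (𝓝[>] 0)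
      (𝓝 (k i : ℂ)) := by
    intro i
    have h : Continuous fun t : ℝ => (k i : ℂ) + t * Complex.I * (η i : ℂ) := by fun_prop
    simpa using (h.tendsto 0).mono_left (nhdsWithin_le_nhds (s := Set.Ioi 0))
  have h2 := ((((h0.mul_const (metric F μ ν : ℂ)).sub ((h1 μ).mul (h1 ν))).const_mul
    (retConst e))).mul (h0.mul (tendsto_specInt_complexSq hm hη k))
  unfold retFn transverse
  push_cast
  exact h2

/-- The retarded distribution. -/
def retDist (F : Form) (e : ℝ) {m : ℝ} (hm : 0 < m) : TensorDist :=
  fun μ ν => (isModerate_retFn F e μ ν hm).toDist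

/-- The fermion loop as a distribution. -/
def loopDist (F : Form) (e : ℝ) {m : ℝ} (hm : 0 < m) : TensorDist :=
  fun μ ν => (isModerate_loopFn F e μ ν hm).toDist

theorem isModerate_causalFn (F : Form) (e : ℝ) {m : ℝ} (hm : 0 < m) (μ ν : Fin 4) :
    IsModerate (causalFn F e m μ ν) := by
  have h := (isModerate_loopFn F e μ ν hm).sub (isModerate_loopFn F e ν μ hm).comp_neg
  simpa only [loopFn_sub_loopFn_neg] using h

theorem causalDist_loopDist (F : Form) (e : ℝ) {m : ℝ} (hm : 0 < m) (μ ν : Fin 4) :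
    causalDist (loopDist F e hm) μ ν = (isModerate_causalFn F e hm μ ν).toDist := by
  have h : causalDist (loopDist F e hm) μ ν =
      loopDist F e hm μ ν - reflect (loopDist F e hm ν μ) := by
    change -reflect (loopDist F e hm ν μ) - -loopDist F e hm μ ν = _
    abel
  rw [h, loopDist, loopDist, IsModerate.reflect_toDist, IsModerate.toDist_sub]
  exact IsModerate.toDist_congr _ _ fun k => loopFn_sub_loopFn_neg F e μ ν k

/-- The advanced part is the reflection of the retarded one, so its support needs no separate
argument. -/
theorem retDist_sub_causalDist (F : Form) (e : ℝ) {m : ℝ} (hm : 0 < m) :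
    retDist F e hm - causalDist (loopDist F e hm) = fun μ ν => reflect (retDist F e hm μ ν) := by
  funext μ ν
  change retDist F e hm μ ν - causalDist (loopDist F e hm) μ ν = _
  rw [causalDist_loopDist, retDist, IsModerate.reflect_toDist, IsModerate.toDist_sub]
  refine IsModerate.toDist_congr _ _ fun k => ?_
  rw [← retFn_sub_retFn_neg F e μ ν k hm]
  ring

/-- A point outside the forward cone lies in a half-space η · y < 0 with η in the open cone, and the
boundary value from the direction η vanishes there. Locality of vanishing combines the half-spaces.
-/
theorem supportedIn_retDist (F : Form) (e : ℝ) {m : ℝ} (hm : 0 < m) :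
    SupportedIn F (retDist F e hm) (forwardCone F) := by
  intro μ ν
  refine isVanishingOn_of_locally fun y hy => ?_
  obtain ⟨η, hη, hηy⟩ := exists_minkDot_neg F hy
  have hV : IsOpen {y | minkDot F η y < 0} :=
    isOpen_lt (Continuous.minkDot F continuous_const continuous_id) continuous_const
  refine ⟨_, hV.mem_nhds hηy, fun φ hφ hs => ?_⟩
  obtain ⟨C, hC⟩ := exists_retExt_bound e hm μ ν hη
  exact integral_eq_zero_of_tube F hφ hs (fun k => differentiableOn_retExt hm hη k)
    (fun k ζ c => retExt_add F e m μ ν η k ζ c) (continuousOn_retExt hm hη) hC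
    (fun k => tendsto_retExt e hm μ ν hη k)

theorem supportedIn_retDist_sub (F : Form) (e : ℝ) {m : ℝ} (hm : 0 < m) :
    SupportedIn F (retDist F e hm - causalDist (loopDist F e hm)) (backwardCone F) := by
  rw [retDist_sub_causalDist]
  exact (supportedIn_retDist F e hm).reflect

theorem supportedIn_causalDist (F : Form) (e : ℝ) {m : ℝ} (hm : 0 < m) :
    SupportedIn F (causalDist (loopDist F e hm)) (forwardCone F ∪ backwardCone F) := by
  intro μ ν
  have h1 := supportedIn_retDist F e hm μ ν
  have h2 := supportedIn_retDist_sub F e hm μ ν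
  have h3 : positionSpace F (causalDist (loopDist F e hm) μ ν) =
      positionSpace F (retDist F e hm μ ν) -
        positionSpace F ((retDist F e hm - causalDist (loopDist F e hm)) μ ν) := by
    rw [← positionSpace_sub, Pi.sub_apply, Pi.sub_apply, sub_sub_cancel]
  rw [h3, Set.compl_union]
  exact Distribution.isVanishingOn_sub (h1.mono Set.inter_subset_left)
    (h2.mono Set.inter_subset_right)

/-! ### Normalization at the origin, ultraviolet asymptotics, singular order. -/

theorem contDiff_minkSq (F : Form) {n : WithTop ℕ∞} : ContDiff ℝ n (minkSq F) := by
  have h : minkSq F = fun k => inner ℝ ((lowerEquiv F).toContinuousLinearEquiv k) k := by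
    ext k
    exact minkDot_eq_inner F k k
  rw [h]
  exact (ContinuousLinearEquiv.contDiff _).inner ℝ contDiff_id

/-- In every Leibniz term of order at most two, one of the factors is differentiated at most once,
and both factors vanish together with their first derivatives. -/
theorem iteratedFDeriv_mul_eq_zero {u v : E4 → ℂ} {U : Set E4} (hU : IsOpen U) (h0 : (0 : E4) ∈ U)
    (hu : ContDiffOn ℝ 2 u U) (hv : ContDiffOn ℝ 2 v U)
    (hu0 : u =O[𝓝 0] fun k : E4 => ‖k - 0‖ ^ 2) (hv0 : v =O[𝓝 0] fun k : E4 => ‖k - 0‖ ^ 2)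
    {j : ℕ} (hj : j ≤ 2) : iteratedFDeriv ℝ j (fun k => u k * v k) 0 = 0 := by
  have hz : ∀ {w : E4 → ℂ}, w =O[𝓝 0] (fun k : E4 => ‖k - 0‖ ^ 2) → ∀ i ≤ 1,
      ‖iteratedFDerivWithin ℝ i w U 0‖ = 0 := by
    intro w hw i hi
    rw [iteratedFDerivWithin_of_isOpen i hU h0]
    interval_cases i
    · rw [norm_iteratedFDeriv_zero, norm_eq_zero]
      exact hw.eq_zero_of_norm_pow two_ne_zero
    · rw [norm_iteratedFDeriv_one, (hw.hasFDerivAt one_lt_two).fderiv, norm_zero]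
  rw [← norm_eq_zero, ← iteratedFDerivWithin_of_isOpen j hU h0]
  refine le_antisymm ((norm_iteratedFDerivWithin_mul_le hu hv hU.uniqueDiffOn h0
    (by exact_mod_cast hj)).trans (le_of_eq (Finset.sum_eq_zero fun i hi => ?_))) (norm_nonneg _)
  rw [Finset.mem_range] at hi
  rcases le_or_gt i 1 with h | h
  · rw [hz hu0 i h]
    ring
  · rw [hz hv0 (j - i) (by omega)]
    ring

/-- Below the threshold the function is the product of k²h − kk and k² I(k²), both O(‖k‖²) and with
I regular at 0. This double zero makes it the central solution. -/
theorem vanishesToOrder_retDist (F : Form) (e : ℝ) {m : ℝ} (hm : 0 < m) (μ ν : Fin 4) :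
    VanishesToOrder (retDist F e hm μ ν) 2 := by
  have hU : IsOpen {k | minkSq F k < 4 * m ^ 2} := isOpen_lt (continuous_minkSq F) continuous_const
  have h0 : (0 : E4) ∈ {k | minkSq F k < 4 * m ^ 2} := by
    simp only [Set.mem_ofPred_eq, minkSq, minkDot_eq_inner, inner_zero_right]
    positivity
  have hs : ContDiff ℝ 2 fun k => (minkSq F k : ℂ) :=
    Complex.ofRealCLM.contDiff.comp (contDiff_minkSq F)
  have hu : ContDiff ℝ 2 fun k => retConst e * (transverse F μ ν k : ℂ) := by
    have h1 := contDiff_minkSq F (n := 2)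
    have h2 : ContDiff ℝ 2 fun k => minkSq F k * metric F μ ν - k μ * k ν := by fun_prop
    exact contDiff_const.mul (Complex.ofRealCLM.contDiff.comp h2)
  have hsp : ContDiffOn ℝ 2 (specInt m) (cutPlane m) :=
    ((differentiableOn_specInt hm).contDiffOn (isOpen_cutPlane m)).restrict_scalars ℝ
  have hI : ContDiffOn ℝ 2 (fun k => specInt m (minkSq F k)) {k | minkSq F k < 4 * m ^ 2} :=
    hsp.comp hs.contDiffOn fun k hk => ofReal_mem_cutPlane hk
  refine ⟨_, fun k => (retConst e * (transverse F μ ν k : ℂ)) *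
    ((minkSq F k : ℂ) * specInt m (minkSq F k)), hU, h0, hu.contDiffOn.mul (hs.contDiffOn.mul hI),
    fun j hj => iteratedFDeriv_mul_eq_zero hU h0 hu.contDiffOn (hs.contDiffOn.mul hI) ?_ ?_ hj,
    fun φ hφ hφU => ?_⟩
  · refine Asymptotics.IsBigO.of_bound (‖retConst e‖ * 2) (Eventually.of_forall fun k => ?_)
    rw [norm_mul, Complex.norm_real, Real.norm_eq_abs, sub_zero, norm_pow, norm_norm, mul_assoc]
    gcongr
    exact abs_transverse_le F μ ν k
  · have h1 : (fun k => specInt m (minkSq F k)) =O[𝓝 0] fun _ => (1 : ℝ) :=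
      (hI.continuousOn.continuousAt (hU.mem_nhds h0)).isBigO_one ℝ
    have h2 : (fun k => (minkSq F k : ℂ)) =O[𝓝 0] fun k : E4 => ‖k - 0‖ ^ 2 := by
      refine Asymptotics.IsBigO.of_bound 1 (Eventually.of_forall fun k => ?_)
      rw [Complex.norm_real, Real.norm_eq_abs, sub_zero, norm_pow, norm_norm, one_mul]
      exact abs_minkSq_le F k
    simpa using h2.mul h1
  · rw [retDist, IsModerate.toDist_apply]
    refine integral_congr_ae (Eventually.of_forall fun k => ?_)
    by_cases hk : k ∈ tsupport φ
    · have h1 : minkSq F k < 4 * m ^ 2 := hφU hk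
      have h2 : bdryFn F m k = specInt m (minkSq F k) := by
        rw [bdryFn, specBdry, if_pos h1, ← specInt_conj, Complex.conj_ofReal, ite_self]
      simp only [retFn, h2]
    · simp [image_eq_zero_of_notMem_tsupport hk]

/-- At infinity w → 1 and ξ = −(4m²/x)/(w + 1)², so log|ξ| is asymptotic to −log|x| while the
argument stays bounded. The filter `cobounded` treats x → ∞ and x → −∞ together. -/
theorem tendsto_mul_specBdry_div_log {m : ℝ} (hm : 0 < m) :
    Tendsto (fun x : ℝ => (x : ℂ) * specBdry m x / (Real.log |x| : ℝ)) (Bornology.cobounded ℝ)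
      (𝓝 (-1)) := by
  have habs : Tendsto (fun x : ℝ => |x|) (Bornology.cobounded ℝ) atTop := tendsto_norm_cobounded_atTop
  have hlog : Tendsto (fun x : ℝ => Real.log |x|) (Bornology.cobounded ℝ) atTop :=
    Real.tendsto_log_atTop.comp habs
  have hloginv : Tendsto (fun x : ℝ => (Real.log |x|)⁻¹) (Bornology.cobounded ℝ) (𝓝 0) :=
    tendsto_inv_atTop_zero.comp hlog
  have hloginvc : Tendsto (fun x : ℝ => (((Real.log |x|)⁻¹ : ℝ) : ℂ)) (Bornology.cobounded ℝ) (𝓝 0) := by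
    simpa [Function.comp_def] using (Complex.continuous_ofReal.tendsto 0).comp hloginv
  have hinv : Tendsto (fun x : ℝ => (x : ℂ)⁻¹) (Bornology.cobounded ℝ) (𝓝 0) := by
    have := (Complex.continuous_ofReal.tendsto 0).comp (tendsto_inv₀_cobounded (α := ℝ))
    simpa [Function.comp_def] using this
  have hw : Tendsto (fun x : ℝ => rootFn m x) (Bornology.cobounded ℝ) (𝓝 1) := by
    have h1 : Tendsto (fun x : ℝ => 1 - 4 * (m : ℂ) ^ 2 / (x : ℂ)) (Bornology.cobounded ℝ) (𝓝 1) := by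
      simpa [div_eq_mul_inv] using (hinv.const_mul (4 * (m : ℂ) ^ 2)).const_sub 1
    have h2 : ContinuousAt (fun z : ℂ => z ^ (1 / 2 : ℂ)) 1 :=
      continuousAt_id.cpow continuousAt_const (by simp)
    simpa [rootFn, Function.comp_def] using h2.tendsto.comp h1
  set q : ℝ → ℂ := fun x => (rootFn m x - 1) / (rootFn m x + 1) with hq
  have hL : Tendsto (fun x : ℝ => Complex.log (q x) * (((Real.log |x|)⁻¹ : ℝ) : ℂ))
      (Bornology.cobounded ℝ) (𝓝 (-1)) := by
    have h1 : Tendsto (fun x : ℝ => Real.log ‖rootFn m x + 1‖) (Bornology.cobounded ℝ)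
        (𝓝 (Real.log 2)) := by
      have h := ((hw.add_const 1).norm).log (by norm_num)
      rw [show ‖(1 : ℂ) + 1‖ = 2 by norm_num] at h
      exact h
    have h2 : Tendsto (fun x : ℝ => (Real.log (4 * m ^ 2) - 2 * Real.log ‖rootFn m x + 1‖) *
        (Real.log |x|)⁻¹ - 1) (Bornology.cobounded ℝ) (𝓝 (-1)) := by
      simpa using (((h1.const_mul 2).const_sub (Real.log (4 * m ^ 2))).mul hloginv).sub_const 1
    have h3 : Tendsto (fun x : ℝ => Complex.arg (q x) * (Real.log |x|)⁻¹) (Bornology.cobounded ℝ)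
        (𝓝 0) := by
      refine squeeze_zero_norm (a := fun x => Real.pi * |(Real.log |x|)⁻¹|) (fun x => ?_) ?_
      · rw [norm_mul, Real.norm_eq_abs, Real.norm_eq_abs]
        exact mul_le_mul_of_nonneg_right (Complex.abs_arg_le_pi _) (abs_nonneg _)
      · simpa using hloginv.abs.const_mul Real.pi
    have h4 := ((Complex.continuous_ofReal.tendsto _).comp h2).add
      (((Complex.continuous_ofReal.tendsto _).comp h3).mul_const Complex.I)
    simp only [Complex.ofReal_zero, zero_mul, add_zero, Complex.ofReal_neg, Complex.ofReal_one] at h4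
    refine h4.congr' ?_
    filter_upwards [habs.eventually_gt_atTop 0, hlog.eventually_gt_atTop 0] with x hx hlx
    have hx0 : x ≠ 0 := abs_pos.1 hx
    have hxc : (x : ℂ) ≠ 0 := by exact_mod_cast hx0
    have hp := rootFn_add_one_ne_zero m (x : ℂ)
    have hqn : ‖q x‖ = 4 * m ^ 2 / |x| / ‖rootFn m x + 1‖ ^ 2 := by
      have h5 : q x = -(((4 * m ^ 2 : ℝ) : ℂ) / (x : ℂ)) / (rootFn m x + 1) ^ 2 := by
        have := rootFn_sq m (x : ℂ)
        rw [hq]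
        field_simp at this ⊢
        push_cast
        linear_combination this
      rw [h5, norm_div, norm_neg, norm_div, norm_pow, Complex.norm_real, Complex.norm_real,
        Real.norm_eq_abs, Real.norm_eq_abs, abs_of_pos (by positivity : 0 < 4 * m ^ 2)]
    have hln : Real.log ‖q x‖ =
        Real.log (4 * m ^ 2) - Real.log |x| - 2 * Real.log ‖rootFn m x + 1‖ := by
      have hn : ‖rootFn m x + 1‖ ≠ 0 := norm_ne_zero_iff.2 hp
      rw [hqn, Real.log_div (by positivity) (by positivity), Real.log_div (by positivity) hx.ne',
        Real.log_pow]
      norm_num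
    simp only [Function.comp_apply, Complex.log, hln]
    have : (Real.log |x| : ℂ) ≠ 0 := by exact_mod_cast hlx.ne'
    push_cast
    field_simp
    ring
  have h1 : Tendsto (fun x : ℝ => (1 + 2 * (m : ℂ) ^ 2 * (x : ℂ)⁻¹) * (rootFn m x *
      (Complex.log (q x) * (((Real.log |x|)⁻¹ : ℝ) : ℂ))) +
      (4 * (m : ℂ) ^ 2 * (x : ℂ)⁻¹ + 5 / 3) * (((Real.log |x|)⁻¹ : ℝ) : ℂ))
      (Bornology.cobounded ℝ) (𝓝 (-1)) := by
    simpa using (((hinv.const_mul (2 * (m : ℂ) ^ 2)).const_add 1).mul (hw.mul hL)).add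
      (((hinv.const_mul (4 * (m : ℂ) ^ 2)).add_const (5 / 3)).mul hloginvc)
  refine h1.congr' ?_
  filter_upwards [habs.eventually_gt_atTop 0, hlog.eventually_gt_atTop 0] with x hx hlx
  have hx0 : x ≠ 0 := abs_pos.1 hx
  have hxc : (x : ℂ) ≠ 0 := by exact_mod_cast hx0
  have h2 := sq_mul_specBdry hm hx0
  have h3 : (x : ℂ) * specBdry m x = (x : ℂ) ^ 2 * specBdry m x / x := by field_simp
  have hlc : (Real.log |x| : ℂ) ≠ 0 := by exact_mod_cast hlx.ne'
  rw [h3, h2, closedForm]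
  push_cast
  simp only [hq]
  field_simp
  ring

theorem tendsto_abs_log : Tendsto (fun α : ℝ => |Real.log α|) (𝓝[>] 0) atTop :=
  tendsto_abs_atBot_atTop.comp Real.tendsto_log_nhdsGT_zero

theorem tendsto_inv_sq_cobounded {s : ℝ} (hs : s ≠ 0) :
    Tendsto (fun α : ℝ => (α⁻¹) ^ 2 * s) (𝓝[>] 0) (Bornology.cobounded ℝ) := by
  rw [← tendsto_norm_atTop_iff_cobounded]
  have h : Tendsto (fun α : ℝ => (α⁻¹) ^ 2 * |s|) (𝓝[>] 0) atTop :=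
    ((tendsto_pow_atTop two_ne_zero).comp tendsto_inv_nhdsGT_zero).atTop_mul_const (abs_pos.2 hs)
  refine h.congr fun α => ?_
  rw [norm_mul, norm_pow, Real.norm_eq_abs, Real.norm_eq_abs, sq_abs]

/-- The logarithm of |α⁻²s| is asymptotically 2|log α|, whence the limit −2. The added 1 keeps the
denominator positive at α = 1. -/
theorem tendsto_specBdry_rescaled {m : ℝ} (hm : 0 < m) {s : ℝ} (hs : s ≠ 0) :
    Tendsto (fun α : ℝ => (((α⁻¹) ^ 2 * s : ℝ) : ℂ) * specBdry m ((α⁻¹) ^ 2 * s) /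
      ((1 + |Real.log α| : ℝ) : ℂ)) (𝓝[>] 0) (𝓝 (-2)) := by
  have h1 := (tendsto_mul_specBdry_div_log hm).comp (tendsto_inv_sq_cobounded hs)
  have hu : Tendsto (fun α : ℝ => (1 + |Real.log α|)⁻¹) (𝓝[>] 0) (𝓝 0) :=
    tendsto_inv_atTop_zero.comp (tendsto_atTop_add_const_left _ _ tendsto_abs_log)
  have h2 : Tendsto (fun α : ℝ => Real.log |(α⁻¹) ^ 2 * s| / (1 + |Real.log α|)) (𝓝[>] 0) (𝓝 2) := by
    have h3 : Tendsto (fun α : ℝ => 2 + (Real.log |s| - 2) * (1 + |Real.log α|)⁻¹) (𝓝[>] 0) (𝓝 2) := by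
      simpa using (hu.const_mul (Real.log |s| - 2)).const_add 2
    refine h3.congr' ?_
    filter_upwards [Ioo_mem_nhdsGT one_pos] with α hα
    have hl : |Real.log α| = -Real.log α := abs_of_neg (Real.log_neg hα.1 hα.2)
    have hpos : 0 < 1 - Real.log α := by linarith [Real.log_neg hα.1 hα.2]
    have hpos' : 1 + -Real.log α ≠ 0 := by linarith
    rw [abs_mul, abs_of_pos (by have := hα.1; positivity : 0 < α⁻¹ ^ 2),
      Real.log_mul (by have := hα.1; positivity) (abs_pos.2 hs).ne', Real.log_pow, Real.log_inv, hl]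
    push_cast
    field_simp
    ring
  have h4 := h1.mul ((Complex.continuous_ofReal.tendsto _).comp h2)
  have h5 : (-1 : ℂ) * ((2 : ℝ) : ℂ) = -2 := by norm_num
  rw [h5] at h4
  refine h4.congr' ?_
  have h6 := (Real.tendsto_log_atTop.comp tendsto_norm_cobounded_atTop).comp
    (tendsto_inv_sq_cobounded hs)
  filter_upwards [h6.eventually_gt_atTop 0] with α hα
  have h7 : (Real.log |(α⁻¹) ^ 2 * s| : ℂ) ≠ 0 := by exact_mod_cast (ne_of_gt hα)
  simp only [Function.comp_apply]
  rw [Complex.ofReal_div, div_mul_div_cancel₀ h7]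

/-- The logarithm is slowly varying, so dividing α² by 1 + |log α| does not change the index 2. -/
theorem tendsto_one_add_log_ratio {a : ℝ} (ha : 0 < a) :
    Tendsto (fun α : ℝ => (1 + |Real.log α|) / (1 + |Real.log (a * α)|)) (𝓝[>] 0) (𝓝 1) := by
  have hscale : Tendsto (fun α : ℝ => a * α) (𝓝[>] 0) (𝓝[>] 0) := by
    refine tendsto_nhdsWithin_iff.2 ⟨?_, ?_⟩
    · simpa using ((continuous_const_mul a).tendsto 0).mono_left nhdsWithin_le_nhds
    · filter_upwards [self_mem_nhdsWithin] with α hα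
      exact mul_pos ha hα
  have h1 : Tendsto (fun α : ℝ => (1 + |Real.log (a * α)|)⁻¹) (𝓝[>] 0) (𝓝 0) :=
    tendsto_inv_atTop_zero.comp
      (tendsto_atTop_add_const_left _ _ (tendsto_abs_log.comp hscale))
  rw [tendsto_iff_norm_sub_tendsto_zero]
  refine squeeze_zero' (Eventually.of_forall fun α => norm_nonneg _) ?_
    (by simpa using h1.const_mul |Real.log a|)
  filter_upwards [self_mem_nhdsWithin] with α hα
  have hα : 0 < α := hα
  have hpos : 0 < 1 + |Real.log (a * α)| := by positivity
  rw [div_sub_one hpos.ne', norm_div, Real.norm_of_nonneg hpos.le, div_eq_mul_inv]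
  refine mul_le_mul_of_nonneg_right ?_ (by positivity)
  rw [add_sub_add_left_eq_sub, Real.norm_eq_abs]
  refine (abs_abs_sub_abs_le_abs_sub _ _).trans ?_
  rw [Real.log_mul ha.ne' hα.ne', sub_add_cancel_right, abs_neg]

theorem isOpen_openCone (F : Form) : IsOpen (openCone F) :=
  (isOpen_lt continuous_const (continuous_minkSq F)).inter
    (isOpen_lt continuous_const (continuous_freq F))

theorem IsModerate.toDist_ne_zero {f : E4 → ℂ} (hf : IsModerate f) (F : Form)
    (h : ∀ k ∈ openCone F, f k ≠ 0) : hf.toDist ≠ 0 := by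
  intro h0
  have h1 := hf.eq_zero_of_toDist_eq_zero h0
  have h2 := (isOpen_openCone F).measure_pos volume (exists_mem_openCone F)
  refine h2.ne' (measure_mono_null (fun k hk => ?_) h1)
  exact h k hk

theorem transverse_one_one_ne_zero {F : Form} {k : E4} (hk : k ∈ openCone F) :
    transverse F 1 1 k ≠ 0 := by
  have h1 : metric F 1 1 = -1 := by cases F <;> rfl
  have h2 := hk.1
  rw [transverse, h1]
  nlinarith [sq_nonneg (k 1)]

theorem retConst_ne_zero {e : ℝ} (he : e ≠ 0) : retConst e ≠ 0 := by
  have : e ^ 2 / 3 / (2 * Real.pi) ^ 4 ≠ 0 := by positivity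
  rw [retConst]
  exact mul_ne_zero (neg_ne_zero.2 Complex.I_ne_zero) (by exact_mod_cast this)

theorem tendsto_retFn_rescaled (F : Form) (e : ℝ) {m : ℝ} (hm : 0 < m) (μ ν : Fin 4) {k : E4}
    (hk : minkSq F k ≠ 0) :
    Tendsto (fun α : ℝ => ((α ^ 2 / (1 + |Real.log α|) : ℝ) : ℂ) * retFn F e m μ ν (α⁻¹ • k))
      (𝓝[>] 0) (𝓝 (-2 * retConst e * (transverse F μ ν k : ℂ))) := by
  have h1 := tendsto_specBdry_rescaled hm hk
  have h2 : Tendsto (fun α : ℝ => (((α⁻¹) ^ 2 * minkSq F k : ℝ) : ℂ) *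
      (if 0 < freq F k then specBdry m ((α⁻¹) ^ 2 * minkSq F k) else
        (starRingEnd ℂ) (specBdry m ((α⁻¹) ^ 2 * minkSq F k))) /
      ((1 + |Real.log α| : ℝ) : ℂ)) (𝓝[>] 0) (𝓝 (-2)) := by
    split_ifs
    · exact h1
    · have h3 := (Complex.continuous_conj.tendsto _).comp h1
      simp only [map_neg, Complex.conj_ofNat] at h3
      refine h3.congr fun α => ?_
      simp only [Function.comp_apply, map_div₀, map_mul, Complex.conj_ofReal]
  have h4 := h2.const_mul (retConst e * (transverse F μ ν k : ℂ))
  rw [show retConst e * (transverse F μ ν k : ℂ) * -2 = -2 * retConst e * (transverse F μ ν k : ℂ)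
    by ring] at h4
  refine h4.congr' ?_
  filter_upwards [self_mem_nhdsWithin] with α hα
  have hα : 0 < α := hα
  have hαc : (α : ℂ) ≠ 0 := by exact_mod_cast hα.ne'
  have h5 : (0 < freq F (α⁻¹ • k)) ↔ 0 < freq F k := by
    rw [freq_smul]
    exact mul_pos_iff_of_pos_left (inv_pos.2 hα)
  simp only [retFn, bdryFn, minkSq_smul, transverse_smul, h5]
  push_cast
  field_simp

/-- The splitting grows like ‖k‖² log‖k‖, so its power-counting function needs the logarithm. The
limit is the polynomial −2 · `retConst` · (k²h − kk), the same for both frequencies since the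
imaginary part is of lower order. -/
theorem hasSingularOrder_retDist (F : Form) {e : ℝ} (he : e ≠ 0) {m : ℝ} (hm : 0 < m) :
    HasSingularOrder (retDist F e hm) 2 := by
  obtain ⟨C, hC, hb⟩ := norm_mul_specBdry_le hm
  have hg : ∀ μ ν, IsModerate fun k => -2 * retConst e * (transverse F μ ν k : ℂ) := by
    intro μ ν
    refine ⟨Continuous.measurable (by fun_prop), 2, ‖-2 * retConst e‖ * 2, fun k => ?_⟩
    rw [norm_mul, Complex.norm_real, Real.norm_eq_abs, mul_assoc]
    have := norm_nonneg k
    refine mul_le_mul_of_nonneg_left ((abs_transverse_le F μ ν k).trans ?_) (norm_nonneg _)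
    gcongr
    linarith
  refine ⟨fun α => α ^ 2 / (1 + |Real.log α|), fun μ ν => (hg μ ν).toDist, ?_, ?_, ?_, ?_, ?_⟩
  · refine ContinuousOn.div (by fun_prop) ?_ fun α _ => by positivity
    exact continuousOn_const.add
      (Real.continuousOn_log.mono fun x (hx : 0 < x) => hx.ne').abs
  · intro α hα
    positivity
  · intro a ha
    have h := (tendsto_one_add_log_ratio ha).const_mul (a ^ 2)
    rw [mul_one] at h
    rw [Real.rpow_two]
    refine h.congr' ?_
    filter_upwards [self_mem_nhdsWithin] with α hα
    have hα : 0 < α := hα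
    have h1 : 1 + |Real.log (a * α)| ≠ 0 := by positivity
    field_simp
  · intro h
    refine (hg 1 1).toDist_ne_zero F (fun k hk => ?_) (congrFun (congrFun h 1) 1)
    have := transverse_one_one_ne_zero hk
    exact mul_ne_zero (mul_ne_zero (by norm_num) (retConst_ne_zero he)) (by exact_mod_cast this)
  · intro μ ν φ
    refine IsModerate.tendsto_rescaled _ _ (N := 4) (C := ‖retConst e‖ * 2 * (C * 3)) ?_ ?_ φ
    · filter_upwards [Ioo_mem_nhdsGT one_pos] with α hα k
      have hα0 := hα.1
      set ℓ := |Real.log α| with hℓ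
      have hl : ℓ = -Real.log α := abs_of_neg (Real.log_neg hα.1 hα.2)
      have hℓ0 : 0 ≤ ℓ := abs_nonneg _
      have h1 := abs_transverse_le F μ ν k
      have h2 := hb ((α⁻¹) ^ 2 * minkSq F k)
      have hlog : Real.log (1 + |(α⁻¹) ^ 2 * minkSq F k|) ≤ ‖k‖ ^ 2 + 2 * ℓ := by
        have h3 : 1 + |(α⁻¹) ^ 2 * minkSq F k| ≤ (α⁻¹) ^ 2 * (1 + |minkSq F k|) := by
          rw [abs_mul, abs_of_pos (by positivity : 0 < α⁻¹ ^ 2), mul_add]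
          have : 1 ≤ α⁻¹ ^ 2 := one_le_pow₀ ((one_le_inv₀ hα0).2 hα.2.le)
          linarith
        refine (Real.log_le_log (by positivity) h3).trans ?_
        rw [Real.log_mul (by positivity) (by positivity), Real.log_pow, Real.log_inv, hl]
        have := Real.log_le_sub_one_of_pos (by positivity : 0 < 1 + |minkSq F k|)
        have := abs_minkSq_le F k
        push_cast
        linarith
      have hk := norm_nonneg k
      have h4 : ‖(((α⁻¹) ^ 2 * minkSq F k : ℝ) : ℂ) * specBdry m ((α⁻¹) ^ 2 * minkSq F k)‖ ≤
          C * 3 * (1 + ‖k‖) ^ 2 * (1 + ℓ) := by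
        refine h2.trans ?_
        rw [mul_assoc, mul_assoc]
        refine mul_le_mul_of_nonneg_left ?_ hC
        have : 0 ≤ ‖k‖ * ℓ := by positivity
        nlinarith [mul_nonneg (sq_nonneg ‖k‖) hℓ0]
      have h5 : ‖((α ^ 2 / (1 + ℓ) : ℝ) : ℂ) * retFn F e m μ ν (α⁻¹ • k)‖ =
          ‖retConst e‖ * |transverse F μ ν k| * (‖(((α⁻¹) ^ 2 * minkSq F k : ℝ) : ℂ) *
            specBdry m ((α⁻¹) ^ 2 * minkSq F k)‖ / (1 + ℓ)) := by
        rw [retFn, norm_mul, norm_mul, norm_mul, norm_mul, norm_bdryFn, minkSq_smul,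
          ← norm_mul _ (specBdry _ _), transverse_smul, Complex.norm_real, Complex.norm_real,
          Real.norm_eq_abs, Real.norm_eq_abs, abs_mul, abs_of_pos (by positivity : 0 < α⁻¹ ^ 2),
          abs_of_pos (by positivity : 0 < α ^ 2 / (1 + ℓ))]
        field_simp
      rw [h5]
      calc _ ≤ ‖retConst e‖ * (2 * ‖k‖ ^ 2) * (C * 3 * (1 + ‖k‖) ^ 2 * (1 + ℓ) / (1 + ℓ)) := by
            gcongr
        _ = ‖retConst e‖ * 2 * (C * 3) * (‖k‖ ^ 2 * (1 + ‖k‖) ^ 2) := by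
            field_simp
        _ ≤ ‖retConst e‖ * 2 * (C * 3) * ((1 + ‖k‖) ^ 2 * (1 + ‖k‖) ^ 2) := by
            gcongr
            linarith
        _ = _ := by ring
    · filter_upwards [ae_minkSq_ne F 0] with k hk
      exact tendsto_retFn_rescaled F e hm μ ν hk

theorem sign_pos_mul {a : ℝ} (ha : 0 < a) (x : ℝ) : Real.sign (a * x) = Real.sign x := by
  rcases lt_trichotomy x 0 with h | rfl | h
  · rw [Real.sign_of_neg h, Real.sign_of_neg (mul_neg_of_pos_of_neg ha h)]
  · rw [mul_zero]
  · rw [Real.sign_of_pos h, Real.sign_of_pos (mul_pos ha h)]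

theorem tendsto_bubble_rescaled (m s : ℝ) :
    Tendsto (fun α : ℝ => bubble m ((α⁻¹) ^ 2 * s)) (𝓝[>] 0) (𝓝 (if 0 < s then 1 else 0)) := by
  split_ifs with hs
  · have h1 : Tendsto (fun x : ℝ => (1 + 2 * m ^ 2 / x) * √(1 - 4 * m ^ 2 / x)) atTop (𝓝 1) := by
      have h2 : ∀ c : ℝ, Tendsto (fun x : ℝ => c / x) atTop (𝓝 0) := fun c =>
        tendsto_const_nhds.div_atTop tendsto_id
      simpa using ((h2 (2 * m ^ 2)).const_add 1).mul ((h2 (4 * m ^ 2)).const_sub 1).sqrt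
    have h3 : Tendsto (fun α : ℝ => (α⁻¹) ^ 2 * s) (𝓝[>] 0) atTop :=
      ((tendsto_pow_atTop two_ne_zero).comp tendsto_inv_nhdsGT_zero).atTop_mul_const hs
    refine (h1.comp h3).congr' ?_
    filter_upwards [h3.eventually_gt_atTop (4 * m ^ 2)] with α hα
    rw [bubble_of_lt hα]
    rfl
  · refine tendsto_const_nhds.congr fun α => (bubble_of_le ?_).symm
    push Not at hs
    have : α⁻¹ ^ 2 * s ≤ 0 := mul_nonpos_of_nonneg_of_nonpos (sq_nonneg _) hs
    nlinarith [sq_nonneg m]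

/-- Under rescaling `bubble` tends to the indicator of k² > 0, its massless form, so α² suffices.
The limit is non-zero on the open forward cone already in the component 1 1. -/
theorem hasSingularOrder_causalDist (F : Form) {e : ℝ} (he : e ≠ 0) {m : ℝ} (hm : 0 < m) :
    HasSingularOrder (causalDist (loopDist F e hm)) 2 := by
  set g : Fin 4 → Fin 4 → E4 → ℂ := fun μ ν k => ((loopConst e * (Real.sign (freq F k) *
    (if 0 < minkSq F k then 1 else 0)) * transverse F μ ν k : ℝ) : ℂ) with hgdef
  have hsign : ∀ x : ℝ, |Real.sign x| ≤ 1 := by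
    intro x
    rcases Real.sign_apply_eq x with h | h | h <;> simp [h]
  have hg : ∀ μ ν, IsModerate (g μ ν) := by
    intro μ ν
    have hs : Measurable Real.sign := by
      unfold Real.sign
      exact Measurable.ite measurableSet_Iio measurable_const
        (Measurable.ite measurableSet_Ioi measurable_const measurable_const)
    have h1 : Measurable fun k => if 0 < minkSq F k then (1 : ℝ) else 0 :=
      Measurable.ite (measurableSet_lt measurable_const (continuous_minkSq F).measurable)
        measurable_const measurable_const
    have h2 := hs.comp (continuous_freq F).measurable
    refine ⟨Complex.measurable_ofReal.comp
      ((measurable_const.mul (h2.mul h1)).mul (continuous_transverse F μ ν).measurable), 2,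
      |loopConst e| * 2, fun k => ?_⟩
    rw [hgdef, Complex.norm_real, Real.norm_eq_abs, abs_mul, abs_mul, abs_mul]
    have h3 := abs_transverse_le F μ ν k
    have h4 : |(if 0 < minkSq F k then (1 : ℝ) else 0)| ≤ 1 := by split_ifs <;> simp
    have hk := norm_nonneg k
    calc _ ≤ |loopConst e| * (1 * 1) * (2 * ‖k‖ ^ 2) := by
          gcongr
          exact hsign _
      _ = |loopConst e| * 2 * ‖k‖ ^ 2 := by ring
      _ ≤ _ := by gcongr; linarith
  have heq : ∀ μ ν (k : E4) (α : ℝ), 0 < α → ((α ^ 2 : ℝ) : ℂ) * causalFn F e m μ ν (α⁻¹ • k) =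
      ((loopConst e * (Real.sign (freq F k) * bubble m ((α⁻¹) ^ 2 * minkSq F k)) *
        transverse F μ ν k : ℝ) : ℂ) := by
    intro μ ν k α hα
    have h1 : Real.sign (freq F (α⁻¹ • k)) = Real.sign (freq F k) := by
      rw [freq_smul, sign_pos_mul (inv_pos.2 hα)]
    rw [causalFn, h1, minkSq_smul, transverse_smul, ← Complex.ofReal_mul]
    congr 1
    field_simp
  refine ⟨fun α => α ^ 2, fun μ ν => (hg μ ν).toDist, by fun_prop, fun α hα => by positivity,
    ?_, ?_, ?_⟩
  · intro a ha
    rw [Real.rpow_two]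
    refine tendsto_const_nhds.congr' ?_
    filter_upwards [self_mem_nhdsWithin] with α hα
    have hα : 0 < α := hα
    field_simp
  · intro h
    refine (hg 1 1).toDist_ne_zero F (fun k hk => ?_) (congrFun (congrFun h 1) 1)
    have h1 := transverse_one_one_ne_zero hk
    have h2 : loopConst e ≠ 0 := by rw [loopConst]; positivity
    rw [hgdef]
    simp [Real.sign_of_pos hk.2, if_pos hk.1, h1, h2]
  · intro μ ν φ
    rw [causalDist_loopDist]
    refine IsModerate.tendsto_rescaled _ _ (N := 2) (C := |loopConst e| * 4) ?_ ?_ φ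
    · filter_upwards [self_mem_nhdsWithin] with α hα k
      rw [heq μ ν k α hα, Complex.norm_real, Real.norm_eq_abs, abs_mul, abs_mul, abs_mul,
        abs_of_nonneg (bubble_nonneg _ _)]
      have h3 := abs_transverse_le F μ ν k
      have hk := norm_nonneg k
      calc _ ≤ |loopConst e| * (1 * 2) * (2 * ‖k‖ ^ 2) := by
            gcongr
            · exact bubble_nonneg _ _
            · exact hsign _
            · exact bubble_le _ _
        _ = |loopConst e| * 4 * ‖k‖ ^ 2 := by ring
        _ ≤ _ := by gcongr; linarith
    · refine Eventually.of_forall fun k => ?_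
      have h1 := (((tendsto_bubble_rescaled m (minkSq F k)).const_mul
        (Real.sign (freq F k))).const_mul (loopConst e)).mul_const (transverse F μ ν k)
      refine ((Complex.continuous_ofReal.tendsto _).comp h1).congr' ?_
      filter_upwards [self_mem_nhdsWithin] with α hα
      exact (heq μ ν k α hα).symm

theorem isCentralSplitting_retDist (F : Form) {e : ℝ} (he : e ≠ 0) {m : ℝ} (hm : 0 < m) :
    IsCentralSplitting F 2 (causalDist (loopDist F e hm)) (retDist F e hm) where
  retarded := supportedIn_retDist F e hm
  advanced := supportedIn_retDist_sub F e hm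
  order := by exact_mod_cast hasSingularOrder_retDist F he hm
  normalized := vanishesToOrder_retDist F e hm

/-! ### The dispersion relation. -/

theorem measurable_sign : Measurable Real.sign := by
  unfold Real.sign
  exact Measurable.ite measurableSet_Iio measurable_const
    (Measurable.ite measurableSet_Ioi measurable_const measurable_const)

/-- The integrand of the dispersion relation along the ray through a time-like vector of square
`s`. -/
def dispKernel (m s : ℝ) (a : ℂ) (t : ℝ) : ℂ :=
  ((Real.sign t * bubble m (t ^ 2 * s) * t ^ 2 : ℝ) : ℂ) / ((t : ℂ) ^ 3 * (a - t))

/-- The integrand vanishes for t²s ≤ 4m², which disposes of the pole t⁻³. For larger |t| it is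
O(t⁻²): |t| ≤ |a| + |a − t| and |a − t| ≥ |Im a| give |t| ≤ K|a − t|. -/
theorem integrable_dispKernel {m s : ℝ} (hm : 0 < m) (hs : 0 < s) {a : ℂ} (ha : a.im ≠ 0) :
    Integrable (dispKernel m s a) := by
  set K := 1 + ‖a‖ / |a.im| with hK
  have hai : 0 < |a.im| := abs_pos.2 ha
  have hK0 : 0 < K := by positivity
  refine (integrable_inv_one_add_sq.const_mul (2 * K * (1 + s / (4 * m ^ 2)))).mono' ?_
    (Eventually.of_forall fun t => ?_)
  · have h1 := measurable_sign
    have h2 := (continuous_bubble hm).measurable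
    exact Measurable.aestronglyMeasurable (by unfold dispKernel; fun_prop)
  · rcases le_or_gt (t ^ 2 * s) (4 * m ^ 2) with h | h
    · rw [dispKernel, bubble_of_le h]
      simp only [mul_zero, zero_mul, Complex.ofReal_zero, zero_div, norm_zero]
      positivity
    · have ht : t ≠ 0 := by
        rintro rfl
        have : 0 < m ^ 2 := by positivity
        simp at h
        linarith
      have ht2 : 0 < |t| := abs_pos.2 ht
      have h1 : |a.im| ≤ ‖a - t‖ := by
        have := Complex.abs_im_le_norm (a - t)
        simpa using this
      have h2 : |t| ≤ K * ‖a - t‖ := by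
        have h3 : |t| ≤ ‖a‖ + ‖a - t‖ := by
          have := norm_sub_le a (a - t)
          rw [sub_sub_cancel, Complex.norm_real, Real.norm_eq_abs] at this
          exact this
        have h4 : ‖a‖ ≤ ‖a‖ / |a.im| * ‖a - t‖ := by
          rw [div_mul_eq_mul_div, le_div_iff₀ hai]
          gcongr
        rw [hK]
        linarith
      have hsg : |Real.sign t| ≤ 1 := by
        rcases Real.sign_apply_eq t with h | h | h <;> simp [h]
      have hn : 0 < ‖a - t‖ := hai.trans_le h1
      rw [dispKernel, norm_div, norm_mul, norm_pow, Complex.norm_real, Complex.norm_real,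
        Real.norm_eq_abs, Real.norm_eq_abs, abs_mul, abs_mul, abs_of_nonneg (bubble_nonneg _ _),
        abs_of_nonneg (sq_nonneg t)]
      have h5 : (t ^ 2)⁻¹ ≤ (1 + s / (4 * m ^ 2)) * (1 + t ^ 2)⁻¹ := by
        rw [← div_eq_mul_inv, inv_eq_one_div, div_le_div_iff₀ (by positivity) (by positivity),
          add_mul, one_mul, one_mul, add_comm]
        gcongr
        rw [div_mul_eq_mul_div, le_div_iff₀ (by positivity)]
        linarith
      calc |Real.sign t| * bubble m (t ^ 2 * s) * t ^ 2 / (|t| ^ 3 * ‖a - t‖)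
          ≤ 1 * 2 * t ^ 2 / (|t| ^ 3 * (|t| / K)) := by
            gcongr
            · exact bubble_nonneg _ _
            · exact bubble_le _ _
            · rw [div_le_iff₀ hK0, mul_comm]
              exact h2
        _ = 2 * K * (t ^ 2)⁻¹ := by
            have h6 : |t| ^ 3 * (|t| / K) = (t ^ 2) ^ 2 / K := by
              rw [← sq_abs t]
              ring
            rw [h6]
            field_simp
        _ ≤ 2 * K * ((1 + s / (4 * m ^ 2)) * (1 + t ^ 2)⁻¹) := by gcongr
        _ = _ := by ring

/-- The substitution t = c/√(1 − v²) with c²s = 4m², for which v = √(1 − 4m²/(t²s)) is the root in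
`bubble`. -/
theorem hasDerivAt_div_sqrt (c : ℝ) {v : ℝ} (hv : v ∈ Set.Ioo (0 : ℝ) 1) :
    HasDerivAt (fun v => c / √(1 - v ^ 2)) (c / √(1 - v ^ 2) * (v / (1 - v ^ 2))) v := by
  have h1 : 0 < 1 - v ^ 2 := by nlinarith [hv.1, hv.2]
  have h2 : HasDerivAt (fun v : ℝ => 1 - v ^ 2) (-(2 * v)) v := by
    simpa using (hasDerivAt_pow 2 v).const_sub 1
  have h3 := (h2.sqrt h1.ne').inv (Real.sqrt_pos.2 h1).ne'
  have h4 := h3.const_mul c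
  refine (h4.congr_deriv ?_).congr_of_eventuallyEq (Eventually.of_forall fun x => ?_)
  · rw [Real.sq_sqrt h1.le]
    have := (Real.sqrt_pos.2 h1).ne'
    field_simp
  · simp [div_eq_mul_inv]

theorem image_div_sqrt {c : ℝ} (hc : 0 < c) :
    (fun v => c / √(1 - v ^ 2)) '' Set.Ioo (0 : ℝ) 1 = Set.Ioi c := by
  ext t
  simp only [Set.mem_image, Set.mem_Ioo, Set.mem_Ioi]
  constructor
  · rintro ⟨v, ⟨hv0, hv1⟩, rfl⟩
    have h1 : 0 < 1 - v ^ 2 := by nlinarith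
    rw [lt_div_iff₀ (Real.sqrt_pos.2 h1)]
    have : √(1 - v ^ 2) < 1 := by
      rw [Real.sqrt_lt' one_pos]
      nlinarith
    nlinarith
  · intro ht
    have ht0 : 0 < t := hc.trans ht
    have h1 : 0 < 1 - (c / t) ^ 2 := by
      have h2 : c / t < 1 := (div_lt_one ht0).2 ht
      have h3 : 0 < c / t := by positivity
      nlinarith
    refine ⟨√(1 - (c / t) ^ 2), ⟨Real.sqrt_pos.2 h1, ?_⟩, ?_⟩
    · rw [Real.sqrt_lt' one_pos]
      have h3 : 0 < c / t := by positivity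
      nlinarith
    · rw [Real.sq_sqrt h1.le, sub_sub_cancel, Real.sqrt_sq (by positivity)]
      field_simp

theorem injOn_div_sqrt {c : ℝ} (hc : 0 < c) :
    Set.InjOn (fun v => c / √(1 - v ^ 2)) (Set.Ioo (0 : ℝ) 1) := by
  intro v hv w hw h
  have h1 : 0 < 1 - v ^ 2 := by nlinarith [hv.1, hv.2]
  have h2 : 0 < 1 - w ^ 2 := by nlinarith [hw.1, hw.2]
  have h3 : √(1 - v ^ 2) = √(1 - w ^ 2) := by
    have h' : c / √(1 - v ^ 2) = c / √(1 - w ^ 2) := h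
    rw [div_eq_div_iff (Real.sqrt_pos.2 h1).ne' (Real.sqrt_pos.2 h2).ne'] at h'
    exact (mul_left_cancel₀ hc.ne' h').symm
  have h4 := (Real.sqrt_inj h1.le h2.le).1 h3
  have h5 : v ^ 2 = w ^ 2 := by linarith
  exact (pow_left_inj₀ hv.1.le hw.1.le two_ne_zero).1 h5

/-- The sign and t³ are both odd, so folding t to −t replaces 1/(a − t) by 1/(a − t) + 1/(a + t) =
2a/(a² − t²). The integral then starts at the threshold t = c, and t = c/√(1 − v²) turns it into the
spectral integral at a²s. -/
theorem integral_dispKernel {m s : ℝ} (hm : 0 < m) (hs : 0 < s) {a : ℂ} (ha : a.im ≠ 0)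
    (ha2 : (a ^ 2).im ≠ 0) :
    ∫ t, dispKernel m s a t = -a * s * specInt m (a ^ 2 * s) := by
  have hint := integrable_dispKernel hm hs ha
  set c := 2 * m / √s with hc
  have hc0 : 0 < c := by positivity
  have hcs : c ^ 2 * s = 4 * m ^ 2 := by
    rw [hc, div_pow, Real.sq_sqrt hs.le]
    field_simp
    norm_num
  set h : ℝ → ℂ := fun t => (bubble m (t ^ 2 * s) : ℂ) / t * (2 * a / (a ^ 2 - (t : ℂ) ^ 2)) with hh
  have hden : ∀ t : ℝ, a ^ 2 - (t : ℂ) ^ 2 ≠ 0 := by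
    intro t h0
    have := congrArg Complex.im h0
    rw [Complex.sub_im, ← Complex.ofReal_pow, Complex.ofReal_im] at this
    simp at this
    exact ha2 (by simpa using this)
  have h1 : ∫ t, dispKernel m s a t = ∫ t in Set.Ioi (0 : ℝ), h t := by
    rw [← intervalIntegral.integral_Iic_add_Ioi (b := 0) hint.integrableOn hint.integrableOn]
    have h2 := integral_comp_neg_Ioi (0 : ℝ) (dispKernel m s a)
    rw [neg_zero] at h2
    rw [← h2, ← integral_add (hint.comp_neg.integrableOn) hint.integrableOn]
    refine setIntegral_congr_fun measurableSet_Ioi fun t ht => ?_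
    have ht : 0 < t := ht
    have htc : (t : ℂ) ≠ 0 := by exact_mod_cast ht.ne'
    have h3 : a - (t : ℂ) ≠ 0 := by
      intro h0
      exact hden t (by linear_combination (a + t) * h0)
    have h4 : a + (t : ℂ) ≠ 0 := by
      intro h0
      exact hden t (by linear_combination (a - t) * h0)
    have h5 := hden t
    simp only [dispKernel, hh, Real.sign_of_pos ht, Real.sign_of_neg (neg_lt_zero.2 ht), neg_sq]
    have h6 : a ^ 2 - (t : ℂ) ^ 2 = (a - t) * (a + t) := by ring
    rw [h6]
    push_cast
    rw [sub_neg_eq_add]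
    field_simp
    ring
  have h2 : ∫ t in Set.Ioi (0 : ℝ), h t = ∫ t in Set.Ioi c, h t := by
    rw [← integral_indicator measurableSet_Ioi, ← integral_indicator measurableSet_Ioi]
    congr 1
    ext t
    by_cases ht : c < t
    · rw [Set.indicator_of_mem (show t ∈ Set.Ioi 0 from hc0.trans ht),
        Set.indicator_of_mem (show t ∈ Set.Ioi c from ht)]
    · rw [Set.indicator_of_notMem (show t ∉ Set.Ioi c from ht)]
      by_cases ht0 : 0 < t
      · rw [Set.indicator_of_mem (show t ∈ Set.Ioi 0 from ht0)]
        push Not at ht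
        have h3 : t ^ 2 * s ≤ 4 * m ^ 2 := by
          rw [← hcs]
          gcongr
        simp [hh, bubble_of_le h3]
      · rw [Set.indicator_of_notMem (show t ∉ Set.Ioi 0 from ht0)]
  rw [h1, h2, ← image_div_sqrt hc0, integral_image_eq_integral_abs_deriv_smul measurableSet_Ioo
    (fun v hv => (hasDerivAt_div_sqrt c hv).hasDerivWithinAt) (injOn_div_sqrt hc0), specInt,
    intervalIntegral.integral_of_le zero_le_one, integral_Ioc_eq_integral_Ioo, ← integral_const_mul]
  refine setIntegral_congr_fun measurableSet_Ioo fun v hv => ?_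
  have hv1 : 0 < 1 - v ^ 2 := by nlinarith [hv.1, hv.2]
  have hv0 := hv.1
  set T := c / √(1 - v ^ 2) with hT
  have hT0 : 0 < T := by positivity
  have hT2 : T ^ 2 = c ^ 2 / (1 - v ^ 2) := by rw [hT, div_pow, Real.sq_sqrt hv1.le]
  have hTs : T ^ 2 * s = 4 * m ^ 2 / (1 - v ^ 2) := by
    rw [hT2, div_mul_eq_mul_div, hcs]
  have hb : bubble m (T ^ 2 * s) = (3 - v ^ 2) / 2 * v := by
    have h3 : 4 * m ^ 2 < T ^ 2 * s := by
      rw [hTs, lt_div_iff₀ hv1]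
      have : 0 < m ^ 2 * v ^ 2 := by positivity
      nlinarith
    rw [bubble_of_lt h3, hTs]
    have h4 : 1 - 4 * m ^ 2 / (4 * m ^ 2 / (1 - v ^ 2)) = v ^ 2 := by
      field_simp
      ring
    rw [h4, Real.sqrt_sq hv0.le]
    field_simp
    ring
  have hd := hden T
  have habs : |T * (v / (1 - v ^ 2))| = T * (v / (1 - v ^ 2)) := abs_of_pos (by positivity)
  simp only [habs, hh, hb, Complex.real_smul]
  have hvc : (1 - (v : ℂ) ^ 2) ≠ 0 := by exact_mod_cast hv1.ne'
  have hTc : (T : ℂ) ≠ 0 := by exact_mod_cast hT0.ne'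
  have hT2c : (T : ℂ) ^ 2 * s * (1 - v ^ 2) = 4 * m ^ 2 := by
    have h5 : ((T ^ 2 * s : ℝ) : ℂ) = ((4 * m ^ 2 / (1 - v ^ 2) : ℝ) : ℂ) := by rw [hTs]
    push_cast at h5
    rw [h5]
    field_simp
  have hden2 : (4 * m ^ 2 : ℂ) - a ^ 2 * s * (1 - v ^ 2) =
      -(s * (1 - v ^ 2) * (a ^ 2 - (T : ℂ) ^ 2)) := by
    linear_combination -hT2c
  have hsc : (s : ℂ) ≠ 0 := by exact_mod_cast hs.ne'
  push_cast
  rw [hden2]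
  field_simp

theorem causalFn_smul (F : Form) (e m : ℝ) (μ ν : Fin 4) (k : E4) (t : ℝ) :
    causalFn F e m μ ν (t • k) = ((loopConst e * Real.sign (freq F k) * transverse F μ ν k : ℝ) : ℂ) *
      ((Real.sign t * bubble m (t ^ 2 * minkSq F k) * t ^ 2 : ℝ) : ℂ) := by
  have h : Real.sign (t * freq F k) = Real.sign t * Real.sign (freq F k) := by
    rcases lt_trichotomy t 0 with ht | rfl | ht
    · rw [Real.sign_of_neg ht, ← neg_mul_neg, sign_pos_mul (neg_pos.2 ht), Real.sign_neg]
      ring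
    · simp
    · rw [sign_pos_mul ht, Real.sign_of_pos ht, one_mul]
  rw [causalFn, freq_smul, minkSq_smul, transverse_smul, h, ← Complex.ofReal_mul]
  congr 1
  ring

/-- With a = 1 + iσε, σ the sign of the frequency, the point a²s approaches s from above the cut for
σ = 1 and from below for σ = −1; this is the prescription in `bdryFn`. The two factors σ, from d̂
and from the prefactor, cancel. -/
theorem dispersionRelation (F : Form) (e : ℝ) {m : ℝ} (hm : 0 < m) (μ ν : Fin 4) :
    DispersionRelation F 2 (causalFn F e m μ ν) (retFn F e m μ ν) := by
  intro k hk
  set s := minkSq F k with hsdef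
  set σ := Real.sign (freq F k) with hσ
  have hσ1 : σ = -1 ∨ σ = 1 := by
    rcases (freq_ne_zero F hk).lt_or_gt with h | h
    · exact Or.inl (Real.sign_of_neg h)
    · exact Or.inr (Real.sign_of_pos h)
  have hσ2 : (σ : ℂ) ^ 2 = 1 := by rcases hσ1 with h | h <;> simp [h]
  set A : ℂ := ((loopConst e * σ * transverse F μ ν k : ℝ) : ℂ) with hA
  have heq : ∀ (ε t : ℝ), causalFn F e m μ ν (t • k) /
      ((t : ℂ) ^ (2 + 1) * (1 - t + σ * Complex.I * ε)) =
      A * dispKernel m s (1 + σ * Complex.I * ε) t := by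
    intro ε t
    rw [causalFn_smul, dispKernel, mul_div_assoc, add_sub_right_comm]
  have him : ∀ ε : ℝ, (1 + σ * Complex.I * ε : ℂ).im = σ * ε := by intro ε; simp
  have him2 : ∀ ε : ℝ, ((1 + σ * Complex.I * ε : ℂ) ^ 2).im = 2 * σ * ε := by
    intro ε
    rw [sq, Complex.mul_im]
    simp
    ring
  have hne : ∀ ε : ℝ, 0 < ε → σ * ε ≠ 0 := by
    intro ε hε
    rcases hσ1 with h | h <;> rw [h] <;> simp [hε.ne']
  simp only [heq]
  refine ⟨fun ε hε => (integrable_dispKernel hm hk (by rw [him]; exact hne ε hε)).const_mul A, ?_⟩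
  have ha : Tendsto (fun ε : ℝ => (1 + σ * Complex.I * ε : ℂ)) (𝓝[>] 0) (𝓝 1) := by
    have h : Continuous fun ε : ℝ => (1 + σ * Complex.I * ε : ℂ) := by fun_prop
    simpa using (h.tendsto 0).mono_left (nhdsWithin_le_nhds (s := Set.Ioi 0))
  have has : Tendsto (fun ε : ℝ => (1 + σ * Complex.I * ε : ℂ) ^ 2 * s) (𝓝[>] 0) (𝓝 (s : ℂ)) := by
    simpa using (ha.pow 2).mul_const (s : ℂ)
  have hims : ∀ ε : ℝ, ((1 + σ * Complex.I * ε : ℂ) ^ 2 * s).im = 2 * σ * ε * s := by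
    intro ε
    rw [Complex.im_mul_ofReal, him2]
  have hI : Tendsto (fun ε : ℝ => specInt m ((1 + σ * Complex.I * ε : ℂ) ^ 2 * s)) (𝓝[>] 0)
      (𝓝 (bdryFn F m k)) := by
    rcases (freq_ne_zero F hk).lt_or_gt with hf | hf
    · have h1 : σ = -1 := Real.sign_of_neg hf
      rw [bdryFn, if_neg (by linarith)]
      have h2 : Tendsto (fun ε : ℝ => (starRingEnd ℂ) ((1 + σ * Complex.I * ε : ℂ) ^ 2 * s)) (𝓝[>] 0)
          (𝓝[{z | 0 < z.im}] (s : ℂ)) := by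
        refine tendsto_nhdsWithin_iff.2 ⟨?_, ?_⟩
        · have h3 := (Complex.continuous_conj.tendsto _).comp has
          rw [Complex.conj_ofReal] at h3
          exact h3
        · filter_upwards [self_mem_nhdsWithin] with ε hε
          have hε : 0 < ε := hε
          have : 0 < (2 * ε * s) := by positivity
          change 0 < ((starRingEnd ℂ) ((1 + σ * Complex.I * ε : ℂ) ^ 2 * s)).im
          rw [Complex.conj_im, hims, h1]
          linarith
      refine ((Complex.continuous_conj.tendsto _).comp ((tendsto_specInt_upper hm _).comp h2)).congr
        fun ε => ?_
      simp only [Function.comp_apply, specInt_conj, Complex.conj_conj]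
    · have h1 : σ = 1 := Real.sign_of_pos hf
      rw [bdryFn, if_pos hf]
      refine (tendsto_specInt_upper hm _).comp (tendsto_nhdsWithin_iff.2 ⟨has, ?_⟩)
      filter_upwards [self_mem_nhdsWithin] with ε hε
      have hε : 0 < ε := hε
      change 0 < ((1 + σ * Complex.I * ε : ℂ) ^ 2 * s).im
      rw [hims, h1]
      positivity
  have hlim := ((ha.mul_const (s : ℂ)).mul hI).const_mul (retConst e * (transverse F μ ν k : ℂ))
  rw [one_mul] at hlim
  refine hlim.congr' ?_
  filter_upwards [self_mem_nhdsWithin] with ε hε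
  have hε : 0 < ε := hε
  rw [integral_const_mul, integral_dispKernel hm hk (by rw [him]; exact hne ε hε)
    (by rw [him2, mul_assoc]; exact mul_ne_zero two_ne_zero (hne ε hε)), hA, retConst, loopConst]
  have hpi : (Real.pi : ℂ) ≠ 0 := by exact_mod_cast Real.pi_ne_zero
  push_cast
  generalize specInt m _ = J
  generalize (1 + (σ : ℂ) * Complex.I * ε) = a
  field_simp
  rw [hσ2]
  ring

/-! ### Transversality and closed form of the polarization tensor. -/

theorem sum_lowerIndex_mul_metric (F : Form) (k : E4) (ν : Fin 4) :
    ∑ μ, lowerIndex F k μ * metric F μ ν = k ν := by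
  cases F <;> fin_cases ν <;>
    simp [lowerIndex_lightFront, lowerIndex_instant, metric, Fin.sum_univ_four]

theorem sum_lowerIndex_mul_transverse (F : Form) (k : E4) (ν : Fin 4) :
    ∑ μ, lowerIndex F k μ * transverse F μ ν k = 0 := by
  have h : ∀ μ, lowerIndex F k μ * transverse F μ ν k =
      minkSq F k * (lowerIndex F k μ * metric F μ ν) - (lowerIndex F k μ * k μ) * k ν := by
    intro μ
    rw [transverse]
    ring
  simp only [h, Finset.sum_sub_distrib, ← Finset.mul_sum, ← Finset.sum_mul]
  rw [sum_lowerIndex_mul_metric]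
  exact sub_self _

theorem isModerate_polFn (F : Form) (e : ℝ) {m : ℝ} (hm : 0 < m) (μ ν : Fin 4) :
    IsModerate fun k => Complex.I * (retFn F e m μ ν k + loopFn F e m ν μ (-k)) :=
  (IsModerate.const Complex.I).mul
    ((isModerate_retFn F e μ ν hm).add (isModerate_loopFn F e ν μ hm).comp_neg)

theorem polarizationTensor_eq (F : Form) (e : ℝ) {m : ℝ} (hm : 0 < m) (μ ν : Fin 4) :
    polarizationTensor (loopDist F e hm) (retDist F e hm) μ ν =
      (isModerate_polFn F e hm μ ν).toDist := by
  ext φ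
  have h1 : polarizationTensor (loopDist F e hm) (retDist F e hm) μ ν φ =
      Complex.I * (retDist F e hm μ ν φ - -(reflect (loopDist F e hm ν μ) φ)) := rfl
  have h2 := (isModerate_retFn F e μ ν hm).integrable_mul φ
  have h3 := (isModerate_loopFn F e ν μ hm).comp_neg.integrable_mul φ
  rw [h1, retDist, loopDist, IsModerate.reflect_toDist, IsModerate.toDist_apply,
    IsModerate.toDist_apply, IsModerate.toDist_apply, sub_neg_eq_add, ← integral_add h2 h3,
    ← integral_const_mul]
  refine integral_congr_ae (Eventually.of_forall fun k => ?_)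
  simp only
  ring

/-- The stated function divides by k² and agrees with the function of polynomial growth only off the
light cone, which is a null set. -/
theorem isRegularDist_polarizationTensor (F : Form) (e : ℝ) {m : ℝ} (hm : 0 < m) (μ ν : Fin 4) :
    IsRegularDist (polarizationTensor (loopDist F e hm) (retDist F e hm) μ ν)
      (tensorOf F (fun k => piScalar e m (minkSq F k)) μ ν) := by
  intro φ
  have h := (isModerate_polFn F e hm μ ν).integrable_mul φ
  have hae : (fun k => Complex.I * (retFn F e m μ ν k + loopFn F e m ν μ (-k)) * φ k) =ᵐ[volume]
      fun k => tensorOf F (fun k => piScalar e m (minkSq F k)) μ ν k * φ k := by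
    filter_upwards [ae_minkSq_ne F 0] with k hk
    rw [retFn_add_loopFn_neg_eq_tensorOf F e μ ν k hm hk]
  refine ⟨h.congr hae, ?_⟩
  rw [polarizationTensor_eq, IsModerate.toDist_apply]
  exact integral_congr_ae hae

theorem hasTemperateGrowth_lowerIndex (F : Form) (μ : Fin 4) :
    (fun k : E4 => ((lowerIndex F k μ : ℝ) : ℂ)).HasTemperateGrowth :=
  ((Complex.ofRealCLM.comp (EuclideanSpace.proj μ)).comp
    ((lowerEquiv F).toContinuousLinearEquiv : E4 →L[ℝ] E4)).hasTemperateGrowth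

theorem sum_smulLeftCLM_polarizationTensor (F : Form) (e : ℝ) {m : ℝ} (hm : 0 < m) (ν : Fin 4) :
    ∑ μ, TemperedDistribution.smulLeftCLM ℂ (fun k : E4 => ((lowerIndex F k μ : ℝ) : ℂ))
      (polarizationTensor (loopDist F e hm) (retDist F e hm) μ ν) = 0 := by
  ext φ
  have h0 : (∑ μ, TemperedDistribution.smulLeftCLM ℂ (fun k : E4 => ((lowerIndex F k μ : ℝ) : ℂ))
      (polarizationTensor (loopDist F e hm) (retDist F e hm) μ ν)) φ =
      ∑ μ, polarizationTensor (loopDist F e hm) (retDist F e hm) μ ν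
        (SchwartzMap.smulLeftCLM ℂ (fun k : E4 => ((lowerIndex F k μ : ℝ) : ℂ)) φ) := by
    rw [Fin.sum_univ_four, Fin.sum_univ_four]
    rfl
  rw [h0]
  simp only [polarizationTensor_eq, IsModerate.toDist_apply]
  rw [← integral_finsetSum _ fun μ _ => (isModerate_polFn F e hm μ ν).integrable_mul _]
  change _ = (0 : ℂ)
  rw [← integral_zero E4 ℂ]
  refine integral_congr_ae (Eventually.of_forall fun k => ?_)
  simp only [retFn_add_loopFn_neg F e _ ν k hm,
    SchwartzMap.smulLeftCLM_apply_apply (hasTemperateGrowth_lowerIndex F _), smul_eq_mul]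
  have h1 : ∑ μ, ((lowerIndex F k μ : ℝ) : ℂ) * (transverse F μ ν k : ℂ) = 0 := by
    exact_mod_cast sum_lowerIndex_mul_transverse F k ν
  have h2 : ∀ μ, Complex.I * (retConst e * (transverse F μ ν k : ℂ) *
      ((minkSq F k : ℂ) * specBdry m (minkSq F k))) * (((lowerIndex F k μ : ℝ) : ℂ) * φ k) =
      Complex.I * retConst e * ((minkSq F k : ℂ) * specBdry m (minkSq F k)) * φ k *
        (((lowerIndex F k μ : ℝ) : ℂ) * (transverse F μ ν k : ℂ)) := fun μ => by ring
  simp only [h2, ← Finset.mul_sum, h1, mul_zero]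

/-! ### The complete photon propagator -/

/-- On the range of the idempotent N the geometric series is scalar. The case c = 1 also holds, by
the default values: the matrix is singular, so its inverse is 0, and (1 − c)⁻¹ is 0 too. -/
theorem inv_one_sub_smul_mul {n : Type*} [Fintype n] [DecidableEq n] {N D : Matrix n n ℂ}
    (hN : N * N = N) (hN0 : N ≠ 0) (hD : N * D = D) (c : ℂ) :
    (1 - c • N)⁻¹ * D = (1 - c)⁻¹ • D := by
  by_cases hc : c = 1
  · subst hc
    have h : ¬ IsUnit (1 - (1 : ℂ) • N).det := by
      intro h
      apply hN0
      have h1 : N * (1 - (1 : ℂ) • N) = 0 := by rw [one_smul, mul_sub, mul_one, hN, sub_self]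
      have h2 : N * (1 - (1 : ℂ) • N) * (1 - (1 : ℂ) • N)⁻¹ = 0 := by rw [h1, zero_mul]
      rwa [Matrix.mul_assoc, Matrix.mul_nonsing_inv _ h, mul_one] at h2
    rw [Matrix.nonsing_inv_apply_not_isUnit _ h]
    simp
  · have hc' : 1 - c ≠ 0 := sub_ne_zero.2 (Ne.symm hc)
    have h : (1 - c • N) * (1 + (c / (1 - c)) • N) = 1 := by
      have h1 : (1 - c • N) * (1 + (c / (1 - c)) • N) =
          1 + (c / (1 - c) - c - c * (c / (1 - c))) • N := by
        simp only [sub_mul, mul_add, one_mul, mul_one, Matrix.smul_mul, Matrix.mul_smul, hN, smul_smul]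
        module
      rw [h1]
      have h2 : c / (1 - c) - c - c * (c / (1 - c)) = 0 := by field_simp; ring
      rw [h2, zero_smul, add_zero]
    rw [Matrix.inv_eq_right_inv h, add_mul, one_mul, Matrix.smul_mul, hD]
    have h2 : (1 - c)⁻¹ = 1 + c / (1 - c) := by field_simp; ring
    rw [h2, add_smul, one_smul]

/-- The polarization sum `h_{μν} - (k_μ η_ν + k_ν η_μ)/k⁺ + k² η_μ η_ν/(k⁺)²`. -/
def polarizationSum (k : E4) : Matrix (Fin 4) (Fin 4) ℂ :=
  let x : ℂ := (k 1 / k 0 : ℝ)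
  let y : ℂ := (k 2 / k 0 : ℝ)
  !![-(x ^ 2 + y ^ 2), x, y, 0; x, -1, 0, 0; y, 0, -1, 0; 0, 0, 0, 0]

theorem freePhoton_eq {k : E4} (hs : minkSq .lightFront k ≠ 0) (h0 : k 0 ≠ 0) :
    freePhoton k = (-((((2 * Real.pi : ℝ) : ℂ) ^ 2)⁻¹) / (minkSq .lightFront k : ℂ)) •
      polarizationSum k := by
  have hc : (k 0 : ℂ) ≠ 0 := by exact_mod_cast h0
  have hsc : (minkSq .lightFront k : ℂ) ≠ 0 := by exact_mod_cast hs
  have hpi : (Real.pi : ℂ) ≠ 0 := by exact_mod_cast Real.pi_ne_zero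
  have hsq : (minkSq .lightFront k : ℂ) = 2 * k 0 * k 3 - k 1 ^ 2 - k 2 ^ 2 := by
    rw [minkSq_lightFront]
    push_cast
    ring
  ext μ ν
  fin_cases μ <;> fin_cases ν <;>
    simp [freePhoton, polarizationSum, lowerIndex_lightFront, eta, metric] <;>
    field_simp <;> (rw [hsq]; ring)

/-- The polarization sum with the second index raised. -/
def mixedSum (k : E4) : Matrix (Fin 4) (Fin 4) ℂ :=
  polarizationSum k * (metric .lightFront).map Complex.ofReal

theorem mixedSum_eq (k : E4) : mixedSum k =
    !![0, -((k 1 / k 0 : ℝ) : ℂ), -((k 2 / k 0 : ℝ) : ℂ),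
        -(((k 1 / k 0 : ℝ) : ℂ) ^ 2 + ((k 2 / k 0 : ℝ) : ℂ) ^ 2);
      0, 1, 0, ((k 1 / k 0 : ℝ) : ℂ); 0, 0, 1, ((k 2 / k 0 : ℝ) : ℂ); 0, 0, 0, 0] := by
  ext μ ν
  rw [mixedSum, Matrix.mul_apply, Fin.sum_univ_four]
  simp only [Matrix.map_apply]
  fin_cases μ <;> fin_cases ν <;> simp [polarizationSum, metric]

theorem mixedSum_mul (k : E4) : mixedSum k * polarizationSum k = polarizationSum k := by
  rw [mixedSum_eq]
  ext μ ν
  rw [Matrix.mul_apply, Fin.sum_univ_four]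
  fin_cases μ <;> fin_cases ν <;> simp [polarizationSum] <;> ring

theorem mixedSum_ne_zero (k : E4) : mixedSum k ≠ 0 := by
  intro h
  have := congrFun (congrFun h 1) 1
  simp [mixedSum_eq] at this

/-- The polarization sum annihilates k, so the longitudinal term kk/k² drops out and only the metric
remains, which raises an index. -/
theorem freePhoton_mul_tensorOf (S : E4 → ℂ) {k : E4} (hs : minkSq .lightFront k ≠ 0)
    (h0 : k 0 ≠ 0) :
    freePhoton k * (((2 * Real.pi : ℝ) : ℂ) ^ 4 • Matrix.of fun μ ν => tensorOf .lightFront S μ ν k) =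
      ((((2 * Real.pi : ℝ) : ℂ) ^ 2)⁻¹ * S k / (minkSq .lightFront k : ℂ)) • mixedSum k := by
  have hc : (k 0 : ℂ) ≠ 0 := by exact_mod_cast h0
  have hsc : (minkSq .lightFront k : ℂ) ≠ 0 := by exact_mod_cast hs
  have hpi : (Real.pi : ℂ) ≠ 0 := by exact_mod_cast Real.pi_ne_zero
  have hX : ((((2 * Real.pi : ℝ) : ℂ) ^ 4 • Matrix.of fun μ ν => tensorOf .lightFront S μ ν k) :
      Matrix (Fin 4) (Fin 4) ℂ) = (-S k) • ((metric .lightFront).map Complex.ofReal -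
        ((minkSq .lightFront k : ℂ)⁻¹) • Matrix.vecMulVec (fun μ => (k μ : ℂ)) (fun ν => (k ν : ℂ))) := by
    ext μ ν
    simp only [tensorOf, Matrix.smul_apply, Matrix.of_apply, Matrix.sub_apply, Matrix.map_apply,
      Matrix.vecMulVec_apply, smul_eq_mul]
    push_cast
    field_simp
  have hk : (polarizationSum k).mulVec (fun μ => (k μ : ℂ)) = 0 := by
    ext μ
    fin_cases μ <;> simp [polarizationSum, Matrix.mulVec, dotProduct, Fin.sum_univ_four] <;>
      field_simp <;> ring
  rw [freePhoton_eq hs h0, hX, Matrix.smul_mul, Matrix.mul_smul, Matrix.mul_sub, Matrix.mul_smul,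
    Matrix.mul_vecMulVec, hk, Matrix.zero_vecMulVec, smul_zero, sub_zero, smul_smul, mixedSum]
  congr 1
  ring

theorem completePhoton_eq (S : E4 → ℂ) {k : E4} (hs : minkSq .lightFront k ≠ 0) (h0 : k 0 ≠ 0) :
    completePhoton S k =
      (1 - (((2 * Real.pi : ℝ) : ℂ) ^ 2)⁻¹ * S k / (minkSq .lightFront k : ℂ))⁻¹ • freePhoton k := by
  rw [completePhoton, freePhoton_mul_tensorOf S hs h0]
  refine inv_one_sub_smul_mul ?_ (mixedSum_ne_zero k) ?_ _
  · rw [mixedSum, ← Matrix.mul_assoc]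
    change mixedSum k * polarizationSum k * _ = _
    rw [mixedSum_mul]
  · rw [freePhoton_eq hs h0, Matrix.mul_smul, mixedSum_mul]

theorem smul_freePhoton {k : E4} (hs : minkSq .lightFront k ≠ 0) (h0 : k 0 ≠ 0) :
    (minkSq .lightFront k : ℂ) • freePhoton k =
      (-((((2 * Real.pi : ℝ) : ℂ) ^ 2)⁻¹)) • polarizationSum k := by
  have hsc : (minkSq .lightFront k : ℂ) ≠ 0 := by exact_mod_cast hs
  rw [freePhoton_eq hs h0, smul_smul, mul_div_cancel₀ _ hsc]

theorem continuousAt_polarizationSum {k₀ : E4} (h0 : k₀ 0 ≠ 0) : ContinuousAt polarizationSum k₀ := by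
  have hx : ∀ i, ContinuousAt (fun k : E4 => ((k i / k 0 : ℝ) : ℂ)) k₀ := by
    intro i
    have h1 : ∀ j, ContinuousAt (fun k : E4 => k j) k₀ := fun j => by fun_prop
    exact Complex.continuous_ofReal.continuousAt.comp ((h1 i).div (h1 0) h0)
  have h1 := hx 1
  have h2 := hx 2
  refine continuousAt_pi.2 fun μ => continuousAt_pi.2 fun ν => ?_
  fin_cases μ <;> fin_cases ν <;> simp [polarizationSum] <;>
    first | exact continuousAt_const | (push_cast at h1 h2; fun_prop)

/-- The momenta off the light cone near a point of the light cone. -/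
theorem neBot_offShell {k₀ : E4} (hs : minkSq .lightFront k₀ = 0) (h0 : k₀ 0 ≠ 0) :
    (𝓝[{k | minkSq .lightFront k ≠ 0}] k₀).NeBot := by
  have h : Tendsto (fun t : ℝ => k₀ + t • (!₂[0, 0, 0, 1] : E4)) (𝓝[>] 0)
      (𝓝[{k | minkSq .lightFront k ≠ 0}] k₀) := by
    refine tendsto_nhdsWithin_iff.2 ⟨?_, ?_⟩
    · have h : Continuous fun t : ℝ => k₀ + t • (!₂[0, 0, 0, 1] : E4) := by fun_prop
      simpa using (h.tendsto 0).mono_left (nhdsWithin_le_nhds (s := Set.Ioi 0))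
    · filter_upwards [self_mem_nhdsWithin] with t ht
      have ht : 0 < t := ht
      change minkSq .lightFront _ ≠ 0
      rw [minkSq_add_smul, hs, minkDot_lightFront, minkSq_lightFront]
      simp [h0, ht.ne']
  exact h.neBot

theorem eventually_offShell {k₀ : E4} (h0 : k₀ 0 ≠ 0) :
    ∀ᶠ k in 𝓝[{k | minkSq .lightFront k ≠ 0}] k₀, minkSq .lightFront k ≠ 0 ∧ k 0 ≠ 0 := by
  have h1 : ContinuousAt (fun k : E4 => k 0) k₀ := by fun_prop
  filter_upwards [self_mem_nhdsWithin, mem_nhdsWithin_of_mem_nhds (h1.eventually_ne h0)] with k h2 h3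
  exact ⟨h2, h3⟩

theorem tendsto_minkSq_offShell {k₀ : E4} (hs : minkSq .lightFront k₀ = 0) :
    Tendsto (fun k => (minkSq .lightFront k : ℂ)) (𝓝[{k | minkSq .lightFront k ≠ 0}] k₀) (𝓝 0) := by
  have h : Continuous fun k => (minkSq .lightFront k : ℂ) :=
    Complex.continuous_ofReal.comp (continuous_minkSq _)
  have := (h.tendsto k₀).mono_left (nhdsWithin_le_nhds (s := {k | minkSq .lightFront k ≠ 0}))
  rwa [hs, Complex.ofReal_zero] at this

/-- Near the light cone the scalar is −(e²/3)(k²)² I(k²) with I continuous at 0, so one division by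
k² still leaves a zero. -/
theorem tendsto_piScalar_div (e : ℝ) {m : ℝ} (hm : 0 < m) {k₀ : E4}
    (hs : minkSq .lightFront k₀ = 0) :
    Tendsto (fun k => piScalar e m (minkSq .lightFront k) / (minkSq .lightFront k : ℂ))
      (𝓝[{k | minkSq .lightFront k ≠ 0}] k₀) (𝓝 0) := by
  have h1 := tendsto_minkSq_offShell hs
  have hpos : ((0 : ℝ) : ℂ) ∈ cutPlane m := ofReal_mem_cutPlane (by positivity)
  rw [Complex.ofReal_zero] at hpos
  have h2 := (continuousAt_specInt hm hpos).tendsto.comp h1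
  have h3 := (h1.mul h2).const_mul (-((e : ℂ) ^ 2 / 3))
  rw [zero_mul, mul_zero] at h3
  refine h3.congr' ?_
  have h4 : ∀ᶠ k in 𝓝[{k | minkSq .lightFront k ≠ 0}] k₀, minkSq .lightFront k < 4 * m ^ 2 := by
    refine mem_nhdsWithin_of_mem_nhds
      ((continuous_minkSq .lightFront).continuousAt.eventually_lt_const ?_)
    rw [hs]
    positivity
  filter_upwards [self_mem_nhdsWithin, h4] with k hk hk4
  have hk : minkSq .lightFront k ≠ 0 := hk
  have hkc : (minkSq .lightFront k : ℂ) ≠ 0 := by exact_mod_cast hk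
  rw [piScalar_eq_specBdry e hm hk, specBdry, if_pos hk4]
  simp only [Function.comp_apply]
  field_simp

/-- The geometric series parameter `(2π)⁻² S(k)/k²`. -/
def insertion (S : E4 → ℂ) (k : E4) : ℂ :=
  (((2 * Real.pi : ℝ) : ℂ) ^ 2)⁻¹ * S k / (minkSq .lightFront k : ℂ)

theorem smul_completePhoton (S : E4 → ℂ) {k : E4} (hs : minkSq .lightFront k ≠ 0) (h0 : k 0 ≠ 0) :
    (minkSq .lightFront k : ℂ) • completePhoton S k =
      (-((((2 * Real.pi : ℝ) : ℂ) ^ 2)⁻¹) * (1 - insertion S k)⁻¹) • polarizationSum k := by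
  rw [completePhoton_eq S hs h0, smul_comm, smul_freePhoton hs h0, smul_smul, insertion, mul_comm]

theorem two_pi_sq_inv_ne_zero : (((2 * Real.pi : ℝ) : ℂ) ^ 2)⁻¹ ≠ 0 := by
  have := Real.pi_ne_zero
  simp [this]

theorem polarizationSum_one_one (k : E4) : polarizationSum k 1 1 = -1 := by
  simp [polarizationSum]

/-- The component 1 1 of the polarization sum is the constant −1, so the residue determines the
limit of (1 − c)⁻¹, where c is the insertion. A zero limit would make the residue vanish. Hence c
has a finite limit, and S, a multiple of k²c, tends to 0. -/
theorem PhotonMassShell.tendsto_zero {S : E4 → ℂ} (h : PhotonMassShell S) {k₀ : E4}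
    (hs : minkSq .lightFront k₀ = 0) (h0 : k₀ 0 ≠ 0) :
    Tendsto S (𝓝[{k | minkSq .lightFront k ≠ 0}] k₀) (𝓝 0) := by
  obtain ⟨R, hR, hlim⟩ := h k₀ hs h0
  have hne := neBot_offShell hs h0
  set c := (((2 * Real.pi : ℝ) : ℂ) ^ 2)⁻¹ with hc
  have hc0 : c ≠ 0 := two_pi_sq_inv_ne_zero
  have h1 : Tendsto (fun k => (-c * (1 - insertion S k)⁻¹) • polarizationSum k)
      (𝓝[{k | minkSq .lightFront k ≠ 0}] k₀) (𝓝 R) := by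
    refine hlim.congr' ?_
    filter_upwards [eventually_offShell h0] with k hk
    exact smul_completePhoton S hk.1 hk.2
  have h11 : Tendsto (fun k => (1 - insertion S k)⁻¹) (𝓝[{k | minkSq .lightFront k ≠ 0}] k₀)
      (𝓝 (c⁻¹ * R 1 1)) := by
    have h2 := (tendsto_pi_nhds.1 (tendsto_pi_nhds.1 h1 1) 1).const_mul c⁻¹
    refine h2.congr fun k => ?_
    rw [Matrix.smul_apply, polarizationSum_one_one, smul_eq_mul]
    field_simp
  have hL : c⁻¹ * R 1 1 ≠ 0 := by
    intro h2
    rw [h2] at h11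
    have hM : Tendsto polarizationSum (𝓝[{k | minkSq .lightFront k ≠ 0}] k₀)
        (𝓝 (polarizationSum k₀)) :=
      (continuousAt_polarizationSum h0).tendsto.mono_left nhdsWithin_le_nhds
    have h3 := (h11.const_mul (-c)).smul hM
    rw [mul_zero, zero_smul] at h3
    exact hR (tendsto_nhds_unique h1 h3)
  have h3 : Tendsto (insertion S) (𝓝[{k | minkSq .lightFront k ≠ 0}] k₀)
      (𝓝 (1 - (c⁻¹ * R 1 1)⁻¹)) := by
    refine ((h11.inv₀ hL).const_sub 1).congr fun k => ?_
    rw [inv_inv, sub_sub_cancel]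
  have h4 := (h3.mul (tendsto_minkSq_offShell hs)).const_mul c⁻¹
  rw [mul_zero, mul_zero] at h4
  refine h4.congr' ?_
  filter_upwards [self_mem_nhdsWithin] with k hk
  have hkc : (minkSq .lightFront k : ℂ) ≠ 0 := by exact_mod_cast hk
  rw [insertion, ← hc]
  field_simp

/-- The same component 1 1, where equal residues mean (1 − c)⁻¹ → 1. -/
theorem ChargeNormalized.tendsto_insertion {S : E4 → ℂ} (h : ChargeNormalized S) {k₀ : E4}
    (hs : minkSq .lightFront k₀ = 0) (h0 : k₀ 0 ≠ 0) :
    Tendsto (insertion S) (𝓝[{k | minkSq .lightFront k ≠ 0}] k₀) (𝓝 0) := by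
  set c := (((2 * Real.pi : ℝ) : ℂ) ^ 2)⁻¹ with hc
  have hc0 : c ≠ 0 := two_pi_sq_inv_ne_zero
  have h1 := (tendsto_pi_nhds.1 (tendsto_pi_nhds.1 (h k₀ hs h0) 1) 1).const_mul c⁻¹
  have h2 : Tendsto (fun k => (1 - insertion S k)⁻¹) (𝓝[{k | minkSq .lightFront k ≠ 0}] k₀)
      (𝓝 1) := by
    have h3 := h1.add_const 1
    rw [Matrix.zero_apply, mul_zero, zero_add] at h3
    refine h3.congr' ?_
    filter_upwards [eventually_offShell h0] with k hk
    rw [smul_sub, smul_completePhoton S hk.1 hk.2, smul_freePhoton hk.1 hk.2, ← hc,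
      Matrix.sub_apply, Matrix.smul_apply, Matrix.smul_apply, polarizationSum_one_one, smul_eq_mul,
      smul_eq_mul]
    field_simp
    ring
  refine (((h2.inv₀ one_ne_zero).const_sub 1).congr fun k => by rw [inv_inv, sub_sub_cancel]).trans ?_
  simp

theorem tendsto_residue {S : E4 → ℂ} {k₀ : E4} (h0 : k₀ 0 ≠ 0)
    (h : Tendsto (insertion S) (𝓝[{k | minkSq .lightFront k ≠ 0}] k₀) (𝓝 0)) :
    Tendsto (fun k => (minkSq .lightFront k : ℂ) • completePhoton S k)
        (𝓝[{k | minkSq .lightFront k ≠ 0}] k₀)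
        (𝓝 ((-((((2 * Real.pi : ℝ) : ℂ) ^ 2)⁻¹)) • polarizationSum k₀)) ∧
      Tendsto (fun k => (minkSq .lightFront k : ℂ) • (completePhoton S k - freePhoton k))
        (𝓝[{k | minkSq .lightFront k ≠ 0}] k₀) (𝓝 0) := by
  have hM : Tendsto polarizationSum (𝓝[{k | minkSq .lightFront k ≠ 0}] k₀)
      (𝓝 (polarizationSum k₀)) :=
    (continuousAt_polarizationSum h0).tendsto.mono_left nhdsWithin_le_nhds
  have hinv := (h.const_sub 1).inv₀ (by simp)
  simp only [sub_zero, inv_one] at hinv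
  have h1 : Tendsto (fun k => (minkSq .lightFront k : ℂ) • completePhoton S k)
        (𝓝[{k | minkSq .lightFront k ≠ 0}] k₀)
        (𝓝 ((-((((2 * Real.pi : ℝ) : ℂ) ^ 2)⁻¹)) • polarizationSum k₀)) := by
    have h2 := (hinv.const_mul (-((((2 * Real.pi : ℝ) : ℂ) ^ 2)⁻¹))).smul hM
    rw [mul_one] at h2
    refine h2.congr' ?_
    filter_upwards [eventually_offShell h0] with k hk
    exact (smul_completePhoton S hk.1 hk.2).symm
  refine ⟨h1, ?_⟩
  have h2 := h1.sub (hM.const_smul (-((((2 * Real.pi : ℝ) : ℂ) ^ 2)⁻¹)))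
  rw [sub_self] at h2
  refine h2.congr' ?_
  filter_upwards [eventually_offShell h0] with k hk
  rw [smul_sub, smul_freePhoton hk.1 hk.2]

theorem ParityInvariant.eq_zero {e m : ℝ} {C₀ : ℂ} {C : Fin 4 → ℂ} {C₁ : ℂ}
    (h : ParityInvariant (modifiedScalar e m C₀ C C₁)) : C = 0 := by
  have hlin : ∀ k : E4, minkSq .lightFront k ≠ 0 → ∑ μ, C μ * (k μ : ℂ) = 0 := by
    intro k hk
    have h1 := h k hk
    simp only [modifiedScalar, minkSq_neg, PiLp.neg_apply, Complex.ofReal_neg, mul_neg,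
      Finset.sum_neg_distrib] at h1
    linear_combination (-1 / 2) * h1
  -- The even terms have dropped out; the linear form is tested on four vectors off the light cone
  -- that span the space.
  have ha := hlin !₂[1, 0, 0, 1] (by simp [minkSq_lightFront])
  have hb := hlin !₂[2, 0, 0, 1] (by simp [minkSq_lightFront])
  have hc := hlin !₂[0, 1, 0, 0] (by simp [minkSq_lightFront])
  have hd := hlin !₂[0, 0, 1, 0] (by simp [minkSq_lightFront])
  simp [Fin.sum_univ_four] at ha hb hc hd
  have h0 : C 0 = 0 := by linear_combination hb - ha
  have h3 : C 3 = 0 := by linear_combination ha - h0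
  funext i
  fin_cases i <;> simp [h0, hc, hd, h3]

theorem PhotonMassShell.eq_zero {e m : ℝ} (hm : 0 < m) {C₀ C₁ : ℂ}
    (h : PhotonMassShell (modifiedScalar e m C₀ 0 C₁)) : C₀ = 0 := by
  have hs : minkSq .lightFront (!₂[1, 0, 0, 0] : E4) = 0 := by simp [minkSq_lightFront]
  have h0 : (!₂[1, 0, 0, 0] : E4) 0 ≠ 0 := by simp
  have hne := neBot_offShell hs h0
  have h1 := tendsto_minkSq_offShell hs
  have h2 := ((((tendsto_piScalar_div e hm hs).mul h1).add_const C₀).add (h1.const_mul C₁))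
  rw [zero_mul, mul_zero, zero_add, add_zero] at h2
  refine tendsto_nhds_unique (h2.congr' ?_) (h.tendsto_zero hs h0)
  filter_upwards [self_mem_nhdsWithin] with k hk
  have hkc : (minkSq .lightFront k : ℂ) ≠ 0 := by exact_mod_cast hk
  simp only [modifiedScalar, Pi.zero_apply, zero_mul, Finset.sum_const_zero, add_zero]
  rw [div_mul_cancel₀ _ hkc]

theorem tendsto_insertion_modifiedScalar (e : ℝ) {m : ℝ} (hm : 0 < m) (C₁ : ℂ) {k₀ : E4}
    (hs : minkSq .lightFront k₀ = 0) :
    Tendsto (insertion (modifiedScalar e m 0 0 C₁)) (𝓝[{k | minkSq .lightFront k ≠ 0}] k₀)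
      (𝓝 ((((2 * Real.pi : ℝ) : ℂ) ^ 2)⁻¹ * C₁)) := by
  have h2 := ((tendsto_piScalar_div e hm hs).add_const C₁).const_mul (((2 * Real.pi : ℝ) : ℂ) ^ 2)⁻¹
  rw [zero_add] at h2
  refine h2.congr' ?_
  filter_upwards [self_mem_nhdsWithin] with k hk
  have hkc : (minkSq .lightFront k : ℂ) ≠ 0 := by exact_mod_cast hk
  simp only [insertion, modifiedScalar, Pi.zero_apply, zero_mul, Finset.sum_const_zero, add_zero]
  field_simp

/-- Once C₀ and C_μ vanish, the insertion tends to (2π)⁻²C₁ on the light cone, and charge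
normalization requires this limit to be 0. -/
theorem normalization_iff (e : ℝ) {m : ℝ} (hm : 0 < m) (C₀ : ℂ) (C : Fin 4 → ℂ) (C₁ : ℂ) :
    (ParityInvariant (modifiedScalar e m C₀ C C₁) ∧
      PhotonMassShell (modifiedScalar e m C₀ C C₁) ∧
      ChargeNormalized (modifiedScalar e m C₀ C C₁)) ↔ C₀ = 0 ∧ C = 0 ∧ C₁ = 0 := by
  constructor
  · rintro ⟨h1, h2, h3⟩
    obtain rfl := h1.eq_zero
    obtain rfl := h2.eq_zero hm
    refine ⟨rfl, rfl, ?_⟩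
    have hs : minkSq .lightFront (!₂[1, 0, 0, 0] : E4) = 0 := by simp [minkSq_lightFront]
    have h0 : (!₂[1, 0, 0, 0] : E4) 0 ≠ 0 := by simp
    have hne := neBot_offShell hs h0
    have h4 := tendsto_nhds_unique (tendsto_insertion_modifiedScalar e hm C₁ hs)
      (h3.tendsto_insertion hs h0)
    exact (mul_eq_zero.1 h4).resolve_left two_pi_sq_inv_ne_zero
  · rintro ⟨rfl, rfl, rfl⟩
    have h : ∀ k₀ : E4, minkSq .lightFront k₀ = 0 →
        Tendsto (insertion (modifiedScalar e m 0 0 0)) (𝓝[{k | minkSq .lightFront k ≠ 0}] k₀)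
          (𝓝 0) := by
      intro k₀ hs
      simpa using tendsto_insertion_modifiedScalar e hm 0 hs
    refine ⟨fun k _ => ?_, fun k₀ hs h0 => ⟨_, ?_, (tendsto_residue h0 (h k₀ hs)).1⟩,
      fun k₀ hs h0 => (tendsto_residue h0 (h k₀ hs)).2⟩
    · simp [modifiedScalar, minkSq_neg]
    · intro h1
      have h2 := congrFun (congrFun h1 1) 1
      rw [Matrix.smul_apply, polarizationSum_one_one, Matrix.zero_apply, smul_eq_mul] at h2
      have := two_pi_sq_inv_ne_zero
      simp_all

/-! ### Traces of Dirac matrices -/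

section Ring

variable {R : Type*} [Ring R] {a b c d : R}

/-- The product of four anticommuting elements anticommutes with each of them. -/
theorem chirality_anticomm (hab : b * a = -(a * b)) (hac : c * a = -(a * c)) (had : d * a = -(a * d))
    (hbc : c * b = -(b * c)) (hbd : d * b = -(b * d)) (hcd : d * c = -(c * d)) :
    (a * b * c * d) * a = -(a * (a * b * c * d)) ∧ (a * b * c * d) * b = -(b * (a * b * c * d)) ∧
      (a * b * c * d) * c = -(c * (a * b * c * d)) ∧ (a * b * c * d) * d = -(d * (a * b * c * d)) := by
  have hab' : ∀ x, b * (a * x) = -(a * (b * x)) := fun x => by rw [← mul_assoc, hab]; noncomm_ring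
  have hac' : ∀ x, c * (a * x) = -(a * (c * x)) := fun x => by rw [← mul_assoc, hac]; noncomm_ring
  have had' : ∀ x, d * (a * x) = -(a * (d * x)) := fun x => by rw [← mul_assoc, had]; noncomm_ring
  have hbc' : ∀ x, c * (b * x) = -(b * (c * x)) := fun x => by rw [← mul_assoc, hbc]; noncomm_ring
  have hbd' : ∀ x, d * (b * x) = -(b * (d * x)) := fun x => by rw [← mul_assoc, hbd]; noncomm_ring
  have hcd' : ∀ x, d * (c * x) = -(c * (d * x)) := fun x => by rw [← mul_assoc, hcd]; noncomm_ring
  refine ⟨?_, ?_, ?_, ?_⟩ <;>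
    simp only [mul_assoc, had, hbd, hcd, hab', hac', had', hbc', hbd', hcd', mul_neg,
      neg_neg]

/-- Reordering takes six transpositions, an even number, and the squares contribute 1 · (−1)³. -/
theorem chirality_sq (hab : b * a = -(a * b)) (hac : c * a = -(a * c)) (had : d * a = -(a * d))
    (hbc : c * b = -(b * c)) (hbd : d * b = -(b * d)) (hcd : d * c = -(c * d))
    (ha : a * a = 1) (hb : b * b = -1) (hc : c * c = -1) (hd : d * d = -1) :
    (a * b * c * d) * (a * b * c * d) = -1 := by
  have hab' : ∀ x, b * (a * x) = -(a * (b * x)) := fun x => by rw [← mul_assoc, hab]; noncomm_ring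
  have hac' : ∀ x, c * (a * x) = -(a * (c * x)) := fun x => by rw [← mul_assoc, hac]; noncomm_ring
  have had' : ∀ x, d * (a * x) = -(a * (d * x)) := fun x => by rw [← mul_assoc, had]; noncomm_ring
  have hbc' : ∀ x, c * (b * x) = -(b * (c * x)) := fun x => by rw [← mul_assoc, hbc]; noncomm_ring
  have hbd' : ∀ x, d * (b * x) = -(b * (d * x)) := fun x => by rw [← mul_assoc, hbd]; noncomm_ring
  have hcd' : ∀ x, d * (c * x) = -(c * (d * x)) := fun x => by rw [← mul_assoc, hcd]; noncomm_ring
  have ha' : ∀ x, a * (a * x) = x := fun x => by rw [← mul_assoc, ha, one_mul]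
  have hb' : ∀ x, b * (b * x) = -x := fun x => by rw [← mul_assoc, hb, neg_one_mul]
  have hc' : ∀ x, c * (c * x) = -x := fun x => by rw [← mul_assoc, hc, neg_one_mul]
  simp only [mul_assoc, hab', hac', had', hbc', hbd', hcd', ha', hb', hc', hd, mul_neg, neg_neg]

end Ring

/-- There is an invertible matrix anticommuting with all Dirac matrices. -/
def HasChirality (γ : Fin 4 → Matrix (Fin 4) (Fin 4) ℂ) : Prop :=
  ∃ G : Matrix (Fin 4) (Fin 4) ℂ, G * G = -1 ∧ ∀ μ, G * γ μ = -(γ μ * G)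

theorem IsDirac.hasChirality_instant {γ : Fin 4 → Matrix (Fin 4) (Fin 4) ℂ}
    (h : IsDirac .instant γ) : HasChirality γ := by
  have hanti : ∀ μ ν, metric .instant μ ν = 0 → γ ν * γ μ = -(γ μ * γ ν) := by
    intro μ ν h0
    have h1 := h ν μ
    rw [metric_comm, h0] at h1
    simp only [mul_zero, Complex.ofReal_zero, zero_smul] at h1
    exact eq_neg_of_add_eq_zero_left h1
  have hsq : ∀ μ, γ μ * γ μ = ((metric .instant μ μ : ℝ) : ℂ) • (1 : Matrix (Fin 4) (Fin 4) ℂ) := by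
    intro μ
    have h1 := h μ μ
    rw [← two_smul ℂ (γ μ * γ μ)] at h1
    have h2 := congrArg (fun M => (2 : ℂ)⁻¹ • M) h1
    simp only [smul_smul] at h2
    rw [inv_mul_cancel₀ two_ne_zero, one_smul] at h2
    rw [h2]
    congr 1
    push_cast
    ring
  have h01 := hanti 0 1 (by simp [metric])
  have h02 := hanti 0 2 (by simp [metric])
  have h03 := hanti 0 3 (by simp [metric])
  have h12 := hanti 1 2 (by simp [metric])
  have h13 := hanti 1 3 (by simp [metric])
  have h23 := hanti 2 3 (by simp [metric])
  refine ⟨γ 0 * γ 1 * γ 2 * γ 3, chirality_sq h01 h02 h03 h12 h13 h23 ?_ ?_ ?_ ?_, ?_⟩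
  · rw [hsq 0]; simp [metric]
  · rw [hsq 1]; simp [metric]
  · rw [hsq 2]; simp [metric]
  · rw [hsq 3]; simp [metric]
  · obtain ⟨h0, h1, h2, h3⟩ := chirality_anticomm h01 h02 h03 h12 h13 h23
    intro μ
    fin_cases μ
    exacts [h0, h1, h2, h3]

theorem IsDirac.sum_anticomm {F : Form} {γ : Fin 4 → Matrix (Fin 4) (Fin 4) ℂ} (h : IsDirac F γ)
    (a b : Fin 4 → ℂ) : (∑ α, a α • γ α) * (∑ β, b β • γ β) + (∑ β, b β • γ β) * (∑ α, a α • γ α) =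
      (2 * ∑ α, ∑ β, a α * b β * (metric F α β : ℂ)) • 1 := by
  rw [Finset.sum_mul_sum, Finset.sum_mul_sum]
  rw [Finset.sum_comm (f := fun β α => b β • γ β * a α • γ α), ← Finset.sum_add_distrib]
  simp only [← Finset.sum_add_distrib]
  have h1 : ∀ α β, a α • γ α * b β • γ β + b β • γ β * a α • γ α =
      (2 * (a α * b β * (metric F α β : ℂ))) • (1 : Matrix (Fin 4) (Fin 4) ℂ) := by
    intro α β
    rw [smul_mul_smul_comm, smul_mul_smul_comm, mul_comm (b β), ← smul_add, h α β, smul_smul]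
    congr 1
    push_cast
    ring
  simp only [h1, ← Finset.sum_smul, ← Finset.mul_sum]

/-- The involution Λ that mixes the ± components turns light-front Dirac matrices into instant-form
ones. Anticommutation is linear in γ, so the same G serves for the original matrices. -/
theorem IsDirac.hasChirality {F : Form} {γ : Fin 4 → Matrix (Fin 4) (Fin 4) ℂ}
    (h : IsDirac F γ) : HasChirality γ := by
  cases F
  · set r : ℂ := ((√2 : ℝ) : ℂ)⁻¹ with hr
    have hr2 : r ^ 2 = 1 / 2 := by
      rw [hr, inv_pow, ← Complex.ofReal_pow, Real.sq_sqrt (by norm_num)]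
      norm_num
    set Λ : Matrix (Fin 4) (Fin 4) ℂ := !![r, 0, 0, r; 0, 1, 0, 0; 0, 0, 1, 0; r, 0, 0, -r] with hΛ
    set γ' : Fin 4 → Matrix (Fin 4) (Fin 4) ℂ := fun μ => ∑ α, Λ μ α • γ α with hγ'
    have h' : IsDirac .instant γ' := by
      intro μ ν
      rw [hγ', h.sum_anticomm]
      congr 1
      fin_cases μ <;> fin_cases ν <;>
        simp [hΛ, metric, Fin.sum_univ_four] <;> ring_nf <;> simp [hr2] <;> norm_num
    obtain ⟨G, hG, hGγ⟩ := h'.hasChirality_instant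
    refine ⟨G, hG, fun μ => ?_⟩
    have h1 : γ μ = ∑ ν, Λ μ ν • γ' ν := by
      simp only [hγ', Fin.sum_univ_four, smul_add, smul_smul]
      fin_cases μ <;> simp [hΛ, ← sq, hr2] <;> module
    rw [h1, Finset.mul_sum, Finset.sum_mul, ← Finset.sum_neg_distrib]
    refine Finset.sum_congr rfl fun ν _ => ?_
    rw [Matrix.mul_smul, hGγ, Matrix.smul_mul, smul_neg]
  · exact h.hasChirality_instant

/-- An odd product M anticommutes with G. Then tr(GMG) is −tr M by cyclicity and G² = −1, and tr M
by anticommutation. -/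
theorem IsDirac.trace_three {F : Form} {γ : Fin 4 → Matrix (Fin 4) (Fin 4) ℂ}
    (h : IsDirac F γ) (a b c : Fin 4) : (γ a * γ b * γ c).trace = 0 := by
  obtain ⟨G, hG, hGγ⟩ := h.hasChirality
  set M := γ a * γ b * γ c with hM
  have h1 : G * M = -(M * G) := by
    rw [hM, ← mul_assoc, ← mul_assoc, hGγ a, neg_mul, neg_mul, mul_assoc (γ a), hGγ b, mul_neg,
      neg_mul, neg_neg, ← mul_assoc, mul_assoc _ G, hGγ c, mul_neg, mul_assoc]
    simp only [mul_assoc]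
  have h2 : (G * M * G).trace = -M.trace := by
    rw [Matrix.trace_mul_comm, ← mul_assoc, hG, neg_one_mul, Matrix.trace_neg]
  have h3 : (G * M * G).trace = M.trace := by
    rw [h1, neg_mul, mul_assoc, hG, mul_neg_one, neg_neg]
  rw [h2] at h3
  exact CharZero.neg_eq_self_iff.1 h3

theorem IsDirac.trace_two {F : Form} {γ : Fin 4 → Matrix (Fin 4) (Fin 4) ℂ}
    (h : IsDirac F γ) (a b : Fin 4) : (γ a * γ b).trace = 4 * (metric F a b : ℂ) := by
  have h1 := congrArg Matrix.trace (h a b)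
  rw [Matrix.trace_add, Matrix.trace_mul_comm (γ b), Matrix.trace_smul, Matrix.trace_one] at h1
  simp only [Fintype.card_fin, smul_eq_mul] at h1
  push_cast at h1
  linear_combination h1 / 2

/-- The first matrix is moved past the other three, with a trace of two at each step; cyclicity
returns the original trace with the opposite sign. -/
theorem IsDirac.trace_four {F : Form} {γ : Fin 4 → Matrix (Fin 4) (Fin 4) ℂ}
    (h : IsDirac F γ) (a b c d : Fin 4) : (γ a * γ b * γ c * γ d).trace =
      4 * ((metric F a b : ℂ) * metric F c d - (metric F a c : ℂ) * metric F b d +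
        (metric F a d : ℂ) * metric F b c) := by
  have hexp : ∀ μ ν, γ μ * γ ν = ((2 * metric F μ ν : ℝ) : ℂ) • 1 - γ ν * γ μ :=
    fun μ ν => eq_sub_of_add_eq (h μ ν)
  have h1 : (γ a * γ b * γ c * γ d).trace =
      2 * (metric F a b : ℂ) * (γ c * γ d).trace - (γ b * γ a * γ c * γ d).trace := by
    rw [hexp a b]
    simp only [sub_mul, Matrix.smul_mul, one_mul, Matrix.trace_sub, Matrix.trace_smul, smul_eq_mul]
    push_cast
    ring
  have h2 : (γ b * γ a * γ c * γ d).trace =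
      2 * (metric F a c : ℂ) * (γ b * γ d).trace - (γ b * γ c * γ a * γ d).trace := by
    rw [mul_assoc (γ b), hexp a c]
    simp only [sub_mul, mul_sub, Matrix.smul_mul, Matrix.mul_smul, mul_one, Matrix.trace_sub,
      Matrix.trace_smul, smul_eq_mul, mul_assoc]
    push_cast
    ring
  have h3 : (γ b * γ c * γ a * γ d).trace =
      2 * (metric F a d : ℂ) * (γ b * γ c).trace - (γ a * γ b * γ c * γ d).trace := by
    rw [mul_assoc (γ b * γ c), hexp a d]
    simp only [mul_sub, Matrix.mul_smul, mul_one, Matrix.trace_sub, Matrix.trace_smul, smul_eq_mul]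
    rw [← mul_assoc, Matrix.trace_mul_comm (γ b * γ c * γ d)]
    simp only [← mul_assoc]
    push_cast
    ring
  simp only [h.trace_two] at h1 h2 h3
  linear_combination h1 / 2 - h2 / 2 + h3 / 2

theorem IsDirac.trace_loop {F : Form} {γ : Fin 4 → Matrix (Fin 4) (Fin 4) ℂ}
    (h : IsDirac F γ) (m : ℝ) (μ ν : Fin 4) (p q : E4) :
    (γ μ * (slash F γ p + (m : ℂ) • 1) * γ ν * (slash F γ q + (m : ℂ) • 1)).trace =
      ((4 * (p μ * q ν + p ν * q μ - metric F μ ν * (minkDot F p q - m ^ 2)) : ℝ) : ℂ) := by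
  have hraise : ∀ (k : E4) (ρ : Fin 4),
      ∑ α, ((lowerIndex F k α : ℝ) : ℂ) * (metric F ρ α : ℂ) = (k ρ : ℂ) := by
    intro k ρ
    have := sum_lowerIndex_mul_metric F k ρ
    simp only [metric_comm F _ ρ] at this
    exact_mod_cast this
  have h4 : (γ μ * slash F γ p * γ ν * slash F γ q).trace =
      4 * ((p μ : ℂ) * q ν - (metric F μ ν : ℂ) * minkDot F p q + q μ * p ν) := by
    have e1 : (γ μ * slash F γ p * γ ν * slash F γ q).trace =
        ∑ α, ∑ β, ((lowerIndex F p α : ℝ) : ℂ) * ((lowerIndex F q β : ℝ) : ℂ) *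
          (γ μ * γ α * γ ν * γ β).trace := by
      simp only [slash, Finset.mul_sum, Finset.sum_mul, Matrix.trace_sum, Matrix.mul_smul,
        Matrix.smul_mul, Matrix.trace_smul, smul_eq_mul, mul_assoc]
      rw [Finset.sum_comm]
      refine Finset.sum_congr rfl fun α _ => Finset.sum_congr rfl fun β _ => ?_
      ring
    have e2 : (minkDot F p q : ℂ) = ∑ α, ((lowerIndex F p α : ℝ) : ℂ) *
        ∑ β, ((lowerIndex F q β : ℝ) : ℂ) * (metric F α β : ℂ) := by
      simp only [hraise]
      rw [minkDot]
      push_cast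
      rfl
    rw [e1, ← hraise p μ, ← hraise q ν, ← hraise q μ, ← hraise p ν, e2]
    simp only [h.trace_four, Fin.sum_univ_four, metric_comm F _ ν]
    ring
  have h3 : (γ μ * slash F γ p * γ ν).trace = 0 := by
    simp only [slash, Finset.mul_sum, Finset.sum_mul, Matrix.trace_sum, Matrix.mul_smul,
      Matrix.smul_mul, Matrix.trace_smul, h.trace_three, smul_zero, Finset.sum_const_zero]
  have h3' : (γ μ * γ ν * slash F γ q).trace = 0 := by
    simp only [slash, Finset.mul_sum, Matrix.trace_sum, Matrix.mul_smul,
      Matrix.trace_smul, h.trace_three, smul_zero, Finset.sum_const_zero]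
  simp only [mul_add, add_mul, Matrix.mul_smul, Matrix.smul_mul, mul_one, Matrix.trace_add,
    Matrix.trace_smul, h4, h3, h3', h.trace_two, smul_eq_mul]
  push_cast
  ring

/-- The prefactors i/2π and −i/2π multiply to 1/4π², which with the 4 of the trace gives 1/π². The
second argument is −q so that q, like p, can be taken on the positive mass shell. -/
theorem IsDirac.trace_fermionPart {F : Form} {γ : Fin 4 → Matrix (Fin 4) (Fin 4) ℂ}
    (h : IsDirac F γ) (m : ℝ) (μ ν : Fin 4) (p q : E4) :
    (γ μ * fermionPart F γ m 1 p * γ ν * fermionPart F γ m (-1) (-q)).trace =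
      (((metric F μ ν * (minkDot F p q + m ^ 2) - p μ * q ν - p ν * q μ) / Real.pi ^ 2 : ℝ) : ℂ) := by
  have hpi : (Real.pi : ℂ) ≠ 0 := by exact_mod_cast Real.pi_ne_zero
  simp only [fermionPart, Matrix.mul_smul, Matrix.smul_mul, smul_smul, Matrix.trace_smul,
    h.trace_loop, minkDot_neg_right, PiLp.neg_apply, smul_eq_mul]
  push_cast
  field_simp
  rw [Complex.I_sq]
  ring

/-! ### The two-particle phase space in light-front variables. -/

/-- The point `(p⁺, p¹, p², p⁻)` of the mass shell with given `(p¹, p², p⁻)`. -/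
def onShell (m : ℝ) (u : ℝ × ℝ × ℝ) : E4 :=
  !₂[(u.1 ^ 2 + u.2.1 ^ 2 + m ^ 2) / (2 * u.2.2), u.1, u.2.1, u.2.2]

@[fun_prop]
theorem measurable_onShell (m : ℝ) : Measurable (onShell m) := by
  unfold onShell
  fun_prop

/-- The density of the mass shell in the coordinates `(p¹, p², p⁻)`. -/
def shellWeight (u : ℝ × ℝ × ℝ) : ENNReal := if 0 < u.2.2 then ENNReal.ofReal (1 / (2 * u.2.2)) else 0

@[fun_prop]
theorem measurable_shellWeight : Measurable shellWeight :=
  Measurable.ite (measurableSet_lt measurable_const (by fun_prop)) (by fun_prop) measurable_const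

instance sFinite_massShell (F : Form) (m s : ℝ) : SFinite (massShell F m s) := by
  cases F <;> unfold massShell <;> infer_instance

theorem lintegral_massShell_lightFront (m : ℝ) {g : E4 → ENNReal} (hg : Measurable g) :
    ∫⁻ p, g p ∂massShell .lightFront m 1 = ∫⁻ u, shellWeight u * g (onShell m u) := by
  have hs : MeasurableSet {u : ℝ × ℝ × ℝ | 0 < 1 * u.2.2} :=
    measurableSet_lt measurable_const (by fun_prop)
  have h1 : massShell .lightFront m 1 =
      ((volume.restrict {u : ℝ × ℝ × ℝ | 0 < 1 * u.2.2}).withDensity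
      (fun u => ENNReal.ofReal (1 / (2 * |u.2.2|)))).map (onShell m) := rfl
  rw [h1, lintegral_map hg (by fun_prop), lintegral_withDensity_eq_lintegral_mul _ (by fun_prop)
    (by fun_prop), ← lintegral_indicator hs]
  refine lintegral_congr fun u => ?_
  by_cases hu : 0 < u.2.2
  · rw [Set.indicator_of_mem (by simpa using hu), shellWeight, if_pos hu, Pi.mul_apply,
      abs_of_pos hu]
  · rw [Set.indicator_of_notMem (by simpa using hu), shellWeight, if_neg hu, zero_mul]

theorem isAddRightInvariant_volume : (volume : Measure (ℝ × ℝ × ℝ)).IsAddRightInvariant := by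
  have h : (volume : Measure (ℝ × ℝ)).IsAddLeftInvariant :=
    Measure.prod.instIsAddLeftInvariant
  have h' : (volume : Measure (ℝ × ℝ × ℝ)).IsAddLeftInvariant :=
    Measure.prod.instIsAddLeftInvariant
  infer_instance

/-- The second momentum is replaced by the total of the independent components. The total plus
component is fixed by the mass shell and becomes a variable only through the radial integration. -/
theorem lintegral_massShell_prod (m : ℝ) {f : E4 × E4 → ENNReal} (hf : Measurable f) :
    ∫⁻ z, f z ∂(massShell .lightFront m 1).prod (massShell .lightFront m 1) =
      ∫⁻ k, ∫⁻ u, shellWeight u * shellWeight (k - u) * f (onShell m u, onShell m (k - u)) := by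
  rw [lintegral_prod _ hf.aemeasurable,
    lintegral_massShell_lightFront m (by fun_prop), ← lintegral_lintegral_swap (by fun_prop)]
  refine lintegral_congr fun u => ?_
  have := isAddRightInvariant_volume
  rw [lintegral_massShell_lightFront m (by fun_prop), ← lintegral_const_mul _ (by fun_prop),
    ← lintegral_sub_right_eq_self _ u]
  simp only [mul_assoc]

/-- The radius is exchanged for κ by r² = 2cκ − b, so that r dr = c dκ. Here κ will be the total
plus component. -/
theorem lintegral_mul_radius {h : ℝ → ENNReal} {b c : ℝ} (hc : 0 < c) :
    ∫⁻ r in Set.Ioi (0 : ℝ), ENNReal.ofReal r * h r =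
      ∫⁻ κ, if 0 < 2 * c * κ - b then ENNReal.ofReal c * h (√(2 * c * κ - b)) else 0 := by
  have himg : (fun r : ℝ => (r ^ 2 + b) / (2 * c)) '' Set.Ioi 0 = {κ | 0 < 2 * c * κ - b} := by
    ext κ
    simp only [Set.mem_image, Set.mem_Ioi, Set.mem_ofPred_eq]
    constructor
    · rintro ⟨r, hr, rfl⟩
      field_simp
      nlinarith
    · intro h
      refine ⟨√(2 * c * κ - b), Real.sqrt_pos.2 h, ?_⟩
      rw [Real.sq_sqrt h.le]
      field_simp
      ring
  have hmeas : MeasurableSet {κ : ℝ | 0 < 2 * c * κ - b} :=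
    measurableSet_lt measurable_const (by fun_prop)
  have hinj : Set.InjOn (fun r : ℝ => (r ^ 2 + b) / (2 * c)) (Set.Ioi 0) := by
    intro r hr r' hr' h
    simp only [Set.mem_Ioi] at hr hr' h
    have : r ^ 2 = r' ^ 2 := by
      field_simp at h
      linarith
    exact (pow_left_inj₀ hr.le hr'.le two_ne_zero).1 this
  have hder : ∀ r ∈ Set.Ioi (0 : ℝ),
      HasDerivWithinAt (fun r : ℝ => (r ^ 2 + b) / (2 * c)) (r / c) (Set.Ioi 0) r := by
    intro r _
    have := (((hasDerivAt_pow 2 r).add_const b).div_const (2 * c)).hasDerivWithinAt (s := Set.Ioi 0)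
    refine this.congr_deriv ?_
    field_simp
    norm_num
  have key := lintegral_image_eq_lintegral_abs_deriv_mul measurableSet_Ioi hder hinj
    (fun κ => ENNReal.ofReal c * h (√(2 * c * κ - b)))
  rw [himg, ← lintegral_indicator hmeas] at key
  rw [show (∫⁻ κ, if 0 < 2 * c * κ - b then ENNReal.ofReal c * h (√(2 * c * κ - b)) else 0) = _ from key]
  refine setLIntegral_congr_fun measurableSet_Ioi fun r hr => ?_
  have hr : 0 < r := hr
  have h1 : 2 * c * ((r ^ 2 + b) / (2 * c)) - b = r ^ 2 := by field_simp; ring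
  rw [h1, Real.sqrt_sq hr.le, ← mul_assoc, abs_of_pos (by positivity),
    ← ENNReal.ofReal_mul (by positivity), div_mul_cancel₀ _ hc.ne']

/-- The transverse momentum in the polar coordinates of the relative momentum. -/
theorem lintegral_plane {g : ℝ × ℝ → ENNReal} (hg : Measurable g) {b c : ℝ} (hc : 0 < c) (v : ℝ × ℝ) :
    ∫⁻ w, g w = ∫⁻ φ in Set.Ioo (-Real.pi) Real.pi, ∫⁻ κ, if 0 < 2 * c * κ - b then
      ENNReal.ofReal c * g (v.1 + √(2 * c * κ - b) * Real.cos φ,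
        v.2 + √(2 * c * κ - b) * Real.sin φ) else 0 := by
  rw [← lintegral_add_left_eq_self g v, ← lintegral_comp_polarCoord_symm, polarCoord_target,
    Measure.volume_eq_prod, ← Measure.prod_restrict, lintegral_prod_symm' _ (by fun_prop)]
  refine lintegral_congr fun φ => ?_
  rw [← lintegral_mul_radius hc (h := fun r => g (v.1 + r * Real.cos φ, v.2 + r * Real.sin φ))]
  rfl

theorem lintegral_mul_pos {G : ℝ → ENNReal} (hG : Measurable G) {c : ℝ} (hc : 0 < c) :
    ∫⁻ t, G t = ENNReal.ofReal c * ∫⁻ x, G (x * c) := by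
  conv_lhs => rw [← Real.smul_map_volume_mul_right hc.ne']
  rw [lintegral_smul_measure, lintegral_map hG (by fun_prop), abs_of_pos hc, smul_eq_mul]

theorem lintegral_triple {g : ℝ × ℝ × ℝ → ENNReal} (hg : Measurable g) :
    ∫⁻ u, g u = ∫⁻ t, ∫⁻ w : ℝ × ℝ, g (w.1, w.2, t) := by
  rw [Measure.volume_eq_prod, lintegral_prod _ hg.aemeasurable]
  have h1 : ∀ x, ∫⁻ y : ℝ × ℝ, g (x, y) = ∫⁻ t, ∫⁻ y, g (x, y, t) := fun x => by
    rw [Measure.volume_eq_prod, lintegral_prod_symm' _ (by fun_prop)]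
  simp only [h1]
  rw [lintegral_lintegral_swap (by fun_prop)]
  refine lintegral_congr fun t => ?_
  rw [Measure.volume_eq_prod, lintegral_prod _ (by fun_prop)]

/-- The kinematic region of the phase space at total momentum `(κ, k)`, in terms of the momentum
fraction `x`. -/
def phaseDomain (m : ℝ) : Set ((ℝ × ℝ × ℝ × ℝ) × ℝ × ℝ) :=
  {z | 0 < z.1.2.2.2 ∧ (0 < z.2.1 ∧ z.2.1 < 1) ∧ (-Real.pi < z.2.2 ∧ z.2.2 < Real.pi) ∧
    m ^ 2 < z.2.1 * (1 - z.2.1) *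
      (2 * z.1.1 * z.1.2.2.2 - z.1.2.1 ^ 2 - z.1.2.2.1 ^ 2)}

theorem measurableSet_phaseDomain (m : ℝ) : MeasurableSet (phaseDomain m) := by
  have h : ∀ {f g : (ℝ × ℝ × ℝ × ℝ) × ℝ × ℝ → ℝ}, Measurable f → Measurable g →
      MeasurableSet {z | f z < g z} := measurableSet_lt
  exact (h measurable_const (by fun_prop)).inter <|
    ((h measurable_const (by fun_prop)).inter (h (by fun_prop) measurable_const)).inter <|
    ((h measurable_const (by fun_prop)).inter (h (by fun_prop) measurable_const)).inter <|
    h measurable_const (by fun_prop)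

/-- The length of the relative transverse momentum. -/
def phaseRadius (m : ℝ) (z : (ℝ × ℝ × ℝ × ℝ) × ℝ × ℝ) : ℝ :=
  √(z.2.1 * (1 - z.2.1) * (2 * z.1.1 * z.1.2.2.2 - z.1.2.1 ^ 2 - z.1.2.2.1 ^ 2) - m ^ 2)

/-- The components `(p¹, p², p⁻)` of the first particle. -/
def phaseMomentum (m : ℝ) (z : (ℝ × ℝ × ℝ × ℝ) × ℝ × ℝ) : ℝ × ℝ × ℝ :=
  (z.2.1 * z.1.2.1 + phaseRadius m z * Real.cos z.2.2,
    z.2.1 * z.1.2.2.1 + phaseRadius m z * Real.sin z.2.2, z.2.1 * z.1.2.2.2)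

@[fun_prop]
theorem measurable_phaseMomentum (m : ℝ) : Measurable (phaseMomentum m) := by
  unfold phaseMomentum phaseRadius
  fun_prop

/-- With u⁻ = xk⁻ and u_⊥ = xk_⊥ + r(cos φ, sin φ), the mass shells give r² = x(1 − x)(2κk⁻ − k_⊥²)
− m². The weights 1/(2xk⁻) and 1/(2(1 − x)k⁻) times the Jacobians k⁻ and x(1 − x)k⁻ leave the
constant 1/4. -/
theorem lintegral_shellWeight {m : ℝ} {g : ℝ × ℝ × ℝ → ENNReal} (hg : Measurable g)
    (k : ℝ × ℝ × ℝ) :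
    ∫⁻ u, shellWeight u * shellWeight (k - u) * g u = ∫⁻ κ, ∫⁻ y : ℝ × ℝ,
      (phaseDomain m).indicator (fun z => ENNReal.ofReal (1 / 4) * g (phaseMomentum m z))
        ((κ, k), y) := by
  have hmeas : Measurable ((phaseDomain m).indicator
      (fun z => ENNReal.ofReal (1 / 4) * g (phaseMomentum m z))) :=
    Measurable.indicator (by fun_prop) (measurableSet_phaseDomain m)
  by_cases hk : 0 < k.2.2
  swap
  · have h1 : ∀ u : ℝ × ℝ × ℝ, shellWeight u * shellWeight (k - u) = 0 := by
      intro u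
      by_cases hu : 0 < u.2.2
      · rw [shellWeight, shellWeight, if_neg (c := 0 < (k - u).2.2), mul_zero]
        simp only [Prod.snd_sub, not_lt] at hk ⊢
        linarith
      · rw [shellWeight, if_neg hu, zero_mul]
    have h2 : ∀ κ (y : ℝ × ℝ), ((κ, k), y) ∉ phaseDomain m := fun κ y h => hk h.1
    simp only [h1, Set.indicator_of_notMem (h2 _ _), zero_mul, lintegral_zero]
  have h3 : ∀ κ, ∫⁻ y : ℝ × ℝ, (phaseDomain m).indicator
      (fun z => ENNReal.ofReal (1 / 4) * g (phaseMomentum m z)) ((κ, k), y) =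
      ∫⁻ x, ∫⁻ φ, (phaseDomain m).indicator
      (fun z => ENNReal.ofReal (1 / 4) * g (phaseMomentum m z)) ((κ, k), (x, φ)) := fun κ => by
    rw [Measure.volume_eq_prod, lintegral_prod _ (by fun_prop)]
  simp only [h3]
  rw [lintegral_lintegral_swap (by fun_prop), lintegral_triple (by fun_prop),
    lintegral_mul_pos (by fun_prop) hk, ← lintegral_const_mul _ (by fun_prop)]
  refine lintegral_congr fun x => ?_
  rw [lintegral_lintegral_swap (by fun_prop)]
  by_cases hx : 0 < x ∧ x < 1
  swap
  · have h1 : ∀ w : ℝ × ℝ, shellWeight (w.1, w.2, x * k.2.2) *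
        shellWeight (k - (w.1, w.2, x * k.2.2)) = 0 := by
      intro w
      by_cases hx0 : 0 < x
      · rw [shellWeight, shellWeight, if_neg (c := 0 < (k - (w.1, w.2, x * k.2.2)).2.2), mul_zero]
        have : 1 ≤ x := by by_contra h; exact hx ⟨hx0, by linarith⟩
        simp only [Prod.snd_sub, not_lt]
        nlinarith
      · rw [shellWeight, if_neg, zero_mul]
        simp only [not_lt] at hx0 ⊢
        exact mul_nonpos_of_nonpos_of_nonneg hx0 hk.le
    have h2 : ∀ κ φ : ℝ, ((κ, k), (x, φ)) ∉ phaseDomain m := fun κ φ h => hx h.2.1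
    simp only [h1, Set.indicator_of_notMem (h2 _ _), zero_mul, lintegral_zero, mul_zero]
  have hc : 0 < x * (1 - x) * k.2.2 := mul_pos (mul_pos hx.1 (by linarith)) hk
  rw [lintegral_plane (b := x * (1 - x) * (k.1 ^ 2 + k.2.1 ^ 2) + m ^ 2) (by fun_prop) hc
    (x * k.1, x * k.2.1), ← lintegral_const_mul' _ _ ENNReal.ofReal_ne_top,
    ← lintegral_indicator measurableSet_Ioo]
  refine lintegral_congr fun φ => ?_
  by_cases hφ : φ ∈ Set.Ioo (-Real.pi) Real.pi
  swap
  · have h2 : ∀ κ : ℝ, ((κ, k), (x, φ)) ∉ phaseDomain m := fun κ h => hφ h.2.2.1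
    simp only [Set.indicator_of_notMem (h2 _), Set.indicator_of_notMem hφ, lintegral_zero]
  rw [Set.indicator_of_mem hφ, ← lintegral_const_mul' _ _ ENNReal.ofReal_ne_top]
  refine lintegral_congr fun κ => ?_
  have hiff : 2 * (x * (1 - x) * k.2.2) * κ - (x * (1 - x) * (k.1 ^ 2 + k.2.1 ^ 2) + m ^ 2) =
      x * (1 - x) * (2 * κ * k.2.2 - k.1 ^ 2 - k.2.1 ^ 2) - m ^ 2 := by ring
  rw [hiff]
  by_cases hd : 0 < x * (1 - x) * (2 * κ * k.2.2 - k.1 ^ 2 - k.2.1 ^ 2) - m ^ 2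
  swap
  · rw [if_neg hd, Set.indicator_of_notMem, mul_zero]
    exact fun h => hd (sub_pos.2 h.2.2.2)
  have hmem : ((κ, k), (x, φ)) ∈ phaseDomain m := ⟨hk, hx, hφ, sub_pos.1 hd⟩
  rw [if_pos hd, Set.indicator_of_mem hmem]
  rw [← mul_assoc, ← mul_assoc, ← mul_assoc]
  congr 1
  obtain ⟨hx0, hx1⟩ := hx
  have h1x : 0 < 1 - x := by linarith
  rw [shellWeight, shellWeight, if_pos (mul_pos hx0 hk), if_pos, ← ENNReal.ofReal_mul hk.le,
    ← ENNReal.ofReal_mul (mul_pos hk hc).le, ← ENNReal.ofReal_mul (by positivity)]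
  · congr 1
    simp only [Prod.snd_sub]
    rw [show k.2.2 - x * k.2.2 = (1 - x) * k.2.2 by ring]
    field_simp
    norm_num
  · simp only [Prod.snd_sub]
    nlinarith

/-- The momenta of the two particles. -/
def phasePair (m : ℝ) (z : (ℝ × ℝ × ℝ × ℝ) × ℝ × ℝ) : E4 × E4 :=
  (onShell m (phaseMomentum m z), onShell m (z.1.2 - phaseMomentum m z))

@[fun_prop]
theorem measurable_phasePair (m : ℝ) : Measurable (phasePair m) := by
  unfold phasePair
  fun_prop

/-- The two-particle phase space in terms of the total momentum. -/
theorem massShell_prod_massShell (m : ℝ) :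
    (massShell .lightFront m 1).prod (massShell .lightFront m 1) =
      (ENNReal.ofReal (1 / 4) • volume.restrict (phaseDomain m)).map (phasePair m) := by
  refine Measure.ext_of_lintegral _ fun f hf => ?_
  have hmeas : Measurable ((phaseDomain m).indicator
      (fun z => ENNReal.ofReal (1 / 4) * f (phasePair m z))) :=
    Measurable.indicator (by fun_prop) (measurableSet_phaseDomain m)
  have e1 : ∫⁻ z, (phaseDomain m).indicator
      (fun z => ENNReal.ofReal (1 / 4) * f (phasePair m z)) z = ∫⁻ K, ∫⁻ y, (phaseDomain m).indicator
      (fun z => ENNReal.ofReal (1 / 4) * f (phasePair m z)) (K, y) :=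
    lintegral_prod _ hmeas.aemeasurable
  have e2 : ∫⁻ K : ℝ × ℝ × ℝ × ℝ, ∫⁻ y, (phaseDomain m).indicator
      (fun z => ENNReal.ofReal (1 / 4) * f (phasePair m z)) (K, y) =
      ∫⁻ k, ∫⁻ κ, ∫⁻ y, (phaseDomain m).indicator
      (fun z => ENNReal.ofReal (1 / 4) * f (phasePair m z)) ((κ, k), y) :=
    lintegral_prod_symm' _ (by fun_prop)
  rw [lintegral_massShell_prod m hf, lintegral_map hf (by fun_prop), lintegral_smul_measure,
    smul_eq_mul, ← lintegral_const_mul _ (by fun_prop),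
    ← lintegral_indicator (measurableSet_phaseDomain m), e1, e2]
  refine lintegral_congr fun k => ?_
  rw [lintegral_shellWeight (g := fun u => f (onShell m u, onShell m (k - u))) (by fun_prop)]
  rfl

/-! ### Reflection of the mass shell and passage between the two forms. -/

theorem isNegInvariant_volume : (volume : Measure (ℝ × ℝ × ℝ)).IsNegInvariant := by
  have h : MeasurePreserving (Neg.neg : ℝ → ℝ) volume volume := Measure.measurePreserving_neg volume
  exact ⟨(h.prod (h.prod h)).map_eq⟩

/-- The instant-form mass shell of positive energy. -/
def instantShell (m : ℝ) (u : ℝ × ℝ × ℝ) : E4 :=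
  !₂[√(u.1 ^ 2 + u.2.1 ^ 2 + u.2.2 ^ 2 + m ^ 2), u.1, u.2.1, u.2.2]

@[fun_prop]
theorem measurable_instantShell (m : ℝ) : Measurable (instantShell m) := by
  unfold instantShell
  fun_prop

theorem lintegral_massShell_instant (m : ℝ) {g : E4 → ENNReal} (hg : Measurable g) :
    ∫⁻ p, g p ∂massShell .instant m 1 = ∫⁻ u : ℝ × ℝ × ℝ,
      ENNReal.ofReal (1 / (2 * √(u.1 ^ 2 + u.2.1 ^ 2 + u.2.2 ^ 2 + m ^ 2))) *
        g (instantShell m u) := by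
  have h1 : massShell .instant m 1 = ((volume : Measure (ℝ × ℝ × ℝ)).withDensity
      (fun u => ENNReal.ofReal (1 / (2 * √(u.1 ^ 2 + u.2.1 ^ 2 + u.2.2 ^ 2 + m ^ 2))))).map
      (instantShell m) := by
    unfold instantShell
    simp only [massShell, one_mul]
  rw [h1, lintegral_map hg (by fun_prop), lintegral_withDensity_eq_lintegral_mul _ (by fun_prop)
    (by fun_prop)]
  rfl

theorem massShell_neg_one (F : Form) (m : ℝ) :
    massShell F m (-1) = (massShell F m 1).map (fun p => -p) := by
  have := isNegInvariant_volume
  refine Measure.ext_of_lintegral _ fun g hg => ?_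
  rw [lintegral_map hg (by fun_prop)]
  cases F
  · have hs : MeasurableSet {u : ℝ × ℝ × ℝ | 0 < -1 * u.2.2} :=
      measurableSet_lt measurable_const (by fun_prop)
    have h1 : massShell .lightFront m (-1) =
      ((volume.restrict {u : ℝ × ℝ × ℝ | 0 < -1 * u.2.2}).withDensity
      (fun u => ENNReal.ofReal (1 / (2 * |u.2.2|)))).map (onShell m) := rfl
    rw [h1, lintegral_map hg (by fun_prop), lintegral_withDensity_eq_lintegral_mul _ (by fun_prop)
      (by fun_prop), ← lintegral_indicator hs, lintegral_massShell_lightFront m (by fun_prop),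
      ← lintegral_neg_eq_self]
    refine lintegral_congr fun u => ?_
    have hneg : onShell m (-u) = -onShell m u := by
      ext i
      fin_cases i <;> simp [onShell]
      ring
    by_cases hu : 0 < u.2.2
    · rw [Set.indicator_of_mem (by simpa using hu), shellWeight, if_pos hu, Pi.mul_apply, hneg,
        Prod.snd_neg, Prod.snd_neg, abs_neg, abs_of_pos hu]
    · rw [Set.indicator_of_notMem (by simpa using hu), shellWeight, if_neg hu, zero_mul]
  · have h1 : massShell .instant m (-1) = ((volume : Measure (ℝ × ℝ × ℝ)).withDensity
      (fun u => ENNReal.ofReal (1 / (2 * √(u.1 ^ 2 + u.2.1 ^ 2 + u.2.2 ^ 2 + m ^ 2))))).map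
      (fun u => -instantShell m (-u)) := by
      simp only [massShell]
      congr 1
      ext u i
      fin_cases i <;> simp [instantShell]
    rw [h1, lintegral_map hg (by fun_prop), lintegral_withDensity_eq_lintegral_mul _ (by fun_prop)
      (by fun_prop), lintegral_massShell_instant m (by fun_prop), ← lintegral_neg_eq_self]
    refine lintegral_congr fun u => ?_
    simp

/-- The longitudinal light-front momentum in terms of the third component. -/
theorem lintegral_longitudinal {h : ℝ → ENNReal} {M : ℝ} (hM : 0 < M) :
    ∫⁻ t, ENNReal.ofReal (1 / (2 * √(t ^ 2 + M))) * h ((√(t ^ 2 + M) - t) / √2) =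
      ∫⁻ y, if 0 < y then ENNReal.ofReal (1 / (2 * y)) * h y else 0 := by
  have h2 : (0 : ℝ) < √2 := by positivity
  have h22 : √2 ^ 2 = (2 : ℝ) := Real.sq_sqrt zero_le_two
  have hpos : ∀ t : ℝ, 0 < √(t ^ 2 + M) - t := fun t => by
    rw [sub_pos]
    exact lt_of_le_of_lt (le_abs_self t) (by
      rw [← Real.sqrt_sq_eq_abs]
      exact Real.sqrt_lt_sqrt (sq_nonneg t) (by linarith))
  have hE : ∀ t : ℝ, √(t ^ 2 + M) ^ 2 = t ^ 2 + M := fun t => Real.sq_sqrt (by positivity)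
  have hE0 : ∀ t : ℝ, 0 < √(t ^ 2 + M) := fun t => Real.sqrt_pos.2 (by positivity)
  -- The inverse substitution: y = p⁻ determines p⁺ = M/(2y), and t = p³ = (p⁺ − p⁻)/√2.
  have hleft : ∀ t, (M / (2 * ((√(t ^ 2 + M) - t) / √2)) - (√(t ^ 2 + M) - t) / √2) / √2 = t := by
    intro t
    have := (hpos t).ne'
    field_simp
    rw [h22]
    linear_combination (-2) * hE t
  have himg : (fun t => (√(t ^ 2 + M) - t) / √2) '' Set.univ = Set.Ioi 0 := by
    ext y
    simp only [Set.image_univ, Set.mem_range, Set.mem_Ioi]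
    constructor
    · rintro ⟨t, rfl⟩
      exact div_pos (hpos t) h2
    · intro hy
      refine ⟨(M / (2 * y) - y) / √2, ?_⟩
      have h3 : ((M / (2 * y) - y) / √2) ^ 2 + M = ((M / (2 * y) + y) / √2) ^ 2 := by
        rw [div_pow, div_pow, h22]
        field_simp
        ring
      rw [h3, Real.sqrt_sq (by positivity)]
      field_simp
      rw [h22]
      ring
  have hder : ∀ t ∈ (Set.univ : Set ℝ), HasDerivWithinAt (fun t => (√(t ^ 2 + M) - t) / √2)
      ((t / √(t ^ 2 + M) - 1) / √2) Set.univ t := by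
    intro t _
    have h3 := ((((hasDerivAt_pow 2 t).add_const M).sqrt (by positivity)).sub
      (hasDerivAt_id t)).div_const √2
    refine h3.hasDerivWithinAt.congr_deriv ?_
    have := hE0 t
    field_simp
    norm_num
    ring
  have key := lintegral_image_eq_lintegral_abs_deriv_mul MeasurableSet.univ hder
    (fun t _ t' _ htt => by
      have h3 := hleft t
      rw [show (√(t ^ 2 + M) - t) / √2 = (√(t' ^ 2 + M) - t') / √2 from htt, hleft t'] at h3
      exact h3.symm) (fun y => ENNReal.ofReal (1 / (2 * y)) * h y)
  rw [himg, ← lintegral_indicator measurableSet_Ioi, Measure.restrict_univ] at key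
  rw [show (∫⁻ y, if 0 < y then ENNReal.ofReal (1 / (2 * y)) * h y else 0) = _ from key]
  refine lintegral_congr fun t => ?_
  have h3 := hpos t
  have h4 := hE0 t
  have h5 : |(t / √(t ^ 2 + M) - 1) / √2| = (√(t ^ 2 + M) - t) / (√(t ^ 2 + M) * √2) := by
    rw [show (t / √(t ^ 2 + M) - 1) / √2 = -((√(t ^ 2 + M) - t) / (√(t ^ 2 + M) * √2)) by
      field_simp; ring, abs_neg, abs_of_pos (by positivity)]
  rw [h5, ← mul_assoc, ← ENNReal.ofReal_mul (by positivity)]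
  congr 2
  field_simp

theorem lintegral_triple' {g : ℝ × ℝ × ℝ → ENNReal} (hg : Measurable g) :
    ∫⁻ u, g u = ∫⁻ w : ℝ × ℝ, ∫⁻ t, g (w.1, w.2, t) := by
  rw [lintegral_triple hg, lintegral_lintegral_swap (by fun_prop)]

/-- From light-front components to those of the given form. -/
def fromLightFront : Form → (E4 ≃ₗᵢ[ℝ] E4)
  | .lightFront => LinearIsometryEquiv.refl ℝ E4
  | .instant => lightFrontEquiv

theorem minkDot_fromLightFront (F : Form) (x y : E4) :
    minkDot F (fromLightFront F x) (fromLightFront F y) = minkDot .lightFront x y := by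
  cases F
  · rfl
  · have := minkDot_toLightFront (toLightFront x) (toLightFront y)
    rw [toLightFront_toLightFront, toLightFront_toLightFront] at this
    exact this.symm

/-- At fixed transverse momentum dp³/(2p⁰) becomes dp⁻/(2p⁻). All loop integrals can therefore be
done in light-front variables, for either form. -/
theorem massShell_eq_map (F : Form) {m : ℝ} (hm : 0 < m) :
    massShell F m 1 = (massShell .lightFront m 1).map (fromLightFront F) := by
  cases F
  · exact Measure.map_id.symm
  refine Measure.ext_of_lintegral _ fun g hg => ?_
  have hL : Measurable (fromLightFront .instant) := (fromLightFront .instant).continuous.measurable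
  rw [lintegral_map hg hL, lintegral_massShell_instant m hg,
    lintegral_massShell_lightFront m (g := fun p => g (fromLightFront .instant p)) (hg.comp hL),
    lintegral_triple' (by fun_prop),
    lintegral_triple' (g := fun u => shellWeight u * g (fromLightFront .instant (onShell m u)))
      (measurable_shellWeight.mul (hg.comp (hL.comp (measurable_onShell m))))]
  refine lintegral_congr fun w => ?_
  have hM : 0 < w.1 ^ 2 + w.2 ^ 2 + m ^ 2 := by positivity
  have key := lintegral_longitudinal hM
    (h := fun y => g (fromLightFront .instant (onShell m (w.1, w.2, y))))
  simp only [shellWeight, ite_mul, zero_mul]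
  rw [← key]
  refine lintegral_congr fun t => ?_
  have h1 : w.1 ^ 2 + w.2 ^ 2 + t ^ 2 + m ^ 2 = t ^ 2 + (w.1 ^ 2 + w.2 ^ 2 + m ^ 2) := by ring
  have h2 : fromLightFront .instant
      (onShell m (w.1, w.2, (√(t ^ 2 + (w.1 ^ 2 + w.2 ^ 2 + m ^ 2)) - t) / √2)) =
      instantShell m (w.1, w.2, t) := by
    have h3 : toLightFront (instantShell m (w.1, w.2, t)) =
        onShell m (w.1, w.2, (√(t ^ 2 + (w.1 ^ 2 + w.2 ^ 2 + m ^ 2)) - t) / √2) := by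
      have h22 : √2 ^ 2 = (2 : ℝ) := Real.sq_sqrt zero_le_two
      have hE : √(t ^ 2 + (w.1 ^ 2 + w.2 ^ 2 + m ^ 2)) ^ 2 = t ^ 2 + (w.1 ^ 2 + w.2 ^ 2 + m ^ 2) :=
        Real.sq_sqrt (by positivity)
      have hlt : t < √(t ^ 2 + (w.1 ^ 2 + w.2 ^ 2 + m ^ 2)) :=
        lt_of_le_of_lt (le_abs_self t) (by
          rw [← Real.sqrt_sq_eq_abs]
          exact Real.sqrt_lt_sqrt (sq_nonneg t) (by linarith))
      have hne := (sub_pos.2 hlt).ne'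
      ext i
      fin_cases i
      · simp [toLightFront, instantShell, onShell, h1]
        field_simp
        rw [h22]
        linear_combination 2 * hE
      · simp [toLightFront, instantShell, onShell]
      · simp [toLightFront, instantShell, onShell]
      · simp [toLightFront, instantShell, onShell, h1]
    rw [← h3]
    exact toLightFront_toLightFront _
  rw [h2, h1]

/-! ### Relative momentum and the loop integral at fixed total momentum. -/

/-- The vector with components `(κ, k¹, k², k⁻)`. -/
def totalMomentum (K : ℝ × ℝ × ℝ × ℝ) : E4 := !₂[K.1, K.2.1, K.2.2.1, K.2.2.2]

/-- The longitudinal vector in the decomposition of the relative momentum. -/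
def longVec (K : ℝ × ℝ × ℝ × ℝ) : E4 :=
  !₂[K.1 / 2 - minkSq .lightFront (totalMomentum K) / (2 * K.2.2.2), K.2.1 / 2, K.2.2.1 / 2,
    K.2.2.2 / 2]

/-- The first transverse vector in the decomposition of the relative momentum. -/
def transVec₁ (K : ℝ × ℝ × ℝ × ℝ) : E4 := !₂[K.2.1 / K.2.2.2, 1, 0, 0]

/-- The second transverse vector in the decomposition of the relative momentum. -/
def transVec₂ (K : ℝ × ℝ × ℝ × ℝ) : E4 := !₂[K.2.2.1 / K.2.2.2, 0, 1, 0]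

/-- Half the difference of the two momenta. -/
def relMomentum (m : ℝ) (z : (ℝ × ℝ × ℝ × ℝ) × ℝ × ℝ) : E4 :=
  (2 * z.2.1 - 1) • longVec z.1 + ((phaseRadius m z * Real.cos z.2.2) • transVec₁ z.1 +
    (phaseRadius m z * Real.sin z.2.2) • transVec₂ z.1)

theorem minkSq_totalMomentum (K : ℝ × ℝ × ℝ × ℝ) :
    minkSq .lightFront (totalMomentum K) = 2 * K.1 * K.2.2.2 - K.2.1 ^ 2 - K.2.2.1 ^ 2 := by
  rw [minkSq_lightFront]
  simp [totalMomentum]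

theorem minkSq_onShell (m : ℝ) {u : ℝ × ℝ × ℝ} (hu : u.2.2 ≠ 0) :
    minkSq .lightFront (onShell m u) = m ^ 2 := by
  rw [minkSq_lightFront]
  simp only [onShell, Fin.isValue, PiLp.toLp_apply, Matrix.cons_val]
  field_simp
  ring

theorem phaseRadius_sq {m : ℝ} {z : (ℝ × ℝ × ℝ × ℝ) × ℝ × ℝ} (hz : z ∈ phaseDomain m) :
    phaseRadius m z ^ 2 = z.2.1 * (1 - z.2.1) * minkSq .lightFront (totalMomentum z.1) - m ^ 2 := by
  rw [minkSq_totalMomentum]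
  exact Real.sq_sqrt (sub_nonneg.2 hz.2.2.2.le)

theorem phasePair_eq {m : ℝ} {z : (ℝ × ℝ × ℝ × ℝ) × ℝ × ℝ} (hz : z ∈ phaseDomain m) :
    phasePair m z = ((1 / 2 : ℝ) • totalMomentum z.1 + relMomentum m z,
      (1 / 2 : ℝ) • totalMomentum z.1 - relMomentum m z) := by
  have hR := phaseRadius_sq hz
  rw [minkSq_totalMomentum] at hR
  obtain ⟨hk, ⟨hx0, hx1⟩, -, -⟩ := hz
  have hcs := Real.sin_sq_add_cos_sq z.2.2
  have hx2 : 1 - z.2.1 ≠ 0 := by linarith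
  have hx3 : z.1.2.2.2 - z.2.1 * z.1.2.2.2 ≠ 0 := by
    rw [show z.1.2.2.2 - z.2.1 * z.1.2.2.2 = (1 - z.2.1) * z.1.2.2.2 by ring]
    exact mul_ne_zero hx2 hk.ne'
  have hk' := hk.ne'
  have hx' := hx0.ne'
  -- The mass is eliminated in favour of the radius, split by sin² + cos² = 1, so that the plus
  -- components become rational identities.
  have hm : m ^ 2 = z.2.1 * (1 - z.2.1) * (2 * z.1.1 * z.1.2.2.2 - z.1.2.1 ^ 2 - z.1.2.2.1 ^ 2) -
      phaseRadius m z ^ 2 * (Real.sin z.2.2 ^ 2 + Real.cos z.2.2 ^ 2) := by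
    rw [hcs, hR]; ring
  refine Prod.ext ?_ ?_
  · ext i
    fin_cases i
    · simp only [phasePair, onShell, phaseMomentum, relMomentum, longVec, transVec₁, transVec₂,
        minkSq_totalMomentum, hm]
      simp [totalMomentum]
      field_simp
      linear_combination phaseRadius m z ^ 2 * hcs
    all_goals
      simp [phasePair, onShell, phaseMomentum, relMomentum, longVec, transVec₁, transVec₂,
        totalMomentum]
      ring
  · ext i
    fin_cases i
    · simp only [phasePair, onShell, phaseMomentum, relMomentum, longVec, transVec₁, transVec₂,
        minkSq_totalMomentum, hm]
      simp [totalMomentum]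
      field_simp
      linear_combination phaseRadius m z ^ 2 * hcs
    all_goals
      simp [phasePair, onShell, phaseMomentum, relMomentum, longVec, transVec₁, transVec₂,
        totalMomentum]
      ring

/-- Both momenta are on shell, so the square of their sum is 2m² + 2 p · q. -/
theorem minkDot_phasePair {m : ℝ} {z : (ℝ × ℝ × ℝ × ℝ) × ℝ × ℝ} (hz : z ∈ phaseDomain m) :
    minkDot .lightFront (phasePair m z).1 (phasePair m z).2 + m ^ 2 =
      minkSq .lightFront (totalMomentum z.1) / 2 := by
  have hk : 0 < z.1.2.2.2 := hz.1
  have h0 : 0 < z.2.1 * z.1.2.2.2 := mul_pos hz.2.1.1 hk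
  have h1 : 0 < z.1.2.2.2 - z.2.1 * z.1.2.2.2 := by nlinarith [hz.2.1.2]
  have hp : minkSq .lightFront (phasePair m z).1 = m ^ 2 := minkSq_onShell m h0.ne'
  have hq : minkSq .lightFront (phasePair m z).2 = m ^ 2 := minkSq_onShell m h1.ne'
  have hK : totalMomentum z.1 = (phasePair m z).1 + (phasePair m z).2 := by
    rw [phasePair_eq hz]
    module
  rw [hK, minkSq, minkDot_add_left, minkDot_add_right, minkDot_add_right,
    minkDot_comm _ (phasePair m z).2 (phasePair m z).1]
  rw [minkSq] at hp hq
  rw [hp, hq]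
  ring

/-- A completeness relation: with s the square of K, the longitudinal and the two transverse vectors
are orthogonal to K and to each other, with squares −s/4, −1 and −1. -/
theorem transverse_lightFront_eq {K : ℝ × ℝ × ℝ × ℝ} (hK : K.2.2.2 ≠ 0) (μ ν : Fin 4) :
    transverse .lightFront μ ν (totalMomentum K) = -4 * (longVec K μ * longVec K ν) -
      minkSq .lightFront (totalMomentum K) *
        (transVec₁ K μ * transVec₁ K ν + transVec₂ K μ * transVec₂ K ν) := by
  rw [transverse, longVec, minkSq_totalMomentum]
  fin_cases μ <;> fin_cases ν <;>
    (simp [totalMomentum, transVec₁, transVec₂, metric]; try field_simp) <;> try ring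

theorem transverse_fromLightFront (F : Form) {K : ℝ × ℝ × ℝ × ℝ} (hK : K.2.2.2 ≠ 0) (μ ν : Fin 4) :
    transverse F μ ν (fromLightFront F (totalMomentum K)) =
      -4 * (fromLightFront F (longVec K) μ * fromLightFront F (longVec K) ν) -
      minkSq .lightFront (totalMomentum K) *
        (fromLightFront F (transVec₁ K) μ * fromLightFront F (transVec₁ K) ν +
          fromLightFront F (transVec₂ K) μ * fromLightFront F (transVec₂ K) ν) := by
  cases F
  · exact transverse_lightFront_eq hK μ ν
  have h := transverse_lightFront_eq hK
  have h22 : √2 ^ 2 = (2 : ℝ) := Real.sq_sqrt zero_le_two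
  have hL : ∀ x : E4, fromLightFront .instant x =
      !₂[(x 0 + x 3) / √2, x 1, x 2, (x 0 - x 3) / √2] := fun _ => rfl
  have hsq : minkSq .instant (fromLightFront .instant (totalMomentum K)) =
      minkSq .lightFront (totalMomentum K) := minkDot_fromLightFront _ _ _
  simp only [transverse] at h ⊢
  rw [hsq]
  generalize minkSq .lightFront (totalMomentum K) = s at h ⊢
  simp only [hL]
  generalize totalMomentum K = k at h ⊢
  generalize longVec K = a at h ⊢
  generalize transVec₁ K = b at h ⊢
  generalize transVec₂ K = c at h ⊢
  have h00 := h 0 0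
  have h01 := h 0 1
  have h02 := h 0 2
  have h03 := h 0 3
  have h11 := h 1 1
  have h12 := h 1 2
  have h13 := h 1 3
  have h22' := h 2 2
  have h23 := h 2 3
  have h33 := h 3 3
  simp [metric] at h00 h01 h02 h03 h11 h12 h13 h22' h23 h33
  fin_cases μ <;> fin_cases ν <;> simp [metric] <;> field_simp <;> (try rw [h22])
  · linear_combination h00 + 2 * h03 + h33
  · linear_combination h01 + h13
  · linear_combination h02 + h23
  · linear_combination h00 - h33
  · linear_combination h01 + h13
  · linear_combination h11
  · linear_combination h12
  · linear_combination h01 - h13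
  · linear_combination h02 + h23
  · linear_combination h12
  · linear_combination h22'
  · linear_combination h02 - h23
  · linear_combination h00 - h33
  · linear_combination h01 - h13
  · linear_combination h02 - h23
  · linear_combination h00 - 2 * h03 + h33

/-- The trace of the fermion loop on the two-particle phase space. -/
def loopKernel (F : Form) (m : ℝ) (μ ν : Fin 4) (z : (ℝ × ℝ × ℝ × ℝ) × ℝ × ℝ) : ℝ :=
  (transverse F μ ν (fromLightFront F (totalMomentum z.1)) / 2 +
    2 * (fromLightFront F (relMomentum m z) μ * fromLightFront F (relMomentum m z) ν)) / Real.pi ^ 2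

theorem minkSq_fromLightFront (F : Form) (k : E4) :
    minkSq F (fromLightFront F k) = minkSq .lightFront k := minkDot_fromLightFront F k k

theorem freq_fromLightFront_pos_iff (F : Form) {k : E4} (h : 0 < minkSq .lightFront k) :
    0 < freq F (fromLightFront F k) ↔ 0 < k 3 := by
  cases F
  · rfl
  · have h1 : minkSq .instant (toLightFront k) = minkSq .lightFront k := minkSq_fromLightFront .instant k
    have h2 := freq_fromInstant_pos_iff .lightFront (x := toLightFront k) (by rwa [h1])
    rw [show fromInstant .lightFront (toLightFront k) = k from toLightFront_toLightFront k] at h2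
    exact h2.symm

theorem loopKernel_eq (F : Form) {m : ℝ} (μ ν : Fin 4) {z : (ℝ × ℝ × ℝ × ℝ) × ℝ × ℝ}
    (hz : z ∈ phaseDomain m) {p q : E4} (hp : p = fromLightFront F (phasePair m z).1)
    (hq : q = fromLightFront F (phasePair m z).2) :
    (metric F μ ν * (minkDot F p q + m ^ 2) - p μ * q ν - p ν * q μ) / Real.pi ^ 2 =
      loopKernel F m μ ν z := by
  rw [hp, hq, minkDot_fromLightFront, minkDot_phasePair hz, loopKernel, transverse,
    minkSq_fromLightFront]
  simp only [phasePair_eq hz, map_add, map_sub, map_smul, PiLp.add_apply, PiLp.sub_apply,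
    PiLp.smul_apply, smul_eq_mul]
  ring

theorem fromLightFront_relMomentum (F : Form) (m : ℝ) (z : (ℝ × ℝ × ℝ × ℝ) × ℝ × ℝ) (μ : Fin 4) :
    fromLightFront F (relMomentum m z) μ = (2 * z.2.1 - 1) * fromLightFront F (longVec z.1) μ +
      (phaseRadius m z * Real.cos z.2.2 * fromLightFront F (transVec₁ z.1) μ +
        phaseRadius m z * Real.sin z.2.2 * fromLightFront F (transVec₂ z.1) μ) := by
  simp [relMomentum]

/-- The linear and mixed harmonics integrate to zero over a period; cos² and sin² average to 1/2. -/
theorem integral_angle (α A B C A' B' C' R : ℝ) :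
    ∫ φ in Set.Ioo (-Real.pi) Real.pi, (α + 2 * ((A + (R * Real.cos φ * B + R * Real.sin φ * C)) *
      (A' + (R * Real.cos φ * B' + R * Real.sin φ * C')))) =
      2 * Real.pi * (α + 2 * (A * A') + R ^ 2 * (B * B' + C * C')) := by
  rw [← integral_Ioc_eq_integral_Ioo, ← intervalIntegral.integral_of_le (by linarith [Real.pi_pos])]
  have hder : ∀ φ ∈ Set.uIcc (-Real.pi) Real.pi, HasDerivAt (fun φ => (α + 2 * (A * A') + R ^ 2 * (B * B' + C * C')) * φ +
      (R * 2 * (A * B' + B * A') * Real.sin φ - R * 2 * (A * C' + C * A') * Real.cos φ +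
      R ^ 2 * (B * B' - C * C') * (Real.sin φ * Real.cos φ) +
      R ^ 2 * (B * C' + C * B') * (Real.sin φ * Real.sin φ)))
      (α + 2 * ((A + (R * Real.cos φ * B + R * Real.sin φ * C)) *
      (A' + (R * Real.cos φ * B' + R * Real.sin φ * C')))) φ := by
    intro φ _
    have hs := Real.hasDerivAt_sin φ
    have hc := Real.hasDerivAt_cos φ
    refine (((hasDerivAt_id φ).const_mul _).add ((((hs.const_mul _).sub (hc.const_mul _)).add
      ((hs.mul hc).const_mul _)).add ((hs.mul hs).const_mul _))).congr_deriv ?_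
    have := Real.sin_sq_add_cos_sq φ
    linear_combination (-R ^ 2 * (B * B' + C * C')) * this
  rw [intervalIntegral.integral_eq_sub_of_hasDerivAt hder
    (Continuous.intervalIntegrable (by fun_prop) _ _)]
  simp
  ring

theorem integral_fraction (a b w : ℝ) (hw : 0 ≤ w) :
    ∫ x in Set.Ioo ((1 - w) / 2) ((1 + w) / 2), (a + b * (2 * x - 1) ^ 2) = a * w + b * w ^ 3 / 3 := by
  rw [← integral_Ioc_eq_integral_Ioo, ← intervalIntegral.integral_of_le (by linarith)]
  have hder : ∀ x ∈ Set.uIcc ((1 - w) / 2) ((1 + w) / 2), HasDerivAt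
      (fun x => a * x + b / 6 * (2 * x - 1) ^ 3) (a + b * (2 * x - 1) ^ 2) x := by
    intro x _
    refine (((hasDerivAt_id x).const_mul _).add (((((hasDerivAt_id x).const_mul 2).sub_const 1).pow
      3).const_mul _)).congr_deriv ?_
    simp
    ring
  rw [intervalIntegral.integral_eq_sub_of_hasDerivAt hder
    (Continuous.intervalIntegrable (by fun_prop) _ _)]
  ring

/-- Since 4x(1 − x) = 1 − (2x − 1)² and 4m² = (1 − w²)s, the mass condition says |2x − 1| < w. -/
theorem slice_phaseDomain {m : ℝ} (hm : 0 < m) {K : ℝ × ℝ × ℝ × ℝ} (hk : 0 < K.2.2.2)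
    (hs : 4 * m ^ 2 < minkSq .lightFront (totalMomentum K)) :
    {y | (K, y) ∈ phaseDomain m} =
      Set.Ioo ((1 - √(1 - 4 * m ^ 2 / minkSq .lightFront (totalMomentum K))) / 2)
        ((1 + √(1 - 4 * m ^ 2 / minkSq .lightFront (totalMomentum K))) / 2) ×ˢ
      Set.Ioo (-Real.pi) Real.pi := by
  ext ⟨x, φ⟩
  simp only [phaseDomain, Set.mem_ofPred_eq, Set.mem_prod, ← minkSq_totalMomentum]
  generalize minkSq .lightFront (totalMomentum K) = s at hs
  have hs0 : 0 < s := lt_trans (by positivity) hs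
  have hw2 : √(1 - 4 * m ^ 2 / s) ^ 2 = 1 - 4 * m ^ 2 / s := by
    refine Real.sq_sqrt ?_
    rw [sub_nonneg, div_le_one hs0]
    exact hs.le
  have hw0 := Real.sqrt_nonneg (1 - 4 * m ^ 2 / s)
  generalize √(1 - 4 * m ^ 2 / s) = w at hw2 hw0
  have hm2 : 4 * m ^ 2 = (1 - w ^ 2) * s := by
    rw [hw2]; field_simp; ring
  have hw1 : w < 1 := by
    by_contra h
    have h1 : 1 ≤ w ^ 2 := one_le_pow₀ (not_lt.1 h)
    nlinarith [sq_pos_of_pos hm, mul_nonneg (sub_nonneg.2 h1) hs0.le]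
  have key : m ^ 2 < x * (1 - x) * s ↔ x ∈ Set.Ioo ((1 - w) / 2) ((1 + w) / 2) := by
    have h1 : m ^ 2 < x * (1 - x) * s ↔ (2 * x - 1) ^ 2 < w ^ 2 := by
      constructor
      · intro h; nlinarith
      · intro h; nlinarith
    rw [h1, sq_lt_sq, abs_of_nonneg hw0, abs_lt, Set.mem_Ioo]
    constructor <;> rintro ⟨h, h'⟩ <;> constructor <;> linarith
  rw [key]
  constructor
  · rintro ⟨-, -, h, h'⟩
    exact ⟨h', h⟩
  · rintro ⟨h', h⟩
    exact ⟨hk, ⟨by linarith [h'.1], by linarith [h'.2]⟩, h, h'⟩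

theorem slice_phaseDomain_eq_empty {m : ℝ} {K : ℝ × ℝ × ℝ × ℝ}
    (h : ¬ (0 < K.2.2.2 ∧ 4 * m ^ 2 < minkSq .lightFront (totalMomentum K))) (y : ℝ × ℝ) :
    (K, y) ∉ phaseDomain m := by
  rintro ⟨hk, ⟨hx0, hx1⟩, -, hy⟩
  refine h ⟨hk, ?_⟩
  simp only [← minkSq_totalMomentum] at hy hx0 hx1
  have hx2 : 0 < y.1 * (1 - y.1) := mul_pos hx0 (by linarith)
  have hs : 0 ≤ minkSq .lightFront (totalMomentum K) := by
    by_contra hs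
    nlinarith [sq_nonneg m]
  nlinarith [mul_nonneg (sq_nonneg (2 * y.1 - 1)) hs]

/-- After the angle, only the longitudinal square and the sum of the transverse squares remain. The
integral over the fraction brings them into the ratio −4 : −s of the completeness relation, with the
factor w(3 − w²)/2 = (1 + 2m²/s)w. -/
theorem integral_loopKernel (F : Form) {m : ℝ} (hm : 0 < m) (μ ν : Fin 4) (K : ℝ × ℝ × ℝ × ℝ) :
    ∫ y, (phaseDomain m).indicator (loopKernel F m μ ν) (K, y) =
      if 0 < freq F (fromLightFront F (totalMomentum K)) then
        2 / (3 * Real.pi) * bubble m (minkSq F (fromLightFront F (totalMomentum K))) *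
          transverse F μ ν (fromLightFront F (totalMomentum K)) else 0 := by
  by_cases h : 0 < K.2.2.2 ∧ 4 * m ^ 2 < minkSq .lightFront (totalMomentum K)
  swap
  · simp only [Set.indicator_of_notMem (slice_phaseDomain_eq_empty h _), integral_zero]
    split_ifs with hf
    · rw [bubble_of_le]
      · simp
      · by_contra hs
        rw [minkSq_fromLightFront, not_le] at hs
        rw [freq_fromLightFront_pos_iff F (lt_of_le_of_lt (by positivity) hs)] at hf
        exact h ⟨hf, hs⟩
    · rfl
  obtain ⟨hk, hs⟩ := h
  have hs0 : 0 < minkSq .lightFront (totalMomentum K) := lt_trans (by positivity) hs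
  have hslice := slice_phaseDomain hm hk hs
  have h1 : ∀ y, (phaseDomain m).indicator (loopKernel F m μ ν) (K, y) =
      {y | (K, y) ∈ phaseDomain m}.indicator (fun y => loopKernel F m μ ν (K, y)) y := fun y => by
    by_cases hy : (K, y) ∈ phaseDomain m
    · rw [Set.indicator_of_mem hy, Set.indicator_of_mem (by exact hy)]
    · rw [Set.indicator_of_notMem hy, Set.indicator_of_notMem (by exact hy)]
  have hcont : Continuous fun y : ℝ × ℝ => loopKernel F m μ ν (K, y) := by
    unfold loopKernel
    simp only [fromLightFront_relMomentum, phaseRadius]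
    fun_prop
  simp only [h1]
  rw [hslice, integral_indicator (measurableSet_Ioo.prod measurableSet_Ioo), Measure.volume_eq_prod,
    setIntegral_prod, if_pos ((freq_fromLightFront_pos_iff F hs0).2 hk), bubble_of_lt
    (by rwa [minkSq_fromLightFront]), minkSq_fromLightFront, transverse_fromLightFront F hk.ne']
  swap
  · exact (hcont.continuousOn.integrableOn_compact (isCompact_Icc.prod isCompact_Icc)).mono_set
      (Set.prod_mono Set.Ioo_subset_Icc_self Set.Ioo_subset_Icc_self)
  set s := minkSq .lightFront (totalMomentum K) with hsdef
  have hw2 : √(1 - 4 * m ^ 2 / s) ^ 2 = 1 - 4 * m ^ 2 / s := by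
    refine Real.sq_sqrt ?_
    rw [sub_nonneg, div_le_one hs0]
    exact hs.le
  have hw0 := Real.sqrt_nonneg (1 - 4 * m ^ 2 / s)
  generalize √(1 - 4 * m ^ 2 / s) = w at hw2 hw0
  have hm2 : m ^ 2 = (1 - w ^ 2) * s / 4 := by
    rw [hw2]; field_simp; ring
  set a := fromLightFront F (longVec K) μ * fromLightFront F (longVec K) ν with ha
  set b := fromLightFront F (transVec₁ K) μ * fromLightFront F (transVec₁ K) ν +
    fromLightFront F (transVec₂ K) μ * fromLightFront F (transVec₂ K) ν with hb
  have h2 : ∀ x ∈ Set.Ioo ((1 - w) / 2) ((1 + w) / 2),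
      ∫ φ in Set.Ioo (-Real.pi) Real.pi, loopKernel F m μ ν (K, (x, φ)) =
      2 / Real.pi * ((-4 * a - s * b) / 2 + s / 4 * w ^ 2 * b) + 2 / Real.pi * (2 * a - s / 4 * b) * (2 * x - 1) ^ 2 := by
    intro x hx
    have hR : √(x * (1 - x) * s - m ^ 2) ^ 2 = s / 4 * (w ^ 2 - (2 * x - 1) ^ 2) := by
      rw [Real.sq_sqrt, hm2]
      · ring
      · rw [hm2]
        have : 0 ≤ (w - (2 * x - 1)) * (w + (2 * x - 1)) :=
          mul_nonneg (by linarith [hx.2]) (by linarith [hx.1])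
        nlinarith
    simp only [loopKernel, fromLightFront_relMomentum, phaseRadius, transverse_fromLightFront F hk.ne',
      ← minkSq_totalMomentum, ← hsdef, ← ha, ← hb]
    rw [integral_div, integral_angle, hR, ← hb]
    have := Real.pi_ne_zero
    field_simp
    rw [ha]
    ring
  rw [setIntegral_congr_fun measurableSet_Ioo h2, integral_fraction _ _ _ hw0, hm2]
  have := Real.pi_ne_zero
  field_simp
  ring

/-! ### Absolute convergence and evaluation of the loop. -/

/-- The components of a four-vector as a tuple. -/
def coordEquiv : E4 ≃ᵐ ℝ × ℝ × ℝ × ℝ :=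
  (MeasurableEquiv.toLp 2 (Fin 4 → ℝ)).symm.trans <|
    (MeasurableEquiv.piFinSuccAbove (fun _ => ℝ) 0).trans <|
    (MeasurableEquiv.refl ℝ).prodCongr <|
    (MeasurableEquiv.piFinSuccAbove (fun _ => ℝ) 0).trans <|
    (MeasurableEquiv.refl ℝ).prodCongr MeasurableEquiv.finTwoArrow

theorem coordEquiv_apply (k : E4) : coordEquiv k = (k 0, k 1, k 2, k 3) := rfl

theorem coordEquiv_symm (K : ℝ × ℝ × ℝ × ℝ) : coordEquiv.symm K = totalMomentum K := by
  rw [MeasurableEquiv.symm_apply_eq, coordEquiv_apply]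
  rfl

theorem measurePreserving_coordEquiv : MeasurePreserving coordEquiv volume volume := by
  have h3 : MeasurePreserving ((MeasurableEquiv.piFinSuccAbove (fun _ : Fin 3 => ℝ) 0).trans
      ((MeasurableEquiv.refl ℝ).prodCongr MeasurableEquiv.finTwoArrow)) volume volume :=
    ((MeasurePreserving.id volume).prod (volume_preserving_finTwoArrow ℝ)).comp
      (volume_preserving_piFinSuccAbove (fun _ : Fin 3 => ℝ) 0)
  exact (((MeasurePreserving.id volume).prod h3).comp
    (volume_preserving_piFinSuccAbove (fun _ : Fin 4 => ℝ) 0)).comp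
    (EuclideanSpace.volume_preserving_symm_measurableEquiv_toLp (Fin 4))

/-- The measurable equivalence from tuples to four-vectors of the given form. -/
def momentumEquiv (F : Form) : ℝ × ℝ × ℝ × ℝ ≃ᵐ E4 :=
  coordEquiv.symm.trans (fromLightFront F).toMeasurableEquiv

theorem momentumEquiv_apply (F : Form) (K : ℝ × ℝ × ℝ × ℝ) :
    momentumEquiv F K = fromLightFront F (totalMomentum K) := by
  rw [← coordEquiv_symm]
  rfl

theorem measurePreserving_momentumEquiv (F : Form) :
    MeasurePreserving (momentumEquiv F) volume volume :=
  (fromLightFront F).measurePreserving.comp (measurePreserving_coordEquiv.symm coordEquiv)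

/-- The term s/k⁻ in the plus component has no direct bound. Instead, the plus components of the two
particles are non-negative with sum K⁺, so their half difference is controlled by K⁺. The other
components follow from |2x − 1| ≤ 1 and the bound ‖K‖ on the radius. -/
theorem norm_relMomentum_le {m : ℝ} {z : (ℝ × ℝ × ℝ × ℝ) × ℝ × ℝ} (hz : z ∈ phaseDomain m) :
    ‖relMomentum m z‖ ≤ 4 * ‖totalMomentum z.1‖ := by
  set N := ‖totalMomentum z.1‖ with hN
  have hpair := phasePair_eq hz
  have hRsq := phaseRadius_sq hz
  obtain ⟨hk, ⟨hx0, hx1⟩, -, -⟩ := hz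
  have hN0 : 0 ≤ N := norm_nonneg _
  have hR0 : 0 ≤ phaseRadius m z := Real.sqrt_nonneg _
  have hR : phaseRadius m z ≤ N := by
    refine abs_le_of_sq_le_sq' ?_ hN0 |>.2
    have h1 := (abs_le.1 (abs_minkSq_le .lightFront (totalMomentum z.1))).2
    have h2 : 0 ≤ z.2.1 * (1 - z.2.1) := mul_nonneg hx0.le (by linarith)
    have h3 : z.2.1 * (1 - z.2.1) ≤ 1 := by nlinarith
    calc phaseRadius m z ^ 2 ≤ z.2.1 * (1 - z.2.1) * minkSq .lightFront (totalMomentum z.1) := by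
          rw [hRsq]; linarith [sq_nonneg m]
      _ ≤ z.2.1 * (1 - z.2.1) * N ^ 2 := by gcongr
      _ ≤ 1 * N ^ 2 := by gcongr
      _ = N ^ 2 := one_mul _
  have hu : |2 * z.2.1 - 1| ≤ 1 := abs_le.2 ⟨by linarith, by linarith⟩
  have hK := abs_apply_le_norm (totalMomentum z.1)
  have htrans : ∀ (x t : ℝ), |x| ≤ N → |t| ≤ 1 →
      |(2 * z.2.1 - 1) * (x / 2) + phaseRadius m z * t| ≤ 2 * N := by
    intro x t hx ht
    refine (abs_add_le _ _).trans ?_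
    rw [abs_mul, abs_mul, abs_div, abs_of_nonneg hR0, abs_of_pos (two_pos : (0 : ℝ) < 2)]
    have h1 : |2 * z.2.1 - 1| * (|x| / 2) ≤ 1 * (N / 2) := by gcongr
    have h2 : phaseRadius m z * |t| ≤ N * 1 := by gcongr
    linarith
  have h0 : |relMomentum m z 0| ≤ 2 * N := by
    have h1 : (phasePair m z).1 0 = 1 / 2 * z.1.1 + relMomentum m z 0 := by
      rw [hpair]; simp [totalMomentum]
    have h2 : (phasePair m z).2 0 = 1 / 2 * z.1.1 - relMomentum m z 0 := by
      rw [hpair]; simp [totalMomentum]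
    have h3 : 0 ≤ (phasePair m z).1 0 := by
      simp only [phasePair, onShell, phaseMomentum, Fin.isValue, PiLp.toLp_apply, Matrix.cons_val]
      positivity
    have h4 : 0 ≤ (phasePair m z).2 0 := by
      simp only [phasePair, onShell, phaseMomentum, Fin.isValue, PiLp.toLp_apply, Matrix.cons_val,
        Prod.snd_sub]
      have : 0 ≤ z.1.2.2.2 - z.2.1 * z.1.2.2.2 := by nlinarith
      positivity
    have h5 : |z.1.1| ≤ N := hK 0
    have h6 := le_abs_self z.1.1
    rw [abs_le]
    constructor <;> linarith
  have h1 : |relMomentum m z 1| ≤ 2 * N := by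
    have := htrans z.1.2.1 (Real.cos z.2.2) (hK 1) (Real.abs_cos_le_one _)
    simpa [relMomentum, longVec, transVec₁, transVec₂] using this
  have h2 : |relMomentum m z 2| ≤ 2 * N := by
    have := htrans z.1.2.2.1 (Real.sin z.2.2) (hK 2) (Real.abs_sin_le_one _)
    simpa [relMomentum, longVec, transVec₁, transVec₂] using this
  have h3 : |relMomentum m z 3| ≤ 2 * N := by
    have := htrans z.1.2.2.2 0 (hK 3) (by simp)
    simpa [relMomentum, longVec, transVec₁, transVec₂] using this
  refine abs_le_of_sq_le_sq' ?_ (by positivity) |>.2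
  rw [EuclideanSpace.norm_sq_eq, Fin.sum_univ_four]
  simp only [Real.norm_eq_abs]
  have hsq : ∀ x : ℝ, |x| ≤ 2 * N → |x| ^ 2 ≤ (2 * N) ^ 2 := fun x hx => by gcongr
  linarith [hsq _ h0, hsq _ h1, hsq _ h2, hsq _ h3]

theorem abs_loopKernel_le (F : Form) {m : ℝ} (μ ν : Fin 4) {z : (ℝ × ℝ × ℝ × ℝ) × ℝ × ℝ}
    (hz : z ∈ phaseDomain m) :
    |loopKernel F m μ ν z| ≤ 33 * (1 + ‖momentumEquiv F z.1‖) ^ 2 := by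
  rw [momentumEquiv_apply]
  have h1 := abs_transverse_le F μ ν (fromLightFront F (totalMomentum z.1))
  have h2 : ∀ i, |fromLightFront F (relMomentum m z) i| ≤
      4 * ‖fromLightFront F (totalMomentum z.1)‖ := fun i => by
    refine (abs_apply_le_norm _ i).trans ?_
    rw [LinearIsometryEquiv.norm_map, LinearIsometryEquiv.norm_map]
    exact norm_relMomentum_le hz
  set N := ‖fromLightFront F (totalMomentum z.1)‖ with hN
  have hN0 : 0 ≤ N := norm_nonneg _
  have hpi : 1 ≤ Real.pi ^ 2 := one_le_pow₀ (by linarith [Real.pi_gt_three])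
  rw [loopKernel, abs_div, abs_of_nonneg (by positivity : 0 ≤ Real.pi ^ 2)]
  refine (div_le_self (abs_nonneg _) hpi).trans ?_
  have h3 := mul_le_mul (h2 μ) (h2 ν) (abs_nonneg _) (by positivity)
  rw [← abs_mul] at h3
  refine (abs_add_le _ _).trans ?_
  rw [abs_div, abs_mul 2, abs_of_pos (two_pos : (0 : ℝ) < 2)]
  nlinarith

theorem measurable_loopKernel (F : Form) (m : ℝ) (μ ν : Fin 4) : Measurable (loopKernel F m μ ν) := by
  have hL : ∀ {f : (ℝ × ℝ × ℝ × ℝ) × ℝ × ℝ → E4} (i : Fin 4), Measurable f →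
      Measurable fun z => fromLightFront F (f z) i := fun i hf =>
    ((by fun_prop : Continuous fun x : E4 => fromLightFront F x i).measurable).comp hf
  have hK : Measurable fun z : (ℝ × ℝ × ℝ × ℝ) × ℝ × ℝ => fromLightFront F (totalMomentum z.1) := by
    simp only [← momentumEquiv_apply]
    exact (momentumEquiv F).measurable.comp measurable_fst
  have h1 : Measurable fun z : (ℝ × ℝ × ℝ × ℝ) × ℝ × ℝ =>
      transverse F μ ν (fromLightFront F (totalMomentum z.1)) :=
    (continuous_transverse F μ ν).measurable.comp hK
  have h2 : Measurable (relMomentum m) := by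
    unfold relMomentum longVec transVec₁ transVec₂ phaseRadius
    simp only [minkSq_totalMomentum]
    fun_prop
  unfold loopKernel
  exact ((h1.div_const _).add (((hL μ h2).mul (hL ν h2)).const_mul _)).div_const _

/-- The kernel is bounded by a polynomial in the total momentum, which the Schwartz function
controls, and the fibre over it is contained in a fixed rectangle. -/
theorem integrable_loopKernel (F : Form) (m : ℝ) (μ ν : Fin 4) (φ : 𝓢(E4, ℂ)) :
    Integrable fun z : (ℝ × ℝ × ℝ × ℝ) × ℝ × ℝ =>
      (((phaseDomain m).indicator (loopKernel F m μ ν) z : ℝ) : ℂ) * φ (momentumEquiv F z.1) := by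
  have h1 : Integrable fun K => 33 * (1 + ‖momentumEquiv F K‖) ^ 2 * ‖φ (momentumEquiv F K)‖ :=
    ((measurePreserving_momentumEquiv F).integrable_comp_emb
      (momentumEquiv F).measurableEmbedding).2 (integrable_pow_mul_schwartz 33 2 φ)
  have h2 : Integrable ((Set.Icc (0 : ℝ) 1 ×ˢ Set.Icc (-Real.pi) Real.pi).indicator
      fun _ => (1 : ℝ)) volume :=
    (integrable_indicator_iff (measurableSet_Icc.prod measurableSet_Icc)).2
      (continuous_const.continuousOn.integrableOn_compact (isCompact_Icc.prod isCompact_Icc))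
  refine (h1.mul_prod h2).mono' ?_ (Eventually.of_forall fun z => ?_)
  · exact ((Complex.measurable_ofReal.comp ((measurable_loopKernel F m μ ν).indicator
      (measurableSet_phaseDomain m))).mul (φ.continuous.measurable.comp
        ((momentumEquiv F).measurable.comp measurable_fst))).aestronglyMeasurable
  · by_cases hz : z ∈ phaseDomain m
    · have hy : z.2 ∈ Set.Icc (0 : ℝ) 1 ×ˢ Set.Icc (-Real.pi) Real.pi :=
        ⟨⟨hz.2.1.1.le, hz.2.1.2.le⟩, hz.2.2.1.1.le, hz.2.2.1.2.le⟩
      rw [Set.indicator_of_mem hz, Set.indicator_of_mem hy, norm_mul, Complex.norm_real,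
        Real.norm_eq_abs, mul_one]
      gcongr
      exact abs_loopKernel_le F μ ν hz
    · rw [Set.indicator_of_notMem hz, Complex.ofReal_zero, zero_mul, norm_zero]
      exact mul_nonneg (by positivity) (Set.indicator_nonneg (fun _ _ => zero_le_one) _)

theorem massShell_prod_eq_map (F : Form) {m : ℝ} (hm : 0 < m) :
    (massShell F m 1).prod (massShell F m (-1)) =
      (ENNReal.ofReal (1 / 4) • volume.restrict (phaseDomain m)).map
        (fun z => (fromLightFront F (phasePair m z).1, -fromLightFront F (phasePair m z).2)) := by
  have hL : Measurable (fromLightFront F) := (fromLightFront F).continuous.measurable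
  rw [massShell_neg_one, massShell_eq_map F hm, Measure.map_map measurable_neg hL,
    Measure.map_prod_map _ _ hL (measurable_neg.comp hL), massShell_prod_massShell,
    Measure.map_map (hL.prodMap (measurable_neg.comp hL)) (measurable_phasePair m)]
  rfl

theorem isFermionLoop_loopDist (F : Form) (e : ℝ) {m : ℝ} (hm : 0 < m)
    {γ : Fin 4 → Matrix (Fin 4) (Fin 4) ℂ} (hγ : IsDirac F γ) :
    IsFermionLoop F e m γ (loopDist F e hm) := by
  intro μ ν φ
  have hL : Measurable (fromLightFront F) := (fromLightFront F).continuous.measurable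
  have hT : Measurable fun z : (ℝ × ℝ × ℝ × ℝ) × ℝ × ℝ =>
      (fromLightFront F (phasePair m z).1, -fromLightFront F (phasePair m z).2) := by
    have := measurable_phasePair m
    exact (hL.comp this.fst).prodMk (hL.comp this.snd).neg
  have htr : ∀ z : E4 × E4,
      (γ μ * fermionPart F γ m 1 z.1 * γ ν * fermionPart F γ m (-1) z.2).trace =
      (((metric F μ ν * (minkDot F z.1 (-z.2) + m ^ 2) - z.1 μ * (-z.2) ν - z.1 ν * (-z.2) μ) /
        Real.pi ^ 2 : ℝ) : ℂ) := fun z => by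
    have := hγ.trace_fermionPart m μ ν z.1 (-z.2)
    rwa [neg_neg] at this
  simp only [htr]
  have hcont : Continuous fun z : E4 × E4 =>
      (((metric F μ ν * (minkDot F z.1 (-z.2) + m ^ 2) - z.1 μ * (-z.2) ν - z.1 ν * (-z.2) μ) /
        Real.pi ^ 2 : ℝ) : ℂ) * φ (z.1 - z.2) := by
    have h1 : Continuous fun z : E4 × E4 => minkDot F z.1 (-z.2) :=
      Continuous.minkDot F (by fun_prop) (by fun_prop)
    have h2 := φ.continuous
    fun_prop
  have hker : ∀ z ∈ phaseDomain m,
      (((metric F μ ν * (minkDot F (fromLightFront F (phasePair m z).1)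
        (- -fromLightFront F (phasePair m z).2) + m ^ 2) -
        fromLightFront F (phasePair m z).1 μ * (- -fromLightFront F (phasePair m z).2) ν -
        fromLightFront F (phasePair m z).1 ν * (- -fromLightFront F (phasePair m z).2) μ) /
        Real.pi ^ 2 : ℝ) : ℂ) * φ (fromLightFront F (phasePair m z).1 -
          -fromLightFront F (phasePair m z).2) =
      (loopKernel F m μ ν z : ℂ) * φ (momentumEquiv F z.1) := by
    intro z hz
    rw [loopKernel_eq F μ ν hz rfl (neg_neg _), momentumEquiv_apply, sub_neg_eq_add, ← map_add]
    congr 3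
    rw [phasePair_eq hz]
    module
  have hmeas := measurableSet_phaseDomain m
  have hind : ∀ z, (phaseDomain m).indicator
      (fun z => (loopKernel F m μ ν z : ℂ) * φ (momentumEquiv F z.1)) z =
      (((phaseDomain m).indicator (loopKernel F m μ ν) z : ℝ) : ℂ) * φ (momentumEquiv F z.1) := fun z => by
    by_cases hz : z ∈ phaseDomain m
    · rw [Set.indicator_of_mem hz, Set.indicator_of_mem hz]
    · rw [Set.indicator_of_notMem hz, Set.indicator_of_notMem hz, Complex.ofReal_zero, zero_mul]
  have hint := integrable_loopKernel F m μ ν φ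
  -- The constant is e²/(2π)² times the phase-space density 1/4; multiplied by 2/(3π) from the fibre
  -- integral it becomes `loopConst`.
  have hinner : ∀ K, ((e ^ 2 / (16 * Real.pi ^ 2) : ℝ) : ℂ) *
      ∫ y, (((phaseDomain m).indicator (loopKernel F m μ ν) (K, y) : ℝ) : ℂ) *
      φ (momentumEquiv F K) = loopFn F e m μ ν (momentumEquiv F K) * φ (momentumEquiv F K) := by
    intro K
    rw [integral_mul_const, integral_complex_ofReal, integral_loopKernel F hm, ← momentumEquiv_apply,
      loopFn, ← mul_assoc]
    congr 1
    split_ifs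
    · rw [← Complex.ofReal_mul, loopConst]
      congr 1
      have := Real.pi_ne_zero
      field_simp
      ring
    · simp
  rw [massShell_prod_eq_map F hm]
  constructor
  · rw [integrable_map_measure hcont.aestronglyMeasurable hT.aemeasurable]
    refine Integrable.smul_measure ?_ ENNReal.ofReal_ne_top
    refine IntegrableOn.congr_fun ?_ (fun z hz => (hker z hz).symm) hmeas
    rw [← integrable_indicator_iff hmeas]
    exact hint.congr (Eventually.of_forall fun z => (hind z).symm)
  · rw [integral_map hT.aemeasurable hcont.aestronglyMeasurable, integral_smul_measure,
      setIntegral_congr_fun hmeas hker, ← integral_indicator hmeas]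
    simp only [hind]
    rw [Measure.volume_eq_prod, integral_prod _ hint]
    have hfin : ∫ K, loopFn F e m μ ν (momentumEquiv F K) * φ (momentumEquiv F K) =
        ∫ k, loopFn F e m μ ν k * φ k :=
      (measurePreserving_momentumEquiv F).integral_comp' (fun k => loopFn F e m μ ν k * φ k)
    rw [loopDist, IsModerate.toDist_apply, ← hfin]
    simp only [← hinner]
    rw [integral_const_mul, ENNReal.toReal_ofReal (by norm_num), Complex.real_smul, ← mul_assoc]
    congr 1
    have := Real.pi_ne_zero
    push_cast
    field_simp
    ring

end LFQED

end

theorem mainTheorem1 (e m : ℝ) (he : e ≠ 0) (hm : 0 < m) :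
    -- the construction, in the light-front form and, with the same scalar, in the instant form
    (∀ (F : Form) (γ : Fin 4 → Matrix (Fin 4) (Fin 4) ℂ), IsDirac F γ →
      ∃ P r : TensorDist,
        IsFermionLoop F e m γ P ∧
        -- the causal distribution has causal support and singular order 2
        SupportedIn F (causalDist P) (forwardCone F ∪ backwardCone F) ∧
        HasSingularOrder (causalDist P) 2 ∧
        -- it has exactly one central splitting, given by the dispersion relation
        IsCentralSplitting F 2 (causalDist P) r ∧
        (∀ r' : TensorDist, IsCentralSplitting F 2 (causalDist P) r' → r' = r) ∧
        (∀ μ ν, ∃ fd fr : E4 → ℂ, Continuous fd ∧ IsRegularDist (causalDist P μ ν) fd ∧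
          IsRegularDist (r μ ν) fr ∧ DispersionRelation F 2 fd fr) ∧
        -- the vacuum polarization tensor is transverse and has the stated form
        (∀ ν, ∑ μ, TemperedDistribution.smulLeftCLM ℂ (fun k : E4 => ((lowerIndex F k μ : ℝ) : ℂ))
          (polarizationTensor P r μ ν) = 0) ∧
        (∀ μ ν, IsRegularDist (polarizationTensor P r μ ν)
          (tensorOf F (fun k => piScalar e m (minkSq F k)) μ ν))) ∧
    -- the light-front and the instant-form scalars coincide at corresponding momenta
    (∀ k : E4, piScalar e m (minkSq .lightFront (toLightFront k)) = piScalar e m (minkSq .instant k)) ∧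
    -- the normalization constants are fixed to zero
    (∀ (C₀ : ℂ) (C : Fin 4 → ℂ) (C₁ : ℂ),
      (ParityInvariant (modifiedScalar e m C₀ C C₁) → C = 0) ∧
      (ParityInvariant (modifiedScalar e m C₀ C C₁) →
        PhotonMassShell (modifiedScalar e m C₀ C C₁) → C₀ = 0) ∧
      ((ParityInvariant (modifiedScalar e m C₀ C C₁) ∧
          PhotonMassShell (modifiedScalar e m C₀ C C₁) ∧
          ChargeNormalized (modifiedScalar e m C₀ C C₁)) ↔
        C₀ = 0 ∧ C = 0 ∧ C₁ = 0)) := by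
  refine ⟨fun F γ hγ => ⟨loopDist F e hm, retDist F e hm, isFermionLoop_loopDist F e hm hγ,
    supportedIn_causalDist F e hm, by exact_mod_cast hasSingularOrder_causalDist F he hm,
    isCentralSplitting_retDist F he hm,
    fun r' hr' => (isCentralSplitting_retDist F he hm).unique hr',
    fun μ ν => ⟨causalFn F e m μ ν, retFn F e m μ ν, continuous_causalFn F e μ ν hm, ?_,
      (isModerate_retFn F e μ ν hm).isRegularDist, dispersionRelation F e hm μ ν⟩,
    sum_smulLeftCLM_polarizationTensor F e hm, isRegularDist_polarizationTensor F e hm⟩,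
    fun k => ?_, fun C₀ C C₁ => ⟨fun h => h.eq_zero, fun h h' => ?_, normalization_iff e hm C₀ C C₁⟩⟩
  · rw [causalDist_loopDist]
    exact (isModerate_causalFn F e hm μ ν).isRegularDist
  · rw [minkSq, minkDot_toLightFront, minkSq]
  · rw [h.eq_zero] at h'
    exact h'.eq_zero hm
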